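/- **Conventions.** Let $n\ge 0$ be an integer and let $[\overline n]=\{1<2<\dots<n<\overline n<\dots<\overline 2<\overline 1\}$, where $\overline{\imath}$ is viewed as $-i$ (so $\overline{\overline{\imath}}=i$; letters have a sign and an absolute value). For $a\in[\overline n]$ let $\prec_a$ be the circular order on $[\overline n]$ starting at $a$; "$a\prec b\preceq c$" refers to $\prec_a$. The root system of type $D_n$ is $\{\pm\varepsilon_i\pm\varepsilon_j: i<j\}$, with positive roots $\varepsilon_i\pm\varepsilon_j$ ($i<j$); write $(i,j)$ and $(i,\overline\jmath)$ for $\varepsilon_i-\varepsilon_j$ and $\varepsilon_i+\varepsilon_j$, and for the reflections $t_{ij}t_{\overline\imath\,\overline\jmath}$ and $t_{i\overline\jmath}t_{\overline\imath j}$ on $[\overline n]$. The Weyl group $W$ consists of the signed permutations $w$ (bijections with $w(\overline\imath)=\overline{w(i)}$) with an even number of sign changes; $\ell$ is its length function and $\rho$ half the sum of the positive roots. The quantum Bruhat graph has an edge $w\xrightarrow{\alpha}ws_\alpha$ ($\alpha$ a positive root) iff $\ell(ws_\alpha)=\ell(w)+1$ or $\ell(ws_\alpha)=\ell(w)-2\langle\rho,\alpha^\vee\rangle+1$.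 **Quantum alcove model.** Fix column heights $p=(p_1\ge\dots\ge p_r)$ with $1\le p_i<n$. For $k<n$ let $\Gamma^l(k)=\Gamma^{kk}\cdots\Gamma^{k1}$ and $\Gamma^r(k)=\Gamma^k\cdots\Gamma^2$, where $$\Gamma^{ki}=((i,k+1),\dots,(i,n),\,(i,\overline n),\dots,(i,\overline{k+1}),\,(i,\overline{i-1}),\dots,(i,\overline1)),\qquad \Gamma^i=((i,\overline{i-1}),\dots,(i,\overline 1)),$$ and $\Gamma=\Gamma^l(p_1)\Gamma^r(p_1)\cdots\Gamma^l(p_r)\Gamma^r(p_r)$, which we regard as $2r$ segments $\Gamma_1,\dots,\Gamma_{2r}$ of heights $p_1,p_1,\dots,p_r,p_r$. Let $\mathcal A$ be the set of admissible subsets: sets of positions in $\Gamma$, equivalently subsequences $T=T_1\cdots T_{2r}$ with $T_q\subseteq\Gamma_q$, whose roots, read from left to right, label a path in the quantum Bruhat graph starting at the identity. The filling map $\mathrm{fill\_D}$ sends $T$ to the columns $(T_1\cdots T_q)[1,k]$, $q=1,\dots,2r$, where $k$ is the height of $\Gamma_q$ and $w[1,k]=(w(1),\dots,w(k))$; $\mathrm{sfill\_D}$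 sorts each of these columns increasingly. **KN columns.** A type $D_n$ KN column is a column with entries in $[\overline n]$ that increases strictly from top to bottom, except that $n$ and $\overline n$ may alternate, and such that if $j$ is in the $a$-th box from the top and $\overline\jmath$ is below it, in the $b$-th box from the bottom, then $a+b\le j$. $B^{k,1}$ is the set of KN columns of heights $k,k-2,k-4,\dots\,(\ge 0)$, and $B^p=B^{p_1,1}\times\dots\times B^{p_r,1}$. **$\mathrm{split\_D}$.** In a KN column replace each $\overline n$ directly above an $n$ by two letters $0$; call the result $C$. Let $z_1\ge z_2\ge\cdots$ list all letters $0$ of $C$ (regarded as larger than $n$), then all $z\in[n]$ with $z,\overline z\in C$. Let $t_i\in[n]$ be greatest with $t_i<\min(t_{i-1},z_i)$ (no bound $t_0$ for $i=1$) and $t_i,\overline{t_i}\notin C$. The left column arises by changing each $z_i$ into $t_i$, the right one by changing each $\overline{z_i}$ (each $0$, if $z_i=0$) into $\overline{t_i}$; both are sorted. **$\mathrm{extend}$.** If the two columns have height $h\le k$, let $i_1<\dots<i_{k-h}$ be the smallest $i\in[n]$ such that $i,\overline\imath$ occur in neither column; add $\overline{\imath_1},\dots,\overline{\imath_{k-h}}$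 to the left column, $i_1,\dots,i_{k-h}$ to the right one, and sort. Thus $\mathrm{extend}\circ\mathrm{split\_D}$ sends an element of $B^p$ to a filling with $2r$ columns of heights $p_1,p_1,\dots,p_r,p_r$. **Blocked off.** Columns $C=(l_1,l_2,\dots)$ and $C'=(r_1,r_2,\dots)$ are *type $D_n$ blocked off at $i$* (by $b=r_i$) if one of the following holds. (B) $|l_i|\le b<n$, with $|l_i|=b$ iff $l_i=\overline b$; $\{1,\dots,b\}\subseteq\{|l_1|,\dots,|l_i|\}$ and $\{1,\dots,b\}\subseteq\{|r_1|,\dots,|r_i|\}$; and $\#\{j\le i: l_j<0,\ r_j>0\}$ is odd. (D) $-|l_i|\le b<0$, with $-|l_i|=b$ iff $l_i=\overline b$; $\{|b|,\dots,n\}\subseteq\{|l_1|,\dots,|l_i|\}$ and $\{|b|,\dots,n\}\subseteq\{|r_1|,\dots,|r_i|\}$; and $\#\{j\le i: l_j>0,\ r_j<0\}$ is odd. **$\mathrm{ord\_D}$.** Given columns $b_1,\dots,b_{2r}$, put $C_1=b_1$; for $q\ge2$ and $j=1,2,\dots,k$, where $k$ is the height of $b_q$, let $C_q(j)$ be the $\prec_{C_{q-1}(j)}$-minimal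 element $x$ of $b_q\setminus\{C_q(1),\dots,C_q(j-1)\}$ such that, if $j<k$, the columns $C_{q-1}$ and $(C_q(1),\dots,C_q(j-1),x)$ are not type $D_n$ blocked off at $j$. **$\mathrm{Path\_D}$.** Start with $A=\mathrm{id}\in W$. For $q=1,\dots,2r$ let $S_q=\emptyset$ and run through the roots $(l,m)$ of $\Gamma_q$ in order ($k$ is the height of $\Gamma_q$, and $A$ is carried over from one segment to the next): if either $(l,m)=(k,k+1)$ and $A[1,k],C_q$ are type $D_n$ blocked off at $k$, or $A(l)\ne C_q(l)$, $A(l)\prec A(m)\preceq C_q(l)$ and $(A\cdot(l,m))[1,k],C_q$ are not type $D_n$ blocked off at $l$, then append $(l,m)$ to $S_q$ and replace $A$ by $A\cdot(l,m)$. The output is $S_1\cdots S_{2r}$. **Theorem.** The map $\mathrm{extend}\circ\mathrm{split\_D}$ is injective on $B^p$, and, identifying $B^p$ with its image under this map, $\mathrm{sfill\_D}$ is a bijection $\mathcal A\to B^p$ whose inverse is $\mathrm{Path\_D}\circ\mathrm{ord\_D}\circ\mathrm{extend}\circ\mathrm{split\_D}$. -/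

import Mathlib

namespace QAlcoveD

noncomputable section

/-! ### Letters, the order on them, and the circular orders

The alphabet `{1 < 2 < ⋯ < n < n̄ < ⋯ < 2̄ < 1̄}` is realized by the nonzero integers `x` with
`|x| ≤ n`, where `ī` is `-i`.  The auxiliary letter `0` is the integer `0`. -/

/-- `x` is a letter of the alphabet `1, …, n, n̄, …, 1̄`. -/
def IsLetter (n : ℕ) (x : ℤ) : Prop := x ≠ 0 ∧ x.natAbs ≤ n

/-- The position (from `1` to `2n`) of a letter in `1 < 2 < ⋯ < n < n̄ < ⋯ < 1̄`. -/
def pos (n : ℕ) (x : ℤ) : ℤ := if 0 < x then x else 2 * n + 1 + x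

/-- The number of clockwise steps from `a` to `x` when the `2n` letters are put on a circle.
The circular order starting at `a` is: `x ≺ₐ y` iff `circ n a x < circ n a y`. -/
def circ (n : ℕ) (a x : ℤ) : ℤ := (pos n x - pos n a) % (2 * n)

/-- Reorder a column increasingly. -/
def sortCol (n : ℕ) (C : List ℤ) : List ℤ := C.insertionSort (fun a b => pos n a ≤ pos n b)

/-! ### The root system of type `Dₙ`, signed permutations, the quantum Bruhat graph

A signed permutation is extended to a permutation `w` of `ℤ` with `w (-x) = - w x`, fixing all
integers of absolute value greater than `n`.  All the words that occur below are products of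
type `Dₙ` reflections, so they lie in the Weyl group of type `Dₙ`. -/

/-- The vector `ε_x` for a letter `x`, with `ε_{ī} = -ε_i`. -/
def eps (n : ℕ) (x : ℤ) : Fin n → ℤ := fun c =>
  if x = (c : ℤ) + 1 then 1 else if x = -((c : ℤ) + 1) then -1 else 0

/-- The root with label `(i, m)`: `(i, j)` is `ε_i - ε_j` and `(i, j̄)` is `ε_i + ε_j`. -/
def root (n : ℕ) (β : ℤ × ℤ) : Fin n → ℤ := eps n β.1 - eps n β.2

/-- The positive roots `ε_i ± ε_j`, `1 ≤ i < j ≤ n`. -/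
def posRoots (n : ℕ) : Finset (Fin n → ℤ) :=
  (((Finset.Icc (1 : ℤ) n) ×ˢ (Finset.Icc (-(n : ℤ)) n)).filter
    (fun β => β.1 < β.2.natAbs)).image (root n)

/-- The linear action of a signed permutation, `w ε_i = ε_{w(i)}`. -/
def act (n : ℕ) (w : Equiv.Perm ℤ) (v : Fin n → ℤ) : Fin n → ℤ :=
  ∑ c : Fin n, v c • eps n (w ((c : ℤ) + 1))

/-- The length function: the number of positive roots that are sent to negative roots. -/
def len (n : ℕ) (w : Equiv.Perm ℤ) : ℕ :=
  ((posRoots n).filter (fun β => -(act n w β) ∈ posRoots n)).card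

/-- `2⟨ρ, α^∨⟩`, where `2ρ` is the sum of the positive roots.  Since `⟨α, α⟩ = 2` for all roots
of type `Dₙ`, the coroot `α^∨` is `α`. -/
def twoRhoPairing (n : ℕ) (α : Fin n → ℤ) : ℤ := (∑ β ∈ posRoots n, β) ⬝ᵥ α

/-- The reflection with label `(i, m)`, that is `t_{i m} t_{ī m̄}`. -/
def refl (β : ℤ × ℤ) : Equiv.Perm ℤ := Equiv.swap β.1 β.2 * Equiv.swap (-β.1) (-β.2)

/-- There is an edge `w → w s_β` with label `β` in the quantum Bruhat graph. -/
def QEdge (n : ℕ) (w : Equiv.Perm ℤ) (β : ℤ × ℤ) : Prop :=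
  len n (w * refl β) = len n w + 1 ∨
    (len n (w * refl β) : ℤ) = len n w - twoRhoPairing n (root n β) + 1

/-- The list of labels describes a path in the quantum Bruhat graph starting at `w`. -/
def IsQPath (n : ℕ) : Equiv.Perm ℤ → List (ℤ × ℤ) → Prop
  | _, [] => True
  | w, β :: T => QEdge n w β ∧ IsQPath n (w * refl β) T

/-! ### The chain of roots, admissible subsets, and the filling map -/

/-- The letters `b, b - 1, …, a` as integers. -/
def descend (a b : ℕ) : List ℤ := ((List.range' a (b + 1 - a)).reverse).map (fun (j : ℕ) => (j : ℤ))

/-- `Γ^{ki} = ((i,k+1), …, (i,n), (i,n̄), …, (i,\overline{k+1}), (i,\overline{i-1}), …, (i,1̄))`. -/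
def chainKI (n k i : ℕ) : List (ℤ × ℤ) :=
  ((descend (k + 1) n).reverse.map (fun j => ((i : ℤ), j))) ++
  ((descend (k + 1) n).map (fun j => ((i : ℤ), -j))) ++
  ((descend 1 (i - 1)).map (fun j => ((i : ℤ), -j)))

/-- `Γ^l(k) = Γ^{kk} ⋯ Γ^{k1}`. -/
def chainL (n k : ℕ) : List (ℤ × ℤ) := (List.range' 1 k).reverse.flatMap (chainKI n k)

/-- `Γ^r(k) = Γ^k ⋯ Γ^2`, where `Γ^i = ((i,\overline{i-1}), …, (i,1̄))`. -/
def chainR (k : ℕ) : List (ℤ × ℤ) :=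
  (List.range' 2 (k - 1)).reverse.flatMap
    (fun i => (descend 1 (i - 1)).map (fun j => ((i : ℤ), -j)))

/-- The chain `Γ = Γ^l(p₁) Γ^r(p₁) Γ^l(p₂) Γ^r(p₂) ⋯`, as the list of its segments. -/
def chain (n : ℕ) (p : List ℕ) : List (List (ℤ × ℤ)) := p.flatMap (fun k => [chainL n k, chainR k])

/-- The list of column heights `p₁, p₁, p₂, p₂, …` of the doubled shape. -/
def dbl (p : List ℕ) : List ℕ := p.flatMap (fun k => [k, k])

/-- The admissible subsets.  A set of positions in the chain is given by the folding sequence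
`T = T₁^l T₁^r T₂^l T₂^r ⋯`, where each factor is a subsequence of the corresponding segment
(no root is repeated inside a segment, see `chain_nodup`). -/
def Admissible (n : ℕ) (p : List ℕ) : Set (List (List (ℤ × ℤ))) :=
  {T | List.Forall₂ List.Sublist T (chain n p) ∧ IsQPath n 1 T.flatten}

/-- The column `w[1,k]`. -/
def col (k : ℕ) (w : Equiv.Perm ℤ) : List ℤ := (List.range' 1 k).map (fun (i : ℕ) => w (i : ℤ))

/-- Auxiliary to `fillD`: the columns after each of the segments, starting with the word `w`. -/
def fillFrom : Equiv.Perm ℤ → List ℕ → List (List (ℤ × ℤ)) → List (List ℤ)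
  | w, k :: ks, T :: Ts =>
      col k (w * (T.map refl).prod) :: fillFrom (w * (T.map refl).prod) ks Ts
  | _, _, _ => []

/-- The filling map `fill_D`. -/
def fillD (p : List ℕ) (T : List (List (ℤ × ℤ))) : List (List ℤ) := fillFrom 1 (dbl p) T

/-- The sorted filling map `sfill_D`, with values in fillings of the doubled shape. -/
def sfillD (n : ℕ) (p : List ℕ) (T : List (List (ℤ × ℤ))) : List (List ℤ) :=
  (fillD p T).map (sortCol n)

/-! ### Kashiwara-Nakashima columns -/

/-- `C` is a KN column of type `Dₙ` (of height `C.length`): its entries increase strictly from top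
to bottom, except that `n̄` may be directly above `n`; and if `j` is in the `a`-th box from the
top, and `j̄` is below it, in the `b`-th box from the bottom, then `a + b ≤ j`. -/
def IsKN (n : ℕ) (C : List ℤ) : Prop :=
  (∀ x ∈ C, IsLetter n x) ∧
  C.IsChain (fun x y => pos n x < pos n y ∨ (x = -(n : ℤ) ∧ y = n)) ∧
  ∀ (a b j : ℕ), a < b → 1 ≤ j → C[a]? = some (j : ℤ) → C[b]? = some (-(j : ℤ)) →
    (a + 1) + (C.length - b) ≤ j

/-- The KN columns of heights `k, k - 2, k - 4, …`, which label the vertices of `B^{k,1}`. -/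
def IsKRColumn (n k : ℕ) (C : List ℤ) : Prop :=
  IsKN n C ∧ C.length ≤ k ∧ Even (k - C.length)

/-- The set `B^p = B^{p₁,1} ⊗ B^{p₂,1} ⊗ ⋯`. -/
def KR (n : ℕ) (p : List ℕ) : Set (List (List ℤ)) := {b | List.Forall₂ (IsKRColumn n) p b}

/-! ### Splitting and extending -/

/-- Replace each `n̄` directly above `n` by two letters `0`. -/
def toZeros (n : ℕ) : List ℤ → List ℤ
  | x :: y :: C => if x = -(n : ℤ) ∧ y = n then 0 :: 0 :: toZeros n C else x :: toZeros n (y :: C)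
  | C => C

/-- `z₁ ≥ z₂ ≥ ⋯`: the letters `0` of the column (which are larger than `n`, and are therefore
recorded here as `n + 1`), then the unbarred letters `z` with `z` and `z̄` both in the column. -/
def splitI (n : ℕ) (C : List ℤ) : List ℕ :=
  List.replicate (C.count 0) (n + 1) ++
    (List.range' 1 n).reverse.filter (fun (z : ℕ) => (z : ℤ) ∈ C ∧ -(z : ℤ) ∈ C)

/-- Given `z₁, z₂, …`, the letters `t₁ > t₂ > ⋯`: here `t_i` is the greatest letter in `[n]` such
that `t_i < min(t_{i-1}, z_i)` and neither `t_i` nor its negative is in `C` (the bound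
`t_{i-1}` is the first argument; the value is `0` if there is no such letter). -/
def splitJ (C : List ℤ) : ℕ → List ℕ → List ℕ
  | _, [] => []
  | t, z :: zs =>
      let t' := Nat.findGreatest (fun s => (s : ℤ) ∉ C ∧ -(s : ℤ) ∉ C) (min t z - 1)
      t' :: splitJ C t' zs

/-- The splitting of a column that may contain letters `0`. In the left column each `0` and each
`z ∈ I` is changed into the corresponding `t`; in the right column each `0` and each `z̄`, `z ∈ I`,
is changed into the corresponding `t̄`. -/
def splitB (n : ℕ) (C : List ℤ) : List ℤ × List ℤ :=
  let J : List ℤ := (splitJ C (n + 1) (splitI n C)).map (fun (t : ℕ) => (t : ℤ))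
  (sortCol n (C.filter (fun x => x ≠ 0 ∧ ¬ (0 < x ∧ -x ∈ C)) ++ J),
   sortCol n (C.filter (fun x => x ≠ 0 ∧ ¬ (x < 0 ∧ -x ∈ C)) ++ J.map (fun t => -t)))

/-- The splitting of a KN column of type `Dₙ`. -/
def splitColD (n : ℕ) (C : List ℤ) : List ℤ × List ℤ := splitB n (toZeros n C)

/-- `i₁ < ⋯ < i_{k-r}`: the smallest letters `i` such that `i` and `ī` are in neither column. -/
def extLetters (n k : ℕ) (L R : List ℤ) : List ℤ :=
  (((List.range' 1 n).map (fun (i : ℕ) => (i : ℤ))).filter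
    (fun i => i ∉ L ∧ -i ∉ L ∧ i ∉ R ∧ -i ∉ R)).take (k - L.length)

/-- The extension of a split column to height `k`. -/
def extendCol (n k : ℕ) (LR : List ℤ × List ℤ) : List ℤ × List ℤ :=
  (sortCol n (LR.1 ++ (extLetters n k LR.1 LR.2).map (fun i => -i)),
   sortCol n (LR.2 ++ extLetters n k LR.1 LR.2))

/-- `split_D`, column by column. -/
def splitD (n : ℕ) (b : List (List ℤ)) : List (List ℤ × List ℤ) := b.map (splitColD n)

/-- `extend`, column by column; the result is a filling of the doubled shape. -/
def extend (n : ℕ) (p : List ℕ) (b : List (List ℤ × List ℤ)) : List (List ℤ) :=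
  (List.zipWith (extendCol n) p b).flatMap (fun LR => [LR.1, LR.2])

/-! ### The blocked off conditions, and the algorithms -/

/-- The entry `C(i)`, with rows numbered from `1`. -/
def ent (C : List ℤ) (i : ℕ) : ℤ := C.getD (i - 1) 0

/-- `x` is an absolute value of one of the first `i` entries of `C`. -/
def AbsIn (x : ℤ) (C : List ℤ) (i : ℕ) : Prop := x ∈ (C.take i).map (fun y => (y.natAbs : ℤ))

instance (x : ℤ) (C : List ℤ) (i : ℕ) : Decidable (AbsIn x C i) :=
  inferInstanceAs (Decidable (x ∈ (C.take i).map (fun y => (y.natAbs : ℤ))))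

/-- The columns `C`, `C'` are blocked off at `i` by `b = C'(i)`. -/
def BlockedOff (n : ℕ) (C C' : List ℤ) (i : ℕ) : Prop :=
  ((ent C i).natAbs : ℤ) ≤ ent C' i ∧ ent C' i < n ∧ (((ent C i).natAbs : ℤ) = ent C' i ↔ ent C i = -ent C' i) ∧
  (∀ x ∈ Finset.Icc 1 (ent C' i), AbsIn x C i ∧ AbsIn x C' i) ∧
  Odd ((Finset.Icc 1 i).filter (fun j => ent C j < 0 ∧ 0 < ent C' j)).card

instance (n : ℕ) (C C' : List ℤ) (i : ℕ) : Decidable (BlockedOff n C C' i) := by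
  unfold BlockedOff; infer_instance

/-- The columns `C`, `C'` are type `Dₙ` blocked off at `i` by `b = C'(i)`. -/
def BlockedOffD (n : ℕ) (C C' : List ℤ) (i : ℕ) : Prop :=
  BlockedOff n C C' i ∨
  (-((ent C i).natAbs : ℤ) ≤ ent C' i ∧ ent C' i < 0 ∧ (-((ent C i).natAbs : ℤ) = ent C' i ↔ ent C i = -ent C' i) ∧
    (∀ x ∈ Finset.Icc ((ent C' i).natAbs : ℤ) n, AbsIn x C i ∧ AbsIn x C' i) ∧
    Odd ((Finset.Icc 1 i).filter (fun j => 0 < ent C j ∧ ent C' j < 0)).card)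

instance (n : ℕ) (C C' : List ℤ) (i : ℕ) : Decidable (BlockedOffD n C C' i) := by
  unfold BlockedOffD; infer_instance

/-- The loop over the rows in the reorder algorithm: `P` is the previous (reordered) column, `k`
the height of the present one, `C` its rows `1, …, j - 1` that have been chosen, and `b` the list
of the entries that are left.  For `j < k` only the entries are allowed that do not make
`P` and the present column blocked off at `j`. (The first argument is the number of rows left.) -/
def reorderLoop (n k : ℕ) (P : List ℤ) : ℕ → List ℤ → List ℤ → List ℤ
  | 0, C, _ => C
  | s + 1, C, b =>
      let j := C.length + 1
      match (b.filter (fun x => j < k → ¬ BlockedOffD n P (C ++ [x]) j)).argmin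
          (circ n (ent P j)) with
      | none => C
      | some x => reorderLoop n k P s (C ++ [x]) (b.erase x)

/-- Reorder the column `b` with respect to the previous column `P`. -/
def reorderCol (n : ℕ) (P b : List ℤ) : List ℤ := reorderLoop n b.length P b.length [] b

/-- Reorder the columns of a filling one after the other, the column before them being `P`. -/
def ordFrom (n : ℕ) : List ℤ → List (List ℤ) → List (List ℤ)
  | _, [] => []
  | P, b :: bs => reorderCol n P b :: ordFrom n (reorderCol n P b) bs

/-- The reorder algorithm `ord_D`: the first column is kept. -/
def ordD (n : ℕ) : List (List ℤ) → List (List ℤ)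
  | [] => []
  | b :: bs => b :: ordFrom n b bs

/-- The path algorithm for one column `C` of height `k`, starting with the word `w` and running
through a list of roots. The result is the list of the selected roots. -/
def pathCol (n k : ℕ) (C : List ℤ) : Equiv.Perm ℤ → List (ℤ × ℤ) → List (ℤ × ℤ)
  | _, [] => []
  | w, β :: G =>
      if β = ((k : ℤ), (k : ℤ) + 1) ∧ BlockedOffD n (col k w) C k then
        β :: pathCol n k C (w * refl β) G
      else if w β.1 ≠ ent C β.1.toNat ∧
          (0 < circ n (w β.1) (w β.2) ∧
            circ n (w β.1) (w β.2) ≤ circ n (w β.1) (ent C β.1.toNat)) ∧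
          ¬ BlockedOffD n (col k (w * refl β)) C β.1.toNat then
        β :: pathCol n k C (w * refl β) G
      else pathCol n k C w G

/-- The path algorithm, column by column; the word reached at the end of a segment is the initial
word of the next one. -/
def pathFrom (n : ℕ) : Equiv.Perm ℤ → List (List (ℤ × ℤ)) → List (List ℤ) → List (List (ℤ × ℤ))
  | w, G :: Gs, C :: Cs =>
      let S := pathCol n C.length C w G
      S :: pathFrom n (w * (S.map refl).prod) Gs Cs
  | _, _, _ => []

/-- The path algorithm `Path_D`, which starts with the identity. -/
def pathD (n : ℕ) (p : List ℕ) (C : List (List ℤ)) : List (List (ℤ × ℤ)) :=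
  pathFrom n 1 (chain n p) C

/-! ### No root is repeated inside a segment of the chain -/

theorem descend_nodup (a b : ℕ) : (descend a b).Nodup := by
  unfold descend
  refine List.Nodup.map (fun x y h => by simpa using h) ?_
  exact List.nodup_reverse.2 List.nodup_range'

theorem mem_descend {a b : ℕ} {x : ℤ} (h : x ∈ descend a b) : (a : ℤ) ≤ x ∧ x ≤ b := by
  unfold descend at h
  simp only [List.mem_map, List.mem_reverse, List.mem_range'_1] at h
  obtain ⟨j, hj, rfl⟩ := h
  omega

theorem chain_nodup {n : ℕ} {p : List ℕ} {G : List (ℤ × ℤ)} (h : G ∈ chain n p) : G.Nodup := by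
  have key : ∀ (l : List ℕ) (f : ℕ → List (ℤ × ℤ)), l.Nodup → (∀ i ∈ l, (f i).Nodup) →
      (∀ i ∈ l, ∀ β ∈ f i, β.1 = (i : ℤ)) → (l.flatMap f).Nodup := by
    intro l f hl h1 h2
    refine List.nodup_flatMap.2 ⟨h1, ?_⟩
    refine hl.imp_of_mem ?_
    intro i j hi hj hij β hβ hβ'
    have e1 := h2 i hi β hβ
    have e2 := h2 j hj β hβ'
    omega
  have inj : ∀ i : ℕ, Function.Injective (fun j : ℤ => ((i : ℤ), j)) := fun i x y h => by
    simpa using h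
  have injn : ∀ i : ℕ, Function.Injective (fun j : ℤ => ((i : ℤ), -j)) := fun i x y h => by
    simpa using h
  unfold chain at h
  simp only [List.mem_flatMap, List.mem_cons, List.not_mem_nil, or_false] at h
  obtain ⟨k, -, rfl | rfl⟩ := h
  · refine key _ _ (List.nodup_reverse.2 List.nodup_range') ?_ ?_
    · intro i hi
      simp only [List.mem_reverse, List.mem_range'_1] at hi
      unfold chainKI
      refine List.Nodup.append (List.Nodup.append ?_ ?_ ?_) ?_ ?_
      · exact (List.nodup_reverse.2 (descend_nodup _ _)).map (inj i)
      · exact (descend_nodup _ _).map (injn i)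
      · intro β h1 h2
        simp only [List.mem_map, List.mem_reverse] at h1 h2
        obtain ⟨x, hx, rfl⟩ := h1
        obtain ⟨y, hy, hxy⟩ := h2
        have h3 := mem_descend hx
        have h4 := mem_descend hy
        simp only [Prod.mk.injEq, true_and] at hxy
        omega
      · exact (descend_nodup _ _).map (injn i)
      · intro β h1 h2
        simp only [List.mem_append, List.mem_map, List.mem_reverse] at h1 h2
        obtain ⟨y, hy, rfl⟩ := h2
        have h4 := mem_descend hy
        rcases h1 with ⟨x, hx, hxy⟩ | ⟨x, hx, hxy⟩ <;>
        · have h3 := mem_descend hx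
          simp only [Prod.mk.injEq, true_and] at hxy
          omega
    · intro i _ β hβ
      unfold chainKI at hβ
      simp only [List.mem_append, List.mem_map] at hβ
      rcases hβ with (⟨x, -, rfl⟩ | ⟨x, -, rfl⟩) | ⟨x, -, rfl⟩ <;> rfl
  · refine key _ _ (List.nodup_reverse.2 List.nodup_range') ?_ ?_
    · intro i _
      exact (descend_nodup _ _).map (injn i)
    · intro i _ β hβ
      simp only [List.mem_map] at hβ
      obtain ⟨x, -, rfl⟩ := hβ
      rfl

end

end QAlcoveD

namespace QAlcoveD

section

open Finset

/-! ### Letters and positions -/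

/-- Strict betweenness on a circle, for integers that are seen as points of a circle. -/
def Bt (a x b : ℤ) : Prop := (a < x ∧ x < b) ∨ (x < b ∧ b < a) ∨ (b < a ∧ a < x)

theorem IsLetter.neg {n : ℕ} {x : ℤ} (h : IsLetter n x) : IsLetter n (-x) := by
  unfold IsLetter at *; omega

theorem isLetter_neg_iff {n : ℕ} {x : ℤ} : IsLetter n (-x) ↔ IsLetter n x := by
  unfold IsLetter; omega

theorem pos_bounds {n : ℕ} {x : ℤ} (h : IsLetter n x) : 1 ≤ pos n x ∧ pos n x ≤ 2 * n := by
  unfold IsLetter at h; unfold pos; split_ifs <;> omega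

theorem pos_neg {n : ℕ} {x : ℤ} (h : IsLetter n x) : pos n (-x) = 2 * n + 1 - pos n x := by
  unfold IsLetter at h; unfold pos; split_ifs <;> omega

theorem pos_le_iff {n : ℕ} {x : ℤ} (h : IsLetter n x) : pos n x ≤ n ↔ 0 < x := by
  unfold IsLetter at h; unfold pos; split_ifs <;> omega

theorem pos_inj {n : ℕ} {x y : ℤ} (hx : IsLetter n x) (hy : IsLetter n y)
    (h : pos n x = pos n y) : x = y := by
  unfold IsLetter at *; unfold pos at h; split_ifs at h <;> omega

theorem pos_of_pos {n : ℕ} {x : ℤ} (h : 0 < x) : pos n x = x := by simp [pos, h]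

theorem pos_of_neg {n : ℕ} {x : ℤ} (h : x < 0) : pos n x = 2 * n + 1 + x := by
  unfold pos; split_ifs <;> omega

/-- A permutation of `ℤ` that induces a signed permutation of the letters. -/
def SP (n : ℕ) (w : Equiv.Perm ℤ) : Prop :=
  (∀ x, w (-x) = -w x) ∧ ∀ x, IsLetter n x → IsLetter n (w x)

theorem SP.neg {n : ℕ} {w : Equiv.Perm ℤ} (h : SP n w) (x : ℤ) : w (-x) = -w x := h.1 x

theorem SP.letter {n : ℕ} {w : Equiv.Perm ℤ} (h : SP n w) {x : ℤ} (hx : IsLetter n x) :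
    IsLetter n (w x) := h.2 x hx

theorem SP.one (n : ℕ) : SP n 1 := ⟨fun _ => rfl, fun _ h => h⟩

/-- A label of a reflection: two letters with different absolute values. -/
def Lab (n : ℕ) (i m : ℤ) : Prop := IsLetter n i ∧ IsLetter n m ∧ i ≠ m ∧ i ≠ -m

theorem refl_apply (i m x : ℤ) : refl (i, m) x =
    Equiv.swap i m (Equiv.swap (-i) (-m) x) := rfl

theorem refl_fst {n : ℕ} {i m : ℤ} (h : Lab n i m) : refl (i, m) i = m := by
  obtain ⟨⟨h1, -⟩, ⟨h2, -⟩, h3, h4⟩ := h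
  rw [refl_apply, Equiv.swap_apply_of_ne_of_ne (a := -i) (b := -m) (by omega) (by omega),
    Equiv.swap_apply_left]

theorem refl_snd {n : ℕ} {i m : ℤ} (h : Lab n i m) : refl (i, m) m = i := by
  obtain ⟨⟨h1, -⟩, ⟨h2, -⟩, h3, h4⟩ := h
  rw [refl_apply, Equiv.swap_apply_of_ne_of_ne (a := -i) (b := -m) (by omega) (by omega),
    Equiv.swap_apply_right]

theorem refl_neg_fst {n : ℕ} {i m : ℤ} (h : Lab n i m) : refl (i, m) (-i) = -m := by
  obtain ⟨⟨h1, -⟩, ⟨h2, -⟩, h3, h4⟩ := h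
  rw [refl_apply, Equiv.swap_apply_left, Equiv.swap_apply_of_ne_of_ne (by omega) (by omega)]

theorem refl_neg_snd {n : ℕ} {i m : ℤ} (h : Lab n i m) : refl (i, m) (-m) = -i := by
  obtain ⟨⟨h1, -⟩, ⟨h2, -⟩, h3, h4⟩ := h
  rw [refl_apply, Equiv.swap_apply_right, Equiv.swap_apply_of_ne_of_ne (by omega) (by omega)]

theorem refl_of_ne {i m x : ℤ} (h1 : x ≠ i) (h2 : x ≠ m) (h3 : x ≠ -i) (h4 : x ≠ -m) :
    refl (i, m) x = x := by
  rw [refl_apply, Equiv.swap_apply_of_ne_of_ne h3 h4, Equiv.swap_apply_of_ne_of_ne h1 h2]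

theorem refl_cases {n : ℕ} {i m : ℤ} (h : Lab n i m) (x : ℤ) :
    (x = i ∧ refl (i, m) x = m) ∨ (x = m ∧ refl (i, m) x = i) ∨
    (x = -i ∧ refl (i, m) x = -m) ∨ (x = -m ∧ refl (i, m) x = -i) ∨
    (x ≠ i ∧ x ≠ m ∧ x ≠ -i ∧ x ≠ -m ∧ refl (i, m) x = x) := by
  by_cases h1 : x = i
  · subst h1; exact Or.inl ⟨rfl, refl_fst h⟩
  by_cases h2 : x = m
  · subst h2; exact Or.inr (Or.inl ⟨rfl, refl_snd h⟩)
  by_cases h3 : x = -i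
  · subst h3; exact Or.inr (Or.inr (Or.inl ⟨rfl, refl_neg_fst h⟩))
  by_cases h4 : x = -m
  · subst h4; exact Or.inr (Or.inr (Or.inr (Or.inl ⟨rfl, refl_neg_snd h⟩)))
  · exact Or.inr (Or.inr (Or.inr (Or.inr ⟨h1, h2, h3, h4, refl_of_ne h1 h2 h3 h4⟩)))

theorem refl_neg_apply {n : ℕ} {i m : ℤ} (h : Lab n i m) (x : ℤ) :
    refl (i, m) (-x) = -refl (i, m) x := by
  have h' := h
  obtain ⟨⟨h1, -⟩, ⟨h2, -⟩, h3, h4⟩ := h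
  rcases refl_cases h' x with h5 | h5 | h5 | h5 | h5 <;>
  rcases refl_cases h' (-x) with h6 | h6 | h6 | h6 | h6 <;> omega

theorem refl_letter {n : ℕ} {i m : ℤ} (h : Lab n i m) {x : ℤ} (hx : IsLetter n x) :
    IsLetter n (refl (i, m) x) := by
  have h' := h
  obtain ⟨h1, h2, h3, h4⟩ := h
  have := h1.neg
  have := h2.neg
  rcases refl_cases h' x with ⟨_, h5⟩ | ⟨_, h5⟩ | ⟨_, h5⟩ | ⟨_, h5⟩ | ⟨_, _, _, _, h5⟩ <;>
  rw [h5] <;> assumption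

theorem refl_refl {n : ℕ} {i m : ℤ} (h : Lab n i m) (x : ℤ) :
    refl (i, m) (refl (i, m) x) = x := by
  rcases refl_cases h x with ⟨h0, h5⟩ | ⟨h0, h5⟩ | ⟨h0, h5⟩ | ⟨h0, h5⟩ | ⟨_, _, _, _, h5⟩ <;>
  rw [h5] <;> try subst h0
  · exact refl_snd h
  · exact refl_fst h
  · exact refl_neg_snd h
  · exact refl_neg_fst h
  · exact h5

theorem SP.mul_refl {n : ℕ} {w : Equiv.Perm ℤ} (hw : SP n w) {i m : ℤ} (h : Lab n i m) :
    SP n (w * refl (i, m)) := by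
  refine ⟨fun x => ?_, fun x hx => ?_⟩
  · rw [Equiv.Perm.mul_apply, Equiv.Perm.mul_apply, refl_neg_apply h, hw.neg]
  · exact hw.letter (refl_letter h hx)

theorem mul_refl_fst {n : ℕ} {w : Equiv.Perm ℤ} {i m : ℤ} (h : Lab n i m) :
    (w * refl (i, m)) i = w m := by rw [Equiv.Perm.mul_apply, refl_fst h]

theorem mul_refl_snd {n : ℕ} {w : Equiv.Perm ℤ} {i m : ℤ} (h : Lab n i m) :
    (w * refl (i, m)) m = w i := by rw [Equiv.Perm.mul_apply, refl_snd h]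

theorem mul_refl_neg_snd {n : ℕ} {w : Equiv.Perm ℤ} (hw : SP n w) {i m : ℤ} (h : Lab n i m) :
    (w * refl (i, m)) (-m) = -w i := by
  rw [Equiv.Perm.mul_apply, refl_neg_snd h, hw.neg]

theorem mul_refl_of_ne {w : Equiv.Perm ℤ} {i m x : ℤ} (h1 : x ≠ i) (h2 : x ≠ m) (h3 : x ≠ -i)
    (h4 : x ≠ -m) : (w * refl (i, m)) x = w x := by
  rw [Equiv.Perm.mul_apply, refl_of_ne h1 h2 h3 h4]

theorem SP.natAbs_inj {n : ℕ} {w : Equiv.Perm ℤ} (hw : SP n w) {x y : ℤ}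
    (h : (w x).natAbs = (w y).natAbs) : x = y ∨ x = -y := by
  rcases Int.natAbs_eq_natAbs_iff.1 h with h | h
  · exact Or.inl (w.injective h)
  · rw [← hw.neg] at h
    exact Or.inr (w.injective h)

/-- The condition that there is an edge labelled `(i, m)` at `w` in the quantum Bruhat graph. -/
def Jump (n : ℕ) (w : Equiv.Perm ℤ) (i m : ℤ) : Prop :=
  ∀ l, IsLetter n l → pos n i < pos n l → pos n l < pos n m → l ≠ -i → l ≠ -m →
    ¬ Bt (pos n (w i)) (pos n (w l)) (pos n (w m))

/-! ### Lengths, and the edges of the quantum Bruhat graph -/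

/-- The set of letters. -/
noncomputable def letters (n : ℕ) : Finset ℤ := (Icc (-(n : ℤ)) n).erase 0

theorem mem_letters {n : ℕ} {x : ℤ} : x ∈ letters n ↔ IsLetter n x := by
  unfold letters IsLetter; simp only [mem_erase, mem_Icc]; omega

theorem eps_neg (n : ℕ) (x : ℤ) : eps n (-x) = -eps n x := by
  funext c; simp only [eps, Pi.neg_apply]; split_ifs <;> omega

theorem act_eps {n : ℕ} {w : Equiv.Perm ℤ} (hw : SP n w) {x : ℤ} (hx : IsLetter n x) :
    act n w (eps n x) = eps n (w x) := by
  have key : ∀ y : ℤ, 0 < y → IsLetter n y → act n w (eps n y) = eps n (w y) := by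
    intro y hy hl
    have hc : ((y - 1).toNat) < n := by unfold IsLetter at hl; omega
    unfold act
    rw [sum_eq_single (⟨(y - 1).toNat, hc⟩ : Fin n)]
    · have h1 : (((⟨(y - 1).toNat, hc⟩ : Fin n) : ℕ) : ℤ) + 1 = y := by simp; omega
      rw [h1]
      simp only [eps]
      rw [if_pos (by simp; omega), one_smul]
    · intro c _ hc'
      have : (c : ℤ) + 1 ≠ y := by
        intro h; apply hc'; ext; simp; omega
      simp only [eps]
      rw [if_neg (by omega), if_neg (by omega), zero_smul]
    · simp
  rcases lt_trichotomy x 0 with h | h | h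
  · have h1 := key (-x) (by omega) hx.neg
    rw [eps_neg, hw.neg, eps_neg] at h1
    have h2 : act n w (-eps n x) = -act n w (eps n x) := by
      unfold act; simp [Finset.sum_neg_distrib]
    rw [h2] at h1
    exact neg_injective h1
  · exact absurd h hx.1
  · exact key x h hx

theorem act_root {n : ℕ} {w : Equiv.Perm ℤ} (hw : SP n w) {x y : ℤ} (hx : IsLetter n x)
    (hy : IsLetter n y) : act n w (root n (x, y)) = root n (w x, w y) := by
  have h2 : act n w (eps n x - eps n y) = act n w (eps n x) - act n w (eps n y) := by
    unfold act; simp [sub_mul, Finset.sum_sub_distrib]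
  simp only [root]
  rw [h2, act_eps hw hx, act_eps hw hy]

/-- A linear form that is positive on the positive roots. -/
def height (n : ℕ) (v : Fin n → ℤ) : ℤ := ∑ c : Fin n, v c * (2 * n + 1 - 2 * ((c : ℤ) + 1))

theorem sum_eps_mul {n : ℕ} (f : ℤ → ℤ) (hf : ∀ x, f (-x) = -f x) {x : ℤ} (hx : IsLetter n x) :
    ∑ c : Fin n, eps n x c * f ((c : ℤ) + 1) = f x := by
  have key : ∀ y : ℤ, 0 < y → IsLetter n y → ∑ c : Fin n, eps n y c * f ((c : ℤ) + 1) = f y := by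
    intro y hy hl
    have hc : ((y - 1).toNat) < n := by unfold IsLetter at hl; omega
    rw [sum_eq_single (⟨(y - 1).toNat, hc⟩ : Fin n)]
    · have h1 : (((⟨(y - 1).toNat, hc⟩ : Fin n) : ℕ) : ℤ) + 1 = y := by simp; omega
      rw [h1]
      simp only [eps]
      rw [if_pos (by simp; omega), one_mul]
    · intro c _ hc'
      have : (c : ℤ) + 1 ≠ y := by
        intro h; apply hc'; ext; simp; omega
      simp only [eps]
      rw [if_neg (by omega), if_neg (by omega), zero_mul]
    · simp
  rcases lt_trichotomy x 0 with h | h | h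
  · have h1 := key (-x) (by omega) hx.neg
    rw [eps_neg, hf] at h1
    simp only [Pi.neg_apply, neg_mul, Finset.sum_neg_distrib] at h1
    exact neg_injective h1
  · exact absurd h hx.1
  · exact key x h hx

theorem height_eps {n : ℕ} {x : ℤ} (hx : IsLetter n x) :
    height n (eps n x) = 2 * n + 1 - 2 * pos n x := by
  have h := sum_eps_mul (n := n)
    (fun y => if 0 < y then 2 * n + 1 - 2 * y else if y < 0 then -(2 * n + 1 + 2 * y) else 0)
    (by intro y; split_ifs <;> omega) hx
  unfold height
  rw [sum_congr rfl (g := fun c : Fin n => eps n x c * (if 0 < (c : ℤ) + 1 then 2 * n + 1 - 2 * ((c : ℤ) + 1) else if (c : ℤ) + 1 < 0 then -(2 * n + 1 + 2 * ((c : ℤ) + 1)) else 0)), h]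
  · obtain ⟨h0, h1⟩ := hx
    unfold pos; split_ifs <;> omega
  · intro c _
    rw [if_pos (by omega)]

theorem height_sub (n : ℕ) (u v : Fin n → ℤ) : height n (u - v) = height n u - height n v := by
  unfold height; simp [sub_mul, Finset.sum_sub_distrib]

theorem root_mem_posRoots {n : ℕ} {x y : ℤ} (hx : IsLetter n x) (hy : IsLetter n y)
    (hxy : x.natAbs ≠ y.natAbs) : root n (x, y) ∈ posRoots n ↔ pos n x < pos n y := by
  constructor
  · intro h
    unfold posRoots at h
    simp only [mem_image, mem_filter, mem_product, mem_Icc, Prod.exists] at h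
    obtain ⟨a, b, ⟨⟨⟨h1, h2⟩, h3, h4⟩, h5⟩, h6⟩ := h
    have ha : IsLetter n a := ⟨by omega, by omega⟩
    have hb : IsLetter n b := ⟨by omega, by omega⟩
    have h7 := congrArg (height n) h6
    simp only [root, height_sub, height_eps ha, height_eps hb, height_eps hx, height_eps hy] at h7
    have h8 : pos n a < pos n b := by unfold pos; split_ifs <;> omega
    omega
  · intro h
    unfold posRoots
    simp only [mem_image, mem_filter, mem_product, mem_Icc, Prod.exists]
    obtain ⟨hx0, hx1⟩ := hx
    obtain ⟨hy0, hy1⟩ := hy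
    unfold pos at h
    rcases lt_or_gt_of_ne hxy with h1 | h1
    · refine ⟨x, y, ⟨⟨⟨?_, ?_⟩, ?_, ?_⟩, ?_⟩, rfl⟩ <;> split_ifs at h <;> omega
    · refine ⟨-y, -x, ⟨⟨⟨?_, ?_⟩, ?_, ?_⟩, ?_⟩, ?_⟩
      iterate 5 split_ifs at h <;> omega
      simp only [root, eps_neg]
      abel

/-- The standard labels of the positive roots. -/
noncomputable def stdLabels (n : ℕ) : Finset (ℤ × ℤ) :=
  ((Finset.Icc (1 : ℤ) n) ×ˢ (Finset.Icc (-(n : ℤ)) n)).filter (fun β => β.1 < β.2.natAbs)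

theorem mem_stdLabels {n : ℕ} {x y : ℤ} : (x, y) ∈ stdLabels n ↔
    IsLetter n x ∧ IsLetter n y ∧ 0 < x ∧ x < y.natAbs := by
  unfold stdLabels IsLetter
  simp only [mem_filter, mem_product, mem_Icc]
  omega

theorem eps_inj {n : ℕ} {x y : ℤ} (hx : IsLetter n x) (hy : IsLetter n y)
    (h : eps n x = eps n y) : x = y := by
  have h1 := congrArg (height n) h
  rw [height_eps hx, height_eps hy] at h1
  exact pos_inj hx hy (by omega)

theorem root_injOn (n : ℕ) : Set.InjOn (root n) (stdLabels n) := by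
  rintro ⟨x, y⟩ h ⟨x', y'⟩ h' he
  simp only [mem_coe, mem_stdLabels] at h h'
  obtain ⟨hx, hy, h1, h2⟩ := h
  obtain ⟨hx', hy', h1', h2'⟩ := h'
  have ev : ∀ z : ℤ, 0 < z → IsLetter n z →
      (if x = z then (1 : ℤ) else if x = -z then -1 else 0) - (if y = z then (1 : ℤ) else if y = -z then -1 else 0)
      = (if x' = z then (1 : ℤ) else if x' = -z then -1 else 0) - (if y' = z then (1 : ℤ) else if y' = -z then -1 else 0) := by
    intro z hz hl
    have hc : ((z - 1).toNat) < n := by unfold IsLetter at hl; omega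
    have := congrFun he ⟨(z - 1).toNat, hc⟩
    have e : ((z - 1).toNat : ℤ) + 1 = z := by omega
    simpa only [root, eps, Pi.sub_apply, e] using this
  have e1 := ev x h1 hx
  have e2 := ev x' h1' hx'
  have hxx : x = x' := by
    rw [if_pos rfl, if_neg (c := y = x) (by omega), if_neg (c := y = -x) (by omega)] at e1
    rw [if_pos (c := x' = x') rfl, if_neg (c := y' = x') (by omega),
      if_neg (c := y' = -x') (by omega)] at e2
    clear ev he
    by_contra hne
    rw [if_neg (c := x' = x) (by omega), if_neg (c := x' = -x) (by omega)] at e1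
    rw [if_neg (c := x = x') (by omega), if_neg (c := x = -x') (by omega)] at e2
    have f1 : y' = -x := by by_contra hh; rw [if_neg hh] at e1; split_ifs at e1 <;> omega
    have f2 : y = -x' := by by_contra hh; rw [if_neg hh] at e2; split_ifs at e2 <;> omega
    omega
  subst hxx
  have : eps n y = eps n y' := by
    simp only [root] at he
    exact sub_right_injective he
  rw [eps_inj hy hy' this]

theorem len_eq {n : ℕ} {w : Equiv.Perm ℤ} (hw : SP n w) :
    len n w = ((stdLabels n).filter (fun β => pos n (w β.2) < pos n (w β.1))).card := by
  unfold len
  have h0 : posRoots n = (stdLabels n).image (root n) := rfl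
  rw [h0, filter_image, card_image_of_injOn]
  · congr 1
    apply filter_congr
    rintro ⟨x, y⟩ hβ
    obtain ⟨hx, hy, h1, h2⟩ := mem_stdLabels.1 hβ
    rw [act_root hw hx hy]
    have e : -root n (w x, w y) = root n (w y, w x) := by simp [root]
    rw [e, ← h0, root_mem_posRoots (hw.letter hy) (hw.letter hx)]
    intro h
    rcases hw.natAbs_inj h with h | h <;> omega
  · exact (root_injOn n).mono (by intro β; simp; tauto)

/-- The contribution of a pair of letters to twice the length. -/
def invTerm (n : ℕ) (w : Equiv.Perm ℤ) (x y : ℤ) : ℤ :=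
  if x.natAbs ≠ y.natAbs ∧ pos n x < pos n y ∧ pos n (w y) < pos n (w x) then 1 else 0

theorem two_len_eq {n : ℕ} {w : Equiv.Perm ℤ} (hw : SP n w) :
    2 * (len n w : ℤ) = ∑ x ∈ letters n, ∑ y ∈ letters n, invTerm n w x y := by
  rw [← sum_product']
  unfold invTerm
  rw [← sum_filter, sum_const, nsmul_eq_mul, mul_one]
  set E := (letters n ×ˢ letters n).filter
    (fun β => β.1.natAbs ≠ β.2.natAbs ∧ pos n β.1 < pos n β.2 ∧ pos n (w β.2) < pos n (w β.1)) with hE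
  have h1 : E.filter (fun β => β.1.natAbs < β.2.natAbs) =
      (stdLabels n).filter (fun β => pos n (w β.2) < pos n (w β.1)) := by
    ext ⟨x, y⟩
    simp only [hE, mem_filter, mem_product, mem_letters, mem_stdLabels]
    constructor
    · rintro ⟨⟨⟨h1, h2⟩, h3, h4, h5⟩, h6⟩
      refine ⟨⟨h1, h2, ?_⟩, h5⟩
      unfold IsLetter at h1 h2; unfold pos at h4; split_ifs at h4 <;> omega
    · rintro ⟨⟨h1, h2, h3, h4⟩, h5⟩
      refine ⟨⟨⟨h1, h2⟩, by omega, ?_, h5⟩, by omega⟩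
      unfold IsLetter at h1 h2; unfold pos; split_ifs <;> omega
  have h2 : (E.filter (fun β => ¬ β.1.natAbs < β.2.natAbs)).card =
      (E.filter (fun β => β.1.natAbs < β.2.natAbs)).card := by
    refine card_bij' (fun β _ => (-β.2, -β.1)) (fun β _ => (-β.2, -β.1)) ?_ ?_ ?_ ?_
    · rintro ⟨x, y⟩ h
      simp only [hE, mem_filter, mem_product, mem_letters] at h ⊢
      obtain ⟨⟨⟨h1, h2⟩, h3, h4, h5⟩, h6⟩ := h
      simp only [hw.neg, pos_neg h1, pos_neg h2, pos_neg (hw.letter h1), pos_neg (hw.letter h2), Int.natAbs_neg]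
      exact ⟨⟨⟨h2.neg, h1.neg⟩, by omega, by omega, by omega⟩, by omega⟩
    · rintro ⟨x, y⟩ h
      simp only [hE, mem_filter, mem_product, mem_letters] at h ⊢
      obtain ⟨⟨⟨h1, h2⟩, h3, h4, h5⟩, h6⟩ := h
      simp only [hw.neg, pos_neg h1, pos_neg h2, pos_neg (hw.letter h1), pos_neg (hw.letter h2), Int.natAbs_neg]
      exact ⟨⟨⟨h2.neg, h1.neg⟩, by omega, by omega, by omega⟩, by omega⟩
    · rintro ⟨x, y⟩ _; simp
    · rintro ⟨x, y⟩ _; simp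
  have h3 := card_filter_add_card_filter_not (s := E) (fun β => β.1.natAbs < β.2.natAbs)
  rw [h2, h1] at h3
  rw [len_eq hw]
  push_cast [← h3]
  ring

theorem indicator_sum_aux {px pi pm vx vi vm : ℤ} (h : pi < pm) (hv : vi < vm) (h1 : px ≠ pi)
    (h2 : px ≠ pm) (h3 : vx ≠ vi) (h4 : vx ≠ vm) :
    (((if px < pm ∧ vi < vx then 1 else 0 : ℤ) - (if px < pi ∧ vi < vx then 1 else 0)) +
    ((if pm < px ∧ vx < vi then 1 else 0) - (if pi < px ∧ vx < vi then 1 else 0))) +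
    (((if px < pi ∧ vm < vx then 1 else 0 : ℤ) - (if px < pm ∧ vm < vx then 1 else 0)) +
    ((if pi < px ∧ vx < vm then 1 else 0) - (if pm < px ∧ vx < vm then 1 else 0))) =
    2 * (if pi < px ∧ px < pm ∧ vi < vx ∧ vx < vm then 1 else 0) := by
  have a : px < pi ∨ (pi < px ∧ px < pm) ∨ pm < px := by omega
  have b : vx < vi ∨ (vi < vx ∧ vx < vm) ∨ vm < vx := by omega
  rcases a with a | a | a <;> rcases b with b | b | b <;>
  · repeat' first
      | rw [if_pos (by omega)]
      | rw [if_neg (by omega)]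
    try norm_num

/-- The letters strictly between `i` and `m`, other than `-i` and `-m`, with property `R`. -/
noncomputable def inner (n : ℕ) (i m : ℤ) (R : ℤ → Prop) : Finset ℤ := by
  classical
  exact (letters n).filter
    (fun x => (pos n i < pos n x ∧ pos n x < pos n m ∧ x ≠ -i ∧ x ≠ -m) ∧ R x)

theorem mem_inner {n : ℕ} {i m : ℤ} {R : ℤ → Prop} {x : ℤ} : x ∈ inner n i m R ↔
    IsLetter n x ∧ (pos n i < pos n x ∧ pos n x < pos n m ∧ x ≠ -i ∧ x ≠ -m) ∧ R x := by
  classical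
  unfold inner; rw [mem_filter, mem_letters]

theorem sum_letters_refl {n : ℕ} {i m : ℤ} (h : Lab n i m) (f : ℤ → ℤ) :
    ∑ x ∈ letters n, f (refl (i, m) x) = ∑ x ∈ letters n, f x := by
  refine sum_nbij' (refl (i, m)) (refl (i, m)) ?_ ?_ ?_ ?_ ?_
  · intro x hx; exact mem_letters.2 (refl_letter h (mem_letters.1 hx))
  · intro x hx; exact mem_letters.2 (refl_letter h (mem_letters.1 hx))
  · intro x _; exact refl_refl h x
  · intro x _; exact refl_refl h x
  · intro x _; rfl

theorem sum_letters_neg {n : ℕ} (f : ℤ → ℤ) :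
    ∑ x ∈ letters n, f (-x) = ∑ x ∈ letters n, f x := by
  refine sum_nbij' (fun x => -x) (fun x => -x) ?_ ?_ ?_ ?_ ?_
  · intro x hx; exact mem_letters.2 (mem_letters.1 hx).neg
  · intro x hx; exact mem_letters.2 (mem_letters.1 hx).neg
  · intro x _; simp
  · intro x _; simp
  · intro x _; rfl

/-- The change of the contribution of a pair of letters to twice the length. -/
def invDiff (n : ℕ) (w : Equiv.Perm ℤ) (i m x y : ℤ) : ℤ :=
  invTerm n (w * refl (i, m)) (refl (i, m) x) (refl (i, m) y) - invTerm n w x y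

theorem two_len_sub {n : ℕ} {w : Equiv.Perm ℤ} (hw : SP n w) {i m : ℤ} (h : Lab n i m) :
    2 * (len n (w * refl (i, m)) : ℤ) - 2 * len n w =
      ∑ x ∈ letters n, ∑ y ∈ letters n, invDiff n w i m x y := by
  rw [two_len_eq hw, two_len_eq (hw.mul_refl h)]
  unfold invDiff
  simp only [sum_sub_distrib]
  congr 1
  rw [← sum_letters_refl h]
  refine sum_congr rfl fun x _ => ?_
  rw [← sum_letters_refl h]

theorem refl_natAbs_ne {n : ℕ} {i m : ℤ} (h : Lab n i m) (x y : ℤ) :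
    (refl (i, m) x).natAbs ≠ (refl (i, m) y).natAbs ↔ x.natAbs ≠ y.natAbs := by
  have : (refl (i, m) x).natAbs = (refl (i, m) y).natAbs ↔ x.natAbs = y.natAbs := by
    rw [Int.natAbs_eq_natAbs_iff, Int.natAbs_eq_natAbs_iff, ← refl_neg_apply h,
      (refl (i, m)).injective.eq_iff, (refl (i, m)).injective.eq_iff]
  exact not_congr this

theorem invDiff_eq {n : ℕ} {w : Equiv.Perm ℤ} {i m : ℤ} (h : Lab n i m) (x y : ℤ) :
    invDiff n w i m x y =
      (if x.natAbs ≠ y.natAbs ∧ pos n (refl (i, m) x) < pos n (refl (i, m) y) ∧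
        pos n (w y) < pos n (w x) then 1 else 0) -
      (if x.natAbs ≠ y.natAbs ∧ pos n x < pos n y ∧ pos n (w y) < pos n (w x) then 1 else 0) := by
  unfold invDiff invTerm
  simp only [refl_natAbs_ne h, Equiv.Perm.mul_apply, refl_refl h]

theorem invDiff_of_ne {n : ℕ} {w : Equiv.Perm ℤ} {i m : ℤ} (h : Lab n i m) {x y x' y' : ℤ}
    (hx : refl (i, m) x = x') (hy : refl (i, m) y = y') (hxy : x.natAbs ≠ y.natAbs) :
    invDiff n w i m x y =
      (if pos n x' < pos n y' ∧ pos n (w y) < pos n (w x) then 1 else 0) -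
      (if pos n x < pos n y ∧ pos n (w y) < pos n (w x) then 1 else 0) := by
  rw [invDiff_eq h, hx, hy]
  simp only [ne_eq, hxy, not_false_eq_true, true_and]

theorem invDiff_outer {n : ℕ} {w : Equiv.Perm ℤ} (hw : SP n w) {i m x : ℤ} (h : Lab n i m)
    (him : pos n i < pos n m) (hv : pos n (w i) < pos n (w m)) (hx : IsLetter n x)
    (h1 : x ≠ i) (h2 : x ≠ m) (h3 : x ≠ -i) (h4 : x ≠ -m) :
    (invDiff n w i m x i + invDiff n w i m i x) + (invDiff n w i m x m + invDiff n w i m m x) =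
      2 * (if pos n i < pos n x ∧ pos n x < pos n m ∧ pos n (w i) < pos n (w x) ∧
        pos n (w x) < pos n (w m) then 1 else 0) := by
  have e := refl_of_ne h1 h2 h3 h4
  have hi := h.1
  have hm := h.2.1
  rw [invDiff_of_ne h e (refl_fst h) (by omega), invDiff_of_ne h (refl_fst h) e (by omega),
    invDiff_of_ne h e (refl_snd h) (by omega), invDiff_of_ne h (refl_snd h) e (by omega)]
  refine indicator_sum_aux him hv ?_ ?_ ?_ ?_
  · exact fun hh => h1 (pos_inj hx hi hh)
  · exact fun hh => h2 (pos_inj hx hm hh)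
  · exact fun hh => h1 (w.injective (pos_inj (hw.letter hx) (hw.letter hi) hh))
  · exact fun hh => h2 (w.injective (pos_inj (hw.letter hx) (hw.letter hm) hh))

theorem invDiff_neg {n : ℕ} {w : Equiv.Perm ℤ} (hw : SP n w) {i m : ℤ} (h : Lab n i m) {x y : ℤ}
    (hx : IsLetter n x) (hy : IsLetter n y) :
    invDiff n w i m (-x) (-y) = invDiff n w i m y x := by
  rw [invDiff_eq h, invDiff_eq h]
  simp only [refl_neg_apply h, hw.neg, pos_neg hx, pos_neg hy, pos_neg (hw.letter hx),
    pos_neg (hw.letter hy), pos_neg (refl_letter h hx), pos_neg (refl_letter h hy), Int.natAbs_neg]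
  congr 1
  · congr 1
    simp only [ne_eq, eq_iff_iff]
    omega
  · congr 1
    simp only [ne_eq, eq_iff_iff]
    omega

theorem invDiff_zero {n : ℕ} {w : Equiv.Perm ℤ} {i m : ℤ} (h : Lab n i m) {x y : ℤ}
    (hx : refl (i, m) x = x) (hy : refl (i, m) y = y) : invDiff n w i m x y = 0 := by
  rw [invDiff_eq h, hx, hy, sub_self]

theorem len_mul_refl_of_lt {n : ℕ} {w : Equiv.Perm ℤ} (hw : SP n w) {i m : ℤ} (h : Lab n i m)
    (him : pos n i < pos n m) (hv : pos n (w i) < pos n (w m)) :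
    len n (w * refl (i, m)) = len n w + 1 + 2 * (inner n i m (fun x =>
      pos n (w i) < pos n (w x) ∧ pos n (w x) < pos n (w m))).card := by
  have hi := h.1
  have hm := h.2.1
  have him1 := h.2.2.1
  have him2 := h.2.2.2
  have hi0 := hi.1
  have hm0 := hm.1
  set g := invDiff n w i m with hg
  set S : Finset ℤ := {i, m, -i, -m} with hS
  have hSl : S ⊆ letters n := by
    intro x hx
    simp only [hS, mem_insert, mem_singleton] at hx
    rw [mem_letters]
    rcases hx with rfl | rfl | rfl | rfl
    exacts [hi, hm, hi.neg, hm.neg]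
  have sumS : ∀ f : ℤ → ℤ, ∑ x ∈ S, f x = f i + (f m + (f (-i) + f (-m))) := by
    intro f
    rw [hS, sum_insert, sum_insert, sum_insert, sum_singleton]
    all_goals simp only [mem_insert, mem_singleton]; omega
  have fixS : ∀ x ∈ letters n \ S, IsLetter n x ∧ x ≠ i ∧ x ≠ m ∧ x ≠ -i ∧ x ≠ -m := by
    intro x hx
    simp only [hS, mem_sdiff, mem_letters, mem_insert, mem_singleton, not_or] at hx
    exact hx
  have split : ∀ f : ℤ → ℤ, ∑ x ∈ letters n, f x = ∑ x ∈ letters n \ S, f x + ∑ x ∈ S, f x :=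
    fun f => (sum_sdiff hSl).symm
  let φ : ℤ → ℤ := fun x => if pos n i < pos n x ∧ pos n x < pos n m ∧
    pos n (w i) < pos n (w x) ∧ pos n (w x) < pos n (w m) then 1 else 0
  have outer : ∀ x ∈ letters n \ S, ∑ y ∈ S, (g x y + g y x) = 2 * φ x + 2 * φ (-x) := by
    intro x hx
    obtain ⟨hl, h1, h2, h3, h4⟩ := fixS x hx
    rw [sumS]
    have e1 := invDiff_outer hw h him hv hl h1 h2 h3 h4
    have e2 := invDiff_outer hw h him hv hl.neg (x := -x) (by omega) (by omega) (by omega)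
      (by omega)
    have f1 := invDiff_neg hw h hl.neg hi
    have f2 := invDiff_neg hw h hi hl.neg
    have f3 := invDiff_neg hw h hl.neg hm
    have f4 := invDiff_neg hw h hm hl.neg
    rw [neg_neg] at f1 f2 f3 f4
    rw [← f1, ← f2, ← f3, ← f4] at e2
    have e3 : 2 * φ x = _ := e1.symm
    have e4 : 2 * φ (-x) = _ := e2.symm
    rw [e3, e4]
    ring
  have inn : ∑ x ∈ S, ∑ y ∈ S, g x y = 2 := by
    rw [sumS, sumS, sumS, sumS, sumS]
    have z : ∀ x y : ℤ, x.natAbs = y.natAbs → g x y = 0 := by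
      intro x y hxy
      rw [hg, invDiff_eq h, if_neg (by tauto), if_neg (by tauto), sub_self]
    rw [z i i rfl, z i (-i) (by omega), z m m rfl, z m (-m) (by omega), z (-i) i (by omega),
      z (-i) (-i) rfl, z (-m) m (by omega), z (-m) (-m) rfl]
    have e1 : g i m = 0 := by
      rw [hg, invDiff_of_ne h (refl_fst h) (refl_snd h) (by omega), if_neg (by omega),
        if_neg (by omega), sub_self]
    have e2 : g m i = 1 := by
      rw [hg, invDiff_of_ne h (refl_snd h) (refl_fst h) (by omega), if_pos (by omega),
        if_neg (by omega), sub_zero]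
    have e3 : g (-i) (-m) = 1 := by rw [hg, invDiff_neg hw h hi hm]; exact e2
    have e4 : g (-m) (-i) = 0 := by rw [hg, invDiff_neg hw h hm hi]; exact e1
    have swp : ∀ x y x' y', refl (i, m) x = x' → refl (i, m) y = y' → IsLetter n x →
        IsLetter n y → IsLetter n x' → IsLetter n y' → x.natAbs ≠ y.natAbs →
        (pos n x' < pos n y' ↔ pos n x < pos n y) → g x y = 0 := by
      intro x y x' y' hx hy _ _ _ _ hne hiff
      rw [hg, invDiff_of_ne h hx hy hne]
      simp only [hiff, sub_self]
    have p1 := pos_neg hi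
    have p2 := pos_neg hm
    have e5 : g i (-m) = 0 := swp i (-m) m (-i) (refl_fst h) (refl_neg_snd h) hi hm.neg hm hi.neg
      (by omega) (by omega)
    have e6 : g (-m) i = 0 := swp (-m) i (-i) m (refl_neg_snd h) (refl_fst h) hm.neg hi hi.neg hm
      (by omega) (by omega)
    have e7 : g m (-i) = 0 := swp m (-i) i (-m) (refl_snd h) (refl_neg_fst h) hm hi.neg hi hm.neg
      (by omega) (by omega)
    have e8 : g (-i) m = 0 := swp (-i) m (-m) i (refl_neg_fst h) (refl_snd h) hi.neg hm hm.neg hi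
      (by omega) (by omega)
    rw [e1, e2, e3, e4, e5, e6, e7, e8]
    norm_num
  have total := two_len_sub hw h
  rw [← hg, split] at total
  have t1 : ∑ x ∈ letters n \ S, ∑ y ∈ letters n, g x y =
      ∑ x ∈ letters n \ S, ∑ y ∈ S, g x y := by
    refine sum_congr rfl fun x hx => ?_
    rw [split]
    have : ∑ y ∈ letters n \ S, g x y = 0 := by
      refine sum_eq_zero fun y hy => ?_
      obtain ⟨-, a1, a2, a3, a4⟩ := fixS x hx
      obtain ⟨-, b1, b2, b3, b4⟩ := fixS y hy
      exact invDiff_zero h (refl_of_ne a1 a2 a3 a4) (refl_of_ne b1 b2 b3 b4)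
    rw [this, zero_add]
  have t2 : ∑ x ∈ S, ∑ y ∈ letters n, g x y =
      ∑ x ∈ letters n \ S, ∑ y ∈ S, g y x + ∑ x ∈ S, ∑ y ∈ S, g x y := by
    rw [sum_comm (s := letters n \ S), ← sum_add_distrib]
    exact sum_congr rfl fun x _ => split _
  rw [t1, t2, inn, ← add_assoc, ← sum_add_distrib] at total
  simp only [← sum_add_distrib] at total
  rw [sum_congr rfl outer, sum_add_distrib, ← mul_sum, ← mul_sum] at total
  have z : ∀ x ∈ S, φ x = 0 ∨ x = -i ∨ x = -m := by
    intro x hx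
    simp only [hS, mem_insert, mem_singleton] at hx
    rcases hx with rfl | rfl | rfl | rfl
    · left; exact if_neg (by omega)
    · left; exact if_neg (by omega)
    · right; left; rfl
    · right; right; rfl
  have c1 : ∑ x ∈ letters n \ S, φ x = ((inner n i m (fun x =>
      pos n (w i) < pos n (w x) ∧ pos n (w x) < pos n (w m))).card : ℤ) := by
    rw [card_eq_sum_ones]
    push_cast
    simp only [φ]
    rw [← sum_filter]
    refine sum_congr ?_ fun _ _ => rfl
    ext x
    simp only [mem_filter, mem_inner, mem_sdiff, mem_letters, hS, mem_insert, mem_singleton, not_or]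
    constructor
    · rintro ⟨⟨a, b, c, d, e⟩, f1, f2, f3, f4⟩
      exact ⟨a, ⟨f1, f2, d, e⟩, f3, f4⟩
    · rintro ⟨a, ⟨f1, f2, d, e⟩, f3, f4⟩
      refine ⟨⟨a, ?_, ?_, d, e⟩, f1, f2, f3, f4⟩
      · rintro rfl; omega
      · rintro rfl; omega
  have c2 : ∑ x ∈ letters n \ S, φ (-x) = ∑ x ∈ letters n \ S, φ x := by
    refine sum_nbij' (fun x => -x) (fun x => -x) ?_ ?_ ?_ ?_ ?_
    · intro x hx
      obtain ⟨hl, h1, h2, h3, h4⟩ := fixS x hx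
      simp only [mem_sdiff, mem_letters, hS, mem_insert, mem_singleton, not_or]
      exact ⟨hl.neg, by omega, by omega, by omega, by omega⟩
    · intro x hx
      obtain ⟨hl, h1, h2, h3, h4⟩ := fixS x hx
      simp only [mem_sdiff, mem_letters, hS, mem_insert, mem_singleton, not_or]
      exact ⟨hl.neg, by omega, by omega, by omega, by omega⟩
    · intro x _; simp
    · intro x _; simp
    · intro x _; rfl
  rw [c2, c1] at total
  omega

theorem mul_refl_mul_refl {n : ℕ} {w : Equiv.Perm ℤ} {i m : ℤ} (h : Lab n i m) :
    w * refl (i, m) * refl (i, m) = w := by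
  ext x
  simp only [Equiv.Perm.mul_apply, refl_refl h]

theorem len_mul_refl_of_gt {n : ℕ} {w : Equiv.Perm ℤ} (hw : SP n w) {i m : ℤ} (h : Lab n i m)
    (him : pos n i < pos n m) (hv : pos n (w m) < pos n (w i)) :
    len n w = len n (w * refl (i, m)) + 1 + 2 * (inner n i m (fun x =>
      pos n (w m) < pos n (w x) ∧ pos n (w x) < pos n (w i))).card := by
  have := len_mul_refl_of_lt (hw.mul_refl h) h him (by rwa [mul_refl_fst h, mul_refl_snd h])
  rw [mul_refl_mul_refl h, mul_refl_fst h, mul_refl_snd h] at this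
  rw [this]
  congr 3
  ext x
  simp only [mem_inner]
  refine and_congr_right fun hx => and_congr_right fun h1 => ?_
  rw [mul_refl_of_ne (by rintro rfl; omega) (by rintro rfl; omega) h1.2.2.1 h1.2.2.2]

theorem exists_pos_eq {n : ℕ} {p : ℤ} (h1 : 1 ≤ p) (h2 : p ≤ 2 * n) :
    ∃ x, IsLetter n x ∧ pos n x = p := by
  by_cases h : p ≤ n
  · exact ⟨p, ⟨by omega, by omega⟩, by unfold pos; rw [if_pos (by omega)]⟩
  · exact ⟨p - (2 * n + 1), ⟨by omega, by omega⟩, by unfold pos; rw [if_neg (by omega)]; omega⟩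

theorem card_letters_filter {n : ℕ} (R : ℤ → Prop) [DecidablePred R] :
    ((letters n).filter (fun y => R (pos n y))).card = ((Icc 1 (2 * (n : ℤ))).filter R).card := by
  refine card_bij (fun y _ => pos n y) ?_ ?_ ?_
  · intro y hy
    simp only [mem_filter, mem_letters, mem_Icc] at hy ⊢
    exact ⟨pos_bounds hy.1, hy.2⟩
  · intro y hy z hz h
    simp only [mem_filter, mem_letters] at hy hz
    exact pos_inj hy.1 hz.1 h
  · intro p hp
    simp only [mem_filter, mem_Icc] at hp
    obtain ⟨x, hx, rfl⟩ := exists_pos_eq hp.1.1 hp.1.2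
    exact ⟨x, by simp only [mem_filter, mem_letters]; exact ⟨hx, hp.2⟩, rfl⟩

theorem natAbs_ne_iff_pos {n : ℕ} {x y : ℤ} (hx : IsLetter n x) (hy : IsLetter n y) :
    x.natAbs ≠ y.natAbs ↔ pos n x ≠ pos n y ∧ pos n x ≠ 2 * n + 1 - pos n y := by
  rw [← pos_neg hy, ne_eq, Int.natAbs_eq_natAbs_iff, not_or]
  constructor
  · rintro ⟨h1, h2⟩
    exact ⟨fun h => h1 (pos_inj hx hy h), fun h => h2 (pos_inj hx hy.neg h)⟩
  · rintro ⟨h1, h2⟩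
    exact ⟨by rintro rfl; exact h1 rfl, by rintro rfl; exact h2 rfl⟩

theorem sum_later {n : ℕ} {x : ℤ} (hx : IsLetter n x) :
    ∑ y ∈ letters n, (if x.natAbs ≠ y.natAbs ∧ pos n x < pos n y then (1 : ℤ) else 0) =
      2 * n - pos n x - if 0 < x then 1 else 0 := by
  rw [← sum_filter, sum_const, nsmul_eq_mul, mul_one]
  have e : (letters n).filter (fun y => x.natAbs ≠ y.natAbs ∧ pos n x < pos n y) =
      (letters n).filter (fun y => pos n x < pos n y ∧ pos n y ≠ 2 * n + 1 - pos n x) := by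
    refine filter_congr fun y hy => ?_
    rw [natAbs_ne_iff_pos hx (mem_letters.1 hy)]
    omega
  rw [e, card_letters_filter (fun p => pos n x < p ∧ p ≠ 2 * n + 1 - pos n x)]
  have b := pos_bounds hx
  have c := pos_le_iff hx
  have e2 : (Icc 1 (2 * (n : ℤ))).filter (fun p => pos n x < p ∧ p ≠ 2 * n + 1 - pos n x) =
      (Icc (pos n x + 1) (2 * n)).erase (2 * n + 1 - pos n x) := by
    ext p
    simp only [mem_filter, mem_Icc, mem_erase]
    omega
  rw [e2]
  by_cases h : 0 < x
  · rw [if_pos h, card_erase_of_mem (by rw [mem_Icc]; omega), Int.card_Icc]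
    have := c.2 h
    omega
  · rw [if_neg h, erase_eq_of_notMem (by rw [mem_Icc]; omega), Int.card_Icc]
    omega

theorem card_inner_true {n : ℕ} {i m : ℤ} (h : Lab n i m) (him : pos n i < pos n m) :
    ((inner n i m (fun _ => True)).card : ℤ) = pos n m - pos n i - 1 -
      (if 0 < i ∧ m < 0 then 1 else 0) := by
  classical
  have hi := h.1
  have hm := h.2.1
  have e : inner n i m (fun _ => True) = (letters n).filter (fun y => (pos n i < pos n y ∧
      pos n y < pos n m) ∧ pos n y ≠ 2 * n + 1 - pos n i ∧ pos n y ≠ 2 * n + 1 - pos n m) := by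
    ext y
    simp only [mem_inner, mem_filter, mem_letters, and_true]
    refine and_congr_right fun hy => ?_
    rw [← pos_neg hi, ← pos_neg hm]
    constructor
    · rintro ⟨a, b, c, d⟩
      exact ⟨⟨a, b⟩, fun hh => c (pos_inj hy hi.neg hh), fun hh => d (pos_inj hy hm.neg hh)⟩
    · rintro ⟨⟨a, b⟩, c, d⟩
      exact ⟨a, b, by rintro rfl; exact c rfl, by rintro rfl; exact d rfl⟩
  rw [e, card_letters_filter (fun p => (pos n i < p ∧ p < pos n m) ∧ p ≠ 2 * n + 1 - pos n i ∧
    p ≠ 2 * n + 1 - pos n m)]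
  have b := pos_bounds hi
  have b' := pos_bounds hm
  have c := pos_le_iff hi
  have c' := pos_le_iff hm
  have hm0 := hm.1
  have hne : pos n i ≠ 2 * n + 1 - pos n m := by
    rw [← pos_neg hm]; intro hh; exact h.2.2.2 (pos_inj hi hm.neg hh)
  have e2 : (Icc 1 (2 * (n : ℤ))).filter (fun p => (pos n i < p ∧ p < pos n m) ∧
      p ≠ 2 * n + 1 - pos n i ∧ p ≠ 2 * n + 1 - pos n m) =
      ((Icc (pos n i + 1) (pos n m - 1)).erase (2 * n + 1 - pos n i)).erase
        (2 * n + 1 - pos n m) := by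
    ext p
    simp only [mem_filter, mem_Icc, mem_erase]
    omega
  rw [e2]
  by_cases hc : 0 < i ∧ m < 0
  · rw [if_pos hc]
    by_cases hd : pos n i < 2 * n + 1 - pos n m
    · rw [card_erase_of_mem (by rw [mem_erase, mem_Icc]; omega), erase_eq_of_notMem
        (by rw [mem_Icc]; omega), Int.card_Icc]
      omega
    · rw [erase_eq_of_notMem (by rw [mem_erase, mem_Icc]; omega), card_erase_of_mem
        (by rw [mem_Icc]; omega), Int.card_Icc]
      omega
  · rw [if_neg hc, erase_eq_of_notMem (by rw [mem_erase, mem_Icc]; omega), erase_eq_of_notMem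
      (by rw [mem_Icc]; omega), Int.card_Icc]
    omega

/-- The inner product of `ε_x` with the root `(i, m)`. -/
def pairing (i m x : ℤ) : ℤ :=
  ((if x = i then 1 else 0) - (if x = -i then 1 else 0)) -
  ((if x = m then 1 else 0) - (if x = -m then 1 else 0))

theorem eps_dot {n : ℕ} {i m : ℤ} (h : Lab n i m) {x : ℤ} (hx : IsLetter n x) :
    eps n x ⬝ᵥ root n (i, m) = pairing i m x := by
  have key : ∀ z : ℤ, IsLetter n z → eps n x ⬝ᵥ eps n z =
      (if x = z then 1 else 0) - (if x = -z then 1 else 0) := by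
    intro z hz
    have := sum_eps_mul (n := n) (fun y => (if y = z then 1 else 0) - (if y = -z then 1 else 0))
      (by intro y; split_ifs <;> omega) hx
    rw [← this]
    unfold dotProduct
    refine sum_congr rfl fun c _ => ?_
    congr 1
    simp only [eps]
    have := hz.1
    split_ifs <;> omega
  simp only [root, dotProduct_sub]
  rw [key i h.1, key m h.2.1]
  rfl

theorem pairing_neg (i m x : ℤ) : pairing i m (-x) = -pairing i m x := by
  unfold pairing
  simp only [neg_eq_iff_eq_neg, neg_neg]
  ring

theorem twoRho_eq {n : ℕ} {i m : ℤ} (h : Lab n i m) (him : pos n i < pos n m) :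
    twoRhoPairing n (root n (i, m)) = 2 + 2 * ((inner n i m (fun _ => True)).card : ℤ) := by
  have hi := h.1
  have hm := h.2.1
  have h0 : posRoots n = (stdLabels n).image (root n) := rfl
  have s1 : twoRhoPairing n (root n (i, m)) =
      ∑ β ∈ stdLabels n, (pairing i m β.1 - pairing i m β.2) := by
    unfold twoRhoPairing
    rw [sum_dotProduct, h0, sum_image (root_injOn n)]
    refine sum_congr rfl ?_
    rintro ⟨x, y⟩ hβ
    obtain ⟨hx, hy, -, -⟩ := mem_stdLabels.1 hβ
    have : root n (x, y) = eps n x - eps n y := rfl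
    rw [this, sub_dotProduct, eps_dot h hx, eps_dot h hy]
  set E := (letters n ×ˢ letters n).filter
    (fun β => β.1.natAbs ≠ β.2.natAbs ∧ pos n β.1 < pos n β.2) with hE
  have h1 : E.filter (fun β => β.1.natAbs < β.2.natAbs) = stdLabels n := by
    ext ⟨x, y⟩
    simp only [hE, mem_filter, mem_product, mem_letters, mem_stdLabels]
    constructor
    · rintro ⟨⟨⟨h1, h2⟩, h3, h4⟩, h6⟩
      refine ⟨h1, h2, ?_⟩
      unfold IsLetter at h1 h2; unfold pos at h4; split_ifs at h4 <;> omega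
    · rintro ⟨h1, h2, h3, h4⟩
      refine ⟨⟨⟨h1, h2⟩, by omega, ?_⟩, by omega⟩
      unfold IsLetter at h1 h2; unfold pos; split_ifs <;> omega
  have h2 : ∑ β ∈ E.filter (fun β => ¬ β.1.natAbs < β.2.natAbs),
      (pairing i m β.1 - pairing i m β.2) = ∑ β ∈ E.filter (fun β => β.1.natAbs < β.2.natAbs),
      (pairing i m β.1 - pairing i m β.2) := by
    refine sum_bij' (fun β _ => (-β.2, -β.1)) (fun β _ => (-β.2, -β.1)) ?_ ?_ ?_ ?_ ?_
    · rintro ⟨x, y⟩ h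
      simp only [hE, mem_filter, mem_product, mem_letters] at h ⊢
      obtain ⟨⟨⟨h1, h2⟩, h3, h4⟩, h6⟩ := h
      simp only [pos_neg h1, pos_neg h2, Int.natAbs_neg]
      exact ⟨⟨⟨h2.neg, h1.neg⟩, by omega, by omega⟩, by omega⟩
    · rintro ⟨x, y⟩ h
      simp only [hE, mem_filter, mem_product, mem_letters] at h ⊢
      obtain ⟨⟨⟨h1, h2⟩, h3, h4⟩, h6⟩ := h
      simp only [pos_neg h1, pos_neg h2, Int.natAbs_neg]
      exact ⟨⟨⟨h2.neg, h1.neg⟩, by omega, by omega⟩, by omega⟩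
    · rintro ⟨x, y⟩ _; simp
    · rintro ⟨x, y⟩ _; simp
    · rintro ⟨x, y⟩ _
      simp only [pairing_neg]
      ring
  have h3 := sum_filter_add_sum_filter_not E (fun β => β.1.natAbs < β.2.natAbs)
    (fun β => pairing i m β.1 - pairing i m β.2)
  rw [h2, h1, ← s1, hE, sum_filter, sum_product] at h3
  let c : ℤ → ℤ → ℤ := fun x y => if x.natAbs ≠ y.natAbs ∧ pos n x < pos n y then 1 else 0
  let D : ℤ → ℤ := fun x => ∑ y ∈ letters n, c x y
  have h4 : ∑ x ∈ letters n, ∑ y ∈ letters n, (if x.natAbs ≠ y.natAbs ∧ pos n x < pos n y then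
      pairing i m x - pairing i m y else 0) =
      ∑ x ∈ letters n, pairing i m x * (D x - D (-x)) := by
    have e : ∀ x y, (if x.natAbs ≠ y.natAbs ∧ pos n x < pos n y then
      pairing i m x - pairing i m y else 0) = pairing i m x * c x y - pairing i m y * c x y := by
      intro x y
      simp only [c]
      split_ifs <;> ring
    simp only [e, sum_sub_distrib, mul_sub]
    congr 1
    · simp only [D, mul_sum]
    · rw [sum_comm]
      refine sum_congr rfl fun x hx => ?_
      rw [← mul_sum]
      congr 1
      simp only [D]
      rw [← sum_letters_neg]
      refine sum_congr rfl fun y hy => ?_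
      simp only [c, Int.natAbs_neg, pos_neg (mem_letters.1 hx), pos_neg (mem_letters.1 hy)]
      congr 1
      simp only [ne_eq, eq_iff_iff]
      omega
  have h5 : ∑ x ∈ letters n, pairing i m x * (D x - D (-x)) =
      2 * ((D i - D (-i)) - (D m - D (-m))) := by
    have pick : ∀ z : ℤ, IsLetter n z → ∑ x ∈ letters n, (if x = z then (1 : ℤ) else 0) *
        (D x - D (-x)) = D z - D (-z) := by
      intro z hz
      rw [sum_eq_single z]
      · simp
      · intro b _ hb; simp [hb]
      · intro hn; exact absurd (mem_letters.2 hz) hn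
    simp only [pairing, sub_mul, sum_sub_distrib]
    simp only [pick i hi, pick m hm, pick _ hi.neg, pick _ hm.neg]
    simp only [neg_neg]
    ring
  have f : ∀ x, IsLetter n x → D x = 2 * n - pos n x - if 0 < x then 1 else 0 :=
    fun x hx => sum_later hx
  rw [h4, h5, f i hi, f m hm, f _ hi.neg, f _ hm.neg, pos_neg hi, pos_neg hm] at h3
  rw [card_inner_true h him]
  have := hi.1
  have := hm.1
  have hc : m < 0 ∨ 0 < i ∧ 0 < m ∨ i < 0 ∧ 0 < m := by omega
  have := pos_le_iff hi
  have := pos_le_iff hm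
  split_ifs at h3 ⊢ <;> omega

theorem qEdge_iff {n : ℕ} {w : Equiv.Perm ℤ} (hw : SP n w) {i m : ℤ} (h : Lab n i m)
    (him : pos n i < pos n m) : QEdge n w (i, m) ↔ Jump n w i m := by
  have hi := h.1
  have hm := h.2.1
  unfold QEdge
  rw [twoRho_eq h him]
  rcases lt_trichotomy (pos n (w i)) (pos n (w m)) with hv | hv | hv
  · have e := len_mul_refl_of_lt hw h him hv
    set c := inner n i m (fun x => pos n (w i) < pos n (w x) ∧ pos n (w x) < pos n (w m)) with hc
    have : (len n (w * refl (i, m)) = len n w + 1 ∨ (len n (w * refl (i, m)) : ℤ) = len n w -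
      (2 + 2 * ((inner n i m (fun _ => True)).card : ℤ)) + 1) ↔ c = ∅ := by
      rw [← card_eq_zero]; omega
    rw [this, eq_empty_iff_forall_notMem]
    constructor
    · intro h1 l hl h2 h3 h4 h5 h6
      refine h1 l (mem_inner.2 ⟨hl, ⟨h2, h3, h4, h5⟩, ?_⟩)
      unfold Bt at h6; omega
    · intro h1 l hl
      obtain ⟨a, ⟨b1, b2, b3, b4⟩, d⟩ := mem_inner.1 hl
      exact h1 l a b1 b2 b3 b4 (Or.inl d)
  · exact absurd (w.injective (pos_inj (hw.letter hi) (hw.letter hm) hv)) h.2.2.1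
  · have e := len_mul_refl_of_gt hw h him hv
    set c := inner n i m (fun x => pos n (w m) < pos n (w x) ∧ pos n (w x) < pos n (w i)) with hc
    have hsub : c ⊆ inner n i m (fun _ => True) := by
      intro x hx
      obtain ⟨a, b, d⟩ := mem_inner.1 hx
      exact mem_inner.2 ⟨a, b, trivial⟩
    have hle := card_le_card hsub
    have : (len n (w * refl (i, m)) = len n w + 1 ∨ (len n (w * refl (i, m)) : ℤ) = len n w -
      (2 + 2 * ((inner n i m (fun _ => True)).card : ℤ)) + 1) ↔
        inner n i m (fun _ => True) ⊆ c := by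
      constructor
      · intro h1
        rw [eq_of_subset_of_card_le hsub (by omega)]
      · intro h1
        have := card_le_card h1
        omega
    rw [this]
    constructor
    · intro h1 l hl h2 h3 h4 h5 h6
      obtain ⟨-, -, d⟩ := mem_inner.1 (h1 (mem_inner.2 ⟨hl, ⟨h2, h3, h4, h5⟩, trivial⟩))
      unfold Bt at h6; omega
    · intro h1 l hl
      obtain ⟨a, ⟨b1, b2, b3, b4⟩, -⟩ := mem_inner.1 hl
      refine mem_inner.2 ⟨a, ⟨b1, b2, b3, b4⟩, ?_⟩
      have h2 := h1 l a b1 b2 b3 b4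
      have n1 : pos n (w l) ≠ pos n (w i) := fun hh => by
        have := w.injective (pos_inj (hw.letter a) (hw.letter hi) hh)
        subst this; omega
      have n2 : pos n (w l) ≠ pos n (w m) := fun hh => by
        have := w.injective (pos_inj (hw.letter a) (hw.letter hm) hh)
        subst this; omega
      unfold Bt at h2; omega

/-! ### Paths through the rows of a segment -/

/-- The end of the path with labels `T` that starts at `w`. -/
def endw (w : Equiv.Perm ℤ) (T : List (ℤ × ℤ)) : Equiv.Perm ℤ := w * (T.map refl).prod

@[simp] theorem endw_nil (w : Equiv.Perm ℤ) : endw w [] = w := by simp [endw]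

@[simp] theorem endw_cons (w : Equiv.Perm ℤ) (β : ℤ × ℤ) (T : List (ℤ × ℤ)) :
    endw w (β :: T) = endw (w * refl β) T := by simp [endw, mul_assoc]

theorem endw_append (w : Equiv.Perm ℤ) (T U : List (ℤ × ℤ)) :
    endw w (T ++ U) = endw (endw w T) U := by simp [endw, mul_assoc]

theorem isQPath_append {n : ℕ} {w : Equiv.Perm ℤ} {T U : List (ℤ × ℤ)} :
    IsQPath n w (T ++ U) ↔ IsQPath n w T ∧ IsQPath n (endw w T) U := by
  induction T generalizing w with
  | nil => simp [IsQPath]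
  | cons β T ih => simp only [List.cons_append, IsQPath, ih, endw_cons, and_assoc]

/-- The labels in the `l`-th row of the left segment of height `k`. -/
def RowLab (n k : ℕ) (l m : ℤ) : Prop :=
  1 ≤ l ∧ l ≤ k ∧ k < n ∧ ((k < m.natAbs ∧ m.natAbs ≤ n) ∨ (m < 0 ∧ -m < l))

theorem RowLab.lab {n k : ℕ} {l m : ℤ} (h : RowLab n k l m) : Lab n l m := by
  unfold RowLab at h; unfold Lab IsLetter; omega

theorem RowLab.pos_lt {n k : ℕ} {l m : ℤ} (h : RowLab n k l m) : pos n l < pos n m := by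
  unfold RowLab at h; unfold pos; split_ifs <;> omega

/-- All labels are in row `i`. -/
def InRow (n k : ℕ) (i : ℤ) (T : List (ℤ × ℤ)) : Prop := ∀ β ∈ T, β.1 = i ∧ RowLab n k i β.2

/-- All labels are in rows above row `i`. -/
def Above (n k : ℕ) (i : ℤ) (T : List (ℤ × ℤ)) : Prop :=
  ∀ β ∈ T, RowLab n k β.1 β.2 ∧ β.1 < i

theorem InRow.cons_iff {n k : ℕ} {i : ℤ} {β : ℤ × ℤ} {T : List (ℤ × ℤ)} :
    InRow n k i (β :: T) ↔ (β.1 = i ∧ RowLab n k i β.2) ∧ InRow n k i T := by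
  simp only [InRow, List.mem_cons, forall_eq_or_imp]

theorem Above.cons_iff {n k : ℕ} {i : ℤ} {β : ℤ × ℤ} {T : List (ℤ × ℤ)} :
    Above n k i (β :: T) ↔ (RowLab n k β.1 β.2 ∧ β.1 < i) ∧ Above n k i T := by
  simp only [Above, List.mem_cons, forall_eq_or_imp]

/-- The position of the value `w x`. -/
def vp (n : ℕ) (w : Equiv.Perm ℤ) (x : ℤ) : ℤ := pos n (w x)

theorem vp_bounds {n : ℕ} {w : Equiv.Perm ℤ} (hw : SP n w) {x : ℤ} (hx : IsLetter n x) :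
    1 ≤ vp n w x ∧ vp n w x ≤ 2 * n := pos_bounds (hw.letter hx)

theorem vp_neg {n : ℕ} {w : Equiv.Perm ℤ} (hw : SP n w) {x : ℤ} (hx : IsLetter n x) :
    vp n w (-x) = 2 * n + 1 - vp n w x := by
  unfold vp; rw [hw.neg, pos_neg (hw.letter hx)]

theorem vp_inj {n : ℕ} {w : Equiv.Perm ℤ} (hw : SP n w) {x y : ℤ} (hx : IsLetter n x)
    (hy : IsLetter n y) (h : vp n w x = vp n w y) : x = y :=
  w.injective (pos_inj (hw.letter hx) (hw.letter hy) h)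

theorem vp_ne {n : ℕ} {w : Equiv.Perm ℤ} (hw : SP n w) {x y : ℤ} (hx : IsLetter n x)
    (hy : IsLetter n y) (h : x ≠ y) : vp n w x ≠ vp n w y := fun hh => h (vp_inj hw hx hy hh)

theorem vp_ne_neg {n : ℕ} {w : Equiv.Perm ℤ} (hw : SP n w) {x y : ℤ} (hx : IsLetter n x)
    (hy : IsLetter n y) (h : x ≠ -y) : vp n w x ≠ 2 * n + 1 - vp n w y := by
  rw [← vp_neg hw hy]; exact vp_ne hw hx hy.neg h

theorem vp_fst {n : ℕ} {w : Equiv.Perm ℤ} {i m : ℤ} (h : Lab n i m) :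
    vp n (w * refl (i, m)) i = vp n w m := by unfold vp; rw [mul_refl_fst h]

theorem vp_snd {n : ℕ} {w : Equiv.Perm ℤ} {i m : ℤ} (h : Lab n i m) :
    vp n (w * refl (i, m)) m = vp n w i := by unfold vp; rw [mul_refl_snd h]

theorem vp_neg_snd {n : ℕ} {w : Equiv.Perm ℤ} (hw : SP n w) {i m : ℤ} (h : Lab n i m) :
    vp n (w * refl (i, m)) (-m) = 2 * n + 1 - vp n w i := by
  rw [vp_neg (hw.mul_refl h) h.2.1, vp_snd h]

theorem vp_of_ne {n : ℕ} {w : Equiv.Perm ℤ} {i m x : ℤ} (h1 : x ≠ i) (h2 : x ≠ m) (h3 : x ≠ -i)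
    (h4 : x ≠ -m) : vp n (w * refl (i, m)) x = vp n w x := by
  unfold vp; rw [mul_refl_of_ne h1 h2 h3 h4]

theorem SP.endw {n : ℕ} {w : Equiv.Perm ℤ} (hw : SP n w) {T : List (ℤ × ℤ)}
    (h : ∀ β ∈ T, Lab n β.1 β.2) : SP n (endw w T) := by
  induction T generalizing w with
  | nil => simpa using hw
  | cons β T ih =>
    rw [endw_cons]
    exact ih (hw.mul_refl (h β (by simp))) fun γ hγ => h γ (by simp [hγ])

theorem InRow.lab {n k : ℕ} {i : ℤ} {T : List (ℤ × ℤ)} (h : InRow n k i T) :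
    ∀ β ∈ T, Lab n β.1 β.2 := fun β hβ => by
  obtain ⟨h1, h2⟩ := h β hβ
  rw [h1]; exact h2.lab

theorem Above.lab {n k : ℕ} {i : ℤ} {T : List (ℤ × ℤ)} (h : Above n k i T) :
    ∀ β ∈ T, Lab n β.1 β.2 := fun β hβ => (h β hβ).1.lab

/-- `y` is not in the half-open arc from `a` (exclusive) to `b` (inclusive), and `y ≠ a`. -/
def Cut (y a b : ℤ) : Prop := (y < a ∧ a ≤ b) ∨ (a ≤ b ∧ b < y) ∨ (y < a ∧ b < y)

theorem Cut.trans {y a b c : ℤ} (h1 : Cut y a b) (h2 : Cut y b c) : Cut y a c := by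
  unfold Cut at *; omega

theorem Cut.refl {y a : ℤ} (h : y ≠ a) : Cut y a a := by unfold Cut; omega

theorem cut_of_not_bt {y a b : ℤ} (h : ¬ Bt a y b) (h1 : y ≠ a) (h2 : y ≠ b) : Cut y a b := by
  unfold Bt at h; unfold Cut; omega

theorem IsQPath.head {n k : ℕ} {w : Equiv.Perm ℤ} (hw : SP n w) {i m : ℤ} (hl : RowLab n k i m)
    {T : List (ℤ × ℤ)} (h : IsQPath n w ((i, m) :: T)) :
    Jump n w i m ∧ IsQPath n (w * QAlcoveD.refl (i, m)) T :=
  ⟨(qEdge_iff hw hl.lab hl.pos_lt).1 h.1, h.2⟩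

/-- A letter at a place that the remaining roots of a row jump over cannot be passed. -/
theorem stuck {n k : ℕ} {i q : ℤ} {T : List (ℤ × ℤ)} {w : Equiv.Perm ℤ} (hw : SP n w)
    (hT : InRow n k i T) (hp : IsQPath n w T) (hi : IsLetter n i) (hq : IsLetter n q)
    (hqi : pos n i < pos n q) (hqi' : q ≠ -i)
    (h : ∀ β ∈ T, pos n q < pos n β.2 ∧ q ≠ -β.2) :
    vp n (endw w T) q = vp n w q ∧ Cut (vp n w q) (vp n w i) (vp n (endw w T) i) := by
  have hne : q ≠ i := by rintro rfl; omega
  induction T generalizing w with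
  | nil => simpa using Cut.refl (vp_ne hw hq hi hne)
  | cons β T ih =>
    obtain ⟨l, m⟩ := β
    obtain ⟨⟨rfl, hl⟩, hT'⟩ := InRow.cons_iff.1 hT
    obtain ⟨hj, hp'⟩ := hp.head hw hl
    obtain ⟨h1, h2⟩ := h _ (List.mem_cons_self ..)
    dsimp only at h1 h2 hl hj hp'
    have hqm : q ≠ m := by rintro rfl; omega
    obtain ⟨e1, e2⟩ := ih (hw.mul_refl hl.lab) hT' hp' fun γ hγ => h γ (by simp [hγ])
    rw [vp_of_ne hne hqm hqi' h2] at e1 e2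
    rw [vp_fst hl.lab] at e2
    rw [endw_cons]
    refine ⟨e1, Cut.trans ?_ e2⟩
    exact cut_of_not_bt (hj q hq hqi h1 hqi' h2) (vp_ne hw hq hi hne)
      (vp_ne hw hq hl.lab.2.1 hqm)

/-- A letter at a place that is not used any more does not end up in the row. -/
theorem unreachable {n k : ℕ} {i q : ℤ} {T : List (ℤ × ℤ)} {w : Equiv.Perm ℤ} (hw : SP n w)
    (hT : InRow n k i T) (hi : IsLetter n i) (hq : IsLetter n q) (hqi : q ≠ i)
    (h : ∀ β ∈ T, q ≠ β.2) (hpw : T.Pairwise (fun β γ => γ.2 ≠ -β.2)) :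
    vp n (endw w T) i ≠ vp n w q := by
  induction T generalizing w q with
  | nil => simpa using (vp_ne hw hi hq (Ne.symm hqi))
  | cons β T ih =>
    obtain ⟨l, m⟩ := β
    obtain ⟨⟨rfl, hl⟩, hT'⟩ := InRow.cons_iff.1 hT
    rw [List.pairwise_cons] at hpw
    dsimp only at hl
    rw [endw_cons]
    have hqm : q ≠ m := h _ (List.mem_cons_self ..)
    have hl0 := hl.lab.1.1
    have hRow : ∀ γ ∈ T, γ.2 ≠ -l ∧ γ.2 ≠ l := by
      intro γ hγ
      have := (hT' γ hγ).2
      unfold RowLab at this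
      omega
    have key : ∀ q', IsLetter n q' → q' ≠ l → (∀ γ ∈ T, q' ≠ γ.2) →
        vp n (w * QAlcoveD.refl (l, m)) q' = vp n w q →
        vp n (endw (w * QAlcoveD.refl (l, m)) T) l ≠ vp n w q := by
      intro q' h1 h2 h3 h4
      rw [← h4]
      exact ih (hw.mul_refl hl.lab) hT' h1 h2 h3 hpw.2
    by_cases h1 : q = -m
    · subst h1
      refine key (-l) hi.neg (by omega) (fun γ hγ => ?_) ?_
      · exact fun hh => (hRow γ hγ).1 hh.symm
      · rw [vp_neg (hw.mul_refl hl.lab) hi, vp_fst hl.lab, vp_neg hw hl.lab.2.1]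
    · by_cases h2 : q = -l
      · subst h2
        refine key (-m) hl.lab.2.1.neg (by have := hl.lab; unfold Lab at this; omega)
          (fun γ hγ hh => hpw.1 γ hγ hh.symm) ?_
        rw [vp_neg_snd hw hl.lab, vp_neg hw hi]
      · exact key q hq hqi (fun γ hγ => h γ (by simp [hγ])) (vp_of_ne hqi hqm h2 h1)

theorem Above.pos_facts {n k : ℕ} {i l m : ℤ} (h : RowLab n k l m) (hli : l < i) (hik : i ≤ k) :
    IsLetter n i ∧ pos n l < pos n i ∧ pos n i < pos n m ∧ i ≠ -l ∧ i ≠ -m ∧ i ≠ l ∧ i ≠ m ∧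
    (m.natAbs < l → pos n l < pos n (-i) ∧ pos n (-i) < pos n m) := by
  unfold RowLab at h
  have hi : IsLetter n i := ⟨by omega, by omega⟩
  refine ⟨hi, ?_, ?_, by omega, by omega, by omega, by omega, fun hm => ⟨?_, ?_⟩⟩ <;> unfold pos <;> split_ifs <;>
    omega

/-- While rows above row `i` are changed, their entries do not pass the entry of row `i`. -/
theorem above_fix {n k : ℕ} {i q : ℤ} {T : List (ℤ × ℤ)} {w : Equiv.Perm ℤ}
    (hT : Above n k i T) (hq : i ≤ q) (hqk : q ≤ k) :
    endw w T q = w q := by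
  induction T generalizing w with
  | nil => simp
  | cons β T ih =>
    obtain ⟨l, m⟩ := β
    obtain ⟨⟨hl, hli⟩, hT'⟩ := Above.cons_iff.1 hT
    dsimp only at hl hli
    rw [endw_cons, ih hT']
    unfold RowLab at hl
    exact mul_refl_of_ne (by omega) (by omega) (by omega) (by omega)

theorem above_cut {n k : ℕ} {i j : ℤ} {T : List (ℤ × ℤ)} {w : Equiv.Perm ℤ} (hw : SP n w)
    (hT : Above n k i T) (hp : IsQPath n w T) (hik : i ≤ k) (hkn : k < n) (hj : 1 ≤ j) (hji : j < i) :
    Cut (vp n w i) (vp n w j) (vp n (endw w T) j) := by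
  have hi : IsLetter n i := ⟨by omega, by omega⟩
  have hjl : IsLetter n j := ⟨by omega, by omega⟩
  induction T generalizing w with
  | nil => simpa using Cut.refl (vp_ne hw hi hjl (by omega))
  | cons β T ih =>
    obtain ⟨l, m⟩ := β
    obtain ⟨⟨hl, hli⟩, hT'⟩ := Above.cons_iff.1 hT
    dsimp only at hl hli
    obtain ⟨hjm, hp'⟩ := hp.head hw hl
    obtain ⟨-, p1, p2, p3, p4, p5, p6, p7⟩ := Above.pos_facts hl hli hik
    have e := ih (hw.mul_refl hl.lab) hT' hp'
    have p8 : i ≠ -l := p3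
    rw [vp_of_ne p5 p6 p8 p4] at e
    rw [endw_cons]
    refine Cut.trans ?_ e
    have hl' := hl
    unfold RowLab at hl'
    rcases refl_cases hl.lab j with ⟨h, -⟩ | ⟨h, -⟩ | ⟨h, -⟩ | ⟨h, -⟩ | ⟨h1, h2, h3, h4, -⟩
    · subst h
      rw [vp_fst hl.lab]
      exact cut_of_not_bt (hjm i hi p1 p2 p3 p4) (vp_ne hw hi hl.lab.1 p5) (vp_ne hw hi hl.lab.2.1 p6)
    · omega
    · omega
    · subst h
      rw [vp_neg_snd hw hl.lab, vp_neg hw hl.lab.2.1]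
      obtain ⟨q1, q2⟩ := p7 (by omega)
      have h5 := hjm (-i) hi.neg q1 q2 (by omega) (by omega)
      have h6 := vp_ne hw hi.neg hl.lab.1 (by omega)
      have h7 := vp_ne hw hi.neg hl.lab.2.1 (by omega)
      unfold vp at h6 h7 ⊢
      rw [hw.neg, pos_neg (hw.letter hi)] at h5 h6 h7
      have := pos_bounds (hw.letter hi)
      unfold Bt at h5; unfold Cut; omega
    · rw [vp_of_ne h1 h2 h3 h4]
      exact Cut.refl (vp_ne hw hi hjl (by omega))

/-- The closed arc from `a` to `b`. -/
def CArc (a x b : ℤ) : Prop := Bt a x b ∨ x = a ∨ x = b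

/-- The closed arc from the negative of `c` to `c`, for a position `c`. -/
def Arc (n : ℕ) (c x : ℤ) : Prop := CArc (2 * n + 1 - c) x c

theorem Arc.neg_iff {n : ℕ} {c x : ℤ} :
    Arc n c (2 * n + 1 - x) ↔ Arc n c x := by
  unfold Arc CArc Bt; omega

/-- `x` is on the same side (unbarred or barred) as `c`. -/
def Sd (n : ℕ) (c x : ℤ) : Prop := x ≤ n ↔ c ≤ n

instance (n : ℕ) (c x : ℤ) : Decidable (Sd n c x) := inferInstanceAs (Decidable (_ ↔ _))

theorem not_carc_of_not_bt {N c u v e : ℤ} (h3 : ¬ CArc (N - c) (N - v) e)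
    (b : ¬ Bt u c v) (n1 : c ≠ u) (n2 : c ≠ v) : ¬ CArc (N - c) (N - u) e := by
  unfold CArc Bt at *; omega

theorem not_carc_of_not_bt' {N c u v e : ℤ} (h1 : ¬ CArc (N - c) u e)
    (b : ¬ Bt u (N - c) v) (n1 : u ≠ N - c) (n2 : v ≠ N - c) : ¬ CArc (N - c) v e := by
  unfold CArc Bt at *; omega

theorem arc_iff_of_not_bt {n : ℕ} {c u v : ℤ}
    (n1 : c ≠ u) (n2 : c ≠ v) (n3 : c ≠ 2 * n + 1 - u)
    (n4 : c ≠ 2 * n + 1 - v) (b : ¬ Bt u c v) (b' : ¬ Bt u (2 * n + 1 - c) v) :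
    (Arc n c u ↔ Arc n c v) ∧ (Arc n c u → Sd n c u → Sd n c v) ∧
      (¬ Arc n c u → ¬ Sd n c u → ¬ Sd n c v) := by
  refine ⟨⟨?_, ?_⟩, ?_, ?_⟩ <;> unfold Arc CArc Bt at * <;> (try unfold Sd) <;> intros <;> omega

theorem not_arc_of_not_bt {n : ℕ} {c u v : ℤ}
    (n1 : c ≠ u) (n2 : c ≠ v) (b : ¬ Bt u c v) (h : ¬ Arc n c v) :
    ¬ Arc n c u ∧ (¬ Sd n c u → ¬ Sd n c v) := by
  refine ⟨?_, ?_⟩ <;> unfold Arc CArc Bt at * <;> (try unfold Sd) <;> intros <;> omega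

theorem arc_of_cut {n : ℕ} {c u v y : ℤ}
    (b : Cut y u v) (b' : Cut y v c) (hy : ¬ Arc n c y)
    (h : Arc n c u) : Arc n c v ∧ (Sd n c u → Sd n c v) := by
  refine ⟨?_, ?_⟩ <;> unfold Arc CArc Bt Cut at * <;> (try unfold Sd) <;> intros <;> omega

theorem Sd.neg_iff {n : ℕ} {c x : ℤ} : Sd n c (2 * n + 1 - x) ↔ ¬ Sd n c x := by
  unfold Sd; omega

/-- Rows whose entries are in none of the two arcs `[-c, e]`, `[-e, c]` cannot end up in the
first of them. -/
theorem above_avoid {n k : ℕ} {i r e c : ℤ} {T : List (ℤ × ℤ)} {w : Equiv.Perm ℤ} (hw : SP n w)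
    (hT : Above n k i T) (hp : IsQPath n w T) (hs : T.Pairwise (fun β γ => γ.1 ≤ β.1))
    (hi1 : 1 ≤ i) (hik : i ≤ k) (hkn : k < n) (he : 1 ≤ e ∧ e ≤ 2 * n) (hc : vp n w i = c)
    (h1 : ∀ q : ℤ, k < q → q ≤ n → ¬ CArc (2 * n + 1 - c) (vp n w q) e ∧
      ¬ CArc (2 * n + 1 - c) (2 * n + 1 - vp n w q) e)
    (h2 : ∀ l, r < l → 1 ≤ l → l < i → ¬ CArc (2 * n + 1 - c) (vp n w l) e) :
    ∀ l, r < l → 1 ≤ l → l < i → ¬ CArc (2 * n + 1 - c) (vp n (endw w T) l) e := by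
  have hi : IsLetter n i := ⟨by omega, by omega⟩
  induction T generalizing w with
  | nil => simpa using h2
  | cons β T ih =>
    obtain ⟨l', m⟩ := β
    by_cases hr : l' ≤ r
    · intro l hl hl1 hli
      have hA : Above n k (r + 1) ((l', m) :: T) := by
        intro γ hγ
        refine ⟨(hT γ hγ).1, ?_⟩
        rcases List.mem_cons.1 hγ with rfl | hγ
        · dsimp only; omega
        · have := (List.pairwise_cons.1 hs).1 γ hγ
          dsimp only at this; omega
      have := above_fix (w := w) hA (q := l) (by omega) (by omega)
      unfold vp at h2 ⊢
      rw [this]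
      exact h2 l hl hl1 hli
    obtain ⟨⟨hl, hli⟩, hT'⟩ := Above.cons_iff.1 hT
    dsimp only at hl hli
    obtain ⟨hjm, hp'⟩ := hp.head hw hl
    obtain ⟨-, p1, p2, p3, p4, p5, p6, p7⟩ := Above.pos_facts hl hli hik
    rw [endw_cons]
    have hlab := hl.lab
    have n1 := vp_ne hw hi hlab.1 p5
    have n2 := vp_ne hw hi hlab.2.1 p6
    have n3 := vp_ne_neg hw hi hlab.1 p3
    have n4 := vp_ne_neg hw hi hlab.2.1 p4
    have b1 := hjm i hi p1 p2 p3 p4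
    have hu := h2 l' (by omega) (by unfold RowLab at hl; omega) hli
    have hlr := hl
    unfold RowLab at hlr
    refine ih (hw.mul_refl hlab) hT' hp' (List.pairwise_cons.1 hs).2
      (by rw [vp_of_ne p5 p6 p3 p4, hc]) ?_ ?_
    all_goals change ¬ Bt (vp n w l') (vp n w i) (vp n w m) at b1
    all_goals subst hc
    · intro q hq hqn
      rcases refl_cases hlab q with ⟨h, -⟩ | ⟨h, -⟩ | ⟨h, -⟩ | ⟨h, -⟩ | ⟨g1, g2, g3, g4, -⟩
      · omega
      · subst h
        rw [vp_snd hlab]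
        have hv := h1 q hq hqn
        exact ⟨hu, not_carc_of_not_bt hv.2 b1 n1 n2⟩
      · omega
      · subst h
        rw [vp_neg_snd hw hlab]
        have hv := h1 (-m) hq hqn
        rw [vp_neg hw hlab.2.1] at hv
        rw [sub_sub_cancel]
        exact ⟨not_carc_of_not_bt hv.1 b1 n1 n2, hu⟩
      · rw [vp_of_ne g1 g2 g3 g4]; exact h1 q hq hqn
    · intro l g0 g1 g2
      rcases refl_cases hlab l with ⟨h, -⟩ | ⟨h, -⟩ | ⟨h, -⟩ | ⟨h, -⟩ | ⟨g3, g4, g5, g6, -⟩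
      · subst h
        rw [vp_fst hlab]
        by_cases hm : m.natAbs < l
        · obtain ⟨q1, q2⟩ := p7 hm
          have b2 := hjm (-i) hi.neg q1 q2 (by omega) (by omega)
          change ¬ Bt (vp n w l) (vp n w (-i)) (vp n w m) at b2
          rw [vp_neg hw hi] at b2
          exact not_carc_of_not_bt' hu b2 (fun h => n3 (by omega)) (fun h => n4 (by omega))
        · by_cases hm0 : 0 < m
          · exact (h1 m (by omega) (by omega)).1
          · have := (h1 (-m) (by omega) (by omega)).2
            rwa [vp_neg hw hlab.2.1, sub_sub_cancel] at this
      · omega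
      · omega
      · subst h
        rw [vp_neg_snd hw hlab]
        have hv := h2 (-m) g0 g1 g2
        rw [vp_neg hw hlab.2.1] at hv
        exact not_carc_of_not_bt hv b1 n1 n2
      · rw [vp_of_ne g3 g4 g5 g6]; exact h2 l g0 g1 g2

/-- The number of rows `j ≤ i` where `w` and `u` have entries on the sides of `-c` and `c`. -/
noncomputable def cross (n : ℕ) (c : ℤ) (w u : Equiv.Perm ℤ) (i : ℤ) : ℕ :=
  ((Icc 1 i).filter (fun j => ¬ Sd n c (vp n w j) ∧ Sd n c (vp n u j))).card

/-- The relations between the words `w` and `u` if all letters of the arc `[-c, c]` stay in the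
rows `1, …, i` on the way from `w` to `u`. -/
structure ArcStable (n : ℕ) (c : ℤ) (w u : Equiv.Perm ℤ) (i : ℤ) : Prop where
  arc : ∀ j, 1 ≤ j → j ≤ i → (Arc n c (vp n w j) ↔ Arc n c (vp n u j))
  same : ∀ j, 1 ≤ j → j ≤ i → Arc n c (vp n w j) → Sd n c (vp n w j) → Sd n c (vp n u j)
  opp : ∀ j, 1 ≤ j → j ≤ i → ¬ Arc n c (vp n w j) → ¬ Sd n c (vp n w j) → ¬ Sd n c (vp n u j)
  even : Even (cross n c w u i)
  out : ∀ q : ℤ, i < q → q ≤ n → ¬ Arc n c (vp n u q)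

theorem ArcStable.refl {n : ℕ} {c i : ℤ} {w : Equiv.Perm ℤ}
    (h : ∀ q : ℤ, i < q → q ≤ n → ¬ Arc n c (vp n w q)) : ArcStable n c w w i := by
  refine ⟨fun _ _ _ => Iff.rfl, fun _ _ _ _ h => h, fun _ _ _ _ h => h, ?_, h⟩
  have : cross n c w w i = 0 := by
    unfold cross
    rw [card_eq_zero, filter_eq_empty_iff]
    intro j _ h
    exact h.1 h.2
  rw [this]; exact Even.zero

theorem ArcStable.step_outer {n k : ℕ} {c i l m : ℤ} {w u : Equiv.Perm ℤ} (hw : SP n w)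
    (hl : RowLab n k l m) (hli : l ≤ i) (hik : i ≤ k) (hc : 1 ≤ c ∧ c ≤ 2 * n)
    (h : ArcStable n c (w * QAlcoveD.refl (l, m)) u i)
    (h1 : ¬ Arc n c (vp n w l)) (h2 : ¬ Arc n c (vp n w m))
    (h3 : ¬ Sd n c (vp n w l) → ¬ Sd n c (vp n w m)) : ArcStable n c w u i := by
  have hlab := hl.lab
  have hlr := hl
  unfold RowLab at hlr
  have row : ∀ j, 1 ≤ j → j ≤ i →
      (vp n (w * QAlcoveD.refl (l, m)) j = vp n w j) ∨
      (¬ Arc n c (vp n w j) ∧ ¬ Arc n c (vp n (w * QAlcoveD.refl (l, m)) j) ∧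
        (¬ Sd n c (vp n w j) → ¬ Sd n c (vp n (w * QAlcoveD.refl (l, m)) j))) := by
    intro j hj1 hji
    rcases refl_cases hlab j with ⟨h, -⟩ | ⟨h, -⟩ | ⟨h, -⟩ | ⟨h, -⟩ | ⟨g3, g4, g5, g6, -⟩
    · subst h; right; rw [vp_fst hlab]; exact ⟨h1, h2, h3⟩
    · omega
    · omega
    · subst h; right
      rw [vp_neg_snd hw hlab, vp_neg hw hlab.2.1, Arc.neg_iff, Arc.neg_iff]
      rw [Sd.neg_iff, Sd.neg_iff, not_not, not_not]
      exact ⟨h2, h1, fun h' => not_not.1 fun h'' => h3 h'' h'⟩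
    · left; exact vp_of_ne g3 g4 g5 g6
  refine ⟨?_, ?_, ?_, ?_, h.out⟩
  · intro j hj1 hji
    have := h.arc j hj1 hji
    rcases row j hj1 hji with e | ⟨e1, e2, -⟩
    · rwa [e] at this
    · exact ⟨fun g => absurd g e1, fun g => absurd (this.2 g) e2⟩
  · intro j hj1 hji ha hs
    rcases row j hj1 hji with e | ⟨e1, e2, -⟩
    · have := h.same j hj1 hji
      rw [e] at this
      exact this ha hs
    · exact absurd ha e1
  · intro j hj1 hji ha hs
    have := h.opp j hj1 hji
    rcases row j hj1 hji with e | ⟨e1, e2, e3⟩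
    · rw [e] at this
      exact this ha hs
    · exact this e2 (e3 hs)
  · have e := h.even
    have : cross n c w u i = cross n c (w * QAlcoveD.refl (l, m)) u i := by
      unfold cross
      congr 1
      refine filter_congr fun j hj => ?_
      rw [mem_Icc] at hj
      have ho := h.opp j hj.1 hj.2
      rcases row j hj.1 hj.2 with e | ⟨e1, e2, e3⟩
      · rw [e]
      · exact ⟨fun g => absurd g.2 (ho e2 (e3 g.1)), fun g => absurd g.2 (ho e2 g.1)⟩
    rwa [this]

theorem ArcStable.step_inner {n k : ℕ} {c i l m : ℤ} {w u : Equiv.Perm ℤ} (hw : SP n w)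
    (hl : RowLab n k l m) (hli : l ≤ i) (hm : m.natAbs < l)
    (hc : 1 ≤ c ∧ c ≤ 2 * n) (h : ArcStable n c (w * QAlcoveD.refl (l, m)) u i)
    (h1 : Arc n c (vp n w l)) (h2 : Arc n c (vp n w m))
    (h3 : Sd n c (vp n w l) → Sd n c (vp n w m)) : ArcStable n c w u i := by
  have hlab := hl.lab
  have hlr := hl
  unfold RowLab at hlr
  have el : vp n (w * QAlcoveD.refl (l, m)) l = vp n w m := vp_fst hlab
  have em : vp n (w * QAlcoveD.refl (l, m)) (-m) = 2 * n + 1 - vp n w l := vp_neg_snd hw hlab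
  have em' : vp n w (-m) = 2 * n + 1 - vp n w m := vp_neg hw hlab.2.1
  have a1 : Arc n c (vp n w (-m)) := by rw [em', Arc.neg_iff]; exact h2
  have a2 : Arc n c (vp n (w * QAlcoveD.refl (l, m)) (-m)) := by
    rw [em, Arc.neg_iff]; exact h1
  have a3 : Arc n c (vp n (w * QAlcoveD.refl (l, m)) l) := by rw [el]; exact h2
  have row : ∀ j, 1 ≤ j → j ≤ i → j = l ∨ j = -m ∨
      vp n (w * QAlcoveD.refl (l, m)) j = vp n w j := by
    intro j hj1 hji
    rcases refl_cases hlab j with ⟨h, -⟩ | ⟨h, -⟩ | ⟨h, -⟩ | ⟨h, -⟩ | ⟨g3, g4, g5, g6, -⟩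
    · exact Or.inl h
    · omega
    · omega
    · exact Or.inr (Or.inl h)
    · exact Or.inr (Or.inr (vp_of_ne g3 g4 g5 g6))
  have sl := h.same l (by omega) hli a3
  have sm := h.same (-m) (by omega) (by omega) a2
  refine ⟨?_, ?_, ?_, ?_, h.out⟩
  · intro j hj1 hji
    have := h.arc j hj1 hji
    rcases row j hj1 hji with rfl | rfl | e
    · exact iff_of_true h1 (this.1 a3)
    · exact iff_of_true a1 (this.1 a2)
    · rwa [e] at this
  · intro j hj1 hji ha hs
    rcases row j hj1 hji with rfl | rfl | e
    · rw [el] at sl; exact sl (h3 hs)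
    · apply sm
      rw [em, Sd.neg_iff]; rw [em', Sd.neg_iff] at hs
      exact fun g => hs (h3 g)
    · have := h.same j hj1 hji
      rw [e] at this
      exact this ha hs
  · intro j hj1 hji ha hs
    rcases row j hj1 hji with rfl | rfl | e
    · exact absurd h1 ha
    · exact absurd a1 ha
    · have := h.opp j hj1 hji
      rw [e] at this
      exact this ha hs
  · have e := h.even
    by_cases hs : Sd n c (vp n w l) ↔ Sd n c (vp n w m)
    · have : cross n c w u i = cross n c (w * QAlcoveD.refl (l, m)) u i := by
        unfold cross
        congr 1
        refine filter_congr fun j hj => ?_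
        rw [mem_Icc] at hj
        rcases row j hj.1 hj.2 with rfl | rfl | e
        · rw [el, hs]
        · rw [em, em', Sd.neg_iff, Sd.neg_iff, hs]
        · rw [e]
      rwa [this]
    · have g1 : ¬ Sd n c (vp n w l) := by tauto
      have g2 : Sd n c (vp n w m) := by tauto
      have g3 : Sd n c (vp n u l) := sl (by rw [el]; exact g2)
      have g4 : Sd n c (2 * n + 1 - vp n w l) := Sd.neg_iff.2 g1
      have g5 : Sd n c (vp n u (-m)) := sm (by rw [em]; exact g4)
      have g6 : ¬ Sd n c (2 * n + 1 - vp n w m) := by rw [Sd.neg_iff, not_not]; exact g2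
      have : (Icc 1 i).filter (fun j => ¬ Sd n c (vp n w j) ∧ Sd n c (vp n u j)) =
          insert l (insert (-m) ((Icc 1 i).filter (fun j =>
            ¬ Sd n c (vp n (w * QAlcoveD.refl (l, m)) j) ∧ Sd n c (vp n u j)))) := by
        ext j
        simp only [mem_filter, mem_insert, mem_Icc]
        constructor
        · rintro ⟨hj, hs1, hs2⟩
          rcases row j hj.1 hj.2 with rfl | rfl | e
          · exact Or.inl rfl
          · exact Or.inr (Or.inl rfl)
          · rw [e]; exact Or.inr (Or.inr ⟨hj, hs1, hs2⟩)
        · rintro (rfl | rfl | ⟨hj, hs1, hs2⟩)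
          · exact ⟨⟨by omega, hli⟩, g1, g3⟩
          · exact ⟨⟨by omega, by omega⟩, by rw [em']; exact g6, g5⟩
          · rcases row j hj.1 hj.2 with rfl | rfl | e
            · exact ⟨hj, g1, g3⟩
            · exact ⟨hj, by rw [em']; exact g6, g5⟩
            · exact ⟨hj, by rwa [e] at hs1, hs2⟩
      unfold cross at e ⊢
      rw [this, card_insert_of_notMem, card_insert_of_notMem]
      · rw [Nat.even_iff] at e ⊢; omega
      · simp only [mem_filter, not_and]
        intro _ h'
        exact absurd (by rw [em]; exact g4) h'
      · simp only [mem_insert, mem_filter, not_or, not_and]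
        refine ⟨by omega, fun _ h' => ?_⟩
        exact absurd (by rw [el]; exact g2) h'

theorem arcStable_above {n k : ℕ} {i c : ℤ} {T : List (ℤ × ℤ)} {w : Equiv.Perm ℤ} (hw : SP n w)
    (hT : Above n k i T) (hp : IsQPath n w T) (hi1 : 1 ≤ i) (hik : i ≤ k) (hkn : k < n)
    (hc : vp n w i = c) (h : ∀ q : ℤ, i < q → q ≤ n → ¬ Arc n c (vp n w q)) :
    ArcStable n c w (endw w T) i := by
  have hi : IsLetter n i := ⟨by omega, by omega⟩
  induction T generalizing w with
  | nil => rw [endw_nil]; exact ArcStable.refl h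
  | cons β T ih =>
    obtain ⟨l, m⟩ := β
    obtain ⟨⟨hl, hli⟩, hT'⟩ := Above.cons_iff.1 hT
    dsimp only at hl hli
    obtain ⟨hjm, hp'⟩ := hp.head hw hl
    obtain ⟨-, p1, p2, p3, p4, p5, p6, p7⟩ := Above.pos_facts hl hli hik
    rw [endw_cons]
    have hlab := hl.lab
    have hcb := vp_bounds hw hi
    have n1 := vp_ne hw hi hlab.1 p5
    have n2 := vp_ne hw hi hlab.2.1 p6
    have n3 := vp_ne_neg hw hi hlab.1 p3
    have n4 := vp_ne_neg hw hi hlab.2.1 p4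
    have b1 := hjm i hi p1 p2 p3 p4
    change ¬ Bt (vp n w l) (vp n w i) (vp n w m) at b1
    have hlr := hl
    unfold RowLab at hlr
    subst hc
    have ih' : (∀ q : ℤ, i < q → q ≤ n → ¬ Arc n (vp n w i) (vp n (w * QAlcoveD.refl (l, m)) q)) →
        ArcStable n (vp n w i) (w * QAlcoveD.refl (l, m)) (endw (w * QAlcoveD.refl (l, m)) T) i :=
      fun hh => ih (hw.mul_refl hlab) hT' hp' (vp_of_ne p5 p6 p3 p4) hh
    by_cases hm : m.natAbs < l
    · obtain ⟨q1, q2⟩ := p7 hm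
      have b2 := hjm (-i) hi.neg q1 q2 (by omega) (by omega)
      change ¬ Bt (vp n w l) (vp n w (-i)) (vp n w m) at b2
      rw [vp_neg hw hi] at b2
      have hS := ih' (by
        intro q g1 g2
        rw [vp_of_ne (by omega) (by omega) (by omega) (by omega)]
        exact h q g1 g2)
      obtain ⟨f1, f2, f3⟩ := arc_iff_of_not_bt n1 n2 n3 n4 b1 b2
      by_cases ha : Arc n (vp n w i) (vp n w l)
      · exact ArcStable.step_inner hw hl hli.le hm hcb hS ha (f1.1 ha) (f2 ha)
      · exact ArcStable.step_outer hw hl hli.le hik hcb hS ha (fun g => ha (f1.2 g)) (f3 ha)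
    · have hv : ¬ Arc n (vp n w i) (vp n w m) := by
        by_cases hm0 : 0 < m
        · exact h m (by omega) (by omega)
        · have := h (-m) (by omega) (by omega)
          rwa [vp_neg hw hlab.2.1, Arc.neg_iff] at this
      obtain ⟨ha, ha'⟩ := not_arc_of_not_bt n1 n2 b1 hv
      have hS := ih' (by
        intro q g1 g2
        rcases refl_cases hlab q with ⟨h', -⟩ | ⟨h', -⟩ | ⟨h', -⟩ | ⟨h', -⟩ | ⟨g3, g4, g5, g6, -⟩
        · omega
        · subst h'; rw [vp_snd hlab]; exact ha
        · omega
        · subst h'; rw [vp_neg_snd hw hlab, Arc.neg_iff]; exact ha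
        · rw [vp_of_ne g3 g4 g5 g6]; exact h q g1 g2)
      exact ArcStable.step_outer hw hl hli.le hik hcb hS ha hv ha'

/-- The same for the rest of the row `i` and the rows above it, if the entry of row `i` moves
inside the arc. -/
theorem arcStable_row {n k : ℕ} {i c q₀ : ℤ} {T U : List (ℤ × ℤ)} {w : Equiv.Perm ℤ}
    (hw : SP n w) (hT : InRow n k i T) (hU : Above n k i U) (hp : IsQPath n w (T ++ U))
    (hi1 : 1 ≤ i) (hik : i ≤ k) (hkn : k < n) (hc : vp n (endw w T) i = c)
    (hq1 : i < q₀) (hq2 : q₀ ≤ n) (hq : ∀ β ∈ T, pos n q₀ < pos n β.2 ∧ q₀ ≠ -β.2)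
    (ha : Arc n c (vp n w i)) (h : ∀ q : ℤ, i < q → q ≤ n → ¬ Arc n c (vp n w q)) :
    ArcStable n c w (endw w (T ++ U)) i := by
  have hi : IsLetter n i := ⟨by omega, by omega⟩
  have hq0 : IsLetter n q₀ := ⟨by omega, by omega⟩
  have hqi : pos n i < pos n q₀ := by unfold pos; split_ifs <;> omega
  induction T generalizing w with
  | nil =>
    rw [endw_nil] at hc
    exact arcStable_above hw hU hp hi1 hik hkn hc h
  | cons β T ih =>
    obtain ⟨l, m⟩ := β
    obtain ⟨⟨h0, hl⟩, hT'⟩ := InRow.cons_iff.1 hT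
    dsimp only at h0
    subst h0
    rw [List.cons_append] at hp
    obtain ⟨hjm, hp'⟩ := hp.head hw hl
    dsimp only at hl hjm hp'
    have hlab := hl.lab
    have hw' := hw.mul_refl hlab
    rw [List.cons_append, endw_cons]
    rw [endw_cons] at hc
    have hq' : ∀ β ∈ T, pos n q₀ < pos n β.2 ∧ q₀ ≠ -β.2 := fun γ hγ => hq γ (by simp [hγ])
    obtain ⟨hq3, hq4⟩ := hq _ (List.mem_cons_self ..)
    dsimp only at hq3 hq4
    have hqm : q₀ ≠ m := by rintro rfl; omega
    obtain ⟨-, s2⟩ := stuck hw' hT' (isQPath_append.1 hp').1 hi hq0 hqi (by omega) hq'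
    rw [vp_of_ne (by omega) hqm (by omega) hq4, vp_fst hlab, hc] at s2
    have s1 := cut_of_not_bt (hjm q₀ hq0 hqi hq3 (by omega) hq4) (vp_ne hw hq0 hlab.1 (by omega))
      (vp_ne hw hq0 hlab.2.1 hqm)
    change Cut (vp n w q₀) (vp n w l) (vp n w m) at s1
    have hy := h q₀ hq1 hq2
    have hcb : 1 ≤ c ∧ c ≤ 2 * n := by
      rw [← hc]; exact vp_bounds (hw'.endw hT'.lab) hi
    obtain ⟨hvm, hvs⟩ := arc_of_cut s1 s2 hy ha
    have hlr := hl
    unfold RowLab at hlr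
    have hm : m.natAbs < l := by
      by_contra hm
      by_cases hm0 : 0 < m
      · exact h m (by omega) (by omega) hvm
      · refine h (-m) (by omega) (by omega) ?_
        rwa [vp_neg hw hlab.2.1, Arc.neg_iff]
    refine ArcStable.step_inner hw hl le_rfl hm hcb ?_ ha hvm hvs
    · refine ih hw' hT' hp' hc hq' (by rwa [vp_fst hlab]) ?_
      intro q g1 g2
      rw [vp_of_ne (by omega) (by omega) (by omega) (by omega)]
      exact h q g1 g2

/-- `x` is in the half-open arc from `a` (exclusive) to `c` (inclusive). -/
def Tk (a x c : ℤ) : Prop := Bt a x c ∨ (x = c ∧ x ≠ a)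

theorem arc_opp_absurd {n : ℕ} {c y u a : ℤ} (h1 : Cut y u a)
    (h2 : Cut (2 * n + 1 - a) (2 * n + 1 - y) c) (hu : Arc n c u) (hy : ¬ Arc n c y) : False := by
  unfold Arc CArc Bt Cut at *; omega

theorem skip_arc {n : ℕ} {a x c a' : ℤ} (h : Tk a x c) (hxc : x ≠ c) (h1 : Cut x a a')
    (h2 : Cut (2 * n + 1 - a') (2 * n + 1 - x) c) (h3 : Cut a' (2 * n + 1 - x) c)
    :
    Arc n c x ∧ ¬ Arc n c a' := by
  have b : Bt a' x c := by unfold Tk Bt Cut at *; omega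
  clear h h1
  unfold Arc CArc Bt Cut at *; omega

theorem bt_of_arc {n : ℕ} {x c a' y : ℤ} (ha : ¬ Arc n c a')
    (hy : Arc n c y) (hyx : ¬ Bt a' y (2 * n + 1 - x)) (n1 : y ≠ 2 * n + 1 - x) (n2 : y ≠ c) :
    Bt (2 * n + 1 - x) y c := by
  unfold Arc CArc Bt at *; omega

theorem skip_arc' {n : ℕ} {x c y t : ℤ} (hx : Arc n c x) (hy : Arc n c y)
    (hyx : Bt (2 * n + 1 - x) y c) (h1 : Cut y (2 * n + 1 - x) t) (h2 : Cut t (2 * n + 1 - y) c)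
    (h3 : Cut (2 * n + 1 - t) (2 * n + 1 - y) c) : False := by
  unfold Arc CArc Bt Cut at *; omega

theorem tk_of_cut {a x c y : ℤ} (hax : a ≠ x) (h1 : Cut y a x) (h2 : Cut y x c) :
    Tk a x c := by
  unfold Tk Bt Cut at *; omega

theorem tk_of_cut' {a x c : ℤ} (h2 : Cut a x c) : Tk a x c := by
  unfold Tk Bt Cut at *; omega

theorem tk_of_cut₃ {N a x c y t : ℤ} (hax : a ≠ x) (h1 : Cut y a x) (h2 : Cut y x (N - a))
    (h5 : Cut y (N - a) t) (g4 : Cut (N - t) (N - y) c) (e2 : y ≠ N - y) (e3 : a ≠ N - a)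
    (e4 : t ≠ N - t) : Tk a x c := by
  unfold Tk Bt Cut at *; omega

theorem Tk.not_cut {a x c : ℤ} (h : Tk a x c) : ¬ Cut x a c := by
  unfold Tk Bt Cut at *; omega

/-- The labels are sorted by the positions of their second components. -/
def Srt (n : ℕ) (T : List (ℤ × ℤ)) : Prop := T.Pairwise (fun β γ => pos n β.2 < pos n γ.2)

/-- The word `w` and the column `v` are blocked off at `j`. -/
def Blk (n : ℕ) (w : Equiv.Perm ℤ) (v : ℤ → ℤ) (j : ℤ) : Prop :=
  Arc n (pos n (v j)) (vp n w j) ∧ vp n w j ≠ pos n (v j) ∧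
  (∀ q, j < q → q ≤ n → ¬ Arc n (pos n (v j)) (vp n w q)) ∧
  (∀ x, IsLetter n x → Arc n (pos n (v j)) (pos n x) →
    ∃ q, 1 ≤ q ∧ q ≤ j ∧ (v q = x ∨ v q = -x)) ∧
  Odd ((Icc 1 j).filter (fun q =>
    ¬ Sd n (pos n (v j)) (vp n w q) ∧ Sd n (pos n (v j)) (pos n (v q)))).card

theorem vp_neg_ne {n : ℕ} {x : ℤ} : x ≠ 2 * n + 1 - x := by omega

theorem SP.symm_letter {n : ℕ} {w : Equiv.Perm ℤ} (hw : SP n w) {y : ℤ} (hy : IsLetter n y) :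
    ∃ x, IsLetter n x ∧ w x = y := by
  obtain ⟨x, hx, hxy⟩ := Finset.surj_on_of_inj_on_of_card_le (s := letters n) (t := letters n)
    (fun x _ => w x) (fun x hx => mem_letters.2 (hw.letter (mem_letters.1 hx)))
    (fun _ _ _ _ h => w.injective h) le_rfl y (mem_letters.2 hy)
  exact ⟨x, mem_letters.1 hx, hxy.symm⟩

theorem ArcStable.rows {n : ℕ} {c i : ℤ} {w u : Equiv.Perm ℤ} (hu : SP n u)
    (h : ArcStable n c w u i) (hc : 1 ≤ c ∧ c ≤ 2 * n) {x : ℤ} (hx : IsLetter n x)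
    (hax : Arc n c (pos n x)) : ∃ q, 1 ≤ q ∧ q ≤ i ∧ (u q = x ∨ u q = -x) := by
  obtain ⟨q, hq, rfl⟩ := hu.symm_letter hx
  have hb := hq
  unfold IsLetter at hb
  rcases lt_or_gt_of_ne hq.1 with h0 | h0
  · refine ⟨-q, by omega, ?_, Or.inr (hu.neg q)⟩
    by_contra hqi
    refine h.out (-q) (by omega) (by omega) ?_
    rw [vp_neg hu hq, Arc.neg_iff]
    exact hax
  · refine ⟨q, by omega, ?_, Or.inl rfl⟩
    by_contra hqi
    exact h.out q (by omega) (by omega) hax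

theorem endw_row {n k : ℕ} {i : ℤ} {T U : List (ℤ × ℤ)} {w : Equiv.Perm ℤ} (hU : Above n k i U)
    (hik : i ≤ k) : endw w (T ++ U) i = endw w T i := by
  rw [endw_append, above_fix hU le_rfl hik]

/-- In a row, the label opposite to the place of a letter outside the arc does not occur. -/
theorem opp_notMem {n k : ℕ} {i c q : ℤ} {T : List (ℤ × ℤ)} {w : Equiv.Perm ℤ}
    (hw : SP n w) (hT : InRow n k i T) (hs : Srt n T) (hp : IsQPath n w T)
    (hi1 : 1 ≤ i) (hin : i < q) (hqn : q ≤ n) (h : ∀ β ∈ T, pos n q < pos n β.2)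
    (hc : vp n (endw w T) i = c) (ha : Arc n c (vp n w i)) (hy : ¬ Arc n c (vp n w q)) :
    ∀ β ∈ T, q ≠ -β.2 := by
  rintro ⟨l, m⟩ hβ hm
  obtain ⟨T₁, T₂, rfl⟩ := List.append_of_mem hβ
  have hi : IsLetter n i := ⟨by omega, by omega⟩
  have hq : IsLetter n q := ⟨by omega, by omega⟩
  have hqi : pos n i < pos n q := by unfold pos; split_ifs <;> omega
  obtain ⟨hl, hr⟩ := hT _ hβ
  dsimp only at hl hr hm
  subst hl
  obtain rfl : m = -q := by omega
  rw [isQPath_append] at hp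
  obtain ⟨hp1, hp2⟩ := hp
  have hT1 : InRow n k l T₁ := fun γ hγ => hT γ (by simp [hγ])
  have hT2 : InRow n k l T₂ := fun γ hγ => hT γ (by simp [hγ])
  unfold Srt at hs
  rw [List.pairwise_append, List.pairwise_cons] at hs
  obtain ⟨-, ⟨s1, -⟩, s2⟩ := hs
  have hw1 := hw.endw hT1.lab
  obtain ⟨hj, hp3⟩ := hp2.head hw1 hr
  have hw2 := hw1.mul_refl hr.lab
  have a1 := stuck hw hT1 hp1 hi hq hqi (by omega) fun γ hγ => ⟨h γ (by simp [hγ]), fun hh => by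
    have := s2 γ hγ _ (List.mem_cons_self ..)
    rw [hh, neg_neg] at this; exact absurd this (lt_irrefl _)⟩
  have a2 := stuck hw2 hT2 hp3 hi hq hqi (by omega) fun γ hγ => ⟨h γ (by simp [hγ]), fun hh => by
    have := s1 γ hγ
    rw [hh, neg_neg] at this; exact absurd this (lt_irrefl _)⟩
  have e1 := vp_neg_snd hw1 hr.lab
  rw [neg_neg] at e1
  rw [endw_append, endw_cons] at hc
  rw [hc, e1, vp_fst hr.lab, vp_neg hw1 hq, a1.1] at a2
  exact arc_opp_absurd a1.2 a2.2 ha hy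

theorem not_blk {n k : ℕ} {i : ℤ} {T U : List (ℤ × ℤ)} {w : Equiv.Perm ℤ} (hw : SP n w)
    (hT : InRow n k i T) (hs : Srt n T) (hU : Above n k i U) (hp : IsQPath n w (T ++ U))
    (hi1 : 1 ≤ i) (hik : i ≤ k) (hkn : k < n) (h : ∀ β ∈ T, pos n (i + 1) < pos n β.2) :
    ¬ Blk n w (endw w (T ++ U)) i := by
  rintro ⟨ha, -, hq, -, hodd⟩
  rw [endw_row hU hik] at ha hq hodd
  have h2 := opp_notMem hw hT hs (isQPath_append.1 hp).1 hi1 (lt_add_one i) (by omega) h rfl ha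
    (hq _ (lt_add_one i) (by omega))
  have := (arcStable_row hw hT hU hp hi1 hik hkn rfl (lt_add_one i) (by omega)
    (fun β hβ => ⟨h β hβ, h2 β hβ⟩) ha hq).even
  exact Nat.not_even_iff_odd.2 hodd this

theorem endw_of_ne {w : Equiv.Perm ℤ} {T : List (ℤ × ℤ)} {q : ℤ}
    (h : ∀ β ∈ T, q ≠ β.1 ∧ q ≠ β.2 ∧ q ≠ -β.1 ∧ q ≠ -β.2) : endw w T q = w q := by
  induction T generalizing w with
  | nil => simp
  | cons β T ih =>
    obtain ⟨l, m⟩ := β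
    obtain ⟨h1, h2, h3, h4⟩ := h _ (List.mem_cons_self ..)
    rw [endw_cons, ih fun γ hγ => h γ (by simp [hγ]), mul_refl_of_ne h1 h2 h3 h4]

theorem odd_card_filter_toggle {i : ℤ} (hi : 1 ≤ i) {P Q : ℤ → Prop} [DecidablePred P]
    [DecidablePred Q] (h : ∀ j, 1 ≤ j → j < i → (P j ↔ Q j)) (h' : P i ↔ ¬ Q i)
    (hQ : Even ((Icc 1 i).filter Q).card) : Odd ((Icc 1 i).filter P).card := by
  have e : Icc 1 i = insert i (Icc 1 (i - 1)) := by ext j; simp only [mem_insert, mem_Icc]; omega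
  have e2 : (Icc 1 (i - 1)).filter P = (Icc 1 (i - 1)).filter Q :=
    filter_congr fun j hj => by rw [mem_Icc] at hj; exact h j hj.1 (by omega)
  have e3 : i ∉ (Icc 1 (i - 1)).filter Q := by simp
  rw [e, filter_insert] at hQ ⊢
  rw [e2]
  by_cases hq : Q i
  · rw [if_pos hq, card_insert_of_notMem e3] at hQ
    rw [if_neg (fun hp => h'.1 hp hq)]
    rw [Nat.odd_iff]; rw [Nat.even_iff] at hQ; omega
  · rw [if_neg hq] at hQ
    rw [if_pos (h'.2 hq), card_insert_of_notMem e3]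
    exact hQ.add_one

theorem RowLab.neg_snd {n k : ℕ} {i m : ℤ} (h : RowLab n k i m) (h' : RowLab n k i (-m)) :
    k < m.natAbs := by
  unfold RowLab at *; omega

theorem pos_neg_lt {n : ℕ} {m : ℤ} (h : IsLetter n m) (h' : pos n m < pos n (-m)) : 0 < m := by
  rw [pos_neg h] at h'
  rw [← pos_le_iff h]; omega

theorem neg_of_pos_lt {n : ℕ} {m x : ℤ} (hm : IsLetter n m) (hx : IsLetter n x) (h0 : 0 < m)
    (h : pos n (-m) < pos n x) : x < 0 := by
  by_contra hx0
  have := (pos_le_iff hx).2 (by have := hx.1; omega)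
  have := (pos_le_iff hm).2 h0
  rw [pos_neg hm] at h
  omega

theorem pos_lt_of_neg {n : ℕ} {q x : ℤ} (hq : IsLetter n q) (hx : IsLetter n x) (h0 : 0 < q)
    (h : x < 0) : pos n q < pos n x := by
  have := (pos_le_iff hq).2 h0
  have := (pos_le_iff hx).not.2 (by omega)
  omega

/-- If a letter could be taken by the path algorithm but is skipped, then taking it makes the
columns blocked off. -/
theorem blk_of_skip {n k : ℕ} {i m : ℤ} {T U : List (ℤ × ℤ)} {w : Equiv.Perm ℤ} (hw : SP n w)
    (hT : InRow n k i T) (hs : Srt n T) (hU : Above n k i U) (hp : IsQPath n w (T ++ U))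
    (hi1 : 1 ≤ i) (hik : i ≤ k) (hkn : k < n) (hm : RowLab n k i m)
    (h : ∀ β ∈ T, pos n m < pos n β.2)
    (htk : Tk (vp n w i) (vp n w m) (vp n (endw w T) i)) :
    Blk n (w * refl (i, m)) (endw w (T ++ U)) i := by
  have hi : IsLetter n i := ⟨by omega, by omega⟩
  have hml := hm.lab.2.1
  have hmi : m ≠ -i := fun hh => hm.lab.2.2.2 (by omega)
  have hrow : ∀ β ∈ T, IsLetter n β.2 ∧ β.2 ≠ i ∧ β.2 ≠ -i := fun β hβ => by
    have := (hT β hβ).2.lab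
    exact ⟨this.2.1, fun h => this.2.2.1 h.symm, fun h => this.2.2.2 (by omega)⟩
  have hpT := (isQPath_append.1 hp).1
  have hex : ∃ β ∈ T, m = -β.2 := by
    by_contra hno
    push Not at hno
    exact htk.not_cut (stuck hw hT hpT hi hml hm.pos_lt hmi fun β hβ => ⟨h β hβ, hno β hβ⟩).2
  obtain ⟨⟨l, m'⟩, hβ, hmm⟩ := hex
  obtain ⟨Ta, Tb, rfl⟩ := List.append_of_mem hβ
  obtain ⟨hl, hr⟩ := hT _ hβ
  dsimp only at hl hr hmm
  subst hl
  obtain rfl : m' = -m := by omega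
  have hm0 : 0 < m := pos_neg_lt hml (h _ hβ)
  have hmk := hm.neg_snd hr
  have hTa : InRow n k l Ta := fun γ hγ => hT γ (by simp [hγ])
  have hTb : InRow n k l Tb := fun γ hγ => hT γ (by simp [hγ])
  unfold Srt at hs
  rw [List.pairwise_append, List.pairwise_cons] at hs
  obtain ⟨-, ⟨s1, s1'⟩, s2⟩ := hs
  have s3 : ∀ γ ∈ Ta, pos n γ.2 < pos n (-m) := fun γ hγ => s2 γ hγ _ (List.mem_cons_self ..)
  have s4 : ∀ γ ∈ Tb, γ.2 < 0 := fun γ hγ =>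
    neg_of_pos_lt hml (hrow γ (by simp [hγ])).1 hm0 (s1 γ hγ)
  rw [isQPath_append] at hpT
  obtain ⟨hpa, hpb⟩ := hpT
  have hw1 := hw.endw hTa.lab
  obtain ⟨hj, hpb'⟩ := hpb.head hw1 hr
  have hw2 := hw1.mul_refl hr.lab
  have a1 := stuck hw hTa hpa hi hml hm.pos_lt hmi fun γ hγ => ⟨h γ (by simp [hγ]), fun hh => by
    have := s3 γ hγ
    rw [hh, neg_neg] at this; exact lt_irrefl _ this⟩
  have a2 := stuck hw2 hTb hpb' hi hml hm.pos_lt hmi fun γ hγ => ⟨h γ (by simp [hγ]), fun hh => by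
    have := s1 γ hγ
    dsimp only at this
    rw [hh, neg_neg] at this; exact lt_irrefl _ this⟩
  have a3 := stuck hw2 hTb hpb' hi hml.neg (hm.pos_lt.trans (h _ hβ)) (by omega)
    fun γ hγ => ⟨s1 γ hγ, fun hh => by have := s4 γ hγ; omega⟩
  have hTb2 : Tb.Pairwise (fun β γ => γ.2 ≠ -β.2) :=
    List.Pairwise.imp_of_mem (fun {a b} ha hb _ => by
      have := s4 a ha; have := s4 b hb; omega) s1'
  have a4 := unreachable hw2 hTb hi hi.neg (by omega)
    (fun β hβ => (hrow β (by simp [hβ])).2.2.symm) hTb2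
  have e1 : vp n (endw w Ta * QAlcoveD.refl (l, -m)) m = 2 * n + 1 - vp n (endw w Ta) l := by
    have := vp_neg_snd hw1 hr.lab; rwa [neg_neg] at this
  have ec : endw w (Ta ++ (l, -m) :: Tb) = endw (endw w Ta * QAlcoveD.refl (l, -m)) Tb := by
    rw [endw_append, endw_cons]
  have eu : endw w ((Ta ++ (l, -m) :: Tb) ++ U) =
      endw (endw w Ta * QAlcoveD.refl (l, -m)) (Tb ++ U) := by
    rw [endw_append, ec, endw_append]
  rw [ec] at htk
  have e0 : endw (endw w Ta * QAlcoveD.refl (l, -m)) (Tb ++ U) l =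
    endw (endw w Ta * QAlcoveD.refl (l, -m)) Tb l := endw_row hU hik
  have b0 := vp_bounds (hw2.endw hTb.lab) hi
  set w1 := endw w Ta with hw1e
  rw [vp_neg hw2 hi, vp_fst hr.lab, vp_neg hw1 hml, a1.1, sub_sub_cancel] at a4
  rw [e1, vp_fst hr.lab, vp_neg hw1 hml, a1.1] at a2
  rw [vp_snd hr.lab, vp_fst hr.lab, vp_neg hw1 hml, a1.1] at a3
  obtain ⟨f1, f2⟩ := skip_arc htk a4.symm a1.2 a2.2 a3.2
  set c := vp n (endw (w1 * QAlcoveD.refl (l, -m)) Tb) l with hcdef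
  have e2 : vp n (w1 * QAlcoveD.refl (l, -m)) l = 2 * n + 1 - vp n w m := by
    rw [vp_fst hr.lab, vp_neg hw1 hml, a1.1]
  have hout : ∀ q : ℤ, l < q → q ≤ n → ¬ Arc n c (vp n (w1 * QAlcoveD.refl (l, -m)) q) := by
    intro q hq1 hq2 hy
    by_cases hqm : q = m
    · subst hqm
      rw [e1, Arc.neg_iff] at hy
      exact f2 hy
    have hq : IsLetter n q := ⟨by omega, by omega⟩
    have hqp : pos n l < pos n q := by unfold pos; split_ifs <;> omega
    have hTq : ∀ γ ∈ Tb, pos n q < pos n γ.2 := fun γ hγ =>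
      pos_lt_of_neg hq (hrow γ (by simp [hγ])).1 (by omega) (s4 γ hγ)
    have n1 := vp_ne hw2 hq hi (by omega)
    rw [e2] at n1
    have n2 := unreachable hw2 hTb hi hq (by omega)
      (fun β hβ => by have := s4 β hβ; omega) hTb2
    have n3 := hj q hq hqp (pos_lt_of_neg hq hml.neg (by omega) (by omega)) (by omega) (by omega)
    change ¬ Bt (vp n w1 l) (vp n w1 q) (vp n w1 (-m)) at n3
    have e3 : vp n (w1 * QAlcoveD.refl (l, -m)) q = vp n w1 q :=
      vp_of_ne (by omega) (by omega) (by omega) (by omega)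
    rw [vp_neg hw1 hml, a1.1, ← e3] at n3
    have hbt := bt_of_arc f2 hy n3 n1 n2.symm
    by_cases hex : ∃ β ∈ Tb, q = -β.2
    · obtain ⟨⟨l', m'⟩, hβ', hmm'⟩ := hex
      obtain ⟨Tc, Td, rfl⟩ := List.append_of_mem hβ'
      obtain ⟨hl', hr'⟩ := hTb _ hβ'
      dsimp only at hl' hr' hmm'
      subst hl'
      obtain rfl : m' = -q := by omega
      have hTc : InRow n k l' Tc := fun γ hγ => hTb γ (by simp [hγ])
      have hTd : InRow n k l' Td := fun γ hγ => hTb γ (by simp [hγ])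
      rw [List.pairwise_append, List.pairwise_cons] at s1'
      obtain ⟨-, ⟨t1, -⟩, t2⟩ := s1'
      rw [isQPath_append] at hpb'
      obtain ⟨hpc, hpd⟩ := hpb'
      have hw3 := hw2.endw hTc.lab
      obtain ⟨-, hpd'⟩ := hpd.head hw3 hr'
      have hw4 := hw3.mul_refl hr'.lab
      have c1 := stuck hw2 hTc hpc hi hq hqp (by omega) fun γ hγ => ⟨hTq γ (by simp [hγ]), fun hh => by
        have := t2 γ hγ _ (List.mem_cons_self ..)
        dsimp only at this
        rw [hh, neg_neg] at this; exact lt_irrefl _ this⟩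
      have c2 := stuck hw4 hTd hpd' hi hq hqp (by omega) fun γ hγ => ⟨hTq γ (by simp [hγ]), fun hh => by
        have := t1 γ hγ
        dsimp only at this
        rw [hh, neg_neg] at this; exact lt_irrefl _ this⟩
      have c3 := stuck hw4 hTd hpd' hi hq.neg
        (hqp.trans (pos_lt_of_neg hq hq.neg (by omega) (by omega))) (by omega)
        fun γ hγ => ⟨t1 γ hγ, fun hh => by have := s4 γ (by simp [hγ]); omega⟩
      have e4 := vp_neg_snd hw3 hr'.lab
      rw [neg_neg] at e4
      rw [endw_append, endw_cons] at hcdef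
      rw [← hcdef, e4, vp_fst hr'.lab, vp_neg hw3 hq, c1.1] at c2
      rw [← hcdef, vp_snd hr'.lab, vp_fst hr'.lab, vp_neg hw3 hq, c1.1] at c3
      rw [e2] at c1
      exact skip_arc' f1 hy hbt c1.2 c3.2 c2.2
    · push Not at hex
      have := (stuck hw2 hTb hpb' hi hq hqp (by omega) fun β hβ => ⟨hTq β hβ, hex β hβ⟩).2
      rw [e2] at this
      exact Tk.not_cut (Or.inl hbt) this
  have hst := arcStable_row hw2 hTb hU (isQPath_append.2 ⟨hpb', by
      rw [isQPath_append, ec] at hp; exact hp.2⟩) hi1 hik hkn rfl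
    (q₀ := m) (by omega) (by have := hml.2; omega) (fun γ hγ => ⟨h γ (by simp [hγ]), fun hh => by
      have := s1 γ hγ
      dsimp only at this
      rw [hh, neg_neg] at this; exact lt_irrefl _ this⟩)
    (by rw [← hcdef, e2, Arc.neg_iff]; exact f1) hout
  rw [← hcdef, ← eu] at hst
  have eu' : vp n (endw w ((Ta ++ (l, -m) :: Tb) ++ U)) l = c := by
    rw [hcdef, eu]; unfold vp; rw [e0]
  have hTaq : ∀ γ ∈ Ta, k < γ.2.natAbs := by
    intro γ hγ
    have h1 := (hTa γ hγ).2
    have h2 := s3 γ hγ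
    rw [pos_neg hml, pos_of_pos hm0] at h2
    unfold RowLab at h1
    by_contra h3
    rw [pos_of_neg (by omega)] at h2
    omega
  have hmid : ∀ j, 1 ≤ j → j < l →
      (w1 * QAlcoveD.refl (l, -m)) j = (w * QAlcoveD.refl (l, m)) j := by
    intro j hj1 hj2
    rw [mul_refl_of_ne (by omega) (by omega) (by omega) (by omega),
      mul_refl_of_ne (by omega) (by omega) (by omega) (by omega), hw1e, endw_of_ne]
    intro γ hγ
    have := hTaq γ hγ
    have := (hTa γ hγ).1
    omega
  have e5 : (w1 * QAlcoveD.refl (l, -m)) l = -(w * QAlcoveD.refl (l, m)) l := by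
    rw [mul_refl_fst hr.lab, mul_refl_fst hm.lab, hw1.neg, hw1e,
      pos_inj (hw1.letter hml) (hw.letter hml) a1.1]
  have hw' := hw.mul_refl hm.lab
  have hu : SP n (endw w ((Ta ++ (l, -m) :: Tb) ++ U)) := by
    rw [endw_append]; exact (hw.endw hT.lab).endw hU.lab
  have eu'' : pos n (endw w ((Ta ++ (l, -m) :: Tb) ++ U) l) = c := eu'
  unfold Blk
  rw [eu'', vp_fst hm.lab]
  refine ⟨f1, a4.symm, ?_, fun x hx hax => hst.rows hu b0 hx hax, ?_⟩
  · intro q hq1 hq2 hy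
    have hq : IsLetter n q := ⟨by omega, by omega⟩
    have key : ∃ j : ℤ, 1 ≤ j ∧ j ≤ n ∧ ((w1 * QAlcoveD.refl (l, -m)) j = (w * QAlcoveD.refl (l, m)) q ∨
        (w1 * QAlcoveD.refl (l, -m)) j = -(w * QAlcoveD.refl (l, m)) q) := by
      obtain ⟨j, hj1, hj2⟩ := hw2.symm_letter (hw'.letter hq)
      have hj3 := hj1
      unfold IsLetter at hj3
      rcases lt_or_gt_of_ne hj1.1 with h0 | h0
      · exact ⟨-j, by omega, by omega, Or.inr (by rw [hw2.neg, hj2])⟩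
      · exact ⟨j, by omega, by omega, Or.inl hj2⟩
    obtain ⟨j, hj1, hj2, hj3⟩ := key
    by_cases hjl : l < j
    · refine hout j hjl hj2 ?_
      rcases hj3 with hj3 | hj3
      · unfold vp at hy ⊢; rwa [hj3]
      · unfold vp at hy ⊢; rwa [hj3, pos_neg (hw'.letter hq), Arc.neg_iff]
    · have : (w * QAlcoveD.refl (l, m)) j = (w * QAlcoveD.refl (l, m)) q ∨
          (w * QAlcoveD.refl (l, m)) j = -(w * QAlcoveD.refl (l, m)) q := by
        rcases lt_or_eq_of_le (not_lt.1 hjl) with hjl | rfl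
        · rw [← hmid j hj1 hjl]; exact hj3
        · rw [e5] at hj3; omega
      have := hw'.natAbs_inj (x := j) (y := q) (by omega)
      omega
  · refine odd_card_filter_toggle (Q := fun q => ¬ Sd n c (vp n (w1 * QAlcoveD.refl (l, -m)) q) ∧
      Sd n c (vp n (endw w ((Ta ++ (l, -m) :: Tb) ++ U)) q)) hi1 ?_ ?_ hst.even
    · intro j hj1 hj2
      unfold vp
      rw [hmid j hj1 hj2]
    · rw [e2, eu', eu'', vp_fst hm.lab, Sd.neg_iff]
      have : Sd n c c := Iff.rfl
      tauto

theorem pos_succ_lt {n k : ℕ} {i m : ℤ} (hm : RowLab n k i m) (h : m ≠ i + 1) :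
    pos n (i + 1) < pos n m := by
  unfold RowLab at hm
  rw [pos_of_pos (by omega)]
  unfold pos; split_ifs <;> omega

/-- Along a path the new letter in a row is always taken from the arc that ends in the final
letter of the row, unless the label is `(i, i + 1)`. -/
theorem tk_of_isQPath {n k : ℕ} {i m : ℤ} {T : List (ℤ × ℤ)} {w : Equiv.Perm ℤ} (hw : SP n w)
    (hm : RowLab n k i m) (hT : InRow n k i T) (hs : Srt n ((i, m) :: T))
    (hp : IsQPath n w ((i, m) :: T)) (hi1 : 1 ≤ i) (hik : i ≤ k) (hkn : k < n) (hmi : m ≠ i + 1) :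
    Tk (vp n w i) (vp n w m) (vp n (endw w ((i, m) :: T)) i) := by
  have hi : IsLetter n i := ⟨by omega, by omega⟩
  have hi' : IsLetter n (i + 1) := ⟨by omega, by omega⟩
  have hip : pos n i < pos n (i + 1) := by unfold pos; split_ifs <;> omega
  have hml := hm.lab.2.1
  have hmne : m ≠ -i := fun hh => hm.lab.2.2.2 (by omega)
  obtain ⟨hj, hp'⟩ := hp.head hw hm
  have hw' := hw.mul_refl hm.lab
  unfold Srt at hs
  rw [List.pairwise_cons] at hs
  obtain ⟨h, hs⟩ := hs
  dsimp only at h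
  rw [endw_cons]
  have nax := vp_ne hw hi hml hm.lab.2.2.1
  have hsucc := pos_succ_lt hm hmi
  by_cases hex : ∃ β ∈ T, m = -β.2
  · obtain ⟨⟨l, m'⟩, hβ, hmm⟩ := hex
    obtain ⟨Ta, Tb, rfl⟩ := List.append_of_mem hβ
    obtain ⟨hl, hr⟩ := hT _ hβ
    dsimp only at hl hr hmm
    subst hl
    obtain rfl : m' = -m := by omega
    have hm0 : 0 < m := pos_neg_lt hml (h _ hβ)
    have hjy := hj (l + 1) hi' hip hsucc (by omega) (by omega)
    have cy : Cut (vp n w (l + 1)) (vp n w l) (vp n w m) :=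
      cut_of_not_bt hjy (vp_ne hw hi' hi (by omega)) (vp_ne hw hi' hml hmi.symm)
    have ey : vp n (w * QAlcoveD.refl (l, m)) (l + 1) = vp n w (l + 1) :=
      vp_of_ne (by omega) (by omega) (by omega) (by omega)
    have hTp : ∀ γ ∈ Ta ++ (l, -m) :: Tb, pos n (l + 1) < pos n γ.2 := fun γ hγ =>
      hsucc.trans (h γ hγ)
    by_cases hex2 : ∃ β ∈ Ta ++ (l, -m) :: Tb, l + 1 = -β.2
    · obtain ⟨⟨l', m'⟩, hβ', hmm'⟩ := hex2
      obtain ⟨hl', hr'⟩ := hT _ hβ'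
      dsimp only at hl' hr' hmm'
      subst hl'
      obtain rfl : m' = -(l' + 1) := by omega
      rw [List.pairwise_append, List.pairwise_cons] at hs
      obtain ⟨-, ⟨s1, s1'⟩, s2⟩ := hs
      have hlt : pos n (-m) < pos n (-(l' + 1)) := by
        rw [pos_neg hml, pos_neg hi']; omega
      have hβ'' : (l', -(l' + 1)) ∈ Tb := by
        rcases List.mem_append.1 hβ' with h1 | h1
        · have := s2 _ h1 _ (List.mem_cons_self ..)
          dsimp only at this; omega
        · rcases List.mem_cons.1 h1 with h1 | h1
          · simp only [Prod.mk.injEq, true_and] at h1; omega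
          · exact h1
      obtain ⟨Tc, Td, rfl⟩ := List.append_of_mem hβ''
      rw [List.pairwise_append, List.pairwise_cons] at s1'
      obtain ⟨-, ⟨t1, -⟩, t2⟩ := s1'
      have hTa : InRow n k l' Ta := fun γ hγ => hT γ (by simp [hγ])
      have hTc : InRow n k l' Tc := fun γ hγ => hT γ (by simp [hγ])
      have hTd : InRow n k l' Td := fun γ hγ => hT γ (by simp [hγ])
      rw [isQPath_append] at hp'
      obtain ⟨hpa, hpb⟩ := hp'
      have hw1 := hw'.endw hTa.lab
      obtain ⟨hjb, hpb'⟩ := hpb.head hw1 hr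
      have hw2 := hw1.mul_refl hr.lab
      rw [isQPath_append] at hpb'
      obtain ⟨hpc, hpd⟩ := hpb'
      have hw3 := hw2.endw hTc.lab
      obtain ⟨hjd, hpd'⟩ := hpd.head hw3 hr'
      have hw4 := hw3.mul_refl hr'.lab
      have a0 := stuck hw' hTa hpa hi hml hm.pos_lt hmne fun γ hγ => ⟨h γ (by simp [hγ]), fun hh => by
        have := s2 γ hγ _ (List.mem_cons_self ..)
        dsimp only at this
        rw [hh, neg_neg] at this; exact lt_irrefl _ this⟩
      have a1 := stuck hw' hTa hpa hi hi' hip (by omega) fun γ hγ => ⟨hTp γ (by simp [hγ]), fun hh => by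
        have := s2 γ hγ _ (List.mem_cons_self ..)
        dsimp only at this
        rw [hh, neg_neg] at hlt; exact lt_asymm this hlt⟩
      have a3 := stuck hw2 hTc hpc hi hi' hip (by omega) fun γ hγ => ⟨hTp γ (by simp [hγ]), fun hh => by
        have := t2 γ hγ _ (List.mem_cons_self ..)
        dsimp only at this
        rw [hh, neg_neg] at this; exact lt_irrefl _ this⟩
      have a4 := stuck hw4 hTd hpd' hi hi' hip (by omega) fun γ hγ => ⟨hTp γ (by simp [hγ]), fun hh => by
        have := t1 γ hγ
        dsimp only at this
        rw [hh, neg_neg] at this; exact lt_irrefl _ this⟩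
      have j2 := hjb (l' + 1) hi' hip (hTp (l', -m) (by simp)) (by omega) (by omega)
      have a2 := cut_of_not_bt j2 (vp_ne hw1 hi' hi (by omega)) (vp_ne hw1 hi' hml.neg (by omega))
      have e2 : vp n (endw (w * QAlcoveD.refl (l', m)) Ta * QAlcoveD.refl (l', -m)) (l' + 1) =
        vp n (endw (w * QAlcoveD.refl (l', m)) Ta) (l' + 1) :=
          vp_of_ne (by omega) (by omega) (by omega) (by omega)
      have e4 := vp_neg_snd hw3 hr'.lab
      rw [neg_neg] at e4
      rw [vp_snd hm.lab] at a0
      rw [ey, vp_fst hm.lab] at a1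
      change Cut (vp n _ (l' + 1)) (vp n _ l') (vp n _ (-m)) at a2
      rw [e2, vp_fst hr.lab, vp_neg hw1 hml, a0.1, a1.1] at a3
      rw [vp_neg hw1 hml, a0.1, a1.1] at a2
      rw [e4, vp_fst hr'.lab, vp_neg hw3 hi', a3.1] at a4
      rw [endw_append, endw_cons, endw_append, endw_cons]
      exact tk_of_cut₃ nax cy (a1.2.trans a2) a3.2 a4.2 vp_neg_ne vp_neg_ne vp_neg_ne
    · push Not at hex2
      have := (stuck hw' hT hp' hi hi' hip (by omega) fun β hβ => ⟨hTp β hβ, hex2 β hβ⟩).2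
      rw [ey, vp_fst hm.lab] at this
      exact tk_of_cut nax cy this
  · push Not at hex
    have := (stuck hw' hT hp' hi hml hm.pos_lt hmne fun β hβ => ⟨h β hβ, hex β hβ⟩).2
    rw [vp_snd hm.lab, vp_fst hm.lab] at this
    exact tk_of_cut' this

theorem ent_col {k : ℕ} {w : Equiv.Perm ℤ} {j : ℕ} (h1 : 1 ≤ j) (h2 : j ≤ k) :
    ent (col k w) j = w j := by
  unfold ent col
  rw [List.getD_eq_getElem _ _ (by simp; omega)]
  simp only [List.getElem_map, List.getElem_range']
  congr 2; omega

theorem length_col (k : ℕ) (w : Equiv.Perm ℤ) : (col k w).length = k := by simp [col]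

theorem absIn_iff {x : ℤ} {C : List ℤ} {i : ℕ} : AbsIn x C i ↔
    ∃ q : ℕ, 1 ≤ q ∧ q ≤ i ∧ q ≤ C.length ∧ ((ent C q).natAbs : ℤ) = x := by
  unfold AbsIn
  rw [List.mem_map]
  simp only [List.mem_iff_getElem, List.length_take, List.getElem_take]
  constructor
  · rintro ⟨y, ⟨q, hq, rfl⟩, rfl⟩
    refine ⟨q + 1, by omega, by omega, by omega, ?_⟩
    unfold ent
    rw [Nat.add_sub_cancel, List.getD_eq_getElem _ _ (by omega)]
  · rintro ⟨q, h1, h2, h3, rfl⟩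
    refine ⟨_, ⟨q - 1, by omega, rfl⟩, ?_⟩
    unfold ent
    rw [List.getD_eq_getElem _ _ (by omega)]

theorem arc_pos_iff {n : ℕ} {b y : ℤ} (hb : IsLetter n b) (hy : IsLetter n y) :
    (0 < b → (Arc n (pos n b) (pos n y) ↔ (y.natAbs : ℤ) ≤ b)) ∧
    (b < 0 → (Arc n (pos n b) (pos n y) ↔ -b ≤ (y.natAbs : ℤ))) := by
  unfold IsLetter at hb hy
  unfold Arc CArc Bt pos
  constructor <;> intro h <;> split_ifs <;> omega

theorem card_filter_Icc_cast (j : ℕ) (P : ℤ → Prop) [DecidablePred P] :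
    ((Icc (1 : ℤ) j).filter P).card = ((Icc 1 j).filter (fun q : ℕ => P q)).card := by
  symm
  refine card_bij (fun q _ => (q : ℤ)) ?_ (fun a _ b _ h => by exact_mod_cast h) ?_
  · intro q hq
    simp only [mem_filter, mem_Icc] at hq ⊢
    exact ⟨by omega, hq.2⟩
  · intro q hq
    simp only [mem_filter, mem_Icc] at hq
    lift q to ℕ using (by omega)
    exact ⟨q, by simp only [mem_filter, mem_Icc]; exact ⟨by omega, hq.2⟩, rfl⟩

theorem absIn_col_iff {n k j : ℕ} {w : Equiv.Perm ℤ} (hw : SP n w) (hjk : j ≤ k)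
    {c : ℤ} (hc : 1 ≤ c ∧ c ≤ 2 * n) :
    (∀ x, IsLetter n x → Arc n c (pos n x) → AbsIn (x.natAbs : ℤ) (col k w) j) ↔
      ∀ q : ℤ, j < q → q ≤ n → ¬ Arc n c (vp n w q) := by
  constructor
  · intro h q hq1 hq2 ha
    have hq : IsLetter n q := ⟨by omega, by omega⟩
    obtain ⟨q', h1, h2, -, h3⟩ := absIn_iff.1 (h _ (hw.letter hq) ha)
    rw [ent_col h1 (by omega)] at h3
    have := hw.natAbs_inj (x := q') (y := q) (by omega)
    omega
  · intro h x hx ha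
    obtain ⟨q, hq, rfl⟩ := hw.symm_letter hx
    have key : q.natAbs ≤ j := by
      by_contra hq'
      have hq2 := hq.2
      rcases lt_or_gt_of_ne hq.1 with h0 | h0
      · refine h (-q) (by omega) (by omega) ?_
        rw [vp_neg hw hq, Arc.neg_iff]
        exact ha
      · exact h q (by omega) (by omega) ha
    rw [absIn_iff]
    have := hq.1
    refine ⟨q.natAbs, by omega, key, by rw [length_col]; omega, ?_⟩
    rw [ent_col (by omega) (by omega)]
    rcases Int.natAbs_eq q with e | e
    · rw [← e]
    · have : ((q.natAbs : ℕ) : ℤ) = -q := by omega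
      rw [this, hw.neg, Int.natAbs_neg]

theorem blockedOffD_iff {n k j : ℕ} {w : Equiv.Perm ℤ} {C : List ℤ} (hw : SP n w) (hj1 : 1 ≤ j)
    (hjk : j ≤ k) (hkn : k < n) (hC : j ≤ C.length)
    (hl : ∀ q, 1 ≤ q → q ≤ j → IsLetter n (ent C q)) :
    BlockedOffD n (col k w) C j ↔ Blk n w (fun q => ent C q.toNat) j := by
  have hb := hl j hj1 le_rfl
  have hjl : IsLetter n (j : ℤ) := ⟨by omega, by omega⟩
  have hwj := hw.letter hjl
  have hbl := hb
  have hwl := hwj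
  unfold IsLetter at hbl hwl
  obtain ⟨p1, p2⟩ := arc_pos_iff hb hwj
  have q1 := absIn_col_iff hw hjk (pos_bounds hb)
  have ne : vp n w j ≠ pos n (ent C j) ↔ w j ≠ ent C j :=
    ⟨fun h h' => h (by unfold vp; rw [h']), fun h h' => h (pos_inj hwj hb h')⟩
  have rows : (∀ x, IsLetter n x → Arc n (pos n (ent C j)) (pos n x) → AbsIn (x.natAbs : ℤ) C j) ↔
      ∀ x, IsLetter n x → Arc n (pos n (ent C j)) (pos n x) →
        ∃ q : ℤ, 1 ≤ q ∧ q ≤ j ∧ (ent C q.toNat = x ∨ ent C q.toNat = -x) := by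
    refine forall_congr' fun x => imp_congr_right fun hx => imp_congr_right fun _ => ?_
    rw [absIn_iff]
    constructor
    · rintro ⟨q, h1, h2, h3, h4⟩
      exact ⟨q, by omega, by omega, by rw [Int.toNat_natCast]; omega⟩
    · rintro ⟨q, h1, h2, h3⟩
      exact ⟨q.toNat, by omega, by omega, by omega, by omega⟩
  unfold BlockedOffD BlockedOff Blk
  change _ ↔ Arc n (pos n (ent C j)) (pos n (w j)) ∧ vp n w j ≠ pos n (ent C j) ∧
    (∀ q : ℤ, j < q → q ≤ n → ¬ Arc n (pos n (ent C j)) (vp n w q)) ∧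
    (∀ x, IsLetter n x → Arc n (pos n (ent C j)) (pos n x) →
      ∃ q : ℤ, 1 ≤ q ∧ q ≤ j ∧ (ent C q.toNat = x ∨ ent C q.toNat = -x)) ∧
    Odd ((Icc 1 (j : ℤ)).filter (fun q =>
      ¬ Sd n (pos n (ent C j)) (vp n w q) ∧ Sd n (pos n (ent C j)) (pos n (ent C q.toNat)))).card
  rw [ne, ← q1, ← rows, ent_col hj1 hjk]
  rcases lt_or_gt_of_ne hb.1 with h0 | h0
  · have cd : (Icc 1 j).filter (fun q => 0 < ent (col k w) q ∧ ent C q < 0) =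
        (Icc 1 j).filter (fun q : ℕ => ¬ Sd n (pos n (ent C j)) (vp n w q) ∧
          Sd n (pos n (ent C j)) (pos n (ent C (q : ℤ).toNat))) := by
      refine filter_congr fun q hq => ?_
      rw [mem_Icc] at hq
      have hq' : IsLetter n (q : ℤ) := ⟨by omega, by omega⟩
      unfold Sd vp
      rw [Int.toNat_natCast, pos_le_iff (hw.letter hq'), pos_le_iff (hl q hq.1 hq.2), pos_le_iff hb,
        ent_col hq.1 (by omega)]
      have := (hl q hq.1 hq.2).1
      omega
    rw [card_filter_Icc_cast, ← cd, p2 h0]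
    have all : (∀ x ∈ Icc ((ent C j).natAbs : ℤ) n, AbsIn x (col k w) j ∧ AbsIn x C j) ↔
        (∀ x, IsLetter n x → Arc n (pos n (ent C j)) (pos n x) →
          AbsIn (x.natAbs : ℤ) (col k w) j) ∧
        ∀ x, IsLetter n x → Arc n (pos n (ent C j)) (pos n x) → AbsIn (x.natAbs : ℤ) C j := by
      constructor
      · refine fun h => ⟨fun x hx ha => (h _ ?_).1, fun x hx ha => (h _ ?_).2⟩ <;>
        · rw [(arc_pos_iff hb hx).2 h0] at ha
          have := hx.2
          rw [mem_Icc]; omega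
      · rintro ⟨h1, h2⟩ x hx
        rw [mem_Icc] at hx
        have hxl : IsLetter n x := ⟨by omega, by omega⟩
        have ha := ((arc_pos_iff hb hxl).2 h0).2 (by omega)
        have := h1 x hxl ha
        have := h2 x hxl ha
        rw [show ((x.natAbs : ℕ) : ℤ) = x by omega] at *
        exact ⟨‹_›, ‹_›⟩
    rw [all]
    constructor
    · rintro (⟨h1, -⟩ | ⟨h1, h2, h3, h4, h5⟩)
      · omega
      · exact ⟨by omega, by omega, h4.1, h4.2, h5⟩
    · rintro ⟨h1, h2, h3, h4, h5⟩
      exact Or.inr ⟨by omega, h0, by omega, ⟨h3, h4⟩, h5⟩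
  · have cd : (Icc 1 j).filter (fun q => ent (col k w) q < 0 ∧ 0 < ent C q) =
        (Icc 1 j).filter (fun q : ℕ => ¬ Sd n (pos n (ent C j)) (vp n w q) ∧
          Sd n (pos n (ent C j)) (pos n (ent C (q : ℤ).toNat))) := by
      refine filter_congr fun q hq => ?_
      rw [mem_Icc] at hq
      have hq' : IsLetter n (q : ℤ) := ⟨by omega, by omega⟩
      have := (hw.letter hq').1
      unfold Sd vp
      rw [Int.toNat_natCast, pos_le_iff (hw.letter hq'), pos_le_iff (hl q hq.1 hq.2), pos_le_iff hb,
        ent_col hq.1 (by omega)]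
      omega
    rw [card_filter_Icc_cast, ← cd, p1 h0]
    have all : (∀ x ∈ Icc 1 (ent C j), AbsIn x (col k w) j ∧ AbsIn x C j) ↔
        (∀ x, IsLetter n x → Arc n (pos n (ent C j)) (pos n x) →
          AbsIn (x.natAbs : ℤ) (col k w) j) ∧
        ∀ x, IsLetter n x → Arc n (pos n (ent C j)) (pos n x) → AbsIn (x.natAbs : ℤ) C j := by
      constructor
      · refine fun h => ⟨fun x hx ha => (h _ ?_).1, fun x hx ha => (h _ ?_).2⟩ <;>
        · rw [(arc_pos_iff hb hx).1 h0] at ha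
          have := hx.1
          rw [mem_Icc]; omega
      · rintro ⟨h1, h2⟩ x hx
        rw [mem_Icc] at hx
        have hxl : IsLetter n x := ⟨by omega, by omega⟩
        have ha := ((arc_pos_iff hb hxl).1 h0).2 (by omega)
        have := h1 x hxl ha
        have := h2 x hxl ha
        rw [show ((x.natAbs : ℕ) : ℤ) = x by omega] at *
        exact ⟨‹_›, ‹_›⟩
    rw [all]
    constructor
    · rintro (⟨h1, h2, h3, h4, h5⟩ | ⟨h1, h2, -⟩)
      · exact ⟨by omega, by omega, h4.1, h4.2, h5⟩
      · omega
    · rintro ⟨h1, h2, h3, h4, h5⟩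
      refine Or.inl ⟨by omega, ?_, by omega, ⟨h3, h4⟩, h5⟩
      by_contra hbn
      have hn : IsLetter n (n : ℤ) := ⟨by omega, by omega⟩
      refine q1.1 h3 n (by omega) le_rfl (((arc_pos_iff hb (hw.letter hn)).1 h0).2 ?_)
      have := (hw.letter hn).2
      omega

theorem Blk.congr {n : ℕ} {w : Equiv.Perm ℤ} {v v' : ℤ → ℤ} {j : ℤ} (hj : 1 ≤ j)
    (h : ∀ q, 1 ≤ q → q ≤ j → v q = v' q) : Blk n w v j ↔ Blk n w v' j := by
  unfold Blk
  rw [h j hj le_rfl]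
  have : (Icc 1 j).filter (fun q =>
      ¬ Sd n (pos n (v' j)) (vp n w q) ∧ Sd n (pos n (v' j)) (pos n (v q))) =
    (Icc 1 j).filter (fun q =>
      ¬ Sd n (pos n (v' j)) (vp n w q) ∧ Sd n (pos n (v' j)) (pos n (v' q))) := by
    refine filter_congr fun q hq => ?_
    rw [mem_Icc] at hq
    rw [h q hq.1 hq.2]
  rw [this]
  have e : ∀ x, (∃ q, 1 ≤ q ∧ q ≤ j ∧ (v q = x ∨ v q = -x)) ↔
      ∃ q, 1 ≤ q ∧ q ≤ j ∧ (v' q = x ∨ v' q = -x) := fun x =>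
    exists_congr fun q => and_congr_right fun h1 => and_congr_right fun h2 => by rw [h q h1 h2]
  simp only [e]

theorem blockedOffD_col_iff {n k j : ℕ} {w u : Equiv.Perm ℤ} (hw : SP n w) (hu : SP n u)
    (hj1 : 1 ≤ j) (hjk : j ≤ k) (hkn : k < n) :
    BlockedOffD n (col k w) (col k u) j ↔ Blk n w u j := by
  rw [blockedOffD_iff hw hj1 hjk hkn (by rwa [length_col])]
  · refine Blk.congr (by omega) fun q h1 h2 => ?_
    rw [ent_col (by omega) (by omega)]
    congr 1; omega
  · intro q h1 h2
    rw [ent_col h1 (by omega)]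
    exact hu.letter ⟨by omega, by omega⟩

theorem circ_eq {n : ℕ} {a x : ℤ} (ha : IsLetter n a) (hx : IsLetter n x) :
    circ n a x = if pos n x < pos n a then pos n x - pos n a + 2 * n else pos n x - pos n a := by
  have h1 := pos_bounds ha
  have h2 := pos_bounds hx
  unfold circ
  split_ifs
  · rw [← Int.add_emod_right, Int.emod_eq_of_lt] <;> omega
  · rw [Int.emod_eq_of_lt] <;> omega

theorem circ_tk_iff {n : ℕ} {a x c : ℤ} (ha : IsLetter n a) (hx : IsLetter n x)
    (hc : IsLetter n c) : (0 < circ n a x ∧ circ n a x ≤ circ n a c) ↔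
      Tk (pos n a) (pos n x) (pos n c) := by
  have h1 := pos_bounds ha
  have h2 := pos_bounds hx
  have h3 := pos_bounds hc
  rw [circ_eq ha hx, circ_eq ha hc]
  unfold Tk Bt
  split_ifs <;> omega

theorem Tk.ne {a x c : ℤ} (h : Tk a x c) : a ≠ c := by
  unfold Tk Bt at h; omega

theorem tk_swap {a x c : ℤ} (h : ¬ Tk a x c) (hax : a ≠ x) : Tk x a c := by
  unfold Tk Bt at *; omega

theorem InRow.sublist {n k : ℕ} {i : ℤ} {T G : List (ℤ × ℤ)} (h : InRow n k i G)
    (hT : T.Sublist G) : InRow n k i T := fun β hβ => h β (hT.subset hβ)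

theorem Above.sublist {n k : ℕ} {i : ℤ} {T G : List (ℤ × ℤ)} (h : Above n k i G)
    (hT : T.Sublist G) : Above n k i T := fun β hβ => h β (hT.subset hβ)

theorem pathCol_row {n k : ℕ} {i : ℤ} {G G' : List (ℤ × ℤ)} (hi1 : 1 ≤ i) (hik : i ≤ k)
    (hkn : k < n) (hG : InRow n k i G) (hs : Srt n G) (hA : Above n k i G')
    (ih : ∀ w U, SP n w → U.Sublist G' → IsQPath n w U →
      pathCol n k (col k (endw w U)) w G' = U) :
    ∀ w T, SP n w → T.Sublist (G ++ G') → IsQPath n w T →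
      pathCol n k (col k (endw w T)) w (G ++ G') = T := by
  have hi : IsLetter n i := ⟨by omega, by omega⟩
  induction G with
  | nil => exact ih
  | cons β G ihG =>
    intro w T hw hT hp
    obtain ⟨⟨h0, hr⟩, hG'⟩ := InRow.cons_iff.1 hG
    obtain ⟨l, m⟩ := β
    dsimp only at h0 hr
    subst h0
    have hs' := hs
    unfold Srt at hs'
    rw [List.pairwise_cons] at hs'
    obtain ⟨hm, hs2⟩ := hs'
    dsimp only at hm
    have hml := hr.lab.2.1
    have ihG := ihG hG' hs2
    have eSP : ∀ T : List (ℤ × ℤ), T.Sublist ((l, m) :: G ++ G') → ∀ β ∈ T, Lab n β.1 β.2 := by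
      intro T hT β hβ
      rcases List.mem_append.1 (hT.subset hβ) with h | h
      · exact hG.lab β h
      · exact hA.lab β h
    have hu : SP n (endw w T) := hw.endw (eSP T hT)
    have eC : ent (col k (endw w T)) l.toNat = endw w T l := by
      rw [ent_col (by omega) (by omega)]
      congr 1; omega
    have hw' := hw.mul_refl hr.lab
    have eB : ∀ w', SP n w' →
        (BlockedOffD n (col k w') (col k (endw w T)) l.toNat ↔ Blk n w' (endw w T) l) := by
      intro w' hw'
      rw [blockedOffD_col_iff hw' hu (by omega) (by omega) hkn, Int.toNat_of_nonneg (by omega)]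
    rw [List.cons_append, pathCol]
    dsimp only
    have econd : (w l ≠ ent (col k (endw w T)) l.toNat ∧ (0 < circ n (w l) (w m) ∧
        circ n (w l) (w m) ≤ circ n (w l) (ent (col k (endw w T)) l.toNat)) ∧
        ¬ BlockedOffD n (col k (w * refl (l, m))) (col k (endw w T)) l.toNat) ↔
        w l ≠ endw w T l ∧ Tk (pos n (w l)) (pos n (w m)) (pos n (endw w T l)) ∧
          ¬ Blk n (w * refl (l, m)) (endw w T) l := by
      rw [eC, circ_tk_iff (hw.letter hi) (hw.letter hml) (hu.letter hi), eB _ hw']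
    rw [List.cons_append] at hT
    rcases List.sublist_cons_iff.1 hT with hT | ⟨T', rfl, hT'⟩
    · obtain ⟨T₁, U, rfl, hT1, hU⟩ := List.sublist_append_iff.1 hT
      have hA' := hA.sublist hU
      have hR := hG'.sublist hT1
      have hs3 : Srt n T₁ := hs2.sublist hT1
      have hm' : ∀ β ∈ T₁, pos n m < pos n β.2 := fun β hβ => hm β (hT1.subset hβ)
      rw [if_neg, if_neg]
      · exact ihG w _ hw hT hp
      · intro hcond
        obtain ⟨-, h2, h3⟩ := econd.1 hcond
        refine h3 (blk_of_skip hw hR hs3 hA' hp hi1 hik hkn hr hm' ?_)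
        unfold vp
        rw [← endw_row hA' hik]
        exact h2
      · rintro ⟨h1, h2⟩
        simp only [Prod.mk.injEq] at h1
        obtain ⟨rfl, rfl⟩ := h1
        have := (eB w hw).1 h2
        exact not_blk hw hR hs3 hA' hp hi1 hik hkn hm' this
    · obtain ⟨T₁, U, rfl, hT1, hU⟩ := List.sublist_append_iff.1 hT'
      have hA' := hA.sublist hU
      have hR := hG'.sublist hT1
      have hs3 : Srt n T₁ := hs2.sublist hT1
      have hm' : ∀ β ∈ T₁, pos n m < pos n β.2 := fun β hβ => hm β (hT1.subset hβ)
      have hp' := (hp.head hw hr).2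
      have e0 : endw w ((l, m) :: (T₁ ++ U)) = endw (w * refl (l, m)) (T₁ ++ U) := endw_cons _ _ _
      have er := endw_row (w := w * refl (l, m)) (T := T₁) hA' hik
      have hrec : pathCol n k (col k (endw w ((l, m) :: (T₁ ++ U)))) (w * refl (l, m)) (G ++ G') =
          T₁ ++ U := by
        rw [e0]; exact ihG _ _ hw' hT' hp'
      have hnb : ¬ Blk n (w * refl (l, m)) (endw w ((l, m) :: (T₁ ++ U))) l := by
        rw [e0]
        refine not_blk hw' hR hs3 hA' hp' hi1 hik hkn fun β hβ => ?_
        by_cases hml : m = l + 1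
        · rw [← hml]; exact hm' β hβ
        · exact (pos_succ_lt hr hml).trans (hm' β hβ)
      by_cases htk : Tk (pos n (w l)) (pos n (w m)) (pos n (endw w ((l, m) :: (T₁ ++ U)) l))
      · split_ifs with h1 h2
        · rw [hrec]
        · rw [hrec]
        · exact absurd (econd.2 ⟨fun h => htk.ne (by rw [h]), htk, hnb⟩) h2
      · have hml' : m = l + 1 := by
          by_contra hne
          refine htk ?_
          have hp1 : IsQPath n w ((l, m) :: T₁) :=
            (isQPath_append (T := (l, m) :: T₁) (U := U)).1 hp |>.1
          have := tk_of_isQPath hw hr hR (hs.sublist (hT1.cons_cons _)) hp1 hi1 hik hkn hne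
          rw [e0, er]
          rw [endw_cons] at this
          exact this
        have hlk : l = k := by
          unfold RowLab at hr; omega
        rw [if_pos, hrec]
        refine ⟨by rw [hml', hlk], ?_⟩
        have hb := blk_of_skip hw' hR hs3 hA' hp' hi1 hik hkn hr hm' (by
          rw [vp_fst hr.lab, vp_snd hr.lab]
          refine tk_swap ?_ (vp_ne hw hi hml hr.lab.2.2.1)
          rw [e0, er] at htk
          exact htk)
        rw [mul_refl_mul_refl hr.lab, ← e0] at hb
        have := (eB w hw).2 hb
        rwa [show l.toNat = k by omega] at this

/-- The rows `i, i - 1, …, 1`. -/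
def rowsDown (F : ℕ → List (ℤ × ℤ)) (i : ℕ) : List (ℤ × ℤ) := (List.range' 1 i).reverse.flatMap F

theorem rowsDown_succ (F : ℕ → List (ℤ × ℤ)) (i : ℕ) :
    rowsDown F (i + 1) = F (i + 1) ++ rowsDown F i := by
  unfold rowsDown
  rw [List.range'_concat, List.reverse_append, List.flatMap_append]
  simp [add_comm]

/-- A family of rows of labels as in the segments of the chain. -/
def Rows (n k : ℕ) (F : ℕ → List (ℤ × ℤ)) : Prop :=
  ∀ i : ℕ, 1 ≤ i → i ≤ k → InRow n k i (F i) ∧ Srt n (F i)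

theorem Rows.above {n k : ℕ} {F : ℕ → List (ℤ × ℤ)} (hF : Rows n k F) {i : ℕ} (hik : i ≤ k) :
    Above n k (i + 1) (rowsDown F i) := by
  intro β hβ
  unfold rowsDown at hβ
  simp only [List.mem_flatMap, List.mem_reverse, List.mem_range'_1] at hβ
  obtain ⟨j, hj, hβ⟩ := hβ
  obtain ⟨h1, h2⟩ := (hF j hj.1 (by omega)).1 β hβ
  rw [h1]
  exact ⟨h2, by omega⟩

theorem pathCol_rowsDown {n k : ℕ} {F : ℕ → List (ℤ × ℤ)} (hkn : k < n) (hF : Rows n k F)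
    (i : ℕ) (hik : i ≤ k) : ∀ w T, SP n w → T.Sublist (rowsDown F i) → IsQPath n w T →
      pathCol n k (col k (endw w T)) w (rowsDown F i) = T := by
  induction i with
  | zero =>
    intro w T _ hT _
    rw [show rowsDown F 0 = [] from rfl] at *
    rw [List.sublist_nil.1 hT]
    rfl
  | succ i ih =>
    rw [rowsDown_succ]
    obtain ⟨h1, h2⟩ := hF (i + 1) (by omega) hik
    refine pathCol_row (i := ((i + 1 : ℕ) : ℤ)) (by omega) (by omega) hkn h1 h2 ?_ (ih (by omega))
    exact_mod_cast hF.above (by omega)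

/-- The word `w` and the column with the rows of `u` above row `j` and the letter at position `y`
in row `j` are blocked off at `j`. -/
def BlkY (n : ℕ) (w u : Equiv.Perm ℤ) (y j : ℤ) : Prop :=
  Arc n y (vp n w j) ∧ vp n w j ≠ y ∧
  (∀ q, j < q → q ≤ n → ¬ Arc n y (vp n w q)) ∧
  (∀ q, j ≤ q → q ≤ n → Arc n y (vp n u q) → vp n u q = y ∨ vp n u q = 2 * n + 1 - y) ∧
  Odd (((Icc 1 (j - 1)).filter (fun q => ¬ Sd n y (vp n w q) ∧ Sd n y (vp n u q))).card +
    if Sd n y (vp n w j) then 0 else 1)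

theorem card_filter_Icc_top {j : ℤ} (hj : 1 ≤ j) (P : ℤ → Prop) [DecidablePred P] :
    ((Icc 1 j).filter P).card = ((Icc 1 (j - 1)).filter P).card + if P j then 1 else 0 := by
  have e : Icc 1 j = insert j (Icc 1 (j - 1)) := by ext x; simp only [mem_insert, mem_Icc]; omega
  rw [e, filter_insert]
  split_ifs
  · rw [card_insert_of_notMem (by simp)]
  · rfl

theorem blk_iff_blkY {n : ℕ} {w u : Equiv.Perm ℤ} {v : ℤ → ℤ} {j l : ℤ} (hu : SP n u)
    (hj : 1 ≤ j) (hjl : j ≤ l) (hln : l ≤ n) (h1 : ∀ q, 1 ≤ q → q < j → v q = u q)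
    (h2 : v j = u l) : Blk n w v j ↔ BlkY n w u (vp n u l) j := by
  have hl : IsLetter n l := ⟨by omega, by omega⟩
  have hjn : IsLetter n j := ⟨by omega, by omega⟩
  have e : pos n (v j) = vp n u l := by rw [h2]; rfl
  have card : ((Icc 1 j).filter (fun q =>
      ¬ Sd n (vp n u l) (vp n w q) ∧ Sd n (vp n u l) (pos n (v q)))).card =
    ((Icc 1 (j - 1)).filter (fun q => ¬ Sd n (vp n u l) (vp n w q) ∧
      Sd n (vp n u l) (vp n u q))).card + if Sd n (vp n u l) (vp n w j) then 0 else 1 := by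
    rw [card_filter_Icc_top hj]
    congr 1
    · congr 1
      refine filter_congr fun q hq => ?_
      rw [mem_Icc] at hq
      rw [h1 q hq.1 (by omega)]; rfl
    · rw [e]
      have : Sd n (vp n u l) (vp n u l) := Iff.rfl
      by_cases h : Sd n (vp n u l) (vp n w j)
      · rw [if_pos h, if_neg (fun hh => hh.1 h)]
      · rw [if_neg h, if_pos ⟨h, this⟩]
  have rows : (∀ x, IsLetter n x → Arc n (vp n u l) (pos n x) →
      ∃ q, 1 ≤ q ∧ q ≤ j ∧ (v q = x ∨ v q = -x)) ↔
      ∀ q, j ≤ q → q ≤ n → Arc n (vp n u l) (vp n u q) →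
        vp n u q = vp n u l ∨ vp n u q = 2 * n + 1 - vp n u l := by
    constructor
    · intro h q hq1 hq2 ha
      have hq : IsLetter n q := ⟨by omega, by omega⟩
      obtain ⟨q', h3, h4, h5⟩ := h (u q) (hu.letter hq) ha
      rcases lt_or_eq_of_le h4 with h4 | rfl
      · rw [h1 q' h3 h4] at h5
        have := hu.natAbs_inj (x := q') (y := q) (by omega)
        omega
      · rw [h2] at h5
        rcases h5 with h5 | h5
        · left; unfold vp; rw [h5]
        · right; unfold vp
          rw [h5, pos_neg (hu.letter hq)]; ring
    · intro h x hx ha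
      obtain ⟨q, hq, rfl⟩ := hu.symm_letter hx
      have key : ∃ q' : ℤ, 1 ≤ q' ∧ q' ≤ n ∧ (u q' = u q ∨ u q' = -u q) := by
        have := hq
        unfold IsLetter at this
        rcases lt_or_gt_of_ne hq.1 with h0 | h0
        · exact ⟨-q, by omega, by omega, Or.inr (hu.neg q)⟩
        · exact ⟨q, by omega, by omega, Or.inl rfl⟩
      obtain ⟨q', g1, g2, g3⟩ := key
      by_cases hq' : q' < j
      · exact ⟨q', g1, by omega, by rw [h1 q' g1 hq']; exact g3⟩
      · refine ⟨j, hj, le_rfl, ?_⟩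
        have hql : IsLetter n q' := ⟨by omega, by omega⟩
        have ha' : Arc n (vp n u l) (vp n u q') := by
          unfold vp
          rcases g3 with g3 | g3
          · rw [g3]; exact ha
          · rw [g3, pos_neg (hu.letter hq), Arc.neg_iff]
            exact ha
        rw [h2]
        rcases h q' (by omega) g2 ha' with g | g
        · have := vp_inj hu hql hl g
          rw [← this]; exact g3
        · rw [← vp_neg hu hl] at g
          have := vp_inj hu hql hl.neg g
          rw [this, hu.neg] at g3
          omega
  unfold Blk BlkY
  rw [e, rows, card]

/-- The number of rows with a letter of a self-negative set does not depend on the word. -/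
theorem card_rows_eq {n : ℕ} {w : Equiv.Perm ℤ} (hw : SP n w) {P : ℤ → Prop} [DecidablePred P]
    (hP : ∀ x, P (-x) ↔ P x) :
    ((Icc (1 : ℤ) n).filter (fun q => P (w q))).card = ((Icc (1 : ℤ) n).filter P).card := by
  have habs : ∀ x : ℤ, P (x.natAbs : ℤ) ↔ P x := by
    intro x
    rcases Int.natAbs_eq x with h | h
    · rw [← h]
    · rw [show ((x.natAbs : ℕ) : ℤ) = -x by omega]; exact hP x
  refine card_bij (fun q _ => ((w q).natAbs : ℤ)) ?_ ?_ ?_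
  · intro q hq
    simp only [mem_filter, mem_Icc] at hq ⊢
    have := hw.letter (x := q) ⟨by omega, by omega⟩
    unfold IsLetter at this
    exact ⟨by omega, (habs _).2 hq.2⟩
  · intro q hq q' hq' h
    simp only [mem_filter, mem_Icc] at hq hq'
    have := hw.natAbs_inj (x := q) (y := q') (by exact_mod_cast h)
    omega
  · intro x hx
    simp only [mem_filter, mem_Icc] at hx
    obtain ⟨q, hq, rfl⟩ := hw.symm_letter (y := x) ⟨by omega, by omega⟩
    have := hq
    unfold IsLetter at this
    rcases lt_or_gt_of_ne hq.1 with h0 | h0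
    · refine ⟨-q, ?_, by rw [hw.neg]; omega⟩
      simp only [mem_filter, mem_Icc]
      exact ⟨by omega, by rw [hw.neg, hP]; exact hx.2⟩
    · refine ⟨q, ?_, by omega⟩
      simp only [mem_filter, mem_Icc]
      exact ⟨by omega, hx.2⟩

theorem arc_of_cut' {n : ℕ} {y a b : ℤ} (h : Cut y a b) (ha : Arc n y a) : Arc n y b := by
  unfold Arc CArc Bt Cut at *; omega

theorem arc_rows {n : ℕ} {w u : Equiv.Perm ℤ} {y j l : ℤ} (hw : SP n w) (hu : SP n u)
    (hj : 1 ≤ j) (hjl : j ≤ l) (hln : l ≤ n) (hl : vp n u l = y)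
    (h2 : ∀ q, 1 ≤ q → q < j → Cut y (vp n w q) (vp n u q)) (hwj : Arc n y (vp n w j))
    (hout : ∀ q, j < q → q ≤ n → ¬ Arc n y (vp n w q)) :
    ∀ q, 1 ≤ q → q < j → Arc n y (vp n u q) → Arc n y (vp n w q) := by
  classical
  have hll : IsLetter n l := ⟨by omega, by omega⟩
  have hy : 1 ≤ y ∧ y ≤ 2 * n := by rw [← hl]; exact vp_bounds hu hll
  let P : ℤ → Prop := fun x => IsLetter n x ∧ Arc n y (pos n x)
  have hP : ∀ x, P (-x) ↔ P x := by
    intro x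
    have : IsLetter n x → (Arc n y (pos n (-x)) ↔ Arc n y (pos n x)) := fun hx => by
      rw [pos_neg hx, Arc.neg_iff]
    simp only [P, isLetter_neg_iff]
    exact and_congr_right this
  have hc : ((Icc (1 : ℤ) n).filter (fun q => P (w q))).card =
      ((Icc (1 : ℤ) n).filter (fun q => P (u q))).card := by
    rw [card_rows_eq hw hP, card_rows_eq hu hP]
  have hPw : ∀ {w : Equiv.Perm ℤ}, SP n w → ∀ q : ℤ, 1 ≤ q → q ≤ n → (P (w q) ↔ Arc n y (vp n w q)) :=
    fun hw q h1 h2 => ⟨fun h => h.2, fun h => ⟨hw.letter ⟨by omega, by omega⟩, h⟩⟩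
  have hA : (Icc (1 : ℤ) n).filter (fun q => P (w q)) =
      insert j ((Icc 1 (j - 1)).filter (fun q => P (w q))) := by
    ext q
    simp only [mem_insert, mem_filter, mem_Icc]
    constructor
    · rintro ⟨h3, h4⟩
      rcases lt_trichotomy q j with h5 | h5 | h5
      · exact Or.inr ⟨by omega, h4⟩
      · exact Or.inl h5
      · exact absurd h4.2 (hout q h5 h3.2)
    · rintro (rfl | ⟨h3, h4⟩)
      · exact ⟨by omega, (hPw hw _ (by omega) (by omega)).2 hwj⟩
      · exact ⟨by omega, h4⟩
  have hB : insert l ((Icc 1 (j - 1)).filter (fun q => P (u q))) ⊆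
      (Icc (1 : ℤ) n).filter (fun q => P (u q)) := by
    intro q
    simp only [mem_insert, mem_filter, mem_Icc]
    rintro (rfl | ⟨h3, h4⟩)
    · refine ⟨by omega, (hPw hu _ (by omega) (by omega)).2 ?_⟩
      rw [hl]; exact Or.inr (Or.inr rfl)
    · exact ⟨by omega, h4⟩
  have hB' := card_le_card hB
  rw [← hc, hA, card_insert_of_notMem (by simp only [mem_filter, mem_Icc]; omega),
    card_insert_of_notMem (by simp)] at hB'
  have hsub : (Icc 1 (j - 1)).filter (fun q => P (w q)) ⊆
      (Icc 1 (j - 1)).filter (fun q => P (u q)) := by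
    intro q
    simp only [mem_filter, mem_Icc]
    rintro ⟨h3, h4⟩
    refine ⟨h3, (hPw hu _ (by omega) (by omega)).2 (arc_of_cut' (h2 q h3.1 (by omega)) h4.2)⟩
  have heq := eq_of_subset_of_card_le hsub (by omega)
  intro q h3 h4 h5
  have : q ∈ (Icc 1 (j - 1)).filter (fun q => P (u q)) := by
    simp only [mem_filter, mem_Icc]
    exact ⟨by omega, (hPw hu _ (by omega) (by omega)).2 h5⟩
  rw [← heq] at this
  exact (mem_filter.1 this).2.2

theorem BlkY.of_mul_refl {n : ℕ} {w u : Equiv.Perm ℤ} {y j i m : ℤ} (hw : SP n w)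
    (hl : Lab n i m) (hy : 1 ≤ y ∧ y ≤ 2 * n) (hj : 1 ≤ j) (hji : j < i) (hjm : j < m.natAbs)
    (h : BlkY n (w * refl (i, m)) u y j) : BlkY n w u y j := by
  have e : ∀ q, 1 ≤ q → q ≤ j → vp n (w * refl (i, m)) q = vp n w q := fun q h1 h2 =>
    vp_of_ne (by omega) (by omega) (by omega) (by omega)
  obtain ⟨h1, h2, h3, h4, h5⟩ := h
  rw [e j hj le_rfl] at h1 h2 h5
  have hin := hl.1.2
  have hmn := hl.2.1.2
  have hm0 := hl.2.1.1
  refine ⟨h1, h2, ?_, h4, ?_⟩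
  · intro q hq1 hq2
    rcases refl_cases hl q with ⟨g, -⟩ | ⟨g, -⟩ | ⟨g, -⟩ | ⟨g, -⟩ | ⟨g1, g2, g3, g4, -⟩
    · subst g
      rcases lt_or_gt_of_ne hm0 with h0 | h0
      · have := h3 (-m) (by omega) (by omega)
        rwa [vp_neg_snd hw hl, Arc.neg_iff] at this
      · have := h3 m (by omega) (by omega)
        rwa [vp_snd hl] at this
    · subst g
      have := h3 i hji (by omega)
      rwa [vp_fst hl] at this
    · omega
    · subst g
      have := h3 i hji (by omega)
      rw [vp_fst hl] at this
      rwa [vp_neg hw hl.2.1, Arc.neg_iff]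
    · have := h3 q hq1 hq2
      rwa [vp_of_ne g1 g2 g3 g4] at this
  · have : (Icc 1 (j - 1)).filter (fun q => ¬ Sd n y (vp n (w * refl (i, m)) q) ∧ Sd n y (vp n u q)) =
        (Icc 1 (j - 1)).filter (fun q => ¬ Sd n y (vp n w q) ∧ Sd n y (vp n u q)) := by
      refine filter_congr fun q hq => ?_
      rw [mem_Icc] at hq
      rw [e q hq.1 (by omega)]
    rwa [this] at h5

theorem BlkY.mul_refl_iff {n : ℕ} {w u : Equiv.Perm ℤ} {y j i m : ℤ} (hw : SP n w)
    (hl : Lab n i m) (hy : 1 ≤ y ∧ y ≤ 2 * n) (hj : 1 ≤ j) (hji : j < i) (hjm : j < m.natAbs) :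
    BlkY n (w * refl (i, m)) u y j ↔ BlkY n w u y j := by
  refine ⟨BlkY.of_mul_refl hw hl hy hj hji hjm, fun h => ?_⟩
  refine BlkY.of_mul_refl (hw.mul_refl hl) hl hy hj hji hjm ?_
  rwa [mul_refl_mul_refl hl]

theorem reach_aux {n : ℕ} {y a c x p : ℤ} (ha : Arc n y a) (hx : ¬ Arc n y x)
    (h1 : Cut (2 * n + 1 - x) a c) (h2 : Cut c x y) (hp : ¬ Arc n y p)
    (h3 : Cut (2 * n + 1 - p) a c) : ¬ CArc (2 * n + 1 - c) p y := by
  unfold Arc CArc Bt Cut at *; omega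

theorem parity_aux {n : ℕ} {y a z x t : ℤ} (ha : ¬ Arc n y a) (hz : ¬ Arc n y z) (hx : Arc n y x)
    (h1 : Cut (2 * n + 1 - x) a z) (h2 : Cut y (2 * n + 1 - a) t)
    (h3 : Arc n y t → Arc n y (2 * n + 1 - a))
    (ht : Sd n y t) :
    Sd n y a ↔ Sd n y z := by
  unfold Sd Arc CArc Bt Cut at *; omega

theorem arc_aux {n : ℕ} {b a z x c : ℤ} (ha : ¬ Arc n b a) (hx : Arc n b x) (hc : ¬ Arc n b c)
    (h1 : Cut (2 * n + 1 - x) a z) (h2 : Cut (2 * n + 1 - x) z c) : ¬ Arc n b z := by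
  unfold Arc CArc Bt Cut at *; omega

theorem avoid_aux {n : ℕ} {b a z c p : ℤ} (hz : Arc n b z) (hc : ¬ Arc n b c)
    (h : Cut a z c) (hp : ¬ Arc n b p) (h1 : Cut (2 * n + 1 - p) a c) :
    ¬ CArc (2 * n + 1 - c) p b := by
  unfold Arc CArc Bt Cut at *; omega

theorem avoid_aux' {n : ℕ} {b a z c : ℤ} (ha : ¬ Arc n b a) (hz : Arc n b z) (hc : ¬ Arc n b c)
    (h : Cut a z c)  :
    ¬ CArc (2 * n + 1 - c) (2 * n + 1 - a) b := by
  unfold Arc CArc Bt Cut at *; omega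

theorem not_carc_of_cut {n : ℕ} {a c p : ℤ} (h1 : Cut (2 * n + 1 - p) a c) :
    ¬ CArc (2 * n + 1 - c) p (2 * n + 1 - a) := by
  unfold CArc Bt Cut at *; omega

theorem carc_of_not_cut {n : ℕ} {a c y z : ℤ} (h1 : ¬ Cut y (2 * n + 1 - z) (2 * n + 1 - a)) (h : Cut a z c) :
    CArc (2 * n + 1 - c) y (2 * n + 1 - a) := by
  unfold CArc Bt Cut at *; omega

theorem arc_self_aux {n : ℕ} {a c z : ℤ} (h1 : ¬ Cut c (2 * n + 1 - z) (2 * n + 1 - a)) (h : Cut a z c)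
   (n1 : z ≠ 2 * n + 1 - c) (n2 : c ≠ 2 * n + 1 - a) : Arc n c z ∧ ¬ Arc n c a := by
  unfold Arc CArc Bt Cut at *; omega

theorem arc_self_aux' {n : ℕ} {a c p z : ℤ} (h2 : ¬ Arc n c a) (h : Cut a z c)
   (h3 : Cut (2 * n + 1 - p) a c) : ¬ Arc n c p := by
  unfold Arc CArc Bt Cut at *; omega

theorem cut_neg {N y a b : ℤ} (h : Cut (N - y) a b) : Cut y (N - b) (N - a) := by
  unfold Cut at *; omega

/-- What is needed about a step with label `(i, -r)`, `r < i`, of a path that ends in `u`. -/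
structure InnerStep (n k : ℕ) (w u : Equiv.Perm ℤ) (i r : ℤ) : Prop where
  hw : SP n w
  hu : SP n u
  r1 : 1 ≤ r
  ri : r < i
  ik : i ≤ k
  kn : k < n
  e1 : ∀ p, r < p → p ≤ n → p ≠ i →
    Cut (2 * n + 1 - vp n w p) (vp n w i) (2 * n + 1 - vp n w r) ∧
    Cut (2 * n + 1 - vp n w p) (2 * n + 1 - vp n w r) (vp n u i)
  e1' : ∀ p, i < p → p ≤ n → Cut (vp n w p) (vp n w i) (vp n u i)
  e2 : Cut (vp n w i) (2 * n + 1 - vp n w r) (vp n u i)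
  ne : 2 * n + 1 - vp n w r ≠ 2 * n + 1 - vp n u i
  fix : ∀ p, i < p → p ≤ k → vp n u p = vp n w p
  cut : ∀ l, r ≤ l → l < i → Cut (vp n u i) (vp n (w * refl (i, -r)) l) (vp n u l)
  avoid : ∀ e t : ℤ, 1 ≤ e → e ≤ 2 * n → r ≤ t + 1 →
    (∀ q : ℤ, k < q → q ≤ n → ¬ CArc (2 * n + 1 - vp n u i) (vp n w q) e ∧
      ¬ CArc (2 * n + 1 - vp n u i) (2 * n + 1 - vp n w q) e) →
    (∀ l, t < l → l < i → ¬ CArc (2 * n + 1 - vp n u i) (vp n (w * refl (i, -r)) l) e) →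
    ∀ l, t < l → l < i → ¬ CArc (2 * n + 1 - vp n u i) (vp n u l) e
  top : Arc n (vp n u i) (2 * n + 1 - vp n w r) →
    (∀ q : ℤ, i < q → q ≤ n → ¬ Arc n (vp n u i) (vp n w q)) →
    ArcStable n (vp n u i) (w * refl (i, -r)) u i

/-- The two properties of a word `w` on a path to `u` that make the reorder algorithm find the
column of `u`. -/
def Reord (n k : ℕ) (w u : Equiv.Perm ℤ) (j : ℤ) : Prop :=
  (j < k → ¬ BlkY n w u (vp n u j) j) ∧
  ∀ l, j < l → l ≤ k → Cut (vp n u l) (vp n w j) (vp n u j) ∨ BlkY n w u (vp n u l) j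

namespace InnerStep
variable {n k : ℕ} {w u : Equiv.Perm ℤ} {i r : ℤ}

theorem lab (h : InnerStep n k w u i r) : Lab n i (-r) := by
  have := h.r1; have := h.ri; have := h.ik; have := h.kn
  unfold Lab IsLetter; omega

theorem letter (h : InnerStep n k w u i r) {p : ℤ} (h1 : 1 ≤ p) (h2 : p ≤ k) : IsLetter n p := by
  have := h.kn
  unfold IsLetter; omega

theorem fst (h : InnerStep n k w u i r) :
    vp n (w * QAlcoveD.refl (i, -r)) i = 2 * n + 1 - vp n w r := by
  rw [vp_fst h.lab, vp_neg h.hw (h.letter h.r1 (by have := h.ri; have := h.ik; omega))]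

theorem snd (h : InnerStep n k w u i r) :
    vp n (w * QAlcoveD.refl (i, -r)) r = 2 * n + 1 - vp n w i := by
  have := vp_neg_snd h.hw h.lab
  rwa [neg_neg] at this

theorem other (h : InnerStep n k w u i r) {p : ℤ} (h1 : 1 ≤ p) (h2 : p ≠ i) (h3 : p ≠ r) :
    vp n (w * QAlcoveD.refl (i, -r)) p = vp n w p := by
  have := h.r1; have := h.ri
  exact vp_of_ne h2 (by omega) (by omega) (by omega)

theorem hw' (h : InnerStep n k w u i r) : SP n (w * QAlcoveD.refl (i, -r)) := h.hw.mul_refl h.lab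

theorem not_arc (h : InnerStep n k w u i r) {j l : ℤ} (hrj : r ≤ j) (hjl : j < l) (hli : l < i)
    (hq : ∀ q, j < q → q ≤ n → q ≠ i → ¬ Arc n (vp n u l) (vp n w q)) :
    ¬ Arc n (vp n u l) (vp n w i) := by
  intro ha
  have g1 := h.r1; have g2 := h.ri; have g3 := h.ik; have g4 := h.kn
  have hl : IsLetter n l := h.letter (by omega) (by omega)
  have hyb := vp_bounds h.hu hl
  have hwl := hq l hjl (by omega) (by omega)
  have c1 : ∀ p, r < p → p ≤ n → p ≠ i → Cut (2 * n + 1 - vp n w p) (vp n w i) (vp n u i) :=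
    fun p h1 h2 h3 => (h.e1 p h1 h2 h3).1.trans (h.e1 p h1 h2 h3).2
  have c2 := h.cut l (by omega) hli
  rw [h.other (by omega) (by omega) (by omega)] at c2
  have key : ∀ p, j < p → p ≤ n → p ≠ i → ¬ CArc (2 * n + 1 - vp n u i) (vp n w p) (vp n u l) :=
    fun p h1 h2 h3 => reach_aux ha hwl (c1 l (by omega) (by omega) (by omega)) c2 (hq p h1 h2 h3)
      (c1 p (by omega) h2 h3)
  refine h.avoid (vp n u l) j hyb.1 hyb.2 (by omega) (fun q h1 h2 => ⟨key q (by omega) h2 (by omega), ?_⟩)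
    (fun p h1 h2 => ?_) l hjl hli (Or.inr (Or.inr rfl))
  · refine reach_aux ha hwl (c1 l (by omega) (by omega) (by omega)) c2 ?_ ?_
    · rw [Arc.neg_iff]
      exact hq q (by omega) h2 (by omega)
    · rw [sub_sub_cancel]; exact h.e1' q (by omega) h2
  · rw [h.other (by omega) (by omega) (by omega)]
    exact key p h1 (by omega) (by omega)

theorem blkY_iff (h : InnerStep n k w u i r) {y j : ℤ} (hrj : r < j) (hji : j < i)
    (ha : ¬ Arc n y (vp n w i)) (hz : ¬ Arc n y (2 * n + 1 - vp n w r))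
    (hs : Sd n y (vp n u r) → (Sd n y (vp n w i) ↔ Sd n y (2 * n + 1 - vp n w r))) :
    BlkY n (w * QAlcoveD.refl (i, -r)) u y j ↔ BlkY n w u y j := by
  have g1 := h.r1; have g2 := h.ri; have g3 := h.ik; have g4 := h.kn
  unfold BlkY
  rw [h.other (p := j) (by omega) (by omega) (by omega)]
  have e1 : (∀ q, j < q → q ≤ n → ¬ Arc n y (vp n (w * QAlcoveD.refl (i, -r)) q)) ↔
      ∀ q, j < q → q ≤ n → ¬ Arc n y (vp n w q) := by
    refine forall_congr' fun q => imp_congr_right fun h1 => imp_congr_right fun h2 => not_congr ?_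
    by_cases hq : q = i
    · subst hq; rw [h.fst]; exact iff_of_false hz ha
    · rw [h.other (by omega) hq (by omega)]
  have e2 : (Icc 1 (j - 1)).filter (fun q =>
      ¬ Sd n y (vp n (w * QAlcoveD.refl (i, -r)) q) ∧ Sd n y (vp n u q)) =
      (Icc 1 (j - 1)).filter (fun q => ¬ Sd n y (vp n w q) ∧ Sd n y (vp n u q)) := by
    refine filter_congr fun q hq => ?_
    rw [mem_Icc] at hq
    by_cases hqr : q = r
    · subst hqr
      rw [h.snd, Sd.neg_iff]
      refine and_congr_left fun h' => ?_
      rw [hs h', Sd.neg_iff, not_not]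
    · rw [h.other (by omega) (by omega) hqr]
  rw [e1, e2]

/-- The rows between `r` and `i`. -/
theorem blkY_iff' (h : InnerStep n k w u i r) {y j l : ℤ} (hrj : r < j) (hji : j < i)
    (hjl : j ≤ l) (hlk : l ≤ k) (hl : vp n u l = y)
    (hR : ∀ q, 1 ≤ q → q < j → Cut y (vp n (w * QAlcoveD.refl (i, -r)) q) (vp n u q))
    (hwj : Arc n y (vp n w j))
    (hout : ∀ q, j < q → q ≤ n → ¬ Arc n y (vp n (w * QAlcoveD.refl (i, -r)) q))
    (ha : ¬ Arc n y (vp n w i)) :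
    BlkY n (w * QAlcoveD.refl (i, -r)) u y j ↔ BlkY n w u y j := by
  have g1 := h.r1; have g2 := h.ri; have g3 := h.ik; have g4 := h.kn
  have hz := hout i hji (by omega)
  rw [h.fst] at hz
  refine h.blkY_iff hrj hji ha hz fun hs => ?_
  have hr := arc_rows h.hw' h.hu (by omega) hjl (by omega) hl hR
    (by rwa [h.other (by omega) (by omega) (by omega)]) hout r (by omega) hrj
  have hc := hR r (by omega) hrj
  rw [h.snd] at hr hc
  exact parity_aux ha hz hwj (h.e1 j hrj (by omega) (by omega)).1 hc hr hs

theorem reord_mid (h : InnerStep n k w u i r)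
    (hR : ∀ j, 1 ≤ j → j < i → Reord n k (w * QAlcoveD.refl (i, -r)) u j) {j : ℤ}
    (hrj : r < j) (hji : j < i) : Reord n k w u j := by
  have g1 := h.r1; have g2 := h.ri; have g3 := h.ik; have g4 := h.kn
  obtain ⟨r1, r2⟩ := hR j (by omega) hji
  have ej := h.other (p := j) (by omega) (by omega) (by omega)
  constructor
  · intro hjk hB
    refine r1 hjk ?_
    obtain ⟨b1, b2, b3, b4, b5⟩ := id hB
    have ha := b3 i hji (by omega)
    have hc : ¬ Arc n (vp n u j) (vp n u i) := by
      intro hc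
      rcases b4 i (by omega) (by omega) hc with e | e
      · exact vp_ne h.hu (h.letter (by omega) (by omega)) (h.letter (by omega) (by omega)) (by omega) e
      · exact vp_ne_neg h.hu (h.letter (by omega) (by omega)) (h.letter (by omega) (by omega)) (by omega) e
    obtain ⟨e1, e2⟩ := h.e1 j hrj (by omega) (by omega)
    have hz := arc_aux ha b1 hc e1 e2
    have hout : ∀ q, j < q → q ≤ n → ¬ Arc n (vp n u j) (vp n (w * QAlcoveD.refl (i, -r)) q) := by
      intro q h1 h2
      by_cases hq : q = i
      · subst hq; rwa [h.fst]
      · rw [h.other (by omega) hq (by omega)]; exact b3 q h1 h2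
    refine (h.blkY_iff' hrj hji le_rfl (by omega) rfl ?_ b1 hout ha).2 hB
    intro q h1 h2
    rcases (hR q h1 (by omega)).2 j h2 (by omega) with h3 | h3
    · exact h3
    · exact absurd (by rwa [ej]) (h3.2.2.1 j h2 (by omega))
  · intro l hjl hlk
    rw [← ej]
    rcases r2 l hjl hlk with h3 | hB
    · exact Or.inl h3
    obtain ⟨b1, b2, b3, b4, b5⟩ := id hB
    rcases lt_trichotomy l i with hli | hli | hli
    · right
      rw [ej] at b1
      have hnq : ∀ q, j < q → q ≤ n → q ≠ i → ¬ Arc n (vp n u l) (vp n w q) := by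
        intro q h1 h2 h3
        have := b3 q h1 h2
        rwa [h.other (by omega) h3 (by omega)] at this
      have ha := h.not_arc (by omega) hjl hli hnq
      refine (h.blkY_iff' hrj hji hjl.le hlk rfl ?_ b1 b3 ha).1 hB
      intro q h1 h2
      rcases (hR q h1 (by omega)).2 l (by omega) (by omega) with h3 | h3
      · exact h3
      · exact absurd (by rwa [ej]) (h3.2.2.1 j h2 (by omega))
    · subst hli
      exact Or.inl (h.cut j (by omega) hji)
    · refine absurd ?_ (b3 l hjl (by omega))
      rw [h.other (by omega) (by omega) (by omega), ← h.fix l hli hlk]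
      exact Or.inr (Or.inr rfl)

theorem reord_self (h : InnerStep n k w u i r)
    (hR : Reord n k (w * QAlcoveD.refl (i, -r)) u r) : Reord n k w u r := by
  have g1 := h.r1; have g2 := h.ri; have g3 := h.ik; have g4 := h.kn
  have hr : IsLetter n r := h.letter (by omega) (by omega)
  have hi : IsLetter n i := h.letter (by omega) (by omega)
  have c1 : ∀ p, r < p → p ≤ n → p ≠ i → Cut (2 * n + 1 - vp n w p) (vp n w i) (vp n u i) :=
    fun p h1 h2 h3 => (h.e1 p h1 h2 h3).1.trans (h.e1 p h1 h2 h3).2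
  obtain ⟨r1, r2⟩ := hR
  constructor
  · rintro - ⟨b1, b2, b3, b4, b5⟩
    have bb := vp_bounds h.hu hr
    have ha := b3 i (by omega) (by omega)
    have hc : ¬ Arc n (vp n u r) (vp n u i) := by
      intro hc
      rcases b4 i (by omega) (by omega) hc with e | e
      · exact vp_ne h.hu hi hr (by omega) e
      · exact vp_ne_neg h.hu hi hr (by omega) e
    have hz : Arc n (vp n u r) (2 * n + 1 - vp n w r) := by rwa [Arc.neg_iff]
    refine h.avoid (vp n u r) (r - 1) bb.1 bb.2 (by omega) (fun q h1 h2 => ⟨?_, ?_⟩)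
      (fun p h1 h2 => ?_) r (by omega) h.ri (Or.inr (Or.inr rfl))
    · exact avoid_aux hz hc h.e2 (b3 q (by omega) h2) (c1 q (by omega) h2 (by omega))
    · refine avoid_aux hz hc h.e2 ?_ (by rw [sub_sub_cancel]; exact h.e1' q (by omega) h2)
      rw [Arc.neg_iff]
      exact b3 q (by omega) h2
    · by_cases hp : p = r
      · subst hp
        rw [h.snd]
        exact avoid_aux' ha hz hc h.e2
      · rw [h.other (by omega) (by omega) hp]
        exact avoid_aux hz hc h.e2 (b3 p (by omega) (by omega)) (c1 p (by omega) (by omega) (by omega))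
  · intro l hrl hlk
    have hl : IsLetter n l := h.letter (by omega) (by omega)
    have r2l := r2 l hrl hlk
    rw [h.snd] at r2l
    by_cases hcut : Cut (vp n u l) (vp n w r) (2 * n + 1 - vp n w i)
    · rcases r2l with h3 | ⟨b1, b2, b3, b4, b5⟩
      · exact Or.inl (hcut.trans h3)
      · rcases lt_trichotomy l i with hli | hli | hli
        · exfalso
          rw [h.snd, Arc.neg_iff] at b1
          refine h.not_arc le_rfl hrl hli (fun q h1 h2 h3 => ?_) b1
          have := b3 q h1 h2
          rwa [h.other (by omega) h3 (by omega)] at this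
        · subst hli
          have := h.cut r le_rfl h.ri
          rw [h.snd] at this
          exact Or.inl (hcut.trans this)
        · refine absurd ?_ (b3 l (by omega) (by omega))
          rw [h.other (by omega) (by omega) (by omega), ← h.fix l hli hlk]
          exact Or.inr (Or.inr rfl)
    · rcases lt_trichotomy l i with hli | hli | hli
      · exfalso
        have ba := vp_bounds h.hw hi
        refine h.avoid (2 * n + 1 - vp n w i) r (by omega) (by omega) (by omega)
          (fun q h1 h2 => ⟨?_, ?_⟩) (fun p h1 h2 => ?_) l hrl hli ?_
        · exact not_carc_of_cut (c1 q (by omega) h2 (by omega))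
        · exact not_carc_of_cut (by rw [sub_sub_cancel]; exact h.e1' q (by omega) h2)
        · rw [h.other (by omega) (by omega) (by omega)]
          exact not_carc_of_cut (c1 p (by omega) (by omega) (by omega))
        · refine carc_of_not_cut (z := 2 * n + 1 - vp n w r) ?_ h.e2
          rwa [sub_sub_cancel]
      · subst hli
        right
        have n1 : vp n u l ≠ 2 * n + 1 - vp n w l := by
          have := h.cut r le_rfl h.ri
          rw [h.snd] at this
          unfold Cut at this; omega
        obtain ⟨f1, f2⟩ := arc_self_aux (z := 2 * n + 1 - vp n w r)
          (by rwa [sub_sub_cancel]) h.e2 h.ne n1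
        have f3 : ∀ q, r < q → q ≤ n → q ≠ l → ¬ Arc n (vp n u l) (vp n w q) :=
          fun q h1 h2 h3 => arc_self_aux' f2 h.e2 (c1 q h1 h2 h3)
        have st := h.top f1 fun q h1 h2 => f3 q (by omega) h2 (by omega)
        refine ⟨by rwa [← Arc.neg_iff], fun hh => h.ne (by rw [hh]), ?_, ?_, ?_⟩
        · intro q h1 h2
          by_cases hq : q = l
          · rw [hq]; exact f2
          · exact f3 q h1 h2 hq
        · intro q h1 h2 hq
          rcases lt_trichotomy q l with hql | hql | hql
          · exfalso
            have := (st.arc q (by omega) (by omega)).2 hq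
            by_cases hqr : q = r
            · subst hqr
              rw [h.snd, Arc.neg_iff] at this
              exact f2 this
            · rw [h.other (by omega) (by omega) hqr] at this
              exact f3 q (by omega) h2 (by omega) this
          · left; rw [hql]
          · exact absurd hq (st.out q hql h2)
        · have ev := st.even
          unfold cross at ev
          have e3 : (Icc 1 (l - 1)).filter (fun j =>
              ¬ Sd n (vp n u l) (vp n (w * QAlcoveD.refl (l, -r)) j) ∧ Sd n (vp n u l) (vp n u j)) =
            (Icc 1 (r - 1)).filter (fun j =>
              ¬ Sd n (vp n u l) (vp n w j) ∧ Sd n (vp n u l) (vp n u j)) := by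
            ext q
            simp only [mem_filter, mem_Icc]
            constructor
            · rintro ⟨h1, h2, h3⟩
              have hqr : q < r := by
                by_contra hqr
                refine st.opp q (by omega) (by omega) ?_ h2 h3
                by_cases hqr : q = r
                · subst hqr
                  rw [h.snd, Arc.neg_iff]
                  exact f2
                · rw [h.other (by omega) (by omega) hqr]
                  exact f3 q (by omega) (by omega) (by omega)
              rw [h.other (by omega) (by omega) (by omega)] at h2
              exact ⟨by omega, h2, h3⟩
            · rintro ⟨h1, h2, h3⟩
              rw [h.other (by omega) (by omega) (by omega)]
              exact ⟨by omega, h2, h3⟩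
          have hcc : Sd n (vp n u l) (vp n u l) := Iff.rfl
          rw [card_filter_Icc_top (by omega), e3, h.fst] at ev
          by_cases hs : Sd n (vp n u l) (vp n w r)
          · rw [if_pos ⟨fun h => Sd.neg_iff.1 h hs, hcc⟩] at ev
            rw [if_pos hs]
            rw [Nat.even_iff] at ev; rw [Nat.odd_iff]; omega
          · rw [if_neg (fun h => h.1 (Sd.neg_iff.2 hs))] at ev
            rw [if_neg hs]
            exact ev.add_one
      · exfalso
        have := (h.e1 l (by omega) (by omega) (by omega)).1
        rw [← h.fix l hli hlk] at this
        refine hcut ?_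
        have := cut_neg this
        rwa [sub_sub_cancel] at this

end InnerStep

theorem RowLab.neg_of_inner {n k : ℕ} {i r m : ℤ} (h1 : 1 ≤ r) (hr : RowLab n k i (-r)) (hri : r < i)
    (hm : RowLab n k i m) (h : pos n (-r) < pos n m) : m < 0 ∧ -m < r := by
  have h2 := hr.lab.2.1
  unfold RowLab at *
  rw [pos_of_neg (by omega)] at h
  unfold pos at h; split_ifs at h <;> omega

theorem innerStep {n k : ℕ} {i r : ℤ} {T U : List (ℤ × ℤ)} {w : Equiv.Perm ℤ} (hw : SP n w)
    (hi1 : 1 ≤ i) (hik : i ≤ k) (hkn : k < n) (hr1 : 1 ≤ r) (hri : r < i)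
    (hm : RowLab n k i (-r)) (hT : InRow n k i T) (hs : Srt n ((i, -r) :: T)) (hU : Above n k i U)
    (hUs : U.Pairwise (fun β γ => γ.1 ≤ β.1)) (hp : IsQPath n w ((i, -r) :: T ++ U)) :
    InnerStep n k w (endw w ((i, -r) :: T ++ U)) i r := by
  have hi : IsLetter n i := ⟨by omega, by omega⟩
  have hrl : IsLetter n r := ⟨by omega, by omega⟩
  rw [List.cons_append] at hp ⊢
  obtain ⟨hj, hp'⟩ := hp.head hw hm
  have hw' := hw.mul_refl hm.lab
  unfold Srt at hs
  rw [List.pairwise_cons] at hs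
  obtain ⟨h1, hs⟩ := hs
  have hin : ∀ β ∈ T, β.2 < 0 ∧ -β.2 < r ∧ 1 ≤ -β.2 := fun β hβ => by
    have := hm.neg_of_inner hr1 hri (hT β hβ).2 (h1 β hβ)
    omega
  rw [endw_cons]
  have er : endw (w * refl (i, -r)) (T ++ U) i = endw (w * refl (i, -r)) T i := endw_row hU hik
  have hv := hw'.endw hT.lab
  have hu : SP n (endw (w * refl (i, -r)) (T ++ U)) := by rw [endw_append]; exact hv.endw hU.lab
  rw [isQPath_append] at hp'
  obtain ⟨hpT, hpU⟩ := hp'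
  have evi : vp n (endw (w * refl (i, -r)) (T ++ U)) i = vp n (endw (w * refl (i, -r)) T) i := by
    unfold vp; rw [er]
  have ewi : vp n (w * refl (i, -r)) i = 2 * n + 1 - vp n w r := by
    rw [vp_fst hm.lab, vp_neg hw hrl]
  have epr : pos n (-r) = 2 * n + 1 - r := by rw [pos_neg hrl, pos_of_pos (by omega)]
  have epi : pos n i = i := pos_of_pos (by omega)
  have hTT : ∀ q : ℤ, IsLetter n q → pos n q ≤ pos n (-r) → i < pos n q → q ≠ r → q ≠ -r →
      (∀ β ∈ T, pos n q < pos n β.2 ∧ q ≠ -β.2) := by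
    intro q hq h2 h3 h4 h5 β hβ
    refine ⟨lt_of_le_of_lt h2 (h1 β hβ), ?_⟩
    intro hh
    have := hin β hβ
    rw [pos_of_pos (by omega)] at h3
    omega
  have hmid : ∀ p : ℤ, 1 ≤ p → p ≤ k → p ≠ i → r ≤ p →
      endw (w * refl (i, -r)) T p = (w * refl (i, -r)) p := by
    intro p g1 g2 g3 g4
    refine endw_of_ne fun β hβ => ?_
    have := hin β hβ
    have := (hT β hβ).1
    omega
  have hout : ∀ q : ℤ, i < q → q ≤ n → endw (w * refl (i, -r)) T q = w q := by
    intro q g1 g2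
    rw [endw_of_ne, mul_refl_of_ne (by omega) (by omega) (by omega) (by omega)]
    intro β hβ
    have := hin β hβ
    have := (hT β hβ).1
    omega
  -- a letter that is jumped over
  have hst : ∀ q : ℤ, IsLetter n q → pos n q < pos n (-r) → i < pos n q → q ≠ r → q ≠ -i →
      Cut (vp n w q) (vp n w i) (2 * n + 1 - vp n w r) ∧
      Cut (vp n w q) (2 * n + 1 - vp n w r)
        (vp n (endw (w * refl (i, -r)) (T ++ U)) i) := by
    intro q hq h2 h3 h4 h5
    have hqi : q ≠ i := by rintro rfl; omega
    have hqr : q ≠ -r := by rintro rfl; exact lt_irrefl _ h2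
    have a1 := hj q hq (by omega) h2 h5 (by omega)
    have a2 := (stuck hw' hT hpT hi hq (by omega) h5 (hTT q hq h2.le h3 h4 hqr)).2
    rw [vp_of_ne hqi hqr h5 (by omega), ewi] at a2
    rw [evi]
    refine ⟨?_, a2⟩
    rw [← vp_neg hw hrl]
    exact cut_of_not_bt a1 (vp_ne hw hq hi hqi) (vp_ne hw hq hrl.neg hqr)
  constructor
  · exact hw
  · exact hu
  · exact hr1
  · exact hri
  · exact hik
  · exact hkn
  · intro p g1 g2 g3
    have hp : IsLetter n p := ⟨by omega, by omega⟩
    have epp : pos n (-p) = 2 * n + 1 - p := by rw [pos_neg hp, pos_of_pos (by omega)]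
    rw [← vp_neg hw hp]
    exact hst (-p) hp.neg (by omega) (by omega) (by omega) (by omega)
  · intro p g1 g2
    have hp : IsLetter n p := ⟨by omega, by omega⟩
    have epp : pos n p = p := pos_of_pos (by omega)
    obtain ⟨a1, a2⟩ := hst p hp (by omega) (by omega) (by omega) (by omega)
    exact a1.trans a2
  · have a2 := (stuck hw' hT hpT hi hrl.neg (by omega) (by omega) fun β hβ => ⟨h1 β hβ, by
      have := hin β hβ; omega⟩).2
    rwa [vp_snd hm.lab, ewi, ← evi] at a2
  · have a4 := unreachable hw' hT hi hi.neg (by omega) (fun β hβ => by have := hin β hβ; omega)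
      (List.Pairwise.imp_of_mem (fun {a b} ha hb _ => by
        have := hin a ha; have := hin b hb; omega) hs)
    rw [vp_neg hw' hi, ewi, ← evi] at a4
    have := vp_bounds hu hi
    omega
  · intro p g1 g2
    unfold vp
    rw [endw_append, above_fix hU (by omega) (by omega), hout p g1 (by omega)]
  · intro l g1 g2
    have := above_cut hv hU hpU hik hkn (j := l) (by omega) g2
    rw [← evi, ← endw_append] at this
    unfold vp at this ⊢
    rwa [hmid l (by omega) (by omega) (by omega) g1] at this
  · intro e t g1 g2 g3 g4 g5 l g6 g7
    have := above_avoid (r := t) hv hU hpU hUs hi1 hik hkn ⟨g1, g2⟩ evi.symm ?_ ?_ l g6 (by omega) g7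
    · rwa [← endw_append] at this
    · intro q q1 q2
      unfold vp at g4 ⊢
      rw [hout q (by omega) q2]
      exact g4 q q1 q2
    · intro p p1 p2 p3
      unfold vp at g5 ⊢
      rw [hmid p (by omega) (by omega) (by omega) (by omega)]
      exact g5 p p1 p3
  · intro g1 g2
    have := arcStable_row hw' hT hU (isQPath_append.2 ⟨hpT, hpU⟩) hi1 hik hkn rfl (q₀ := i + 1)
      (by omega) (by omega) (fun β hβ => ⟨?_, ?_⟩) (by rw [← evi, ewi]; exact g1) ?_
    · rwa [← evi] at this
    · refine lt_trans ?_ (h1 β hβ)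
      rw [epr, pos_of_pos (by omega)]
      omega
    · have := hin β hβ; omega
    · intro q h2 h3
      rw [vp_of_ne (by omega) (by omega) (by omega) (by omega), ← evi]
      exact g2 q h2 h3

theorem reord_of_eq {n k : ℕ} {w u : Equiv.Perm ℤ} {j : ℤ} (hw : SP n w) (hj : 1 ≤ j) (hjk : j ≤ k)
    (hkn : k < n) (h : ∀ q : ℤ, j ≤ q → q ≤ k → u q = w q) : Reord n k w u j := by
  have e : ∀ q, j ≤ q → q ≤ k → vp n u q = vp n w q := fun q h1 h2 => by unfold vp; rw [h q h1 h2]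
  refine ⟨fun hjk hB => hB.2.1 (e j le_rfl hjk.le).symm, fun l h1 h2 => Or.inl ?_⟩
  rw [e l h1.le h2, e j le_rfl hjk]
  exact Cut.refl (vp_ne hw ⟨by omega, by omega⟩ ⟨by omega, by omega⟩ (by omega))

theorem reord_row {n k : ℕ} {i : ℤ} {T U : List (ℤ × ℤ)} {w : Equiv.Perm ℤ} (hw : SP n w)
    (hi1 : 1 ≤ i) (hik : i ≤ k) (hkn : k < n) (hT : InRow n k i T) (hs : Srt n T)
    (hU : Above n k i U) (hUs : U.Pairwise (fun β γ => γ.1 ≤ β.1)) (hp : IsQPath n w (T ++ U))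
    (hR : ∀ j : ℤ, 1 ≤ j → j ≤ k → Reord n k (endw w T) (endw w (T ++ U)) j) :
    ∀ j : ℤ, 1 ≤ j → j ≤ k → Reord n k w (endw w (T ++ U)) j := by
  have hi : IsLetter n i := ⟨by omega, by omega⟩
  induction T generalizing w with
  | nil => simpa using hR
  | cons β T ih =>
    obtain ⟨⟨h0, hl⟩, hT'⟩ := InRow.cons_iff.1 hT
    obtain ⟨l, m⟩ := β
    dsimp only at h0 hl
    subst h0
    have hw' := hw.mul_refl hl.lab
    have hp0 := hp
    rw [List.cons_append] at hp
    obtain ⟨hjm, hp'⟩ := hp.head hw hl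
    have hs' := hs
    unfold Srt at hs'
    rw [List.pairwise_cons] at hs'
    obtain ⟨h1, hs'⟩ := hs'
    have eu : endw w ((l, m) :: T ++ U) = endw (w * refl (l, m)) (T ++ U) := by
      rw [List.cons_append, endw_cons]
    have IH := ih hw' hT' hs' hp' (by rw [← eu]; rw [endw_cons] at hR; exact hR)
    rw [← eu] at IH
    have hTU : ∀ β ∈ (l, m) :: T ++ U, Lab n β.1 β.2 := fun β hβ => by
      rcases List.mem_append.1 hβ with h | h
      · exact hT.lab β h
      · exact hU.lab β h
    have hu := hw.endw hTU
    have hfix : ∀ q : ℤ, l < q → q ≤ k → endw w ((l, m) :: T ++ U) q = w q := by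
      intro q g1 g2
      refine endw_of_ne fun β hβ => ?_
      rcases List.mem_append.1 hβ with h | h
      · have := hT β h
        unfold RowLab at this
        omega
      · have := hU β h
        unfold RowLab at this
        omega
    intro j hj1 hjk
    have hj : IsLetter n j := ⟨by omega, by omega⟩
    rcases lt_trichotomy j l with hjl | hjl | hjl
    · by_cases hjm' : j < m.natAbs
      · obtain ⟨r1, r2⟩ := IH j hj1 hjk
        have e : vp n (w * refl (l, m)) j = vp n w j :=
          vp_of_ne (by omega) (by omega) (by omega) (by omega)
        refine ⟨fun h hB => r1 h ?_, fun p g1 g2 => ?_⟩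
        · exact (BlkY.mul_refl_iff hw hl.lab (vp_bounds hu hj) hj1 hjl hjm').2 hB
        · rw [← e]
          exact (r2 p g1 g2).imp_right
            (BlkY.mul_refl_iff hw hl.lab (vp_bounds hu ⟨by omega, by omega⟩) hj1 hjl hjm').1
      · obtain ⟨r, rfl⟩ : ∃ r, m = -r := ⟨-m, by omega⟩
        have hl' := hl
        unfold RowLab at hl'
        have hS := innerStep hw hi1 hik hkn (by omega) (by omega) hl hT' hs hU hUs hp0
        by_cases hjr : j = r
        · subst hjr
          exact hS.reord_self (IH j hj1 hjk)
        · exact hS.reord_mid (fun q g1 g2 => IH q g1 (by omega)) (by omega) hjl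
    · subst hjl
      have er : endw w ((j, m) :: T ++ U) j = endw w ((j, m) :: T) j := endw_row hU hik
      refine ⟨fun hjk' hB => ?_, fun p g1 g2 => Or.inl ?_⟩
      · refine not_blk hw hT hs hU hp0 hi1 hik hkn (fun β hβ => ?_)
          ((blk_iff_blkY hu hj1 le_rfl (by omega) (fun _ _ _ => rfl) rfl).2 hB)
        refine pos_succ_lt (hT β hβ).2 ?_
        have := (hT β hβ).2
        unfold RowLab at this
        omega
      · have hpl : IsLetter n p := ⟨by omega, by omega⟩
        have hpp : pos n p = p := pos_of_pos (by omega)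
        have hpj : pos n j = j := pos_of_pos (by omega)
        have := (stuck hw hT (isQPath_append.1 hp0).1 hi hpl (by omega) (by omega) fun β hβ => ?_).2
        · unfold vp at this ⊢
          rwa [hfix p g1 g2, er]
        · have hβ' := (hT β hβ).2
          unfold RowLab at hβ'
          rw [hpp]
          refine ⟨?_, by omega⟩
          unfold pos; split_ifs <;> omega
    · refine reord_of_eq hw hj1 hjk hkn fun q g1 g2 => hfix q (by omega) g2

theorem Above.pairwise_rowsDown {n k : ℕ} {F : ℕ → List (ℤ × ℤ)} (hF : Rows n k F) (i : ℕ)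
    (hik : i ≤ k) : (rowsDown F i).Pairwise (fun β γ => γ.1 ≤ β.1) := by
  induction i with
  | zero => exact List.Pairwise.nil
  | succ i ih =>
    rw [rowsDown_succ, List.pairwise_append]
    have h1 := (hF (i + 1) (by omega) hik).1
    refine ⟨List.pairwise_of_forall_mem_list fun a ha b hb => ?_, ih (by omega), fun a ha b hb => ?_⟩
    · rw [(h1 a ha).1, (h1 b hb).1]
    · have := (hF.above (i := i) (by omega) b hb).2
      rw [(h1 a ha).1]; push_cast; omega

/-- The word at the beginning of a path through a segment satisfies the conditions under which
the reorder algorithm finds the column at its end. -/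
theorem reord_rowsDown {n k : ℕ} {F : ℕ → List (ℤ × ℤ)} (hkn : k < n) (hF : Rows n k F)
    (i : ℕ) (hik : i ≤ k) : ∀ w T, SP n w → T.Sublist (rowsDown F i) → IsQPath n w T →
      ∀ j : ℤ, 1 ≤ j → j ≤ k → Reord n k w (endw w T) j := by
  induction i with
  | zero =>
    intro w T hw hT _ j h1 h2
    rw [show rowsDown F 0 = [] from rfl] at *
    rw [List.sublist_nil.1 hT]
    exact reord_of_eq hw h1 h2 hkn fun _ _ _ => by simp
  | succ i ih =>
    intro w T hw hT hp
    rw [rowsDown_succ] at hT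
    obtain ⟨T₁, U, rfl, hT1, hU⟩ := List.sublist_append_iff.1 hT
    obtain ⟨h1, h2⟩ := hF (i + 1) (by omega) hik
    have hA := (hF.above (i := i) (by omega)).sublist hU
    have hp' := isQPath_append.1 hp
    have h1' := h1.sublist hT1
    refine reord_row (i := ((i + 1 : ℕ) : ℤ)) hw (by omega) (by omega) hkn h1' (h2.sublist hT1)
      (by exact_mod_cast hA) ((Above.pairwise_rowsDown hF i (by omega)).sublist hU) hp ?_
    rw [endw_append]
    exact ih (by omega) _ U (hw.endw h1'.lab) hU hp'.2

theorem circ_lt_of_cut {n : ℕ} {a x y : ℤ} (ha : IsLetter n a) (hx : IsLetter n x)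
    (hy : IsLetter n y) (h : Cut (pos n y) (pos n a) (pos n x)) : circ n a x < circ n a y := by
  rw [circ_eq ha hx, circ_eq ha hy]
  have b1 := pos_bounds ha
  have b2 := pos_bounds hx
  have b3 := pos_bounds hy
  unfold Cut at h
  split_ifs <;> omega

theorem ent_append_singleton (u : Equiv.Perm ℤ) (j : ℕ) (x : ℤ) {q : ℕ} (h1 : 1 ≤ q)
    (h2 : q ≤ j + 1) : ent (col j u ++ [x]) q = if q ≤ j then u q else x := by
  unfold ent
  split_ifs with h
  · rw [List.getD_append _ _ _ _ (by rw [length_col]; omega)]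
    exact ent_col h1 h
  · have : q = j + 1 := by omega
    subst this
    rw [List.getD_append_right _ _ _ _ (by rw [length_col]; omega), length_col]
    simp

theorem col_succ (u : Equiv.Perm ℤ) (j : ℕ) : col (j + 1) u = col j u ++ [u ((j + 1 : ℕ) : ℤ)] := by
  unfold col
  rw [List.range'_concat]
  simp [add_comm]

theorem reorderLoop_eq {n k k₀ : ℕ} {w u : Equiv.Perm ℤ} (hw : SP n w) (hu : SP n u)
    (hk : k ≤ k₀) (hkn : k₀ < n) (h : ∀ j : ℤ, 1 ≤ j → j ≤ k → Reord n k w u j) :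
    ∀ (s j : ℕ) (b : List ℤ), j + s = k →
      b.Perm ((List.range' (j + 1) s).map (fun (i : ℕ) => u (i : ℤ))) →
      reorderLoop n k (col k₀ w) s (col j u) b = col k u := by
  intro s
  induction s with
  | zero => intro j b hj _; rw [reorderLoop, ← hj]; rfl
  | succ s ih =>
    intro j b hj hb
    have hmem : ∀ x, x ∈ b ↔ ∃ l : ℕ, j + 1 ≤ l ∧ l ≤ k ∧ u l = x := by
      intro x
      rw [hb.mem_iff]
      simp only [List.mem_map, List.mem_range'_1]
      constructor
      · rintro ⟨l, h1, rfl⟩; exact ⟨l, by omega, by omega, rfl⟩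
      · rintro ⟨l, h1, h2, rfl⟩; exact ⟨l, by omega, rfl⟩
    have hjl : IsLetter n ((j + 1 : ℕ) : ℤ) := ⟨by omega, by omega⟩
    have hblk : ∀ l : ℕ, j + 1 ≤ l → l ≤ k →
        (BlockedOffD n (col k₀ w) (col j u ++ [u l]) (j + 1) ↔
          BlkY n w u (vp n u l) ((j + 1 : ℕ) : ℤ)) := by
      intro l h1 h2
      rw [blockedOffD_iff hw (by omega) (by omega) hkn (by simp [length_col])]
      · refine blk_iff_blkY hu (by omega) (by omega) (by omega) ?_ ?_
        · intro q h3 h4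
          rw [ent_append_singleton u j _ (by omega) (by omega), if_pos (by omega)]
          congr 1; omega
        · rw [ent_append_singleton u j _ (by omega) (by omega), if_neg (by omega)]
      · intro q h3 h4
        rw [ent_append_singleton u j _ h3 h4]
        split_ifs
        · exact hu.letter ⟨by omega, by omega⟩
        · exact hu.letter ⟨by omega, by omega⟩
    obtain ⟨r1, r2⟩ := h ((j + 1 : ℕ) : ℤ) (by omega) (by omega)
    have hx0 : u ((j + 1 : ℕ) : ℤ) ∈ b.filter (fun x => (col j u).length + 1 < k →
        ¬ BlockedOffD n (col k₀ w) (col j u ++ [x]) ((col j u).length + 1)) := by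
      rw [List.mem_filter, decide_eq_true_eq, length_col]
      refine ⟨(hmem _).2 ⟨j + 1, le_rfl, by omega, rfl⟩, fun hlt hB => ?_⟩
      exact r1 (by omega) ((hblk (j + 1) le_rfl (by omega)).1 hB)
    have hmin : (b.filter (fun x => (col j u).length + 1 < k →
        ¬ BlockedOffD n (col k₀ w) (col j u ++ [x]) ((col j u).length + 1))).argmin
          (circ n (ent (col k₀ w) ((col j u).length + 1))) = some (u ((j + 1 : ℕ) : ℤ)) := by
      rcases hm : (b.filter (fun x => (col j u).length + 1 < k →
        ¬ BlockedOffD n (col k₀ w) (col j u ++ [x]) ((col j u).length + 1))).argmin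
          (circ n (ent (col k₀ w) ((col j u).length + 1))) with _ | m
      · rw [List.argmin_eq_none] at hm
        rw [hm] at hx0
        simp at hx0
      · have h1 := List.argmin_mem hm
        have h2 := List.le_of_mem_argmin hx0 hm
        rw [List.mem_filter, decide_eq_true_eq, length_col] at h1
        obtain ⟨l, h3, h4, rfl⟩ := (hmem _).1 h1.1
        by_cases hl : l = j + 1
        · rw [hl]
        · exfalso
          have hlt : j + 1 < k := by omega
          have hnb := h1.2 hlt
          rw [hblk l h3 h4] at hnb
          rcases r2 l (by omega) (by omega) with hc | hc
          · have := circ_lt_of_cut (hw.letter hjl) (hu.letter hjl)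
              (hu.letter (x := l) ⟨by omega, by omega⟩) hc
            rw [length_col, ent_col (by omega) (by omega)] at h2
            omega
          · exact hnb hc
    rw [reorderLoop]
    rw [hmin]
    simp only [← col_succ]
    refine ih (j + 1) _ (by omega) ?_
    have : (List.range' (j + 1) (s + 1)).map (fun (i : ℕ) => u (i : ℤ)) =
        u ((j + 1 : ℕ) : ℤ) :: (List.range' (j + 1 + 1) s).map (fun (i : ℕ) => u (i : ℤ)) := by
      rw [List.range'_succ]; rfl
    rw [this] at hb
    have := hb.erase (u ((j + 1 : ℕ) : ℤ))
    rwa [List.erase_cons_head] at this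

theorem sortCol_perm (n : ℕ) (C : List ℤ) : (sortCol n C).Perm C :=
  List.perm_insertionSort _ _

theorem reorderCol_eq {n k k₀ : ℕ} {w u : Equiv.Perm ℤ} (hw : SP n w) (hu : SP n u)
    (hk : k ≤ k₀) (hkn : k₀ < n) (h : ∀ j : ℤ, 1 ≤ j → j ≤ k → Reord n k w u j) :
    reorderCol n (col k₀ w) (sortCol n (col k u)) = col k u := by
  have hp := sortCol_perm n (col k u)
  have hl : (sortCol n (col k u)).length = k := by rw [hp.length_eq, length_col]
  unfold reorderCol
  rw [hl]
  exact reorderLoop_eq hw hu hk hkn h k 0 _ (by omega) hp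

theorem not_blkY_one {n k : ℕ} {u : Equiv.Perm ℤ} {y j : ℤ}
    (hj : 1 ≤ j) (hjk : j ≤ k) (hkn : k < n) : ¬ BlkY n 1 u y j := by
  rintro ⟨h1, -, h3, -, h5⟩
  have e : ∀ q : ℤ, 1 ≤ q → q ≤ n → vp n 1 q = q := fun q hq _ => (pos_of_pos (x := q) (by omega) : pos n q = q)
  have h4 := h3 n (by omega) le_rfl
  rw [e n (by omega) le_rfl] at h4
  rw [e j hj (by omega)] at h1 h5
  have hyn : y ≤ n := by
    by_contra hyn
    refine h4 ?_
    unfold Arc CArc Bt; omega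
  have hs : ∀ q : ℤ, 1 ≤ q → q ≤ n → Sd n y q := fun q _ hq => by unfold Sd; omega
  rw [if_pos (hs j hj (by omega)), filter_eq_empty_iff.2] at h5
  · simp at h5
  · intro q hq
    rw [mem_Icc] at hq
    rw [e q hq.1 (by omega)]
    exact fun h => h.1 (hs q hq.1 (by omega))

theorem sortCol_eq_of_pairwise {n : ℕ} {C : List ℤ}
    (h : C.Pairwise (fun a b => pos n a ≤ pos n b)) : sortCol n C = C :=
  List.Pairwise.insertionSort_eq h

/-- The first column is increasing. -/
theorem col_pairwise_of_reord_one {n k : ℕ} {u : Equiv.Perm ℤ} (hu : SP n u) (hkn : k < n)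
    (h : ∀ j : ℤ, 1 ≤ j → j ≤ k → Reord n k 1 u j) :
    (col k u).Pairwise (fun a b => pos n a < pos n b) := by
  have hc : ∀ j l : ℕ, 1 ≤ j → j < l → l ≤ k → Cut (vp n u l) j (vp n u j) := by
    intro j l h1 h2 h3
    have e : vp n 1 (j : ℤ) = j := pos_of_pos (x := (j : ℤ)) (by omega)
    rcases (h j (by omega) (by omega)).2 l (by omega) (by omega) with h4 | h4
    · rwa [e] at h4
    · exact absurd h4 (not_blkY_one (k := k) (by omega) (by omega) hkn)
  have hge : ∀ j : ℕ, 1 ≤ j → j ≤ k → ∀ q : ℕ, j ≤ q → q ≤ k → (j : ℤ) ≤ vp n u q := by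
    intro j hj
    induction j, hj using Nat.le_induction with
    | base =>
      intro _ q h1 h2
      have := (vp_bounds hu (x := (q : ℤ)) ⟨by omega, by omega⟩).1
      exact_mod_cast this
    | succ j hj ih =>
      intro h1 q h2 h3
      have g1 := ih (by omega) q (by omega) h3
      have g2 := ih (by omega) j le_rfl (by omega)
      have := hc j q hj (by omega) h3
      unfold Cut at this; push_cast; omega
  unfold col
  rw [List.pairwise_map]
  refine List.Pairwise.imp_of_mem ?_ (List.pairwise_lt_range' (s := 1) (n := k))
  intro a b ha hb hab
  rw [List.mem_range'_1] at ha hb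
  have g1 := hge a (by omega) (by omega) b (by omega) (by omega)
  have g2 := hge a (by omega) (by omega) a le_rfl (by omega)
  have := hc a b (by omega) hab (by omega)
  unfold Cut at this
  unfold vp at *
  omega

/-- A segment of the chain with its height. -/
def Seg (n k : ℕ) (G : List (ℤ × ℤ)) : Prop :=
  1 ≤ k ∧ k < n ∧ ∃ F, Rows n k F ∧ G = rowsDown F k

theorem Seg.lab {n k : ℕ} {G T : List (ℤ × ℤ)} (h : Seg n k G) (hT : T.Sublist G) :
    ∀ β ∈ T, Lab n β.1 β.2 := by
  obtain ⟨-, hk, F, hF, rfl⟩ := h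
  intro β hβ
  have := (hF.above le_rfl β (hT.subset hβ)).1
  exact this.lab

theorem Seg.reord {n k : ℕ} {G T : List (ℤ × ℤ)} {w : Equiv.Perm ℤ} (h : Seg n k G)
    (hT : T.Sublist G) (hw : SP n w) (hp : IsQPath n w T) :
    ∀ j : ℤ, 1 ≤ j → j ≤ k → Reord n k w (endw w T) j := by
  obtain ⟨-, hk, F, hF, rfl⟩ := h
  exact reord_rowsDown hk hF k le_rfl w T hw hT hp

theorem Seg.pathCol {n k : ℕ} {G T : List (ℤ × ℤ)} {w : Equiv.Perm ℤ} (h : Seg n k G)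
    (hT : T.Sublist G) (hw : SP n w) (hp : IsQPath n w T) :
    pathCol n k (col k (endw w T)) w G = T := by
  obtain ⟨-, hk, F, hF, rfl⟩ := h
  exact pathCol_rowsDown hk hF k le_rfl w T hw hT hp

theorem pathFrom_fillFrom {n : ℕ} {ks : List ℕ} {Gs Ts : List (List (ℤ × ℤ))}
    (hG : List.Forall₂ (Seg n) ks Gs) (hT : List.Forall₂ List.Sublist Ts Gs) {w : Equiv.Perm ℤ}
    (hw : SP n w) (hp : IsQPath n w Ts.flatten) : pathFrom n w Gs (fillFrom w ks Ts) = Ts := by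
  induction hG generalizing Ts w with
  | nil => cases hT; rfl
  | cons h1 h2 ih =>
    cases hT with
    | cons h3 h4 =>
      rw [List.flatten_cons, isQPath_append] at hp
      rw [fillFrom, pathFrom]
      rw [length_col]
      have e := h1.pathCol h3 hw hp.1
      unfold endw at e
      rw [e]
      congr 1
      exact ih h4 (hw.endw (h1.lab h3)) hp.2

theorem ordFrom_fillFrom {n : ℕ} {ks : List ℕ} {Gs Ts : List (List (ℤ × ℤ))}
    (hG : List.Forall₂ (Seg n) ks Gs) (hT : List.Forall₂ List.Sublist Ts Gs) {w : Equiv.Perm ℤ}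
    (hw : SP n w) (hp : IsQPath n w Ts.flatten) {k₀ : ℕ} (hk : (k₀ :: ks).Pairwise (fun a b => b ≤ a))
    (hk₀ : k₀ < n) :
    ordFrom n (col k₀ w) ((fillFrom w ks Ts).map (sortCol n)) = fillFrom w ks Ts := by
  induction hG generalizing Ts w k₀ with
  | nil => cases hT; rfl
  | cons h1 h2 ih =>
    cases hT with
    | cons h3 h4 =>
      rw [List.flatten_cons, isQPath_append] at hp
      rw [List.pairwise_cons] at hk
      rw [fillFrom, List.map_cons, ordFrom]
      have hu := hw.endw (h1.lab h3)
      have e := reorderCol_eq hw hu (hk.1 _ (List.mem_cons_self ..)) hk₀ (h1.reord h3 hw hp.1)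
      unfold endw at e
      rw [e]
      congr 1
      exact ih h4 hu hp.2 hk.2 h1.2.1

theorem ordD_sfill {n : ℕ} {ks : List ℕ} {Gs Ts : List (List (ℤ × ℤ))}
    (hG : List.Forall₂ (Seg n) ks Gs) (hT : List.Forall₂ List.Sublist Ts Gs)
    (hp : IsQPath n 1 Ts.flatten) (hk : ks.Pairwise (fun a b => b ≤ a)) :
    ordD n ((fillFrom 1 ks Ts).map (sortCol n)) = fillFrom 1 ks Ts := by
  cases hG with
  | nil => cases hT; rfl
  | cons h1 h2 =>
    cases hT with
    | cons h3 h4 =>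
      rw [List.flatten_cons, isQPath_append] at hp
      rw [fillFrom, List.map_cons, ordD]
      have hw := SP.one n
      have hu := hw.endw (h1.lab h3)
      have e := sortCol_eq_of_pairwise ((col_pairwise_of_reord_one hu h1.2.1
        (h1.reord h3 hw hp.1)).imp le_of_lt)
      unfold endw at e
      rw [e]
      congr 1
      exact ordFrom_fillFrom h2 h4 hu hp.2 hk h1.2.1

theorem mem_descend_iff {a b : ℕ} {x : ℤ} : x ∈ descend a b ↔ (a : ℤ) ≤ x ∧ x ≤ b := by
  refine ⟨mem_descend, fun h => ?_⟩
  unfold descend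
  simp only [List.mem_map, List.mem_reverse, List.mem_range'_1]
  exact ⟨x.toNat, by omega, by omega⟩

theorem descend_pairwise (a b : ℕ) : (descend a b).Pairwise (fun x y => y < x) := by
  unfold descend
  rw [List.pairwise_map, List.pairwise_reverse]
  exact (List.pairwise_lt_range' (s := a) (n := b + 1 - a)).imp fun h => by exact_mod_cast h

theorem rows_chainKI {n k : ℕ} (hkn : k < n) : Rows n k (chainKI n k) := by
  intro i h1 h2
  constructor
  · intro β hβ
    unfold chainKI at hβ
    simp only [List.mem_append, List.mem_map, List.mem_reverse, mem_descend_iff] at hβ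
    unfold RowLab
    rcases hβ with (⟨x, hx, rfl⟩ | ⟨x, hx, rfl⟩) | ⟨x, hx, rfl⟩ <;> dsimp only <;>
      refine ⟨rfl, ?_⟩ <;> omega
  · unfold Srt chainKI
    simp only [List.pairwise_append, List.pairwise_map, List.pairwise_reverse, List.mem_append,
      List.mem_map, List.mem_reverse, mem_descend_iff]
    refine ⟨⟨?_, ?_, ?_⟩, ?_, ?_⟩
    · refine (descend_pairwise (k + 1) n).imp_of_mem fun {a b} ha hb hab => ?_
      rw [mem_descend_iff] at ha hb
      rw [pos_of_pos (by omega), pos_of_pos (by omega)]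
      exact hab
    · refine (descend_pairwise (k + 1) n).imp_of_mem fun {a b} ha hb hab => ?_
      rw [mem_descend_iff] at ha hb
      rw [pos_of_neg (by omega), pos_of_neg (by omega)]
      omega
    · rintro _ ⟨x, hx, rfl⟩ _ ⟨y, hy, rfl⟩
      dsimp only
      rw [pos_of_pos (by omega), pos_of_neg (by omega)]
      omega
    · refine (descend_pairwise 1 (i - 1)).imp_of_mem fun {a b} ha hb hab => ?_
      rw [mem_descend_iff] at ha hb
      rw [pos_of_neg (by omega), pos_of_neg (by omega)]
      omega
    · rintro _ (⟨x, hx, rfl⟩ | ⟨x, hx, rfl⟩) _ ⟨y, hy, rfl⟩ <;> dsimp only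
      · rw [pos_of_pos (by omega), pos_of_neg (by omega)]
        omega
      · rw [pos_of_neg (by omega), pos_of_neg (by omega)]
        omega

/-- The rows of the right segments. -/
def rowR (i : ℕ) : List (ℤ × ℤ) := (descend 1 (i - 1)).map (fun j => ((i : ℤ), -j))

theorem rows_rowR {n k : ℕ} (hkn : k < n) : Rows n k rowR := by
  intro i h1 h2
  obtain ⟨h3, h4⟩ := rows_chainKI hkn i h1 h2
  have : (rowR i).Sublist (chainKI n k i) := List.sublist_append_right _ _
  exact ⟨h3.sublist this, List.Pairwise.sublist this h4⟩

theorem chainR_eq {k : ℕ} (hk : 1 ≤ k) : chainR k = rowsDown rowR k := by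
  obtain ⟨k, rfl⟩ : ∃ k', k = k' + 1 := ⟨k - 1, by omega⟩
  unfold rowsDown chainR
  rw [List.range'_succ, List.reverse_cons, List.flatMap_append]
  have : List.flatMap rowR [1] = [] := rfl
  rw [this, List.append_nil]
  rfl

theorem forall₂_seg {n : ℕ} {p : List ℕ} (hpn : ∀ k ∈ p, 1 ≤ k ∧ k < n) :
    List.Forall₂ (Seg n) (dbl p) (chain n p) := by
  induction p with
  | nil => exact List.Forall₂.nil
  | cons k p ih =>
    obtain ⟨h1, h2⟩ := hpn k (List.mem_cons_self ..)
    unfold dbl chain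
    rw [List.flatMap_cons, List.flatMap_cons]
    refine List.Forall₂.cons ⟨h1, h2, _, rows_chainKI h2, rfl⟩
      (List.Forall₂.cons ⟨h1, h2, _, rows_rowR h2, chainR_eq h1⟩ ?_)
    exact ih fun k' hk' => hpn k' (List.mem_cons_of_mem _ hk')

theorem pairwise_dbl {p : List ℕ} (hp : p.Pairwise (fun k k' => k' ≤ k)) :
    (dbl p).Pairwise (fun a b => b ≤ a) := by
  unfold dbl
  rw [List.pairwise_flatMap]
  refine ⟨by simp, hp.imp fun h => ?_⟩
  simpa using h

/-- The path algorithm and the reorder algorithm recover an admissible subset from its sorted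
filling. -/
theorem pathD_ordD_sfillD {n : ℕ} {p : List ℕ} (hp : p.Pairwise (fun k k' => k' ≤ k))
    (hpn : ∀ k ∈ p, 1 ≤ k ∧ k < n) {T : List (List (ℤ × ℤ))} (hT : T ∈ Admissible n p) :
    pathD n p (ordD n (sfillD n p T)) = T := by
  unfold pathD sfillD fillD
  rw [ordD_sfill (forall₂_seg hpn) hT.1 hT.2 (pairwise_dbl hp)]
  exact pathFrom_fillFrom (forall₂_seg hpn) hT.1 (SP.one n) hT.2

/-! ### Exchange of adjacent reflections in a rank two subsystem -/

/-- The condition of `Jump` on positions and values, for the three letters of a triple. -/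
def JumpAt (a b l : ℤ) (A B L : ℤ) : Prop := a < l → l < b → ¬ Bt A L B

theorem Jump.at {n : ℕ} {w : Equiv.Perm ℤ} {i m : ℤ} (h : Jump n w i m) {l : ℤ}
    (hl : IsLetter n l) (h1 : l ≠ -i) (h2 : l ≠ -m) :
    JumpAt (pos n i) (pos n m) (pos n l) (vp n w i) (vp n w m) (vp n w l) :=
  fun h3 h4 => h l hl h3 h4 h1 h2

/-- Three letters with different absolute values, in increasing order. -/
structure Triple (n : ℕ) (p q r : ℤ) : Prop where
  hp : IsLetter n p
  hq : IsLetter n q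
  hr : IsLetter n r
  pq : pos n p < pos n q
  qr : pos n q < pos n r
  pq' : p ≠ -q
  pr' : p ≠ -r
  qr' : q ≠ -r

theorem Triple.ne {n : ℕ} {p q r : ℤ} (t : Triple n p q r) : p ≠ q ∧ p ≠ r ∧ q ≠ r := by
  have := t.pq; have := t.qr
  refine ⟨?_, ?_, ?_⟩ <;> rintro rfl <;> omega

theorem Triple.lab_pq {n : ℕ} {p q r : ℤ} (t : Triple n p q r) : Lab n p q :=
  ⟨t.hp, t.hq, t.ne.1, t.pq'⟩
theorem Triple.lab_pr {n : ℕ} {p q r : ℤ} (t : Triple n p q r) : Lab n p r :=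
  ⟨t.hp, t.hr, t.ne.2.1, t.pr'⟩
theorem Triple.lab_qr {n : ℕ} {p q r : ℤ} (t : Triple n p q r) : Lab n q r :=
  ⟨t.hq, t.hr, t.ne.2.2, t.qr'⟩

/-- The values of a word at the letters of a triple, and elsewhere. -/
structure Vals (n : ℕ) (w w' : Equiv.Perm ℤ) (p q r P Q R : ℤ) : Prop where
  sp : SP n w'
  at_p : vp n w' p = P
  at_q : vp n w' q = Q
  at_r : vp n w' r = R
  at_o : ∀ l, l ≠ p → l ≠ -p → l ≠ q → l ≠ -q → l ≠ r → l ≠ -r → w' l = w l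

theorem Vals.swap_pq {n : ℕ} {w w' : Equiv.Perm ℤ} {p q r P Q R : ℤ} (t : Triple n p q r)
    (v : Vals n w w' p q r P Q R) : Vals n w (w' * refl (p, q)) p q r Q P R := by
  have := t.ne; have := t.pr'; have := t.qr'
  refine ⟨v.sp.mul_refl t.lab_pq, ?_, ?_, ?_, fun l h1 h2 h3 h4 h5 h6 => ?_⟩
  · rw [← v.at_q, vp, mul_refl_fst t.lab_pq]; rfl
  · rw [← v.at_p, vp, mul_refl_snd t.lab_pq]; rfl
  · rw [← v.at_r, vp, mul_refl_of_ne (by omega) (by omega) (by omega) (by omega)]; rfl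
  · rw [mul_refl_of_ne h1 h3 h2 h4, v.at_o l h1 h2 h3 h4 h5 h6]

theorem Vals.swap_pr {n : ℕ} {w w' : Equiv.Perm ℤ} {p q r P Q R : ℤ} (t : Triple n p q r)
    (v : Vals n w w' p q r P Q R) : Vals n w (w' * refl (p, r)) p q r R Q P := by
  have := t.ne; have := t.pq'; have := t.qr'
  refine ⟨v.sp.mul_refl t.lab_pr, ?_, ?_, ?_, fun l h1 h2 h3 h4 h5 h6 => ?_⟩
  · rw [← v.at_r, vp, mul_refl_fst t.lab_pr]; rfl
  · rw [← v.at_q, vp, mul_refl_of_ne (by omega) (by omega) (by omega) (by omega)]; rfl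
  · rw [← v.at_p, vp, mul_refl_snd t.lab_pr]; rfl
  · rw [mul_refl_of_ne h1 h5 h2 h6, v.at_o l h1 h2 h3 h4 h5 h6]

theorem Vals.swap_qr {n : ℕ} {w w' : Equiv.Perm ℤ} {p q r P Q R : ℤ} (t : Triple n p q r)
    (v : Vals n w w' p q r P Q R) : Vals n w (w' * refl (q, r)) p q r P R Q := by
  have := t.ne; have := t.pq'; have := t.pr'
  refine ⟨v.sp.mul_refl t.lab_qr, ?_, ?_, ?_, fun l h1 h2 h3 h4 h5 h6 => ?_⟩
  · rw [← v.at_p, vp, mul_refl_of_ne (by omega) (by omega) (by omega) (by omega)]; rfl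
  · rw [← v.at_r, vp, mul_refl_fst t.lab_qr]; rfl
  · rw [← v.at_q, vp, mul_refl_snd t.lab_qr]; rfl
  · rw [mul_refl_of_ne h3 h5 h4 h6, v.at_o l h1 h2 h3 h4 h5 h6]

/-- Two words agree up to a permutation of the letters of a triple. -/
theorem Vals.ext {n : ℕ} {w w₁ w₂ : Equiv.Perm ℤ} {p q r P Q R : ℤ} (t : Triple n p q r)
    (h1 : Vals n w w₁ p q r P Q R) (h2 : Vals n w w₂ p q r P Q R) : w₁ = w₂ := by
  have key : ∀ x, IsLetter n x → vp n w₁ x = vp n w₂ x → w₁ x = w₂ x := fun x hx h =>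
    pos_inj (h1.sp.letter hx) (h2.sp.letter hx) h
  have ep := key p t.hp (h1.at_p.trans h2.at_p.symm)
  have eq := key q t.hq (h1.at_q.trans h2.at_q.symm)
  have er := key r t.hr (h1.at_r.trans h2.at_r.symm)
  ext x
  by_cases c1 : x = p; · rw [c1, ep]
  by_cases c2 : x = -p; · rw [c2, h1.sp.neg, h2.sp.neg, ep]
  by_cases c3 : x = q; · rw [c3, eq]
  by_cases c4 : x = -q; · rw [c4, h1.sp.neg, h2.sp.neg, eq]
  by_cases c5 : x = r; · rw [c5, er]
  by_cases c6 : x = -r; · rw [c6, h1.sp.neg, h2.sp.neg, er]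
  rw [h1.at_o x c1 c2 c3 c4 c5 c6, h2.at_o x c1 c2 c3 c4 c5 c6]

/-- The triple condition for a pair of positions `a < b` with values `A`, `B`; the other letter of
the triple is at `c` with value `C`. -/
def TripleJump (N a b c A B C : ℤ) : Prop :=
  JumpAt a b c A B C ∧ JumpAt a b (N - c) A B (N - C)

/-- `Jump` in terms of the triple and the other letters. -/
def OtherJump (n : ℕ) (w : Equiv.Perm ℤ) (p q r a b A B : ℤ) : Prop :=
  ∀ l, IsLetter n l → l ≠ p → l ≠ -p → l ≠ q → l ≠ -q → l ≠ r → l ≠ -r →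
    JumpAt a b (pos n l) A B (vp n w l)

theorem Vals.jump_pq {n : ℕ} {w w' : Equiv.Perm ℤ} {p q r P Q R : ℤ} (t : Triple n p q r)
    (v : Vals n w w' p q r P Q R) : Jump n w' p q ↔
    TripleJump (2 * n + 1) (pos n p) (pos n q) (pos n r) P Q R ∧
      OtherJump n w p q r (pos n p) (pos n q) P Q := by
  have hne := t.ne; have h1 := t.pq'; have h2 := t.pr'; have h3 := t.qr'
  constructor
  · intro h
    refine ⟨⟨?_, ?_⟩, fun l hl c1 c2 c3 c4 c5 c6 => ?_⟩
    · have := h.at t.hr (by omega) (by omega)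
      rwa [v.at_p, v.at_q, v.at_r] at this
    · have := h.at t.hr.neg (by omega) (by omega)
      rwa [v.at_p, v.at_q, vp_neg v.sp t.hr, v.at_r, pos_neg t.hr] at this
    · have := h.at hl c2 c4
      unfold vp at *
      rw [v.at_o l c1 c2 c3 c4 c5 c6] at this
      have e1 := v.at_p; have e2 := v.at_q
      unfold vp at *
      rwa [e1, e2] at this
  · rintro ⟨⟨g1, g2⟩, g3⟩ l hl h4 h5 c2 c4
    have c1 : l ≠ p := by rintro rfl; omega
    have c3 : l ≠ q := by rintro rfl; omega
    have e1 := v.at_p; have e2 := v.at_q; have e3 := v.at_r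
    by_cases c5 : l = r
    · subst c5
      unfold vp at e1 e2 e3
      rw [e1, e2, e3]
      exact g1 h4 h5
    by_cases c6 : l = -r
    · have e4 := vp_neg v.sp t.hr
      rw [v.at_r] at e4
      rw [← pos_neg t.hr, ← e4, ← c6] at g2
      unfold vp at *
      rw [e1, e2]
      exact g2 h4 h5
    have := g3 l hl c1 c2 c3 c4 c5 c6 h4 h5
    unfold vp at *
    rw [e1, e2, v.at_o l c1 c2 c3 c4 c5 c6]
    exact this

theorem Vals.jump_qr {n : ℕ} {w w' : Equiv.Perm ℤ} {p q r P Q R : ℤ} (t : Triple n p q r)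
    (v : Vals n w w' p q r P Q R) : Jump n w' q r ↔
    TripleJump (2 * n + 1) (pos n q) (pos n r) (pos n p) Q R P ∧
      OtherJump n w p q r (pos n q) (pos n r) Q R := by
  have hne := t.ne; have h1 := t.pq'; have h2 := t.pr'; have h3 := t.qr'
  constructor
  · intro h
    refine ⟨⟨?_, ?_⟩, fun l hl c1 c2 c3 c4 c5 c6 => ?_⟩
    · have := h.at t.hp (by omega) (by omega)
      rwa [v.at_p, v.at_q, v.at_r] at this
    · have := h.at t.hp.neg (by omega) (by omega)
      rwa [v.at_r, v.at_q, vp_neg v.sp t.hp, v.at_p, pos_neg t.hp] at this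
    · have := h.at hl c4 c6
      have e1 := v.at_r; have e2 := v.at_q
      unfold vp at *
      rw [v.at_o l c1 c2 c3 c4 c5 c6] at this
      rwa [e1, e2] at this
  · rintro ⟨⟨g1, g2⟩, g3⟩ l hl h4 h5 c4 c6
    have c3 : l ≠ q := by rintro rfl; omega
    have c5 : l ≠ r := by rintro rfl; omega
    have e1 := v.at_p; have e2 := v.at_q; have e3 := v.at_r
    by_cases c1 : l = p
    · subst c1
      unfold vp at e1 e2 e3
      rw [e1, e2, e3]
      exact g1 h4 h5
    by_cases c2 : l = -p
    · have e4 := vp_neg v.sp t.hp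
      rw [v.at_p] at e4
      rw [← pos_neg t.hp, ← e4, ← c2] at g2
      unfold vp at *
      rw [e2, e3]
      exact g2 h4 h5
    have := g3 l hl c1 c2 c3 c4 c5 c6 h4 h5
    unfold vp at *
    rw [e2, e3, v.at_o l c1 c2 c3 c4 c5 c6]
    exact this

theorem Vals.jump_pr {n : ℕ} {w w' : Equiv.Perm ℤ} {p q r P Q R : ℤ} (t : Triple n p q r)
    (v : Vals n w w' p q r P Q R) : Jump n w' p r ↔
    TripleJump (2 * n + 1) (pos n p) (pos n r) (pos n q) P R Q ∧
      OtherJump n w p q r (pos n p) (pos n r) P R := by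
  have hne := t.ne; have h1 := t.pq'; have h2 := t.pr'; have h3 := t.qr'
  constructor
  · intro h
    refine ⟨⟨?_, ?_⟩, fun l hl c1 c2 c3 c4 c5 c6 => ?_⟩
    · have := h.at t.hq (by omega) (by omega)
      rwa [v.at_p, v.at_q, v.at_r] at this
    · have := h.at t.hq.neg (by omega) (by omega)
      rwa [v.at_r, v.at_p, vp_neg v.sp t.hq, v.at_q, pos_neg t.hq] at this
    · have := h.at hl c2 c6
      have e1 := v.at_r; have e2 := v.at_p
      unfold vp at *
      rw [v.at_o l c1 c2 c3 c4 c5 c6] at this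
      rwa [e1, e2] at this
  · rintro ⟨⟨g1, g2⟩, g3⟩ l hl h4 h5 c2 c6
    have c1 : l ≠ p := by rintro rfl; omega
    have c5 : l ≠ r := by rintro rfl; omega
    have e1 := v.at_p; have e2 := v.at_q; have e3 := v.at_r
    by_cases c3 : l = q
    · subst c3
      unfold vp at e1 e2 e3
      rw [e1, e2, e3]
      exact g1 h4 h5
    by_cases c4 : l = -q
    · have e4 := vp_neg v.sp t.hq
      rw [v.at_q] at e4
      rw [← pos_neg t.hq, ← e4, ← c4] at g2
      unfold vp at *
      rw [e1, e3]
      exact g2 h4 h5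
    have := g3 l hl c1 c2 c3 c4 c5 c6 h4 h5
    unfold vp at *
    rw [e1, e3, v.at_o l c1 c2 c3 c4 c5 c6]
    exact this

theorem exch_arith1 {N p q r P Q R : ℤ} (h1 : p < q) (h2 : q < r)
    (hn : p + q ≠ N ∧ p + r ≠ N ∧ q + r ≠ N)
    (hN : P ≠ Q ∧ P ≠ R ∧ Q ≠ R ∧ P + Q ≠ N ∧ P + R ≠ N ∧ Q + R ≠ N)
    (j1 : TripleJump N q r p Q R P) (j2 : TripleJump N p q r P R Q) (hc : Bt P Q R) :
    TripleJump N p q r P Q R ∧ TripleJump N p r q Q R P := by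
  unfold TripleJump JumpAt Bt at *; omega

theorem exch_arith2 {N p q r P Q R : ℤ} (h1 : p < q) (h2 : q < r)
    (hn : p + q ≠ N ∧ p + r ≠ N ∧ q + r ≠ N)
    (hN : P ≠ Q ∧ P ≠ R ∧ Q ≠ R ∧ P + Q ≠ N ∧ P + R ≠ N ∧ Q + R ≠ N)
    (j1 : TripleJump N q r p Q R P) (j2 : TripleJump N p q r P R Q) (hc : ¬ Bt P Q R) :
    TripleJump N p r q P R Q ∧ TripleJump N q r p Q P R := by
  unfold TripleJump JumpAt Bt at *; omega

theorem exch_arith3 {N p q r P Q R : ℤ} (h1 : p < q) (h2 : q < r)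
    (hN : P ≠ Q ∧ P ≠ R ∧ Q ≠ R ∧ P + Q ≠ N ∧ P + R ≠ N ∧ Q + R ≠ N)
    (j1 : TripleJump N p r q P R Q) (j2 : TripleJump N p q r R Q P) :
    TripleJump N p q r P Q R ∧ TripleJump N q r p P R Q := by
  unfold TripleJump JumpAt Bt at *; omega

theorem exch_arith4 {N p q r P Q R : ℤ} (h1 : p < q) (h2 : q < r)
    (hN : P ≠ Q ∧ P ≠ R ∧ Q ≠ R ∧ P + Q ≠ N ∧ P + R ≠ N ∧ Q + R ≠ N)
    (j1 : TripleJump N q r p Q R P) (j2 : TripleJump N p r q P Q R) :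
    TripleJump N p q r P Q R ∧ TripleJump N q r p P R Q := by
  unfold TripleJump JumpAt Bt at *; omega

theorem Vals.refl {n : ℕ} {w : Equiv.Perm ℤ} (hw : SP n w) (p q r : ℤ) :
    Vals n w w p q r (vp n w p) (vp n w q) (vp n w r) :=
  ⟨hw, rfl, rfl, rfl, fun _ _ _ _ _ _ _ => rfl⟩

theorem vp_lab {n : ℕ} {w : Equiv.Perm ℤ} (hw : SP n w) {p q : ℤ} (h : Lab n p q) :
    vp n w p ≠ vp n w q ∧ vp n w p + vp n w q ≠ 2 * n + 1 := by
  obtain ⟨h1, h2, h3, h4⟩ := h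
  constructor
  · intro e
    exact h3 (w.injective (pos_inj (hw.letter h1) (hw.letter h2) e))
  · intro e
    have := vp_neg hw h2
    exact h4 (w.injective (pos_inj (hw.letter h1) (hw.letter h2.neg)
      (show vp n w p = vp n w (-q) by omega)))

theorem pos_ne {n : ℕ} {p q : ℤ} (h : Lab n p q) :
    pos n p ≠ pos n q ∧ pos n p + pos n q ≠ 2 * n + 1 := vp_lab (SP.one n) h

theorem Triple.pos_facts {n : ℕ} {p q r : ℤ} (t : Triple n p q r) :
    0 < pos n p ∧ pos n r < 2 * n + 1 ∧ pos n p + pos n q ≠ 2 * n + 1 ∧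
      pos n p + pos n r ≠ 2 * n + 1 ∧ pos n q + pos n r ≠ 2 * n + 1 := by
  have h1 := pos_bounds t.hp
  have h2 := pos_bounds t.hr
  exact ⟨by omega, by omega, (pos_ne t.lab_pq).2, (pos_ne t.lab_pr).2, (pos_ne t.lab_qr).2⟩

theorem Triple.val_facts {n : ℕ} {p q r : ℤ} (t : Triple n p q r) {w : Equiv.Perm ℤ}
    (hw : SP n w) :
    (0 < vp n w p ∧ vp n w p < 2 * n + 1 ∧ 0 < vp n w q ∧ vp n w q < 2 * n + 1 ∧
      0 < vp n w r ∧ vp n w r < 2 * n + 1) ∧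
    (vp n w p ≠ vp n w q ∧ vp n w p ≠ vp n w r ∧ vp n w q ≠ vp n w r ∧
      vp n w p + vp n w q ≠ 2 * n + 1 ∧ vp n w p + vp n w r ≠ 2 * n + 1 ∧
      vp n w q + vp n w r ≠ 2 * n + 1) := by
  have h1 := vp_bounds hw t.hp
  have h2 := vp_bounds hw t.hq
  have h3 := vp_bounds hw t.hr
  have h4 := vp_lab hw t.lab_pq
  have h5 := vp_lab hw t.lab_pr
  have h6 := vp_lab hw t.lab_qr
  omega

theorem Triple.vals_ne {n : ℕ} {p q r : ℤ} (t : Triple n p q r) {w : Equiv.Perm ℤ}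
    (hw : SP n w) {l : ℤ} (hl : IsLetter n l) (c1 : l ≠ p) (c3 : l ≠ q) (c5 : l ≠ r) :
    vp n w l ≠ vp n w p ∧ vp n w l ≠ vp n w q ∧ vp n w l ≠ vp n w r := by
  refine ⟨fun e => c1 ?_, fun e => c3 ?_, fun e => c5 ?_⟩
  · exact w.injective (pos_inj (hw.letter hl) (hw.letter t.hp) e)
  · exact w.injective (pos_inj (hw.letter hl) (hw.letter t.hq) e)
  · exact w.injective (pos_inj (hw.letter hl) (hw.letter t.hr) e)

theorem other_arith1 {p q r l P Q R L : ℤ} (h1 : p < q) (h2 : q < r)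
    (hl : l ≠ p ∧ l ≠ q ∧ l ≠ r) (hL : L ≠ P ∧ L ≠ Q ∧ L ≠ R)
    (j1 : JumpAt q r l Q R L) (j2 : JumpAt p q l P R L) (hc : Bt P Q R) :
    JumpAt p q l P Q L ∧ JumpAt p r l Q R L := by
  unfold JumpAt Bt at *; omega

theorem other_arith2 {p q r l P Q R L : ℤ} (h1 : p < q) (h2 : q < r)
    (hl : l ≠ p ∧ l ≠ q ∧ l ≠ r) (hL : L ≠ P ∧ L ≠ Q ∧ L ≠ R)
    (hP : P ≠ Q ∧ P ≠ R ∧ Q ≠ R)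
    (j1 : JumpAt q r l Q R L) (j2 : JumpAt p q l P R L) (hc : ¬ Bt P Q R) :
    JumpAt p r l P R L ∧ JumpAt q r l Q P L := by
  unfold JumpAt Bt at *; omega

theorem other_arith3 {p q r l P Q R L : ℤ} (h1 : p < q) (h2 : q < r)
    (hl : l ≠ p ∧ l ≠ q ∧ l ≠ r) (hL : L ≠ P ∧ L ≠ Q ∧ L ≠ R)
    (hP : P ≠ Q ∧ P ≠ R ∧ Q ≠ R)
    (j1 : JumpAt p r l P R L) (j2 : JumpAt p q l R Q L) (hc : ¬ Bt P Q R) :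
    JumpAt p q l P Q L ∧ JumpAt q r l P R L := by
  unfold JumpAt Bt at *; omega

theorem other_arith4 {p q r l P Q R L : ℤ} (h1 : p < q) (h2 : q < r)
    (hl : l ≠ p ∧ l ≠ q ∧ l ≠ r) (hL : L ≠ P ∧ L ≠ Q ∧ L ≠ R)
    (hP : P ≠ Q ∧ P ≠ R ∧ Q ≠ R)
    (j1 : JumpAt q r l Q R L) (j2 : JumpAt p r l P Q L) (hc : ¬ Bt P R Q) :
    JumpAt p q l P Q L ∧ JumpAt q r l P R L := by
  unfold JumpAt Bt at *; omega

theorem Triple.exch_qr_pq {n : ℕ} {p q r : ℤ} (t : Triple n p q r) {w : Equiv.Perm ℤ}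
    (hw : SP n w) (j1 : Jump n w q r) (j2 : Jump n (w * QAlcoveD.refl (q, r)) p q) :
    (Jump n w p q ∧ Jump n (w * QAlcoveD.refl (p, q)) p r ∧
      w * QAlcoveD.refl (p, q) * QAlcoveD.refl (p, r) =
        w * QAlcoveD.refl (q, r) * QAlcoveD.refl (p, q)) ∨
    (Jump n w p r ∧ Jump n (w * QAlcoveD.refl (p, r)) q r ∧
      w * QAlcoveD.refl (p, r) * QAlcoveD.refl (q, r) =
        w * QAlcoveD.refl (q, r) * QAlcoveD.refl (p, q)) := by
  have v := Vals.refl hw p q r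
  have f := t.pos_facts
  have g := t.val_facts hw
  rw [v.jump_qr t] at j1
  rw [(v.swap_qr t).jump_pq t] at j2
  by_cases hc : Bt (vp n w p) (vp n w q) (vp n w r)
  · left
    obtain ⟨e1, e2⟩ := exch_arith1 t.pq t.qr f.2.2 g.2 j1.1 j2.1 hc
    rw [v.jump_pq t, (v.swap_pq t).jump_pr t]
    refine ⟨⟨e1, ?_⟩, ⟨e2, ?_⟩, ((v.swap_pq t).swap_pr t).ext t ((v.swap_qr t).swap_pq t)⟩
    · intro l hl c1 c2 c3 c4 c5 c6
      exact (other_arith1 t.pq t.qr (t.vals_ne (SP.one n) hl c1 c3 c5) (t.vals_ne hw hl c1 c3 c5)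
        (j1.2 l hl c1 c2 c3 c4 c5 c6) (j2.2 l hl c1 c2 c3 c4 c5 c6) hc).1
    · intro l hl c1 c2 c3 c4 c5 c6
      exact (other_arith1 t.pq t.qr (t.vals_ne (SP.one n) hl c1 c3 c5) (t.vals_ne hw hl c1 c3 c5)
        (j1.2 l hl c1 c2 c3 c4 c5 c6) (j2.2 l hl c1 c2 c3 c4 c5 c6) hc).2
  · right
    obtain ⟨e1, e2⟩ := exch_arith2 t.pq t.qr f.2.2 g.2 j1.1 j2.1 hc
    rw [v.jump_pr t, (v.swap_pr t).jump_qr t]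
    refine ⟨⟨e1, ?_⟩, ⟨e2, ?_⟩, ((v.swap_pr t).swap_qr t).ext t ((v.swap_qr t).swap_pq t)⟩
    · intro l hl c1 c2 c3 c4 c5 c6
      exact (other_arith2 t.pq t.qr (t.vals_ne (SP.one n) hl c1 c3 c5) (t.vals_ne hw hl c1 c3 c5)
        ⟨g.2.1, g.2.2.1, g.2.2.2.1⟩ (j1.2 l hl c1 c2 c3 c4 c5 c6) (j2.2 l hl c1 c2 c3 c4 c5 c6) hc).1
    · intro l hl c1 c2 c3 c4 c5 c6
      exact (other_arith2 t.pq t.qr (t.vals_ne (SP.one n) hl c1 c3 c5) (t.vals_ne hw hl c1 c3 c5)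
        ⟨g.2.1, g.2.2.1, g.2.2.2.1⟩ (j1.2 l hl c1 c2 c3 c4 c5 c6) (j2.2 l hl c1 c2 c3 c4 c5 c6) hc).2

theorem Triple.exch_pr_pq {n : ℕ} {p q r : ℤ} (t : Triple n p q r) {w : Equiv.Perm ℤ}
    (hw : SP n w) (j1 : Jump n w p r) (j2 : Jump n (w * QAlcoveD.refl (p, r)) p q) :
    Jump n w p q ∧ Jump n (w * QAlcoveD.refl (p, q)) q r ∧
      w * QAlcoveD.refl (p, q) * QAlcoveD.refl (q, r) =
        w * QAlcoveD.refl (p, r) * QAlcoveD.refl (p, q) := by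
  have v := Vals.refl hw p q r
  have g := t.val_facts hw
  rw [v.jump_pr t] at j1
  rw [(v.swap_pr t).jump_pq t] at j2
  have hc : ¬ Bt (vp n w p) (vp n w q) (vp n w r) := j1.1.1 t.pq t.qr
  obtain ⟨e1, e2⟩ := exch_arith3 t.pq t.qr g.2 j1.1 j2.1
  rw [v.jump_pq t, (v.swap_pq t).jump_qr t]
  refine ⟨⟨e1, ?_⟩, ⟨e2, ?_⟩, ((v.swap_pq t).swap_qr t).ext t ((v.swap_pr t).swap_pq t)⟩
  · intro l hl c1 c2 c3 c4 c5 c6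
    exact (other_arith3 t.pq t.qr (t.vals_ne (SP.one n) hl c1 c3 c5) (t.vals_ne hw hl c1 c3 c5)
      ⟨g.2.1, g.2.2.1, g.2.2.2.1⟩ (j1.2 l hl c1 c2 c3 c4 c5 c6) (j2.2 l hl c1 c2 c3 c4 c5 c6) hc).1
  · intro l hl c1 c2 c3 c4 c5 c6
    exact (other_arith3 t.pq t.qr (t.vals_ne (SP.one n) hl c1 c3 c5) (t.vals_ne hw hl c1 c3 c5)
      ⟨g.2.1, g.2.2.1, g.2.2.2.1⟩ (j1.2 l hl c1 c2 c3 c4 c5 c6) (j2.2 l hl c1 c2 c3 c4 c5 c6) hc).2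

theorem Triple.exch_qr_pr {n : ℕ} {p q r : ℤ} (t : Triple n p q r) {w : Equiv.Perm ℤ}
    (hw : SP n w) (j1 : Jump n w q r) (j2 : Jump n (w * QAlcoveD.refl (q, r)) p r) :
    Jump n w p q ∧ Jump n (w * QAlcoveD.refl (p, q)) q r ∧
      w * QAlcoveD.refl (p, q) * QAlcoveD.refl (q, r) =
        w * QAlcoveD.refl (q, r) * QAlcoveD.refl (p, r) := by
  have v := Vals.refl hw p q r
  have g := t.val_facts hw
  rw [v.jump_qr t] at j1
  rw [(v.swap_qr t).jump_pr t] at j2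
  have hc : ¬ Bt (vp n w p) (vp n w r) (vp n w q) := j2.1.1 t.pq t.qr
  obtain ⟨e1, e2⟩ := exch_arith4 t.pq t.qr g.2 j1.1 j2.1
  rw [v.jump_pq t, (v.swap_pq t).jump_qr t]
  refine ⟨⟨e1, ?_⟩, ⟨e2, ?_⟩, ((v.swap_pq t).swap_qr t).ext t ((v.swap_qr t).swap_pr t)⟩
  · intro l hl c1 c2 c3 c4 c5 c6
    exact (other_arith4 t.pq t.qr (t.vals_ne (SP.one n) hl c1 c3 c5) (t.vals_ne hw hl c1 c3 c5)
      ⟨g.2.1, g.2.2.1, g.2.2.2.1⟩ (j1.2 l hl c1 c2 c3 c4 c5 c6) (j2.2 l hl c1 c2 c3 c4 c5 c6) hc).1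
  · intro l hl c1 c2 c3 c4 c5 c6
    exact (other_arith4 t.pq t.qr (t.vals_ne (SP.one n) hl c1 c3 c5) (t.vals_ne hw hl c1 c3 c5)
      ⟨g.2.1, g.2.2.1, g.2.2.2.1⟩ (j1.2 l hl c1 c2 c3 c4 c5 c6) (j2.2 l hl c1 c2 c3 c4 c5 c6) hc).2

theorem jump_mirror {n : ℕ} {w : Equiv.Perm ℤ} (hw : SP n w) {i m : ℤ} (h : Lab n i m)
    (j : Jump n w i m) : Jump n w (-m) (-i) := by
  intro l hl h1 h2 h3 h4 hb
  rw [pos_neg h.2.1] at h1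
  rw [pos_neg h.1] at h2
  refine j (-l) hl.neg ?_ ?_ (by omega) (by omega) ?_
  · rw [pos_neg hl]; omega
  · rw [pos_neg hl]; omega
  · rw [hw.neg, hw.neg, pos_neg (hw.letter h.1), pos_neg (hw.letter h.2.1)] at hb
    rw [hw.neg, pos_neg (hw.letter hl)]
    unfold Bt at *; omega

theorem refl_mirror {n : ℕ} {i m : ℤ} (h : Lab n i m) : refl (-m, -i) = refl (i, m) := by
  have h' : Lab n (-m) (-i) := ⟨h.2.1.neg, h.1.neg, by have := h.2.2; omega, by have := h.2.2; omega⟩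
  have e1 := refl_neg_fst h'
  have e2 := refl_neg_snd h'
  rw [neg_neg, neg_neg] at e1 e2
  ext x
  rcases refl_cases h x with ⟨rfl, g⟩ | ⟨rfl, g⟩ | ⟨rfl, g⟩ | ⟨rfl, g⟩ | ⟨c1, c2, c3, c4, g⟩ <;> rw [g]
  · exact e2
  · exact e1
  · exact refl_snd h'
  · exact refl_fst h'
  · exact refl_of_ne c4 c3 (by omega) (by omega)

theorem Lab.mirror {n : ℕ} {i m : ℤ} (h : Lab n i m) : Lab n (-m) (-i) :=
  ⟨h.2.1.neg, h.1.neg, by have := h.2.2; omega, by have := h.2.2; omega⟩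

theorem refl_comm_of_disjoint {n : ℕ} {a b c d : ℤ} (h1 : Lab n a b) (h2 : Lab n c d)
    (h : c ≠ a ∧ c ≠ -a ∧ c ≠ b ∧ c ≠ -b ∧ d ≠ a ∧ d ≠ -a ∧ d ≠ b ∧ d ≠ -b) :
    refl (a, b) * refl (c, d) = refl (c, d) * refl (a, b) := by
  ext x
  rw [Equiv.Perm.mul_apply, Equiv.Perm.mul_apply]
  by_cases hx : x = c ∨ x = d ∨ x = -c ∨ x = -d
  · have e1 : refl (a, b) x = x := refl_of_ne (by omega) (by omega) (by omega) (by omega)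
    rw [e1]
    rcases refl_cases h2 x with ⟨-, g⟩ | ⟨-, g⟩ | ⟨-, g⟩ | ⟨-, g⟩ | ⟨c1, c2, c3, c4, g⟩ <;>
    · rw [g]
      exact refl_of_ne (by omega) (by omega) (by omega) (by omega)
  · have e1 : refl (c, d) x = x := refl_of_ne (by omega) (by omega) (by omega) (by omega)
    rw [e1]
    symm
    rcases refl_cases h1 x with ⟨-, g⟩ | ⟨-, g⟩ | ⟨-, g⟩ | ⟨-, g⟩ | ⟨c1, c2, c3, c4, g⟩ <;>
    · rw [g]
      exact refl_of_ne (by omega) (by omega) (by omega) (by omega)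

theorem refl_comm_neg {n : ℕ} {a b : ℤ} (h1 : Lab n a b) :
    refl (a, b) * refl (a, -b) = refl (a, -b) * refl (a, b) := by
  have h2 : Lab n a (-b) := ⟨h1.1, h1.2.1.neg, by have := h1.2.2; omega, by have := h1.2.2; omega⟩
  have e := refl_neg_snd h2
  rw [neg_neg] at e
  have e' := refl_neg_fst h2
  rw [neg_neg] at e'
  ext x
  rw [Equiv.Perm.mul_apply, Equiv.Perm.mul_apply]
  rcases refl_cases h1 x with ⟨rfl, g⟩ | ⟨rfl, g⟩ | ⟨rfl, g⟩ | ⟨rfl, g⟩ | ⟨c1, c2, c3, c4, g⟩ <;> rw [g]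
  · rw [refl_fst h2, e, refl_neg_snd h1]
  · rw [refl_fst h2, e, refl_neg_fst h1]
  · rw [refl_snd h2, e', refl_snd h1]
  · rw [refl_neg_fst h2, refl_snd h2, refl_fst h1, neg_neg]
  · rw [refl_of_ne c1 c4 c3 (by rwa [neg_neg]), g]

theorem disjoint_arith {a b c d A B C D : ℤ} (hab : a < b) (hcd : c < d)
    (h : c ≠ a ∧ c ≠ b ∧ d ≠ a ∧ d ≠ b)
    (hv : A ≠ C ∧ A ≠ D ∧ B ≠ C ∧ B ≠ D ∧ A ≠ B ∧ C ≠ D)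
    (k1 : JumpAt a b c A B C) (k2 : JumpAt a b d A B D) (k3 : JumpAt c d a C D B)
    (k4 : JumpAt c d b C D A) :
    JumpAt c d a C D A ∧ JumpAt c d b C D B ∧ JumpAt a b c A B D ∧ JumpAt a b d A B C := by
  unfold JumpAt Bt at *
  refine ⟨?_, ?_, ?_, ?_⟩ <;> omega

/-- Commuting reflections in two orthogonal planes. -/
theorem exch_disjoint {n : ℕ} {w : Equiv.Perm ℤ} (hw : SP n w) {a b c d : ℤ} (h1 : Lab n a b)
    (h2 : Lab n c d) (h : c ≠ a ∧ c ≠ -a ∧ c ≠ b ∧ c ≠ -b ∧ d ≠ a ∧ d ≠ -a ∧ d ≠ b ∧ d ≠ -b)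
    (hab : pos n a < pos n b) (hcd : pos n c < pos n d)
    (j1 : Jump n w a b) (j2 : Jump n (w * refl (a, b)) c d) :
    Jump n w c d ∧ Jump n (w * refl (c, d)) a b := by
  have key : ∀ {a b c d : ℤ}, Lab n a b → Lab n c d → 
      (c ≠ a ∧ c ≠ -a ∧ c ≠ b ∧ c ≠ -b ∧ d ≠ a ∧ d ≠ -a ∧ d ≠ b ∧ d ≠ -b) →
      pos n a < pos n b → pos n c < pos n d →
      Jump n w a b → Jump n (w * refl (a, b)) c d →
      JumpAt (pos n c) (pos n d) (pos n a) (vp n w c) (vp n w d) (vp n w a) ∧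
      JumpAt (pos n c) (pos n d) (pos n b) (vp n w c) (vp n w d) (vp n w b) ∧
      JumpAt (pos n a) (pos n b) (pos n c) (vp n w a) (vp n w b) (vp n w d) ∧
      JumpAt (pos n a) (pos n b) (pos n d) (vp n w a) (vp n w b) (vp n w c) := by
    intro a b c d h1 h2 h hab hcd j1 j2
    have k1 := j1.at h2.1 h.2.1 h.2.2.2.1
    have k2 := j1.at h2.2.1 h.2.2.2.2.2.1 h.2.2.2.2.2.2.2
    have k3 := j2.at h1.1 (by omega) (by omega)
    have k4 := j2.at h1.2.1 (by omega) (by omega)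
    have ec : vp n (w * refl (a, b)) c = vp n w c := by
      unfold vp; rw [mul_refl_of_ne] <;> omega
    have ed : vp n (w * refl (a, b)) d = vp n w d := by
      unfold vp; rw [mul_refl_of_ne] <;> omega
    have ea : vp n (w * refl (a, b)) a = vp n w b := by unfold vp; rw [mul_refl_fst h1]
    have eb : vp n (w * refl (a, b)) b = vp n w a := by unfold vp; rw [mul_refl_snd h1]
    rw [ec, ed, ea] at k3
    rw [ec, ed, eb] at k4
    have hne : ∀ {x y : ℤ}, IsLetter n x → IsLetter n y → x ≠ y → vp n w x ≠ vp n w y :=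
      fun hx hy hxy e => hxy (w.injective (pos_inj (hw.letter hx) (hw.letter hy) e))
    have n1 := hne h1.1 h2.1 (by omega)
    have n2 := hne h1.1 h2.2.1 (by omega)
    have n3 := hne h1.2.1 h2.1 (by omega)
    have n4 := hne h1.2.1 h2.2.1 (by omega)
    have n5 := hne h1.1 h1.2.1 h1.2.2.1
    have n6 := hne h2.1 h2.2.1 h2.2.2.1
    have m1 : pos n c ≠ pos n a := fun e => h.1 (pos_inj h2.1 h1.1 e)
    have m2 : pos n c ≠ pos n b := fun e => h.2.2.1 (pos_inj h2.1 h1.2.1 e)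
    have m3 : pos n d ≠ pos n a := fun e => h.2.2.2.2.1 (pos_inj h2.2.1 h1.1 e)
    have m4 : pos n d ≠ pos n b := fun e => h.2.2.2.2.2.2.1 (pos_inj h2.2.1 h1.2.1 e)
    exact disjoint_arith hab hcd ⟨m1, m2, m3, m4⟩ ⟨n1, n2, n3, n4, n5, n6⟩ k1 k2 k3 k4
  obtain ⟨q1, q2, q3, q4⟩ := key h1 h2 h hab hcd j1 j2
  have hab' : pos n (-b) < pos n (-a) := by rw [pos_neg h1.1, pos_neg h1.2.1]; omega
  obtain ⟨r1, r2, r3, r4⟩ := key h1.mirror h2 (by omega) hab' hcd (jump_mirror hw h1 j1)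
    (by rw [refl_mirror h1]; exact j2)
  have hN : ∀ x, IsLetter n x → vp n w (-x) = 2 * n + 1 - vp n w x := fun x hx => vp_neg hw hx
  constructor
  · intro l hl g1 g2 g3 g4
    by_cases c1 : l = a; · subst c1; exact q1 g1 g2
    by_cases c2 : l = b; · subst c2; exact q2 g1 g2
    by_cases c3 : l = -a; · subst c3; exact r2 g1 g2
    by_cases c4 : l = -b; · subst c4; exact r1 g1 g2
    have := j2 l hl g1 g2 g3 g4
    rwa [mul_refl_of_ne c1 c2 c3 c4, mul_refl_of_ne, mul_refl_of_ne] at this <;> omega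
  · intro l hl g1 g2 g3 g4
    rw [mul_refl_of_ne (x := a), mul_refl_of_ne (x := b)]
    rotate_left 1
    iterate 8 omega
    by_cases c1 : l = c; · subst c1; rw [mul_refl_fst h2]; exact q3 g1 g2
    by_cases c2 : l = d; · subst c2; rw [mul_refl_snd h2]; exact q4 g1 g2
    by_cases c3 : l = -c
    · subst c3
      rw [pos_neg h2.1] at g1 g2
      rw [SP.neg (hw.mul_refl h2), mul_refl_fst h2, pos_neg (hw.letter h2.2.1)]
      rw [pos_neg h1.1, pos_neg h1.2.1, hN _ h1.1, hN _ h1.2.1] at r3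
      unfold JumpAt vp Bt at *; omega
    by_cases c4 : l = -d
    · subst c4
      rw [pos_neg h2.2.1] at g1 g2
      rw [SP.neg (hw.mul_refl h2), mul_refl_snd h2, pos_neg (hw.letter h2.1)]
      rw [pos_neg h1.1, pos_neg h1.2.1, hN _ h1.1, hN _ h1.2.1] at r4
      unfold JumpAt vp Bt at *; omega
    rw [mul_refl_of_ne c1 c2 c3 c4]
    exact j1 l hl g1 g2 g3 g4

/-- Commuting reflections in the same plane. -/
theorem exch_neg {n : ℕ} {w : Equiv.Perm ℤ} (hw : SP n w) {a b : ℤ} (h1 : Lab n a b)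
    (hab : pos n a < pos n b) (hab' : pos n a < pos n (-b))
    (j1 : Jump n w a b) (j2 : Jump n (w * refl (a, b)) a (-b)) :
    Jump n w a (-b) ∧ Jump n (w * refl (a, -b)) a b := by
  have h2 : Lab n a (-b) := ⟨h1.1, h1.2.1.neg, by have := h1.2.2; omega, by have := h1.2.2; omega⟩
  have e1 : (w * refl (a, -b)) a = -w b := by rw [mul_refl_fst h2, hw.neg]
  have e2 : (w * refl (a, -b)) b = -w a := by
    have := mul_refl_neg_snd hw h2; rwa [neg_neg] at this
  have e3 : (w * refl (a, b)) (-b) = -w a := mul_refl_neg_snd hw h1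
  have hv := vp_lab hw h1
  have ba := vp_bounds hw h1.1
  have bb := vp_bounds hw h1.2.1
  have main : ∀ l, IsLetter n l → l ≠ a → l ≠ -a → l ≠ b → l ≠ -b →
      (pos n a < pos n l → pos n l < pos n (-b) → ¬ Bt (vp n w a) (vp n w l) (2 * n + 1 - vp n w b)) ∧
      (pos n a < pos n l → pos n l < pos n b →
        ¬ Bt (2 * n + 1 - vp n w b) (vp n w l) (2 * n + 1 - vp n w a)) := by
    intro l hl c1 c2 c3 c4
    have k1 := j1.at hl c2 c4
    have k1' := j1.at hl.neg (by omega) (by omega)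
    rw [vp_neg hw hl] at k1'
    have k2 := j2.at hl c2 (by omega)
    have k3 := j2.at hl.neg (by omega) (by omega)
    unfold vp at k2 k3
    rw [mul_refl_fst h1, e3, mul_refl_of_ne c1 c3 c2 c4, pos_neg (hw.letter h1.1)] at k2
    rw [mul_refl_fst h1, e3, mul_refl_of_ne (by omega) (by omega) (by omega) (by omega), hw.neg,
      pos_neg (hw.letter h1.1), pos_neg (hw.letter hl)] at k3
    rw [pos_neg h1.2.1] at *
    rw [pos_neg hl] at k3 k1'
    have n1 := vp_lab hw (p := l) (q := a) ⟨hl, h1.1, c1, c2⟩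
    have n2 := vp_lab hw (p := l) (q := b) ⟨hl, h1.2.1, c3, c4⟩
    have bl := vp_bounds hw hl
    have n3 := pos_ne (p := l) (q := b) ⟨hl, h1.2.1, c3, c4⟩
    change JumpAt _ _ _ (vp n w b) (2 * n + 1 - vp n w a) (vp n w l) at k2
    change JumpAt _ _ _ (vp n w b) (2 * n + 1 - vp n w a) (2 * n + 1 - vp n w l) at k3
    generalize vp n w l = L at *
    generalize vp n w a = A at *
    generalize vp n w b = B at *
    generalize pos n l = pl at *
    generalize pos n a = pa at *
    generalize pos n b = pb at *
    clear j1 j2 e1 e2 e3 h1 h2 hl hw c1 c2 c3 c4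
    unfold JumpAt Bt at *
    constructor
    · omega
    · omega
  constructor
  · intro l hl g1 g2 g3 g4
    rw [hw.neg, pos_neg (hw.letter h1.2.1)]
    by_cases c3 : l = b
    · omega
    exact (main l hl (by rintro rfl; omega) g3 c3 (by rintro rfl; omega)).1 g1 g2
  · intro l hl g1 g2 g3 g4
    rw [e1, e2, pos_neg (hw.letter h1.2.1), pos_neg (hw.letter h1.1)]
    have c1 : l ≠ a := by rintro rfl; omega
    have c3 : l ≠ b := by rintro rfl; omega
    rw [mul_refl_of_ne c1 g4 g3 (by omega)]
    exact (main l hl c1 g3 c3 g4).2 g1 g2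

/-! ### The order on the roots, and sorting of paths -/

/-- The key of a root, by which the roots of the chain are sorted; it is given in terms of the
positions `x` of the first letter and `y` of the negative of the second letter of the label. All
roots that are not in the chain have the largest key. -/
def keyAt (n k : ℕ) (x y : ℤ) : ℕ ×ₗ ℕ :=
  if min x y ≤ k ∧ max x y ≤ 2 * n - k then
    if max x y ≤ k then toLex ((k - max x y).toNat, (2 * n + 1 - min x y).toNat)
    else toLex ((k - min x y).toNat, (2 * n + 1 - max x y).toNat)
  else toLex (k, 0)

/-- The key of the root with label `(a, b)`. -/
def key (n k : ℕ) (a b : ℤ) : ℕ ×ₗ ℕ := keyAt n k (pos n a) (2 * n + 1 - pos n b)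

/-- The largest key. -/
def topKey (k : ℕ) : ℕ ×ₗ ℕ := toLex (k, 0)

theorem keyAt_comm (n k : ℕ) (x y : ℤ) : keyAt n k x y = keyAt n k y x := by
  unfold keyAt; rw [min_comm, max_comm]

theorem key_mirror {n k : ℕ} {a b : ℤ} (h : Lab n a b) : key n k (-b) (-a) = key n k a b := by
  unfold key
  rw [pos_neg h.1, pos_neg h.2.1, keyAt_comm]
  congr 1
  ring

theorem keyAt_le {n k : ℕ} {x y : ℤ} (hx : 1 ≤ x) (hy : 1 ≤ y) : keyAt n k x y ≤ topKey k := by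
  unfold keyAt topKey
  split_ifs <;> rw [Prod.Lex.toLex_le_toLex] <;> dsimp only <;> omega

theorem keyAt_inj {n k : ℕ} {x y x' y' : ℤ} (hx : 1 ≤ x) (hy : 1 ≤ y) (hx' : 1 ≤ x')
    (hy' : 1 ≤ y')
    (hk : k < n) (h1 : keyAt n k x y = keyAt n k x' y') (h : keyAt n k x y ≠ topKey k) :
    (x = x' ∧ y = y') ∨ (x = y' ∧ y = x') := by
  unfold keyAt topKey at *
  split_ifs at h1 h <;> simp only [EmbeddingLike.apply_eq_iff_eq, Prod.mk.injEq, ne_eq, not_true] at h1 h <;> omega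

/-- `K` is the pair of integers that is used as the key of the pair `x`, `y`. -/
def KeySpec (n k x y I M : ℤ) : Prop :=
  (x ≤ k ∧ y ≤ x ∧ I = k - x ∧ M = 2 * n + 1 - y) ∨
  (y ≤ k ∧ x ≤ y ∧ I = k - y ∧ M = 2 * n + 1 - x) ∨
  (x ≤ k ∧ k < y ∧ y ≤ 2 * n - k ∧ I = k - x ∧ M = 2 * n + 1 - y) ∨
  (y ≤ k ∧ k < x ∧ x ≤ 2 * n - k ∧ I = k - y ∧ M = 2 * n + 1 - x) ∨
  (((k < x ∧ k < y) ∨ 2 * n - k < x ∨ 2 * n - k < y) ∧ I = k ∧ M = 0)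

theorem exists_keySpec {n k : ℕ} {x y : ℤ} (hk : k < n) (hx : 1 ≤ x) (hy : 1 ≤ y)
    (b1 : x ≤ 2 * n) (b2 : y ≤ 2 * n) :
    ∃ I M : ℕ, KeySpec n k x y I M ∧ keyAt n k x y = toLex (I, M) := by
  unfold keyAt
  split_ifs with h1 h2
  all_goals refine ⟨_, _, ?_, rfl⟩
  · rcases le_total x y with h | h
    · rw [max_eq_right h] at *; rw [min_eq_left h] at *
      unfold KeySpec; omega
    · rw [max_eq_left h] at *; rw [min_eq_right h] at *
      unfold KeySpec; omega
  · rcases le_total x y with h | h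
    · rw [max_eq_right h] at *; rw [min_eq_left h] at *
      unfold KeySpec; omega
    · rw [max_eq_left h] at *; rw [min_eq_right h] at *
      unfold KeySpec; omega
  · rcases le_total x y with h | h
    · rw [max_eq_right h] at *; rw [min_eq_left h] at *
      unfold KeySpec; omega
    · rw [max_eq_left h] at *; rw [min_eq_right h] at *
      unfold KeySpec; omega

theorem keySpec_triple {n k p q r I M I' M' I'' M'' : ℤ} (hp : 1 ≤ p) (hpq : p < q) (hqr : q < r)
    (hr : r ≤ 2 * n) (h0 : 0 ≤ k) (hk : k < n) (h2 : p + r ≠ 2 * n + 1)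
    (h3 : q + r ≠ 2 * n + 1) (s1 : KeySpec n k p (2 * n + 1 - q) I M)
    (s2 : KeySpec n k p (2 * n + 1 - r) I' M') (s3 : KeySpec n k q (2 * n + 1 - r) I'' M'') :
    ((I < I' ∨ I = I' ∧ M < M') ∧ (I' < I'' ∨ I' = I'' ∧ M' < M'')) ∨
    ((I'' < I' ∨ I'' = I' ∧ M'' < M') ∧ (I' < I ∨ I' = I ∧ M' < M)) ∨
    ((I = k ∧ M = 0) ∧ (I' = k ∧ M' = 0) ∧ (I'' = k ∧ M'' = 0)) := by
  unfold KeySpec at *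
  rcases s2 with s2 | s2 | s2 | s2 | s2 <;> rcases s1 with s1 | s1 | s1 | s1 | s1 <;>
    omega

theorem keyAt_triple {n k : ℕ} {p q r : ℤ} (hp : 1 ≤ p) (hpq : p < q) (hqr : q < r)
    (hr : r ≤ 2 * n) (hk : k < n) (h2 : p + r ≠ 2 * n + 1)
    (h3 : q + r ≠ 2 * n + 1) :
    (keyAt n k p (2 * n + 1 - q) < keyAt n k p (2 * n + 1 - r) ∧
      keyAt n k p (2 * n + 1 - r) < keyAt n k q (2 * n + 1 - r)) ∨
    (keyAt n k q (2 * n + 1 - r) < keyAt n k p (2 * n + 1 - r) ∧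
      keyAt n k p (2 * n + 1 - r) < keyAt n k p (2 * n + 1 - q)) ∨
    (keyAt n k p (2 * n + 1 - q) = topKey k ∧ keyAt n k p (2 * n + 1 - r) = topKey k ∧
      keyAt n k q (2 * n + 1 - r) = topKey k) := by
  obtain ⟨I, M, s1, e1⟩ := exists_keySpec (x := p) (y := 2 * n + 1 - q) hk hp (by omega) (by omega)
    (by omega)
  obtain ⟨I', M', s2, e2⟩ := exists_keySpec (x := p) (y := 2 * n + 1 - r) hk hp (by omega) (by omega)
    (by omega)
  obtain ⟨I'', M'', s3, e3⟩ := exists_keySpec (x := q) (y := 2 * n + 1 - r) hk (by omega) (by omega)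
    (by omega) (by omega)
  have := keySpec_triple hp hpq hqr hr (by omega) (by omega) h2 h3 s1 s2 s3
  rw [e1, e2, e3, topKey]
  simp only [Prod.Lex.toLex_lt_toLex, EmbeddingLike.apply_eq_iff_eq, Prod.mk.injEq]
  omega

/-- There is an edge from `w` to `w'` whose label has letters of absolute value at most `K`, and
a root with key `c`. -/
def Step (n k K : ℕ) (w : Equiv.Perm ℤ) (c : ℕ ×ₗ ℕ) (w' : Equiv.Perm ℤ) : Prop :=
  ∃ a b, Lab n a b ∧ a.natAbs ≤ K ∧ b.natAbs ≤ K ∧ pos n a < pos n b ∧ Jump n w a b ∧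
    w' = w * refl (a, b) ∧ c = key n k a b

theorem Step.sp {n k K : ℕ} {w w' : Equiv.Perm ℤ} {c : ℕ ×ₗ ℕ} (h : Step n k K w c w')
    (hw : SP n w) : SP n w' := by
  obtain ⟨a, b, h1, -, -, -, -, rfl, -⟩ := h
  exact hw.mul_refl h1

theorem pos_mirror_lt {n : ℕ} {a b : ℤ} (h : Lab n a b) (hab : pos n a < pos n b) :
    pos n (-b) < pos n (-a) := by
  rw [pos_neg h.1, pos_neg h.2.1]; omega

theorem key_le {n k : ℕ} {a b : ℤ} (h : Lab n a b) : key n k a b ≤ topKey k := by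
  have := pos_bounds h.1
  have := pos_bounds h.2.1
  exact keyAt_le (by omega) (by omega)

theorem Step.le {n k K : ℕ} {w w' : Equiv.Perm ℤ} {c : ℕ ×ₗ ℕ} (h : Step n k K w c w') :
    c ≤ topKey k := by
  obtain ⟨a, b, h1, -, -, -, -, -, rfl⟩ := h
  exact key_le h1

theorem refl_mul_refl {n : ℕ} {i m : ℤ} (h : Lab n i m) : refl (i, m) * refl (i, m) = 1 := by
  ext x; exact refl_refl h x

/-- A root of the chain is determined by its key. -/
theorem Step.cancel {n k K : ℕ} (hk : k < n) {w w₁ w₂ : Equiv.Perm ℤ} {c : ℕ ×ₗ ℕ}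
    (h : Step n k K w c w₁) (h' : Step n k K w₁ c w₂) (hc : c ≠ topKey k) : w₂ = w := by
  obtain ⟨a, b, h1, -, -, -, -, rfl, rfl⟩ := h
  obtain ⟨a', b', h1', -, -, -, -, rfl, e⟩ := h'
  have p1 := pos_bounds h1.1
  have p2 := pos_bounds h1.2.1
  have p3 := pos_bounds h1'.1
  have p4 := pos_bounds h1'.2.1
  rcases keyAt_inj (by omega) (by omega) (by omega) (by omega) hk e hc with ⟨g1, g2⟩ | ⟨g1, g2⟩
  · rw [pos_inj h1.1 h1'.1 g1, pos_inj h1.2.1 h1'.2.1 (by omega), mul_assoc, refl_mul_refl h1',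
      mul_one]
  · have e1 : a = -b' := pos_inj h1.1 h1'.2.1.neg (by rw [pos_neg h1'.2.1]; omega)
    have e2 : b = -a' := pos_inj h1.2.1 h1'.1.neg (by rw [pos_neg h1'.1]; omega)
    rw [e1, e2, refl_mirror h1', mul_assoc, refl_mul_refl h1', mul_one]

/-- The step with first key `c` and the next one can be exchanged for two steps, the first of
which has a smaller key. -/
def Exch (n k K : ℕ) (w : Equiv.Perm ℤ) (c : ℕ ×ₗ ℕ) (w' : Equiv.Perm ℤ) : Prop :=
  ∃ c' d' w₁, c' < c ∧ Step n k K w c' w₁ ∧ Step n k K w₁ d' w'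

theorem Triple.key_cases {n k : ℕ} (hk : k < n) {p q r : ℤ} (t : Triple n p q r) :
    (key n k p q < key n k p r ∧ key n k p r < key n k q r) ∨
    (key n k q r < key n k p r ∧ key n k p r < key n k p q) ∨
    (key n k p q = topKey k ∧ key n k p r = topKey k ∧ key n k q r = topKey k) := by
  obtain ⟨h1, h2, h3, h4, h5⟩ := t.pos_facts
  exact keyAt_triple (by omega) t.pq t.qr (by omega) hk h4 h5

theorem Triple.mirror {n : ℕ} {p q r : ℤ} (t : Triple n p q r) : Triple n (-r) (-q) (-p) :=
  ⟨t.hr.neg, t.hq.neg, t.hp.neg, pos_mirror_lt t.lab_qr t.qr, pos_mirror_lt t.lab_pq t.pq,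
    by have := t.qr'; omega, by have := t.pr'; omega, by have := t.pq'; omega⟩

theorem Triple.exch_aux {n k K : ℕ} {p q r : ℤ} (t : Triple n p q r)
    (hp : p.natAbs ≤ K) (hq : q.natAbs ≤ K) (hr : r.natAbs ≤ K) {w : Equiv.Perm ℤ} (hw : SP n w)
    (g1 : key n k p q < key n k p r) (g2 : key n k p r < key n k q r) :
    (Jump n w q r → Jump n (w * refl (q, r)) p q →
      Exch n k K w (key n k q r) (w * refl (q, r) * refl (p, q))) ∧
    (Jump n w p r → Jump n (w * refl (p, r)) p q →
      Exch n k K w (key n k p r) (w * refl (p, r) * refl (p, q))) ∧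
    (Jump n w q r → Jump n (w * refl (q, r)) p r →
      Exch n k K w (key n k q r) (w * refl (q, r) * refl (p, r))) := by
  have t1 := t.pq
  have t2 := t.qr
  have t3 := t1.trans t2
  refine ⟨fun j1 j2 => ?_, fun j1 j2 => ?_, fun j1 j2 => ?_⟩
  · rcases t.exch_qr_pq hw j1 j2 with ⟨e1, e2, e3⟩ | ⟨e1, e2, e3⟩
    · exact ⟨_, _, _, g1.trans g2, ⟨p, q, t.lab_pq, hp, hq, t1, e1, rfl, rfl⟩,
        ⟨p, r, t.lab_pr, hp, hr, t3, e2, e3.symm, rfl⟩⟩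
    · exact ⟨_, _, _, g2, ⟨p, r, t.lab_pr, hp, hr, t3, e1, rfl, rfl⟩,
        ⟨q, r, t.lab_qr, hq, hr, t2, e2, e3.symm, rfl⟩⟩
  · obtain ⟨e1, e2, e3⟩ := t.exch_pr_pq hw j1 j2
    exact ⟨_, _, _, g1, ⟨p, q, t.lab_pq, hp, hq, t1, e1, rfl, rfl⟩,
        ⟨q, r, t.lab_qr, hq, hr, t2, e2, e3.symm, rfl⟩⟩
  · obtain ⟨e1, e2, e3⟩ := t.exch_qr_pr hw j1 j2
    exact ⟨_, _, _, g1.trans g2, ⟨p, q, t.lab_pq, hp, hq, t1, e1, rfl, rfl⟩,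
        ⟨q, r, t.lab_qr, hq, hr, t2, e2, e3.symm, rfl⟩⟩

/-- Two labels of a triple. -/
def InTriple (p q r : ℤ) (a b : ℤ) : Prop := (a = p ∧ b = q) ∨ (a = p ∧ b = r) ∨ (a = q ∧ b = r)

theorem Triple.exch {n k K : ℕ} (hk : k < n) {p q r : ℤ} (t : Triple n p q r)
    (hp : p.natAbs ≤ K) (hq : q.natAbs ≤ K) (hr : r.natAbs ≤ K) {w : Equiv.Perm ℤ} (hw : SP n w)
    {a b c d : ℤ} (h1 : InTriple p q r a b) (h2 : InTriple p q r c d)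
    (h : key n k c d < key n k a b) (j1 : Jump n w a b) (j2 : Jump n (w * refl (a, b)) c d) :
    Exch n k K w (key n k a b) (w * refl (a, b) * refl (c, d)) := by
  rcases t.key_cases hk with ⟨g1, g2⟩ | ⟨g1, g2⟩ | ⟨g1, g2, g3⟩
  · obtain ⟨m1, m2, m3⟩ := t.exch_aux hp hq hr hw g1 g2
    rcases h1 with ⟨rfl, rfl⟩ | ⟨rfl, rfl⟩ | ⟨rfl, rfl⟩ <;>
    rcases h2 with ⟨rfl, rfl⟩ | ⟨rfl, rfl⟩ | ⟨rfl, rfl⟩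
    · exact absurd h (lt_irrefl _)
    · exact absurd h g1.not_gt
    · exact absurd h (g1.trans g2).not_gt
    · exact m2 j1 j2
    · exact absurd h (lt_irrefl _)
    · exact absurd h g2.not_gt
    · exact m1 j1 j2
    · exact m3 j1 j2
    · exact absurd h (lt_irrefl _)
  · have e1 := key_mirror (k := k) t.lab_pq
    have e2 := key_mirror (k := k) t.lab_pr
    have e3 := key_mirror (k := k) t.lab_qr
    obtain ⟨m1, m2, m3⟩ := t.mirror.exch_aux (K := K) (by omega) (by omega) (by omega) hw
      (by rw [e2, e3]; exact g1) (by rw [e2, e1]; exact g2)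
    rw [refl_mirror t.lab_pq, refl_mirror t.lab_qr, e1] at m1
    rw [refl_mirror t.lab_pr, refl_mirror t.lab_qr, e2] at m2
    rw [refl_mirror t.lab_pq, refl_mirror t.lab_pr, e1] at m3
    have w1 := hw.mul_refl t.lab_pq
    have w2 := hw.mul_refl t.lab_pr
    rcases h1 with ⟨rfl, rfl⟩ | ⟨rfl, rfl⟩ | ⟨rfl, rfl⟩ <;>
    rcases h2 with ⟨rfl, rfl⟩ | ⟨rfl, rfl⟩ | ⟨rfl, rfl⟩
    · exact absurd h (lt_irrefl _)
    · exact m3 (jump_mirror hw t.lab_pq j1) (jump_mirror w1 t.lab_pr j2)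
    · exact m1 (jump_mirror hw t.lab_pq j1) (jump_mirror w1 t.lab_qr j2)
    · exact absurd h g2.not_gt
    · exact absurd h (lt_irrefl _)
    · exact m2 (jump_mirror hw t.lab_pr j1) (jump_mirror w2 t.lab_qr j2)
    · exact absurd h (g1.trans g2).not_gt
    · exact absurd h g1.not_gt
    · exact absurd h (lt_irrefl _)
  · exfalso
    rcases h1 with ⟨rfl, rfl⟩ | ⟨rfl, rfl⟩ | ⟨rfl, rfl⟩ <;>
    rcases h2 with ⟨rfl, rfl⟩ | ⟨rfl, rfl⟩ | ⟨rfl, rfl⟩ <;> simp_all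

/-- Exchange of two labels that have a letter in common. -/
theorem exch_shared {n k K : ℕ} (hk : k < n) {w : Equiv.Perm ℤ} (hw : SP n w) {a b c d : ℤ}
    (l1 : Lab n a b) (l2 : Lab n c d) (hab : pos n a < pos n b) (hcd : pos n c < pos n d)
    (ha : a.natAbs ≤ K) (hb : b.natAbs ≤ K) (hc : c.natAbs ≤ K) (hd : d.natAbs ≤ K)
    (hs : (c = a ∧ d ≠ b ∧ d ≠ -b) ∨ (c = b ∧ d ≠ -a) ∨ (d = a ∧ c ≠ -b) ∨
      (d = b ∧ c ≠ a ∧ c ≠ -a))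
    (h : key n k c d < key n k a b) (j1 : Jump n w a b) (j2 : Jump n (w * refl (a, b)) c d) :
    Exch n k K w (key n k a b) (w * refl (a, b) * refl (c, d)) := by
  have l1' := l1.2.2
  have l2' := l2.2.2
  rcases hs with ⟨rfl, h1, h2⟩ | ⟨rfl, h1⟩ | ⟨rfl, h1⟩ | ⟨rfl, h1, h2⟩
  · rcases lt_trichotomy (pos n b) (pos n d) with g | g | g
    · exact Triple.exch hk ⟨l1.1, l1.2.1, l2.2.1, hab, g, l1'.2, l2'.2, by omega⟩ ha hb hd hw
        (Or.inl ⟨rfl, rfl⟩) (Or.inr (Or.inl ⟨rfl, rfl⟩)) h j1 j2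
    · exact absurd (pos_inj l1.2.1 l2.2.1 g).symm h1
    · exact Triple.exch hk ⟨l1.1, l2.2.1, l1.2.1, hcd, g, l2'.2, l1'.2, by omega⟩ ha hd hb hw
        (Or.inr (Or.inl ⟨rfl, rfl⟩)) (Or.inl ⟨rfl, rfl⟩) h j1 j2
  · exact Triple.exch hk ⟨l1.1, l1.2.1, l2.2.1, hab, hcd, l1'.2, by omega, l2'.2⟩ ha hb hd hw
        (Or.inl ⟨rfl, rfl⟩) (Or.inr (Or.inr ⟨rfl, rfl⟩)) h j1 j2
  · exact Triple.exch hk ⟨l2.1, l1.1, l1.2.1, hcd, hab, l2'.2, by omega, l1'.2⟩ hc ha hb hw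
        (Or.inr (Or.inr ⟨rfl, rfl⟩)) (Or.inl ⟨rfl, rfl⟩) h j1 j2
  · rcases lt_trichotomy (pos n a) (pos n c) with g | g | g
    · exact Triple.exch hk ⟨l1.1, l2.1, l1.2.1, g, hcd, by omega, l1'.2, l2'.2⟩ ha hc hb hw
        (Or.inr (Or.inl ⟨rfl, rfl⟩)) (Or.inr (Or.inr ⟨rfl, rfl⟩)) h j1 j2
    · exact absurd (pos_inj l1.1 l2.1 g).symm h1
    · exact Triple.exch hk ⟨l2.1, l1.1, l1.2.1, g, hab, by omega, l2'.2, l1'.2⟩ hc ha hb hw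
        (Or.inr (Or.inr ⟨rfl, rfl⟩)) (Or.inr (Or.inl ⟨rfl, rfl⟩)) h j1 j2

theorem exch_cases {a b c d : ℤ}
    (s1 : ¬ ((c = a ∧ d ≠ b ∧ d ≠ -b) ∨ (c = b ∧ d ≠ -a) ∨ (d = a ∧ c ≠ -b) ∨
      (d = b ∧ c ≠ a ∧ c ≠ -a)))
    (s3 : ¬ ((-d = a ∧ -c ≠ b ∧ -c ≠ -b) ∨ (-d = b ∧ -c ≠ -a) ∨ (-c = a ∧ -d ≠ -b) ∨
      (-c = b ∧ -d ≠ a ∧ -d ≠ -a)))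
    (s4 : ¬ (c = a ∧ d = b)) (s5 : ¬ (-d = a ∧ -c = b))
    (t1 : ¬ ((c = a ∧ d = -b) ∨ (c = -b ∧ d = a)))
    (t2 : ¬ ((-d = a ∧ -c = -b) ∨ (-d = -b ∧ -c = a))) :
    c ≠ a ∧ c ≠ -a ∧ c ≠ b ∧ c ≠ -b ∧ d ≠ a ∧ d ≠ -a ∧ d ≠ b ∧ d ≠ -b := by
  refine ⟨fun h => ?_, fun h => ?_, fun h => ?_, fun h => ?_, fun h => ?_, fun h => ?_,
    fun h => ?_, fun h => ?_⟩
  · exact s1 (Or.inl ⟨h, fun e => s4 ⟨h, e⟩, fun e => t1 (Or.inl ⟨h, e⟩)⟩)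
  · have h' : -c = a := by rw [h, neg_neg]
    exact s3 (Or.inr (Or.inr (Or.inl ⟨h', fun e => t2 (Or.inr ⟨e, h'⟩)⟩)))
  · exact s1 (Or.inr (Or.inl ⟨h, fun e => t2 (Or.inl ⟨by rw [e, neg_neg], by rw [h]⟩)⟩))
  · have h' : -c = b := by rw [h, neg_neg]
    exact s3 (Or.inr (Or.inr (Or.inr ⟨h', fun e => s5 ⟨e, h'⟩,
      fun e => t1 (Or.inr ⟨h, neg_injective e⟩)⟩)))
  · exact s1 (Or.inr (Or.inr (Or.inl ⟨h, fun e => t1 (Or.inr ⟨e, h⟩)⟩)))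
  · have h' : -d = a := by rw [h, neg_neg]
    exact s3 (Or.inl ⟨h', fun e => s5 ⟨h', e⟩, fun e => t2 (Or.inl ⟨h', e⟩)⟩)
  · exact s1 (Or.inr (Or.inr (Or.inr ⟨h, fun e => s4 ⟨e, h⟩,
      fun e => t2 (Or.inr ⟨by rw [h], by rw [e, neg_neg]⟩)⟩)))
  · have h' : -d = b := by rw [h, neg_neg]
    exact s3 (Or.inr (Or.inl ⟨h', fun e => t1 (Or.inl ⟨neg_injective e, h⟩)⟩))

theorem Step.exch {n k K : ℕ} (hk : k < n) {w w₁ w₂ : Equiv.Perm ℤ} (hw : SP n w)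
    {e f : ℕ ×ₗ ℕ} (h : Step n k K w e w₁) (h' : Step n k K w₁ f w₂) (hef : f < e) :
    Exch n k K w e w₂ := by
  obtain ⟨a, b, l1, ha, hb, hab, j1, rfl, rfl⟩ := h
  obtain ⟨c, d, l2, hc, hd, hcd, j2, rfl, rfl⟩ := h'
  have w1 := hw.mul_refl l1
  have hc' : (-c).natAbs ≤ K := by rwa [Int.natAbs_neg]
  have hd' : (-d).natAbs ≤ K := by rwa [Int.natAbs_neg]
  have mir : ∀ Q : Prop, (Lab n (-d) (-c) → pos n (-d) < pos n (-c) →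
      key n k (-d) (-c) < key n k a b → Jump n (w * refl (a, b)) (-d) (-c) →
      (w * refl (a, b) * refl (-d, -c) = w * refl (a, b) * refl (c, d)) → Q) → Q := fun Q g =>
    g l2.mirror (pos_mirror_lt l2 hcd) (by rw [key_mirror l2]; exact hef)
      (jump_mirror w1 l2 j2) (by rw [refl_mirror l2])
  by_cases s1 : (c = a ∧ d ≠ b ∧ d ≠ -b) ∨ (c = b ∧ d ≠ -a) ∨ (d = a ∧ c ≠ -b) ∨
      (d = b ∧ c ≠ a ∧ c ≠ -a)
  · by_cases s2 : c = b ∧ d = a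
    · rw [s2.1, s2.2] at hcd; omega
    exact exch_shared hk hw l1 l2 hab hcd ha hb hc hd s1 hef j1 j2
  by_cases s3 : (-d = a ∧ -c ≠ b ∧ -c ≠ -b) ∨ (-d = b ∧ -c ≠ -a) ∨ (-c = a ∧ -d ≠ -b) ∨
      (-c = b ∧ -d ≠ a ∧ -d ≠ -a)
  · refine mir _ fun m1 m2 m3 m4 m5 => ?_
    rw [← m5]
    exact exch_shared hk hw l1 m1 hab m2 ha hb hd' hc' s3 m3 j1 m4
  by_cases s4 : c = a ∧ d = b
  · rw [s4.1, s4.2] at hef; exact absurd hef (lt_irrefl _)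
  by_cases s5 : -d = a ∧ -c = b
  · refine mir _ fun m1 m2 m3 m4 m5 => ?_
    rw [s5.1, s5.2] at m3; exact absurd m3 (lt_irrefl _)
  have fin : ∀ {c d : ℤ}, Lab n c d → c.natAbs ≤ K → d.natAbs ≤ K → pos n c < pos n d →
      key n k c d < key n k a b → (Jump n w c d ∧ Jump n (w * refl (c, d)) a b) →
      refl (c, d) * refl (a, b) = refl (a, b) * refl (c, d) →
      Exch n k K w (key n k a b) (w * refl (a, b) * refl (c, d)) := by
    intro c d l2 hc hd hcd hef hj hm
    exact ⟨_, _, _, hef, ⟨c, d, l2, hc, hd, hcd, hj.1, rfl, rfl⟩,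
      ⟨a, b, l1, ha, hb, hab, hj.2, by rw [mul_assoc, mul_assoc, hm], rfl⟩⟩
  have neg : ∀ {c d : ℤ}, Lab n c d → c.natAbs ≤ K → d.natAbs ≤ K → pos n c < pos n d →
      key n k c d < key n k a b → Jump n (w * refl (a, b)) c d →
      (c = a ∧ d = -b) ∨ (c = -b ∧ d = a) →
      Exch n k K w (key n k a b) (w * refl (a, b) * refl (c, d)) := by
    rintro c d l2 hc hd hcd hef j2 (⟨rfl, rfl⟩ | ⟨rfl, rfl⟩)
    · exact fin l2 hc hd hcd hef (exch_neg hw l1 hab hcd j1 j2) (refl_comm_neg l1).symm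
    · have l1m := l1.mirror
      have q1 := exch_neg hw l1m (pos_mirror_lt l1 hab) (by rwa [neg_neg]) (jump_mirror hw l1 j1)
        (by rw [refl_mirror l1, neg_neg]; exact j2)
      have q2 := refl_comm_neg l1m
      rw [refl_mirror l1, neg_neg] at q2
      rw [neg_neg] at q1
      refine fin l2 hc hd hcd hef ⟨q1.1, ?_⟩ q2.symm
      have q3 := jump_mirror (hw.mul_refl l2) l1m q1.2
      rwa [neg_neg, neg_neg] at q3
  by_cases t1 : (c = a ∧ d = -b) ∨ (c = -b ∧ d = a)
  · exact neg l2 hc hd hcd hef j2 t1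
  by_cases t2 : (-d = a ∧ -c = -b) ∨ (-d = -b ∧ -c = a)
  · refine mir _ fun m1 m2 m3 m4 m5 => ?_
    rw [← m5]
    exact neg m1 hd' hc' m2 m3 m4 t2
  have hdis := exch_cases s1 s3 s4 s5 t1 t2
  exact fin l2 hc hd hcd hef (exch_disjoint hw l1 l2 hdis hab hcd j1 j2)
    (refl_comm_of_disjoint l1 l2 hdis).symm

/-- A path, with the list of the keys of its labels. -/
inductive KPath (n k K : ℕ) : Equiv.Perm ℤ → List (ℕ ×ₗ ℕ) → Equiv.Perm ℤ → Prop
  | nil (w) : KPath n k K w [] w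
  | cons {w c w' cs v} : Step n k K w c w' → KPath n k K w' cs v → KPath n k K w (c :: cs) v

/-- The relation between consecutive keys on a sorted path. -/
def KeyRel (k : ℕ) (c d : ℕ ×ₗ ℕ) : Prop := c < d ∨ d = topKey k

theorem KPath.insert {n k K : ℕ} (hk : k < n) {v : Equiv.Perm ℤ} :
    ∀ (N : ℕ) (c : ℕ ×ₗ ℕ) (w w' : Equiv.Perm ℤ) (cs : List (ℕ ×ₗ ℕ)), SP n w → cs.length ≤ N →
      Step n k K w c w' → KPath n k K w' cs v → cs.IsChain (KeyRel k) →
      ∃ ds, KPath n k K w ds v ∧ ds.IsChain (KeyRel k) ∧ ds.length ≤ cs.length + 1 := by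
  intro N
  induction N with
  | zero =>
    intro c w w' cs hw hN hc hp hs
    obtain rfl : cs = [] := List.length_eq_zero_iff.1 (by omega)
    exact ⟨[c], .cons hc hp, List.isChain_singleton _, by simp⟩
  | succ N ih =>
    intro c
    induction c using WellFoundedLT.induction with
    | ind c ihc =>
      intro w w' cs hw hN hc hp hs
      cases hp with
      | nil => exact ⟨[c], .cons hc (.nil _), List.isChain_singleton _, by simp⟩
      | @cons _ d w₂ cs _ hd hp =>
        by_cases hcd : KeyRel k c d
        · exact ⟨c :: d :: cs, .cons hc (.cons hd hp), List.isChain_cons_cons.2 ⟨hcd, hs⟩, by simp⟩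
        · unfold KeyRel at hcd
          push Not at hcd
          have hs' := List.IsChain.tail hs
          rw [List.tail_cons] at hs'
          rw [List.length_cons] at hN
          rcases hcd.1.lt_or_eq with hlt | rfl
          · obtain ⟨c', d', w₁, h1, h2, h3⟩ := hc.exch hk hw hd hlt
            obtain ⟨ds, g1, g2, g3⟩ := ih d' w₁ w₂ cs (h2.sp hw) (by omega) h3 hp hs'
            obtain ⟨es, f1, f2, f3⟩ := ihc c' h1 w w₁ ds hw (by omega) h2 g1 g2
            exact ⟨es, f1, f2, by rw [List.length_cons]; omega⟩
          · obtain rfl := hc.cancel hk hd hcd.2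
            exact ⟨cs, hp, hs', by rw [List.length_cons]; omega⟩

theorem KPath.sort {n k K : ℕ} (hk : k < n) {w v : Equiv.Perm ℤ} {cs : List (ℕ ×ₗ ℕ)}
    (hw : SP n w) (h : KPath n k K w cs v) :
    ∃ ds, KPath n k K w ds v ∧ ds.IsChain (KeyRel k) := by
  induction h with
  | nil => exact ⟨[], .nil _, List.isChain_nil⟩
  | cons h1 h2 ih =>
    obtain ⟨ds, g1, g2⟩ := ih (h1.sp hw)
    obtain ⟨es, f1, f2, -⟩ := KPath.insert hk ds.length _ _ _ ds hw le_rfl h1 g1 g2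
    exact ⟨es, f1, f2⟩

/-! ### Existence of paths in a segment -/

theorem key_rowLab {n k : ℕ} {i m : ℤ} (h : RowLab n k i m) :
    key n k i m = toLex ((k - i).toNat, (pos n m).toNat) := by
  have hm := pos_bounds h.lab.2.1
  unfold RowLab at h
  unfold key
  rw [pos_of_pos (by omega)]
  obtain ⟨I, M, s, e⟩ := exists_keySpec (n := n) (k := k) (x := i) (y := 2 * n + 1 - pos n m)
    h.2.2.1 (by omega) (by omega) (by omega) (by omega)
  rw [e]
  have : (I : ℤ) = k - i ∧ (M : ℤ) = pos n m := by
    unfold KeySpec at s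
    unfold pos at *
    split_ifs at * <;> omega
  rw [← this.1, ← this.2, Int.toNat_natCast, Int.toNat_natCast]

theorem rowLab_of_key_ne {n k : ℕ} (hk : k < n) {a b : ℤ} (h : Lab n a b)
    (hab : pos n a < pos n b) (hkey : key n k a b ≠ topKey k) :
    RowLab n k a b ∨ RowLab n k (-b) (-a) := by
  have h1 := pos_bounds h.1
  have h2 := pos_bounds h.2.1
  have h3 := h.2.2
  by_contra hc
  apply hkey
  unfold key
  obtain ⟨I, M, s, e⟩ := exists_keySpec (n := n) (k := k) (x := pos n a) (y := 2 * n + 1 - pos n b)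
    hk (by omega) (by omega) (by omega) (by omega)
  rw [e]
  have : I = k ∧ M = 0 := by
    obtain ⟨⟨-, ha⟩, ⟨-, hb⟩, -⟩ := h
    unfold KeySpec at s
    unfold RowLab at hc
    unfold pos at *
    split_ifs at * <;> omega
  rw [this.1, this.2]; rfl

theorem refl_mem_of_key_eq {n k : ℕ} (hk : k < n) {a b : ℤ} (h : Lab n a b)
    (hab : pos n a < pos n b) (hkey : key n k a b = topKey k) (x : ℤ) :
    refl (a, b) x ∈ Icc (1 : ℤ) k ↔ x ∈ Icc (1 : ℤ) k := by
  have h1 := pos_bounds h.1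
  have h2 := pos_bounds h.2.1
  have : (0 < a ∧ a ≤ k ∧ 0 < b ∧ b ≤ k) ∨ (a < 0 ∧ -a ≤ k ∧ b < 0 ∧ -b ≤ k) ∨
      (k < a.natAbs ∧ k < b.natAbs) := by
    unfold key at hkey
    obtain ⟨I, M, s, e⟩ := exists_keySpec (n := n) (k := k) (x := pos n a)
      (y := 2 * n + 1 - pos n b) hk (by omega) (by omega) (by omega) (by omega)
    rw [e, topKey, EmbeddingLike.apply_eq_iff_eq, Prod.mk.injEq] at hkey
    obtain ⟨⟨-, ha⟩, ⟨-, hb⟩, -⟩ := h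
    unfold KeySpec at s
    unfold pos at *
    split_ifs at * <;> omega
  rw [mem_Icc, mem_Icc]
  rcases refl_cases h x with ⟨g, g'⟩ | ⟨g, g'⟩ | ⟨g, g'⟩ | ⟨g, g'⟩ | ⟨c1, c2, c3, c4, g'⟩ <;>
    rw [g'] <;> omega

/-- The set of the entries of the column `w[1,k]`. -/
noncomputable def colSet (k : ℕ) (w : Equiv.Perm ℤ) : Finset ℤ := (Icc (1 : ℤ) k).image w

theorem colSet_mul {k : ℕ} {w s : Equiv.Perm ℤ}
    (h : ∀ x, s x ∈ Icc (1 : ℤ) k ↔ x ∈ Icc (1 : ℤ) k) : colSet k (w * s) = colSet k w := by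
  unfold colSet
  ext y
  simp only [mem_image, Equiv.Perm.mul_apply]
  constructor
  · rintro ⟨x, hx, rfl⟩
    exact ⟨s x, (h x).2 hx, rfl⟩
  · rintro ⟨x, hx, rfl⟩
    refine ⟨s.symm x, (h _).1 ?_, ?_⟩ <;> rw [Equiv.apply_symm_apply]
    exact hx

theorem KPath.colSet_eq {n k K : ℕ} (hk : k < n) {w v : Equiv.Perm ℤ} {cs : List (ℕ ×ₗ ℕ)}
    (h : KPath n k K w cs v) (hc : ∀ c ∈ cs, c = topKey k) : colSet k v = colSet k w := by
  induction h with
  | nil => rfl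
  | cons h1 h2 ih =>
    rw [List.forall_mem_cons] at hc
    rw [ih hc.2]
    obtain ⟨a, b, l, -, -, hab, -, rfl, e⟩ := h1
    exact colSet_mul fun x => refl_mem_of_key_eq hk l hab (e ▸ hc.1) x

/-- The key of a label. -/
def lkey (n k : ℕ) (β : ℤ × ℤ) : ℕ ×ₗ ℕ := key n k β.1 β.2

theorem KPath.le {n k K : ℕ} {w v : Equiv.Perm ℤ} {cs : List (ℕ ×ₗ ℕ)} (h : KPath n k K w cs v) :
    ∀ c ∈ cs, c ≤ topKey k := by
  induction h with
  | nil => simp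
  | cons h1 h2 ih => exact List.forall_mem_cons.2 ⟨h1.le, ih⟩

theorem keyRel_top {k : ℕ} {c : ℕ ×ₗ ℕ} {cs : List (ℕ ×ₗ ℕ)} (h : ∀ d ∈ cs, d ≤ topKey k)
    (hc : (c :: cs).IsChain (KeyRel k)) (e : c = topKey k) : ∀ d ∈ c :: cs, d = topKey k := by
  induction cs generalizing c with
  | nil => simpa using e
  | cons d ds ih =>
    rw [List.isChain_cons_cons] at hc
    rw [List.forall_mem_cons] at h
    have hd : d = topKey k := by
      rcases hc.1 with g | g
      · rw [e] at g; exact absurd h.1 g.not_ge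
      · exact g
    rw [List.forall_mem_cons]
    exact ⟨e, ih h.2 hc.2 hd⟩

theorem KPath.split {n k K : ℕ} (hk : k < n) {G : List (ℤ × ℤ)}
    (hG : ∀ i m, RowLab n k i m → i.natAbs ≤ K → m.natAbs ≤ K → (i, m) ∈ G)
    {w v : Equiv.Perm ℤ} {cs : List (ℕ ×ₗ ℕ)} (hw : SP n w) (h : KPath n k K w cs v)
    (hc : cs.IsChain (KeyRel k)) :
    ∃ T ds, (∀ β ∈ T, β ∈ G ∧ lkey n k β ≠ topKey k) ∧ T.map (lkey n k) ++ ds = cs ∧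
      IsQPath n w T ∧ KPath n k K (endw w T) ds v ∧ ∀ d ∈ ds, d = topKey k := by
  induction h with
  | nil w => exact ⟨[], [], by simp, rfl, trivial, by rw [endw_nil]; exact .nil _, by simp⟩
  | @cons w c w' cs v h1 h2 ih =>
    by_cases e : c = topKey k
    · refine ⟨[], c :: cs, by simp, rfl, trivial, by rw [endw_nil]; exact .cons h1 h2, ?_⟩
      exact keyRel_top h2.le hc e
    · have hc' := List.IsChain.tail hc
      obtain ⟨T, ds, g1, g2, g3, g4, g5⟩ := ih (h1.sp hw) hc'
      obtain ⟨a, b, l, ha, hb, hab, hj, rfl, rfl⟩ := h1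
      have main : ∀ {a b : ℤ}, RowLab n k a b → a.natAbs ≤ K → b.natAbs ≤ K → Jump n w a b →
          ∀ s c, refl (a, b) = s → key n k a b = c → 
          (∀ β ∈ T, β ∈ G ∧ lkey n k β ≠ topKey k) → c ≠ topKey k →
          IsQPath n (w * s) T → KPath n k K (endw (w * s) T) ds v →
          ∃ T ds', (∀ β ∈ T, β ∈ G ∧ lkey n k β ≠ topKey k) ∧ T.map (lkey n k) ++ ds' = c :: cs ∧
            IsQPath n w T ∧ KPath n k K (endw w T) ds' v ∧ ∀ d ∈ ds', d = topKey k := by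
        rintro a b hr ha hb hj _ _ rfl rfl g1 e g3 g4
        refine ⟨(a, b) :: T, ds, ?_, ?_, ⟨(qEdge_iff hw hr.lab hr.pos_lt).2 hj, g3⟩, ?_, g5⟩
        · rw [List.forall_mem_cons]
          exact ⟨⟨hG _ _ hr ha hb, e⟩, g1⟩
        · rw [List.map_cons, List.cons_append, g2]; rfl
        · rw [endw_cons]; exact g4
      rcases rowLab_of_key_ne hk l hab e with hr | hr
      · exact main hr ha hb hj _ _ rfl rfl g1 e g3 g4
      · exact main hr (by omega) (by omega) (jump_mirror hw l hj) _ _ (refl_mirror l)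
          (key_mirror l) g1 e g3 g4

theorem sublist_of_keys {n k : ℕ} {G T : List (ℤ × ℤ)}
    (hG : G.Pairwise (fun β γ => lkey n k β < lkey n k γ))
    (hT : T.Pairwise (fun β γ => lkey n k β < lkey n k γ)) (h : ∀ β ∈ T, β ∈ G) :
    T.Sublist G := by
  have hd : T.Nodup := hT.imp fun h e => by rw [e] at h; exact lt_irrefl _ h
  have : Std.Antisymm (fun β γ : ℤ × ℤ => lkey n k β < lkey n k γ) :=
    ⟨fun a b h1 h2 => absurd h1 h2.not_gt⟩
  exact List.sublist_of_subperm_of_pairwise (List.subperm_of_subset hd h) hT hG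

theorem pairwise_rowsDown {n k : ℕ} {F : ℕ → List (ℤ × ℤ)} (hF : Rows n k F) (i : ℕ)
    (hik : i ≤ k) : (rowsDown F i).Pairwise (fun β γ => lkey n k β < lkey n k γ) := by
  have hr : ∀ i : ℕ, 1 ≤ i → i ≤ k → ∀ β ∈ F i, RowLab n k β.1 β.2 ∧ β.1 = i := by
    intro i h1 h2 β hβ
    obtain ⟨h3, h4⟩ := (hF i h1 h2).1 β hβ
    rw [h3]; exact ⟨h4, rfl⟩
  induction i with
  | zero => exact List.Pairwise.nil
  | succ i ih =>
    rw [rowsDown_succ, List.pairwise_append]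
    refine ⟨?_, ih (by omega), ?_⟩
    · refine (hF (i + 1) (by omega) hik).2.imp_of_mem fun {β γ} hβ hγ h => ?_
      obtain ⟨l1, e1⟩ := hr _ (by omega) hik β hβ
      obtain ⟨l2, e2⟩ := hr _ (by omega) hik γ hγ
      have := pos_bounds l2.lab.2.1
      unfold lkey
      rw [key_rowLab l1, key_rowLab l2, Prod.Lex.toLex_lt_toLex]
      dsimp only
      omega
    · intro β hβ γ hγ
      obtain ⟨l1, e1⟩ := hr _ (by omega) hik β hβ
      obtain ⟨l2, e2⟩ := hF.above (by omega) γ hγ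
      have h2 := l2.1
      have h1 := l1.2.1
      unfold lkey
      rw [key_rowLab l1, key_rowLab l2, Prod.Lex.toLex_lt_toLex]
      dsimp only
      omega

/-- A path to `v` gives a path in a segment to a word with the same column set as `v`. -/
theorem exists_sublist_of_kPath {n k K : ℕ} (hk : k < n) {F : ℕ → List (ℤ × ℤ)} (hF : Rows n k F)
    (hG : ∀ i m, RowLab n k i m → i.natAbs ≤ K → m.natAbs ≤ K → (i, m) ∈ rowsDown F k)
    {w v : Equiv.Perm ℤ} {cs : List (ℕ ×ₗ ℕ)} (hw : SP n w) (h : KPath n k K w cs v) :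
    ∃ T, T.Sublist (rowsDown F k) ∧ IsQPath n w T ∧ colSet k (endw w T) = colSet k v := by
  obtain ⟨ds, h1, h2⟩ := h.sort hk hw
  obtain ⟨T, es, g1, rfl, g3, g4, g5⟩ := h1.split hk hG hw h2
  refine ⟨T, sublist_of_keys (pairwise_rowsDown hF k le_rfl) ?_ fun β hβ => (g1 β hβ).1, g3,
    (g4.colSet_eq hk g5).symm⟩
  have h3 := h2.left_of_append
  rw [List.isChain_map] at h3
  have h4 : T.IsChain (fun β γ => lkey n k β < lkey n k γ) := by
    refine List.IsChain.imp_of_mem_imp (fun β γ hβ hγ h => ?_) h3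
    exact h.resolve_right (g1 γ hγ).2
  have : IsTrans (ℤ × ℤ) (fun β γ => lkey n k β < lkey n k γ) := ⟨fun a b c h1 h2 => h1.trans h2⟩
  exact List.isChain_iff_pairwise.1 h4

/-- There is a path from `w` to `v` whose labels have letters of absolute value at most `K`. -/
def Reach (n k K : ℕ) (w v : Equiv.Perm ℤ) : Prop := ∃ cs, KPath n k K w cs v

theorem Reach.refl (n k K : ℕ) (w : Equiv.Perm ℤ) : Reach n k K w w := ⟨[], .nil w⟩

theorem KPath.append {n k K : ℕ} {u v w : Equiv.Perm ℤ} {cs ds : List (ℕ ×ₗ ℕ)}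
    (h1 : KPath n k K u cs v) (h2 : KPath n k K v ds w) : KPath n k K u (cs ++ ds) w := by
  induction h1 with
  | nil => exact h2
  | cons h _ ih => exact .cons h (ih h2)

theorem Reach.trans {n k K : ℕ} {u v w : Equiv.Perm ℤ} (h1 : Reach n k K u v)
    (h2 : Reach n k K v w) : Reach n k K u w := by
  obtain ⟨cs, h1⟩ := h1
  obtain ⟨ds, h2⟩ := h2
  exact ⟨_, h1.append h2⟩

theorem Reach.sp {n k K : ℕ} {w v : Equiv.Perm ℤ} (h : Reach n k K w v) (hw : SP n w) :
    SP n v := by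
  obtain ⟨cs, h⟩ := h
  induction h with
  | nil => exact hw
  | cons h1 _ ih => exact ih (h1.sp hw)

theorem Reach.of_jump {n k K : ℕ} {w : Equiv.Perm ℤ} {a b : ℤ} (h : Lab n a b)
    (ha : a.natAbs ≤ K) (hb : b.natAbs ≤ K) (hab : pos n a < pos n b) (hj : Jump n w a b) :
    Reach n k K w (w * QAlcoveD.refl (a, b)) :=
  ⟨_, .cons ⟨a, b, h, ha, hb, hab, hj, rfl, rfl⟩ (.nil _)⟩

theorem conj_swap (s : Equiv.Perm ℤ) (a b : ℤ) :
    s * Equiv.swap a b = Equiv.swap (s a) (s b) * s := by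
  rw [Equiv.mul_swap_eq_swap_mul]

theorem conj_refl {n : ℕ} {s : Equiv.Perm ℤ} (hs : SP n s) (a b : ℤ) :
    s * refl (a, b) = refl (s a, s b) * s := by
  unfold refl
  dsimp only
  rw [← mul_assoc, conj_swap s a b, mul_assoc, conj_swap s (-a) (-b), hs.neg, hs.neg, mul_assoc]

/-- A reflection is conjugated by another one. -/
theorem refl_conj {n : ℕ} {a b c d : ℤ} (h : Lab n c d) :
    refl (c, d) * refl (a, b) * refl (c, d) = refl (refl (c, d) a, refl (c, d) b) := by
  have hs : SP n (refl (c, d)) := by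
    have := (SP.one n).mul_refl h
    rwa [one_mul] at this
  rw [conj_refl hs, mul_assoc, refl_mul_refl h, mul_one]

theorem reach_conj {n k K : ℕ} {a b c d : ℤ} (h : Lab n c d)
    (h1 : ∀ w, SP n w → Reach n k K w (w * refl (c, d)))
    (h2 : ∀ w, SP n w → Reach n k K w (w * refl (a, b))) {w : Equiv.Perm ℤ} (hw : SP n w) :
    Reach n k K w (w * refl (refl (c, d) a, refl (c, d) b)) := by
  have g1 := h1 w hw
  have g2 := g1.trans (h2 _ (g1.sp hw))
  have g3 := g2.trans (h1 _ (g2.sp hw))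
  rwa [mul_assoc, mul_assoc, ← mul_assoc (refl (c, d)), refl_conj h] at g3

theorem lab_of_lt {n : ℕ} {i m : ℤ} (h1 : 1 ≤ i) (h2 : i < m) (h3 : m ≤ n) : Lab n i m := by
  unfold Lab IsLetter; omega

theorem lab_neg_of_lt {n : ℕ} {i m : ℤ} (h1 : 1 ≤ i) (h2 : i < m) (h3 : m ≤ n) : Lab n i (-m) := by
  unfold Lab IsLetter; omega

theorem reach_adj {n k K : ℕ} (hK : K ≤ n) {w : Equiv.Perm ℤ} {i : ℤ} (h1 : 1 ≤ i)
    (h2 : i + 1 ≤ K) : Reach n k K w (w * refl (i, i + 1)) := by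
  have hl : Lab n i (i + 1) := lab_of_lt h1 (by omega) (by omega)
  have p1 : pos n i = i := pos_of_pos (by omega)
  have p2 : pos n (i + 1) = i + 1 := pos_of_pos (by omega)
  exact Reach.of_jump hl (by omega) (by omega) (by omega) fun l hl' g1 g2 => by omega

theorem reach_pos {n k K : ℕ} (hK : K ≤ n) {i : ℤ} (h1 : 1 ≤ i) (d : ℕ) :
    i + d + 1 ≤ K → ∀ w, SP n w → Reach n k K w (w * refl (i, i + d + 1)) := by
  induction d with
  | zero => intro h w hw; simpa using reach_adj hK h1 (by simpa using h)
  | succ d ih =>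
    intro h w hw
    push_cast at h
    have hl : Lab n (i + d + 1) (i + d + 1 + 1) := lab_of_lt (by omega) (by omega) (by omega)
    have := reach_conj hl (fun w _ => reach_adj hK (by omega) (by omega)) (ih (by omega)) hw
    rw [refl_of_ne (by omega) (by omega) (by omega) (by omega), refl_fst hl] at this
    convert this using 4
    push_cast; ring

theorem reach_refl {n k K : ℕ} (hK : K ≤ n) {i m : ℤ} (h1 : 1 ≤ i) (h2 : i < m) (h3 : m ≤ K)
    {w : Equiv.Perm ℤ} (hw : SP n w) : Reach n k K w (w * refl (i, m)) := by
  have := reach_pos (k := k) hK h1 (m - i - 1).toNat (by omega) w hw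
  rwa [show i + ((m - i - 1).toNat : ℤ) + 1 = m by omega] at this

theorem reach_last {n k : ℕ} (hn : 2 ≤ n) {w : Equiv.Perm ℤ} :
    Reach n k n w (w * refl (n - 1, -n)) := by
  have hl : Lab n ((n : ℤ) - 1) (-n) := lab_neg_of_lt (by omega) (by omega) le_rfl
  have p1 : pos n ((n : ℤ) - 1) = n - 1 := pos_of_pos (by omega)
  have p2 : pos n (-(n : ℤ)) = n + 1 := by rw [pos_of_neg (by omega)]; ring
  have p3 : pos n (n : ℤ) = n := pos_of_pos (by omega)
  refine Reach.of_jump hl (by omega) (by omega) (by omega) fun l hl' g1 g2 g3 g4 => ?_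
  have hln : IsLetter n n := ⟨by omega, by omega⟩
  have : l = n := pos_inj hl' hln (by omega)
  omega

theorem reach_neg {n k : ℕ} {i m : ℤ} (h1 : 1 ≤ i) (h2 : i < m) (h3 : m ≤ n)
    {w : Equiv.Perm ℤ} (hw : SP n w) : Reach n k n w (w * refl (i, -m)) := by
  have a1 : ∀ w, SP n w → Reach n k n w (w * refl (i, -n)) := by
    intro w hw
    by_cases hi : i = n - 1
    · rw [hi]; exact reach_last (by omega)
    · have hl : Lab n i ((n : ℤ) - 1) := lab_of_lt h1 (by omega) (by omega)
      have := reach_conj (k := k) hl (fun w hw => reach_refl le_rfl h1 (by omega) (by omega) hw)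
        (fun w _ => reach_last (by omega)) hw
      rwa [refl_snd hl, refl_of_ne (by omega) (by omega) (by omega) (by omega)] at this
  by_cases hm : m = n
  · rw [hm]; exact a1 w hw
  · have hl : Lab n m n := lab_of_lt (by omega) (by omega) (by omega)
    have := reach_conj (k := k) hl
      (fun w hw => reach_refl le_rfl (by omega) (by omega) (by omega) hw) a1 hw
    rwa [refl_neg_snd hl, refl_of_ne (by omega) (by omega) (by omega) (by omega)] at this

/-- Any letter outside the first rows can be moved into the next row. -/
theorem exists_reach_row {n k : ℕ} {j q : ℤ} (h1 : 1 ≤ j) (hj : j < n) (hq : IsLetter n q)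
    (hjq : j ≤ q.natAbs) {w : Equiv.Perm ℤ} (hw : SP n w) :
    ∃ v, Reach n k n w v ∧ v j = w q ∧ ∀ x : ℤ, 1 ≤ x → x < j → v x = w x := by
  have aux : ∀ w, SP n w → ∀ q : ℤ, IsLetter n q → j < q.natAbs →
      ∃ v, Reach n k n w v ∧ v j = w q ∧ ∀ x : ℤ, 1 ≤ x → x < j → v x = w x := by
    intro w hw q hq hjq
    have hq2 := hq.2
    rcases lt_or_ge 0 q with h | h
    · have hl : Lab n j q := lab_of_lt h1 (by omega) (by omega)
      refine ⟨_, reach_refl le_rfl h1 (by omega) (by omega) hw, mul_refl_fst hl, fun x g1 g2 => ?_⟩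
      exact mul_refl_of_ne (by omega) (by omega) (by omega) (by omega)
    · have hl : Lab n j q := by
        have := lab_neg_of_lt (n := n) (m := -q) h1 (by omega) (by omega)
        rwa [neg_neg] at this
      have := reach_neg (n := n) (k := k) (m := -q) h1 (by omega) (by omega) hw
      rw [neg_neg] at this
      refine ⟨_, this, mul_refl_fst hl, fun x g1 g2 => ?_⟩
      exact mul_refl_of_ne (by omega) (by omega) (by omega) (by omega)
  by_cases hjq' : j < q.natAbs
  · exact aux w hw q hq hjq'
  by_cases e : q = j
  · exact ⟨w, .refl _ _ _ _, by rw [e], fun _ _ _ => rfl⟩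
  have e' : q = -j := by omega
  have hl : Lab n j n := lab_of_lt h1 hj le_rfl
  have r1 := reach_refl (n := n) (k := k) le_rfl h1 hj le_rfl hw
  obtain ⟨v, g1, g2, g3⟩ := aux _ (r1.sp hw) (-n) ⟨by omega, by omega⟩ (by omega)
  refine ⟨v, r1.trans g1, ?_, fun x g4 g5 => ?_⟩
  · rw [g2, mul_refl_neg_snd hw hl, e', hw.neg]
  · rw [g3 x g4 g5, mul_refl_of_ne (by omega) (by omega) (by omega) (by omega)]

/-- A column: the letters have different absolute values. -/
def IsCol (n : ℕ) (S : Finset ℤ) : Prop := ∀ x ∈ S, IsLetter n x ∧ -x ∉ S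

theorem mem_colSet {k : ℕ} {w : Equiv.Perm ℤ} {y : ℤ} :
    y ∈ colSet k w ↔ ∃ x : ℤ, 1 ≤ x ∧ x ≤ k ∧ w x = y := by
  unfold colSet
  simp only [mem_image, mem_Icc, and_assoc]

theorem isCol_colSet {n k : ℕ} (hk : k ≤ n) {w : Equiv.Perm ℤ} (hw : SP n w) :
    IsCol n (colSet k w) := by
  intro y hy
  obtain ⟨x, h1, h2, rfl⟩ := mem_colSet.1 hy
  refine ⟨hw.letter ⟨by omega, by omega⟩, fun h => ?_⟩
  obtain ⟨x', h3, h4, h5⟩ := mem_colSet.1 h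
  rw [← hw.neg] at h5
  have := w.injective h5
  omega

theorem card_colSet (k : ℕ) (w : Equiv.Perm ℤ) : (colSet k w).card = k := by
  unfold colSet
  rw [card_image_of_injective _ w.injective, Int.card_Icc]
  omega

theorem colSet_succ (k : ℕ) (w : Equiv.Perm ℤ) :
    colSet (k + 1) w = insert (w ((k : ℤ) + 1)) (colSet k w) := by
  ext y
  rw [mem_insert, mem_colSet, mem_colSet]
  constructor
  · rintro ⟨x, h1, h2, rfl⟩
    by_cases e : x = k + 1
    · left; rw [e]
    · right; exact ⟨x, h1, by push_cast at h2; omega, rfl⟩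
  · rintro (rfl | ⟨x, h1, h2, rfl⟩)
    · exact ⟨_, by omega, by push_cast; omega, rfl⟩
    · exact ⟨x, h1, by push_cast; omega, rfl⟩

theorem colSet_congr {k : ℕ} {w v : Equiv.Perm ℤ} (h : ∀ x : ℤ, 1 ≤ x → x ≤ k → v x = w x) :
    colSet k v = colSet k w := by
  unfold colSet
  exact image_congr fun x hx => h x (mem_Icc.1 hx).1 (mem_Icc.1 hx).2

/-- All columns can be reached. -/
theorem exists_reach_colSet {n k : ℕ} {w : Equiv.Perm ℤ} (hw : SP n w) (j : ℕ) :
    j < n → ∀ S, IsCol n S → S.card = j → ∃ v, Reach n k n w v ∧ colSet j v = S := by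
  induction j with
  | zero =>
    intro _ S _ hS
    exact ⟨w, .refl _ _ _ _, by rw [card_eq_zero.1 hS]; rfl⟩
  | succ j ih =>
    intro hj S hS hc
    obtain ⟨x, hx⟩ : S.Nonempty := card_pos.1 (by omega)
    obtain ⟨v, h1, h2⟩ := ih (by omega) (S.erase x) (fun y hy => by
      obtain ⟨h1, h2⟩ := mem_erase.1 hy
      exact ⟨(hS y h2).1, fun h => (hS y h2).2 (mem_erase.1 h).2⟩) (by rw [card_erase_of_mem hx]; omega)
    have hv := h1.sp hw
    obtain ⟨q, hq, e⟩ := hv.symm_letter (hS x hx).1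
    have hjq : ((j : ℤ) + 1) ≤ q.natAbs := by
      by_contra hcon
      have hq0 := hq.1
      rcases lt_or_ge 0 q with h | h
      · have : x ∈ colSet j v := mem_colSet.2 ⟨q, by omega, by omega, e⟩
        rw [h2] at this
        exact notMem_erase _ _ this
      · have : -x ∈ colSet j v := mem_colSet.2 ⟨-q, by omega, by omega, by rw [hv.neg, e]⟩
        rw [h2] at this
        exact (hS x hx).2 (mem_erase.1 this).2
    obtain ⟨u, g1, g2, g3⟩ := exists_reach_row (n := n) (k := k) (j := (j : ℤ) + 1) (by omega)
      (by omega) hq hjq hv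
    refine ⟨u, h1.trans g1, ?_⟩
    rw [colSet_succ, g2, e, colSet_congr (w := v) fun y h3 h4 => g3 y h3 (by omega), h2,
      insert_erase hx]

/-! ### The moves of the right segments -/

/-- The column set `S'` arises from `S` by changing the signs of two letters `a`, `b`, where no
letter that is not used lies between `a` and `-b`. -/
def Move (n : ℕ) (S S' : Finset ℤ) : Prop :=
  ∃ a b, a ∈ S ∧ b ∈ S ∧ a ≠ b ∧ S' = insert (-a) (insert (-b) ((S.erase a).erase b)) ∧
    ∀ u, IsLetter n u → u ∉ S → -u ∉ S → ¬ Bt (pos n a) (pos n u) (pos n (-b))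

theorem mem_colSet_iff_of_letter {n k : ℕ} {w : Equiv.Perm ℤ} (hw : SP n w) {q : ℤ}
    (hq : IsLetter n q) : (w q ∉ colSet k w ∧ -w q ∉ colSet k w) ↔ k < q.natAbs := by
  have hq0 := hq.1
  rw [mem_colSet, mem_colSet]
  constructor
  · rintro ⟨h1, h2⟩
    by_contra hc
    rcases lt_or_ge 0 q with h | h
    · exact h1 ⟨q, by omega, by omega, rfl⟩
    · exact h2 ⟨-q, by omega, by omega, hw.neg q⟩
  · intro h
    refine ⟨?_, ?_⟩
    · rintro ⟨x, h1, h2, h3⟩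
      have := w.injective h3; omega
    · rintro ⟨x, h1, h2, h3⟩
      rw [← hw.neg] at h3
      have := w.injective h3; omega

theorem colSet_mul_refl_neg {n k : ℕ} (hk : k ≤ n) {w : Equiv.Perm ℤ} (hw : SP n w) {i j : ℤ}
    (hi : 1 ≤ i) (hik : i ≤ k) (hj : 1 ≤ j) (hjk : j ≤ k) (hij : i ≠ j) :
    colSet k (w * refl (i, -j)) =
      insert (-w i) (insert (-w j) (((colSet k w).erase (w i)).erase (w j))) := by
  have hl : Lab n i (-j) := by unfold Lab IsLetter; omega
  have ei : (w * refl (i, -j)) i = -w j := by rw [mul_refl_fst hl, hw.neg]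
  have ej : (w * refl (i, -j)) j = -w i := by
    have := mul_refl_neg_snd hw hl
    rwa [neg_neg] at this
  ext y
  simp only [mem_insert, mem_erase, mem_colSet]
  constructor
  · rintro ⟨x, h1, h2, rfl⟩
    by_cases c1 : x = i
    · rw [c1, ei]; exact Or.inr (Or.inl rfl)
    by_cases c2 : x = j
    · rw [c2, ej]; exact Or.inl rfl
    rw [mul_refl_of_ne c1 (by omega) (by omega) (by omega)]
    exact Or.inr (Or.inr ⟨fun e => c2 (w.injective e), fun e => c1 (w.injective e), x, h1, h2, rfl⟩)
  · rintro (rfl | rfl | ⟨h1, h2, x, h3, h4, rfl⟩)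
    · exact ⟨j, hj, hjk, ej⟩
    · exact ⟨i, hi, hik, ei⟩
    · refine ⟨x, h3, h4, mul_refl_of_ne ?_ (by omega) (by omega) ?_⟩
      · rintro rfl; exact h2 rfl
      · rintro rfl; rw [neg_neg] at h1; exact h1 rfl

theorem move_of_jump {n k : ℕ} (hk : k ≤ n) {w : Equiv.Perm ℤ} (hw : SP n w) {i j : ℤ}
    (hj : 1 ≤ j) (hji : j < i) (hik : i ≤ k) (h : Jump n w i (-j)) :
    Move n (colSet k w) (colSet k (w * refl (i, -j))) := by
  refine ⟨w i, w j, mem_colSet.2 ⟨i, by omega, hik, rfl⟩, mem_colSet.2 ⟨j, hj, by omega, rfl⟩,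
    fun e => by have := w.injective e; omega,
    colSet_mul_refl_neg hk hw (by omega) hik hj (by omega) (by omega), fun u hu h1 h2 => ?_⟩
  obtain ⟨q, hq, rfl⟩ := hw.symm_letter hu
  have hkq := (mem_colSet_iff_of_letter hw hq).1 ⟨h1, h2⟩
  have hq2 := hq.2
  have p1 : pos n i = i := pos_of_pos (by omega)
  have p2 : pos n (-j) = 2 * n + 1 - j := by rw [pos_of_neg (by omega)]; ring
  have p3 : k < pos n q ∧ pos n q ≤ 2 * n - k := by unfold pos; split_ifs <;> omega
  have := h q hq (by omega) (by omega) (by omega) (by omega)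
  rwa [hw.neg] at this

theorem colSet_mul_refl_pos {n k : ℕ} (hk : k ≤ n) (w : Equiv.Perm ℤ) {i m : ℤ} (hi : 1 ≤ i)
    (him : i < m) (hm : m ≤ k) : colSet k (w * refl (i, m)) = colSet k w := by
  refine colSet_mul fun x => ?_
  rw [mem_Icc, mem_Icc]
  rcases refl_cases (lab_of_lt (n := n) hi him (by omega)) x with ⟨g, g'⟩ | ⟨g, g'⟩ | ⟨g, g'⟩ |
    ⟨g, g'⟩ | ⟨c1, c2, c3, c4, g'⟩ <;> rw [g'] <;> omega

theorem exists_reach_swap {n k : ℕ} (hk : k ≤ n) {w : Equiv.Perm ℤ} (hw : SP n w) {i m : ℤ}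
    (hi : 1 ≤ i) (him : i ≤ m) (hm : m ≤ k) :
    ∃ v, Reach n k k w v ∧ colSet k v = colSet k w ∧ v m = w i ∧ ∀ x : ℤ, m < x → v x = w x := by
  by_cases e : i = m
  · exact ⟨w, .refl _ _ _ _, rfl, by rw [e], fun _ _ => rfl⟩
  · have hl : Lab n i m := lab_of_lt hi (by omega) (by omega)
    exact ⟨_, reach_refl hk hi (by omega) hm hw, colSet_mul_refl_pos hk w hi (by omega) hm,
      mul_refl_snd hl, fun x hx => mul_refl_of_ne (by omega) (by omega) (by omega) (by omega)⟩

theorem exists_reach_move {n k : ℕ} (hk : k < n) {w : Equiv.Perm ℤ} (hw : SP n w) {S' : Finset ℤ}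
    (h : Move n (colSet k w) S') : ∃ v, Reach n k k w v ∧ colSet k v = S' := by
  obtain ⟨a, b, ha, hb, hab, rfl, hu⟩ := h
  obtain ⟨i, hi, hik, rfl⟩ := mem_colSet.1 hb
  obtain ⟨v1, r1, c1, e1, -⟩ := exists_reach_swap hk.le hw hi hik le_rfl
  have hv1 := r1.sp hw
  rw [← c1] at ha hu ⊢
  obtain ⟨j, hj, hjk, e2⟩ := mem_colSet.1 ha
  have hjk' : j ≤ k - 1 := by
    rcases hjk.lt_or_eq with h | h
    · omega
    · exfalso; apply hab; rw [← e2, h, e1]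
  obtain ⟨v2, r2, c2, e3, e4⟩ := exists_reach_swap hk.le hv1 hj hjk' (by omega)
  have hv2 := r2.sp hv1
  have e5 : v2 k = w i := by rw [e4 k (by omega), e1]
  rw [e2] at e3
  rw [← c2] at hu ⊢
  rw [← e3, ← e5] at hu ⊢
  refine ⟨v2 * refl ((k : ℤ) - 1, -k), (r1.trans r2).trans ?_,
    colSet_mul_refl_neg hk.le hv2 (by omega) (by omega) (by omega) (by omega) (by omega)⟩
  have hl : Lab n ((k : ℤ) - 1) (-k) := by unfold Lab IsLetter; omega
  have p1 : pos n ((k : ℤ) - 1) = k - 1 := pos_of_pos (by omega)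
  have p2 : pos n (-(k : ℤ)) = 2 * n + 1 - k := by rw [pos_of_neg (by omega)]; ring
  refine Reach.of_jump hl (by omega) (by omega) (by omega) fun l hlt g1 g2 g3 g4 => ?_
  have hkl : k < l.natAbs := by
    have h1 := hlt.1
    have h2 := hlt.2
    unfold pos at p1 p2 g1 g2
    split_ifs at * <;> omega
  obtain ⟨h1, h2⟩ := (mem_colSet_iff_of_letter hv2 hlt).2 hkl
  rw [hv2.neg]
  exact hu _ (hv2.letter hlt) h1 h2

theorem exists_reach_moves {n k : ℕ} (hk : k < n) {S S' : Finset ℤ}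
    (h : Relation.ReflTransGen (Move n) S S') : ∀ {w : Equiv.Perm ℤ}, SP n w → colSet k w = S →
    ∃ v, Reach n k k w v ∧ colSet k v = S' := by
  induction h using Relation.ReflTransGen.head_induction_on with
  | refl => exact fun {w} hw h => ⟨w, .refl _ _ _ _, h⟩
  | head h1 _ ih =>
    intro w hw h
    obtain ⟨v, r, e⟩ := exists_reach_move hk hw (h ▸ h1)
    obtain ⟨u, r', e'⟩ := ih (r.sp hw) e
    exact ⟨u, r.trans r', e'⟩

theorem mem_rowsDown {F : ℕ → List (ℤ × ℤ)} {k : ℕ} {β : ℤ × ℤ} :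
    β ∈ rowsDown F k ↔ ∃ i : ℕ, 1 ≤ i ∧ i ≤ k ∧ β ∈ F i := by
  unfold rowsDown
  simp only [List.mem_flatMap, List.mem_reverse, List.mem_range'_1]
  constructor
  · rintro ⟨i, h1, h2⟩; exact ⟨i, by omega, by omega, h2⟩
  · rintro ⟨i, h1, h2, h3⟩; exact ⟨i, by omega, h3⟩

theorem mem_rowR {i : ℕ} {β : ℤ × ℤ} (h : β ∈ rowR i) : ∃ j : ℤ, 1 ≤ j ∧ j < i ∧ β = (↑i, -j) := by
  unfold rowR at h
  simp only [List.mem_map, mem_descend_iff] at h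
  obtain ⟨j, h1, rfl⟩ := h
  exact ⟨j, by omega, by omega, rfl⟩

/-- Every path in a right segment consists of moves. -/
theorem moves_of_isQPath {n k : ℕ} (hk : k < n) {T : List (ℤ × ℤ)} :
    ∀ {w : Equiv.Perm ℤ}, SP n w → (∀ β ∈ T, β ∈ chainR k) → 1 ≤ k → IsQPath n w T →
      Relation.ReflTransGen (Move n) (colSet k w) (colSet k (endw w T)) := by
  induction T with
  | nil => intro w _ _ _ _; rw [endw_nil]
  | cons β T ih =>
    intro w hw hT hk1 hp
    rw [List.forall_mem_cons] at hT
    have h1 := hT.1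
    rw [chainR_eq hk1, mem_rowsDown] at h1
    obtain ⟨i, h2, h3, h4⟩ := h1
    obtain ⟨j, h5, h6, rfl⟩ := mem_rowR h4
    have hr : RowLab n k i (-j) := by unfold RowLab; omega
    have hj := (qEdge_iff hw hr.lab hr.pos_lt).1 hp.1
    rw [endw_cons]
    exact (ih (hw.mul_refl hr.lab) hT.2 hk1 hp.2).head
      (move_of_jump hk.le hw h5 h6 (by omega) hj)

theorem exists_path_chainR {n k : ℕ} (hk1 : 1 ≤ k) (hk : k < n) {w : Equiv.Perm ℤ} (hw : SP n w)
    {S : Finset ℤ} (h : Relation.ReflTransGen (Move n) (colSet k w) S) :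
    ∃ T, T.Sublist (chainR k) ∧ IsQPath n w T ∧ colSet k (endw w T) = S := by
  obtain ⟨v, ⟨cs, r⟩, rfl⟩ := exists_reach_moves hk h hw rfl
  rw [chainR_eq hk1]
  refine exists_sublist_of_kPath hk (rows_rowR hk) (fun i m hr h1 h2 => ?_) hw r
  unfold RowLab at hr
  refine mem_rowsDown.2 ⟨i.toNat, by omega, by omega, ?_⟩
  unfold rowR
  rw [List.mem_map]
  exact ⟨-m, mem_descend_iff.2 ⟨by omega, by omega⟩, by rw [neg_neg, Int.toNat_of_nonneg (by omega)]⟩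

theorem exists_path_chainL {n k : ℕ} (hk : k < n) {w : Equiv.Perm ℤ} (hw : SP n w)
    {S : Finset ℤ} (hS : IsCol n S) (hc : S.card = k) :
    ∃ T, T.Sublist (chainL n k) ∧ IsQPath n w T ∧ colSet k (endw w T) = S := by
  obtain ⟨v, ⟨cs, r⟩, rfl⟩ := exists_reach_colSet (k := k) hw k hk S hS hc
  refine exists_sublist_of_kPath (F := chainKI n k) hk (rows_chainKI hk) (fun i m hr h1 h2 => ?_) hw r
  unfold RowLab at hr
  refine mem_rowsDown.2 ⟨i.toNat, by omega, by omega, ?_⟩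
  unfold chainKI
  simp only [List.mem_append, List.mem_map, List.mem_reverse, mem_descend_iff]
  rw [Int.toNat_of_nonneg (by omega)]
  rcases lt_or_ge 0 m with h | h
  · exact Or.inl (Or.inl ⟨m, by omega, rfl⟩)
  · rcases hr.2.2.2 with g | g
    · exact Or.inl (Or.inr ⟨-m, by omega, by rw [neg_neg]⟩)
    · exact Or.inr ⟨-m, by omega, by rw [neg_neg]⟩

/-! ### A ballot condition for the moves -/

/-- The effect of the change of the sign of `d` on the number of the letters between `c` and `n`. -/
def sg (c d : ℤ) : ℤ := if d < -c then 1 else if c < d then -1 else 0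

/-- The condition on the set `D` of the letters that change their signs; `U` is the set of the
unused positive letters. -/
def Bal (D : Finset ℤ) (U : ℤ → Prop) : Prop :=
  ∃ m : ℤ, (∀ c, 0 ≤ c → 0 ≤ 2 * m + ∑ d ∈ D, sg c d) ∧
    (∀ u, 0 < u → U u → 2 * m + ∑ d ∈ D, sg u d = 0) ∧ Even (∑ d ∈ D, sg 0 d)

/-- The letters that are not used in a column. -/
def Unused (n : ℕ) (S : Finset ℤ) (u : ℤ) : Prop := IsLetter n u ∧ u ∉ S ∧ -u ∉ S

theorem Unused.neg {n : ℕ} {S : Finset ℤ} {u : ℤ} (h : Unused n S u) : Unused n S (-u) :=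
  ⟨h.1.neg, h.2.2, by rw [neg_neg]; exact h.2.1⟩

/-- The columns `S` and `R` have the same absolute values, and satisfy the ballot condition. -/
def Ballot (n : ℕ) (S R : Finset ℤ) : Prop :=
  (∀ x, x ∈ R ∨ -x ∈ R ↔ x ∈ S ∨ -x ∈ S) ∧ Bal (S \ R) (Unused n S)

theorem sum_sg {n : ℕ} {S R : Finset ℤ} (hS : IsCol n S) (hR : IsCol n R)
    (h : ∀ x, x ∈ R ∨ -x ∈ R ↔ x ∈ S ∨ -x ∈ S) {c : ℤ} (hc : 0 ≤ c) :
    ∑ d ∈ S \ R, sg c d = (∑ x ∈ R, if c < x then 1 else 0) - ∑ x ∈ S, if c < x then 1 else 0 := by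
  have e : R = S.image (fun x => if x ∈ R then x else -x) := by
    ext y
    rw [mem_image]
    constructor
    · intro hy
      rcases (h y).1 (Or.inl hy) with h1 | h1
      · exact ⟨y, h1, by rw [if_pos hy]⟩
      · exact ⟨-y, h1, by rw [if_neg (hR y hy).2, neg_neg]⟩
    · rintro ⟨x, hx, rfl⟩
      split_ifs with h1
      · exact h1
      · exact ((h x).2 (Or.inl hx)).resolve_left h1
  have e2 : (∑ x ∈ R, if c < x then (1 : ℤ) else 0) =
      ∑ x ∈ S, if c < (if x ∈ R then x else -x) then 1 else 0 := by
    conv_lhs => rw [e]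
    rw [sum_image]
    intro x hx y hy hxy
    have h1 := (hS x hx).2
    have h2 := (hS y hy).2
    dsimp only at hxy
    split_ifs at hxy with h3 h4 h4
    · exact hxy
    · rw [hxy, neg_neg] at h1; exact absurd hy h1
    · rw [← hxy, neg_neg] at h2; exact absurd hx h2
    · omega
  rw [e2, ← sum_sub_distrib, ← filter_notMem_eq_sdiff, sum_filter]
  refine sum_congr rfl fun x hx => ?_
  unfold sg
  split_ifs <;> omega

theorem IsCol.ne {n : ℕ} {S : Finset ℤ} (hS : IsCol n S) {x y : ℤ} (hx : x ∈ S) (hy : y ∈ S) :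
    x ≠ -y := by
  rintro rfl; exact (hS y hy).2 hx

section
variable {n : ℕ} {S : Finset ℤ} {a b : ℤ}

theorem mem_flip {x : ℤ} :
    x ∈ insert (-a) (insert (-b) ((S.erase a).erase b)) ↔
      x = -a ∨ x = -b ∨ (x ∈ S ∧ x ≠ a ∧ x ≠ b) := by
  simp only [mem_insert, mem_erase]; tauto

theorem isCol_flip (hS : IsCol n S) (ha : a ∈ S) (hb : b ∈ S) :
    IsCol n (insert (-a) (insert (-b) ((S.erase a).erase b))) := by
  have h1 := hS.ne ha hb
  have h2 := (hS a ha).1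
  have h3 := (hS b hb).1
  have h4 := h2.1
  have h5 := h3.1
  intro x hx
  rw [mem_flip] at hx
  rw [mem_flip]
  rcases hx with rfl | rfl | ⟨h, h6, h7⟩
  · exact ⟨h2.neg, by omega⟩
  · exact ⟨h3.neg, by omega⟩
  · refine ⟨(hS x h).1, ?_⟩
    rintro (g | g | ⟨g, -⟩)
    · omega
    · omega
    · exact (hS x h).2 g

theorem abs_flip (hS : IsCol n S) (ha : a ∈ S) (hb : b ∈ S) (x : ℤ) :
    (x ∈ insert (-a) (insert (-b) ((S.erase a).erase b)) ∨
      -x ∈ insert (-a) (insert (-b) ((S.erase a).erase b))) ↔ x ∈ S ∨ -x ∈ S := by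
  rw [mem_flip, mem_flip]
  by_cases h1 : x = a; · subst h1; simp [ha]
  by_cases h2 : x = b; · subst h2; simp [hb]
  by_cases h3 : -x = a
  · rw [h3]; simp only [ha, or_true, iff_true]; left; left; omega
  by_cases h4 : -x = b
  · rw [h4]; simp only [hb, or_true, iff_true]; left; right; left; omega
  have h5 : x ≠ -a := by omega
  have h6 : x ≠ -b := by omega
  have h7 : -x ≠ -a := by omega
  have h8 : -x ≠ -b := by omega
  simp [h1, h2, h3, h4, h5, h6, h7, h8]

theorem sum_flip (hS : IsCol n S) (ha : a ∈ S) (hb : b ∈ S) (hab : a ≠ b) (f : ℤ → ℤ) :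
    ∑ x ∈ insert (-a) (insert (-b) ((S.erase a).erase b)), f x =
      ∑ x ∈ S, f x - f a - f b + f (-a) + f (-b) := by
  have h4 := (hS a ha).1.1
  have h5 := (hS b hb).1.1
  rw [sum_insert, sum_insert]
  · have e1 := add_sum_erase S f ha
    have e2 := add_sum_erase (S.erase a) f (mem_erase.2 ⟨hab.symm, hb⟩)
    linarith
  · simp only [mem_erase, not_and]
    intro _ _ h; exact (hS b hb).2 h
  · simp only [mem_insert, mem_erase, not_or, not_and]
    exact ⟨by omega, fun _ _ h => (hS a ha).2 h⟩

end

/-- The positions of the unused letters with respect to a move. -/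
theorem move_arith {n : ℕ} {a b u : ℤ} (ha : IsLetter n a) (hb : IsLetter n b) (hu : IsLetter n u)
    (h0 : 0 < u) (h1 : u ≠ a ∧ u ≠ -a ∧ u ≠ b ∧ u ≠ -b) (hab : a ≠ -b) :
    (¬ Bt (pos n a) (pos n u) (pos n (-b)) ∧ ¬ Bt (pos n a) (pos n (-u)) (pos n (-b))) ↔
    (0 < a ∧ 0 < b ∧ u < a ∧ u < b) ∨ (a < 0 ∧ b < 0 ∧ -a < u ∧ -b < u) ∨
    (0 < a ∧ b < 0 ∧ a < -b ∧ (u < a ∨ -b < u)) ∨ (a < 0 ∧ 0 < b ∧ b < -a ∧ (u < b ∨ -a < u)) := by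
  obtain ⟨ha0, ha1, ha2⟩ : a ≠ 0 ∧ a ≤ n ∧ -a ≤ n := by obtain ⟨_, _⟩ := ha; omega
  obtain ⟨hb0, hb1, hb2⟩ : b ≠ 0 ∧ b ≤ n ∧ -b ≤ n := by obtain ⟨_, _⟩ := hb; omega
  have hu1 : u ≤ n := by obtain ⟨_, _⟩ := hu; omega
  clear ha hb hu
  rw [pos_of_pos h0, pos_of_neg (x := -u) (by omega)]
  unfold Bt
  rcases lt_or_ge 0 a with h | h <;> rcases lt_or_ge 0 b with h' | h'
  · rw [pos_of_pos h, pos_of_neg (x := -b) (by omega)]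
    constructor
    · intro g; left; omega
    · intro g; omega
  · rw [pos_of_pos h, pos_of_pos (x := -b) (by omega)]
    constructor
    · intro g; right; right; left; omega
    · intro g; omega
  · rw [pos_of_neg (x := a) (by omega), pos_of_neg (x := -b) (by omega)]
    constructor
    · intro g; right; right; right; omega
    · intro g; omega
  · rw [pos_of_neg (x := a) (by omega), pos_of_pos (x := -b) (by omega)]
    constructor
    · intro g; right; left; omega
    · intro g; omega

theorem Ballot.refl {n : ℕ} (S : Finset ℤ) : Ballot n S S := by
  refine ⟨fun x => Iff.rfl, 0, ?_, ?_, ?_⟩ <;> rw [sdiff_self] <;> simp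

theorem Ballot.move {n : ℕ} {S S' R : Finset ℤ} (hS : IsCol n S) (hS' : IsCol n S')
    (hU : ∃ u, Unused n S u) (h : Ballot n S S') (hm : Move n S' R) :
    IsCol n R ∧ Ballot n S R := by
  obtain ⟨a, b, ha, hb, hab, rfl, hu⟩ := hm
  have hR := isCol_flip hS' ha hb
  obtain ⟨h1, m, h2, h3, h4⟩ := h
  have habs := fun x => (abs_flip hS' ha hb x).trans (h1 x)
  have la := (hS' a ha).1
  have lb := (hS' b hb).1
  have lab := hS'.ne ha hb
  have hdiff : ∀ c : ℤ, 0 ≤ c → ∑ d ∈ S \ insert (-a) (insert (-b) ((S'.erase a).erase b)), sg c d =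
      ∑ d ∈ S \ S', sg c d + sg c a + sg c b := by
    intro c hc
    rw [sum_sg hS hR habs hc, sum_sg hS hS' h1 hc, sum_flip hS' ha hb hab]
    unfold sg
    split_ifs <;> omega
  have hun : ∀ u, 0 < u → Unused n S u → (0 < a ∧ 0 < b ∧ u < a ∧ u < b) ∨
      (a < 0 ∧ b < 0 ∧ -a < u ∧ -b < u) ∨ (0 < a ∧ b < 0 ∧ a < -b ∧ (u < a ∨ -b < u)) ∨
      (a < 0 ∧ 0 < b ∧ b < -a ∧ (u < b ∨ -a < u)) := by
    intro u hu0 hu1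
    have h5 : u ∉ S' ∧ -u ∉ S' := by
      have := (h1 u).not.2 (by have := hu1.2; tauto)
      tauto
    refine (move_arith la lb hu1.1 hu0 ?_ lab).1 ⟨hu u hu1.1 h5.1 h5.2,
      hu (-u) hu1.1.neg h5.2 (by rw [neg_neg]; exact h5.1)⟩
    refine ⟨?_, ?_, ?_, ?_⟩
    · rintro rfl; exact h5.1 ha
    · rintro rfl; rw [neg_neg] at h5; exact h5.2 ha
    · rintro rfl; exact h5.1 hb
    · rintro rfl; rw [neg_neg] at h5; exact h5.2 hb
  obtain ⟨u0, hu0, hu0'⟩ : ∃ u, 0 < u ∧ Unused n S u := by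
    obtain ⟨u, hu⟩ := hU
    have := hu.1.1
    rcases lt_or_ge 0 u with h | h
    · exact ⟨u, h, hu⟩
    · exact ⟨-u, by omega, hu.neg⟩
  have g0 := hun u0 hu0 hu0'
  refine ⟨hR, habs, if 0 < a ∧ 0 < b then m + 1 else m, fun c hc => ?_, fun u hu1 hu2 => ?_, ?_⟩
  · rw [hdiff c hc]
    have := h2 c hc
    generalize ∑ d ∈ S \ S', sg c d = X at *
    unfold sg
    split_ifs <;> omega
  · rw [hdiff u hu1.le]
    have := h3 u hu1 hu2
    have := hun u hu1 hu2
    generalize ∑ d ∈ S \ S', sg u d = X at *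
    unfold sg
    split_ifs <;> omega
  · rw [hdiff 0 le_rfl]
    have : Even (sg 0 a + sg 0 b) := by
      have := la.1
      have := lb.1
      rw [Int.even_iff]
      unfold sg
      split_ifs <;> omega
    rw [add_assoc]
    exact h4.add this

theorem ballot_of_moves {n : ℕ} {S R : Finset ℤ} (hS : IsCol n S) (hU : ∃ u, Unused n S u)
    (h : Relation.ReflTransGen (Move n) S R) : IsCol n R ∧ Ballot n S R := by
  induction h with
  | refl => exact ⟨hS, .refl _⟩
  | tail _ h2 ih => exact ih.2.move hS ih.1 hU h2

/-- A letter that loses its sign raises the sum. -/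
theorem sum_sg_lt {D : Finset ℤ} {x c : ℤ} (hx : x ∈ D) (hx0 : 0 < x) (hxc : x ≤ c)
    (h : ∀ d ∈ D, ¬ (d < 0 ∧ x ≤ -d ∧ -d ≤ c)) :
    ∑ d ∈ D, sg (x - 1) d + 1 ≤ ∑ d ∈ D, sg c d := by
  have h1 : ∀ d ∈ D, 0 ≤ sg c d - sg (x - 1) d := by
    intro d hd
    have := h d hd
    unfold sg
    split_ifs <;> omega
  have h2 := single_le_sum h1 hx
  rw [sum_sub_distrib] at h2
  have : sg c x - sg (x - 1) x = 1 := by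
    unfold sg
    split_ifs <;> omega
  omega

theorem sum_sg_lt' {D : Finset ℤ} {y u : ℤ} (hy : y ∈ D) (hu0 : 0 < u) (hyu : u < -y)
    (h : ∀ d ∈ D, ¬ (0 < d ∧ u < d ∧ d ≤ -y)) :
    ∑ d ∈ D, sg (-y) d + 1 ≤ ∑ d ∈ D, sg u d := by
  have h1 : ∀ d ∈ D, 0 ≤ sg u d - sg (-y) d := by
    intro d hd
    have := h d hd
    unfold sg
    split_ifs <;> omega
  have h2 := single_le_sum h1 hy
  rw [sum_sub_distrib] at h2
  have : sg u y - sg (-y) y = 1 := by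
    unfold sg
    split_ifs <;> omega
  omega

/-- Two letters whose signs can be changed first. -/
theorem Bal.exists_pair {D : Finset ℤ} {U : ℤ → Prop} (h : Bal D U) (hD : ∀ x ∈ D, x ≠ 0 ∧ -x ∉ D)
    (hDU : ∀ x ∈ D, ¬ U x ∧ ¬ U (-x)) {u0 : ℤ} (hu0 : 0 < u0) (hU : U u0) (hne : D.Nonempty) :
    ∃ a ∈ D, ∃ b ∈ D, a ≠ b ∧ Bal ((D.erase a).erase b) U ∧ ∀ u, 0 < u → U u →
      (0 < a ∧ 0 < b ∧ u < a ∧ u < b) ∨ (a < 0 ∧ b < 0 ∧ -a < u ∧ -b < u) ∨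
      (0 < a ∧ b < 0 ∧ a < -b ∧ (u < a ∨ -b < u)) := by
  obtain ⟨m, h1, h2, h3⟩ := h
  have hsum : ∀ a ∈ D, ∀ b ∈ D, a ≠ b → ∀ c, ∑ d ∈ D, sg c d =
      sg c a + (sg c b + ∑ d ∈ (D.erase a).erase b, sg c d) := by
    intro a ha b hb hab c
    rw [add_sum_erase _ _ (mem_erase.2 ⟨hab.symm, hb⟩), add_sum_erase _ _ ha]
  have hpar : ∀ a ∈ D, ∀ b ∈ D, a ≠ b → Even (∑ d ∈ (D.erase a).erase b, sg 0 d) := by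
    intro a ha b hb hab
    have e1 := hsum a ha b hb hab 0
    rw [Int.even_iff] at h3 ⊢
    have := (hD a ha).1
    have := (hD b hb).1
    unfold sg at e1 h3 ⊢
    split_ifs at e1 <;> omega
  by_cases hc : ∃ q ∈ (D ×ˢ D), 0 < q.1 ∧ q.2 < 0 ∧ q.1 < -q.2
  · obtain ⟨q0, hq0, hq0'⟩ := hc
    obtain ⟨⟨x, y⟩, hq, hmin⟩ := exists_min_image
      ((D ×ˢ D).filter fun q => 0 < q.1 ∧ q.2 < 0 ∧ q.1 < -q.2) (fun q => -q.2 - q.1)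
      ⟨q0, mem_filter.2 ⟨hq0, hq0'⟩⟩
    simp only [mem_filter, mem_product] at hq hmin
    obtain ⟨⟨hx, hy⟩, hx0, hy0, hxy⟩ := hq
    have hxy' : x ≠ y := by omega
    have key : ∀ c, x ≤ c → c < -y → 1 ≤ 2 * m + ∑ d ∈ D, sg c d := by
      intro c hxc hcy
      have := sum_sg_lt hx hx0 hxc fun d hd ⟨hd0, g1, g2⟩ => by
        have : x ≠ -d := by rintro rfl; exact (hD d hd).2 hx
        have := hmin ⟨x, d⟩ ⟨⟨hx, hd⟩, hx0, hd0, by dsimp only; omega⟩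
        dsimp only at this
        omega
      have := h1 (x - 1) (by omega)
      omega
    have hun : ∀ u, 0 < u → U u → u < x ∨ -y < u := by
      intro u hu hu'
      have g1 : u ≠ x := by rintro rfl; exact (hDU u hx).1 hu'
      have g2 : u ≠ -y := by rintro rfl; exact (hDU y hy).2 hu'
      have := h2 u hu hu'
      by_contra hcon
      have := key u (by omega) (by omega)
      omega
    refine ⟨x, hx, y, hy, hxy', ⟨m, fun c hc => ?_, fun u hu hu' => ?_, hpar x hx y hy hxy'⟩,
      fun u hu hu' => Or.inr (Or.inr ⟨hx0, hy0, hxy, hun u hu hu'⟩)⟩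
    · have e := hsum x hx y hy hxy' c
      have g1 := h1 c hc
      have g2 := key c
      unfold sg at e g1 g2 ⊢
      split_ifs at e <;> omega
    · have e := hsum x hx y hy hxy' u
      have g1 := h2 u hu hu'
      have g2 := hun u hu hu'
      unfold sg at e g1 ⊢
      split_ifs at e <;> omega
  · have hc : ∀ x ∈ D, ∀ y ∈ D, 0 < x → y < 0 → -y < x := by
      intro x hx y hy hx0 hy0
      have : x ≠ -y := by rintro rfl; exact (hD y hy).2 hx
      by_contra hcon
      exact hc ⟨⟨x, y⟩, mem_product.2 ⟨hx, hy⟩, hx0, hy0, by dsimp only; omega⟩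
    have hA : ∀ x ∈ D, 0 < x → ∀ u, 0 < u → U u → u < x := by
      intro x hx hx0 u hu hu'
      by_contra hcon
      have := sum_sg_lt hx hx0 (c := u) (by omega) fun d hd ⟨hd0, g1, g2⟩ => by
        have := hc x hx d hd hx0 hd0
        omega
      have := h1 (x - 1) (by omega)
      have := h2 u hu hu'
      omega
    have hB : ∀ y ∈ D, y < 0 → ∀ u, 0 < u → U u → -y < u := by
      intro y hy hy0 u hu hu'
      have g2 : u ≠ -y := by rintro rfl; exact (hDU y hy).2 hu'
      by_contra hcon
      have := sum_sg_lt' hy hu (by omega) fun d hd ⟨hd0, g1, g2⟩ => by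
        have := hc d hd y hy hd0 hy0
        omega
      have := h1 (-y) (by omega)
      have := h2 u hu hu'
      omega
    have hu2 := h2 u0 hu0 hU
    by_cases hp : ∃ a ∈ D, 0 < a
    · obtain ⟨a, ha, ha0⟩ := hp
      obtain ⟨b, hb, hb0, hab⟩ : ∃ b ∈ D, 0 < b ∧ a ≠ b := by
        by_contra hcon
        push Not at hcon
        rw [sum_eq_single_of_mem a ha] at hu2
        · have := hA a ha ha0 u0 hu0 hU
          unfold sg at hu2
          split_ifs at hu2 <;> omega
        · intro d hd hda
          have hd0 := (hD d hd).1
          have : d < 0 := by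
            by_contra hd1
            exact hda (hcon d hd (by omega)).symm
          have := hB d hd this u0 hu0 hU
          unfold sg
          split_ifs <;> omega
      refine ⟨a, ha, b, hb, hab, ⟨m - 1, fun c hc0 => ?_, fun u hu hu' => ?_, hpar a ha b hb hab⟩,
        fun u hu hu' => Or.inl ⟨ha0, hb0, hA a ha ha0 u hu hu', hA b hb hb0 u hu hu'⟩⟩
      · have la := hA a ha ha0 u0 hu0 hU
        have lb := hA b hb hb0 u0 hu0 hU
        rcases le_or_gt c u0 with hcu | hcu
        · have e := hsum a ha b hb hab c
          have := h1 c hc0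
          have e1 : sg c a = -1 := by unfold sg; split_ifs <;> omega
          have e2 : sg c b = -1 := by unfold sg; split_ifs <;> omega
          omega
        · have e := hsum a ha b hb hab u0
          have e1 : sg u0 a = -1 := by unfold sg; split_ifs <;> omega
          have e2 : sg u0 b = -1 := by unfold sg; split_ifs <;> omega
          have : ∑ d ∈ (D.erase a).erase b, sg u0 d ≤ ∑ d ∈ (D.erase a).erase b, sg c d := by
            refine sum_le_sum fun d hd => ?_
            have hd := (mem_erase.1 (mem_erase.1 hd).2).2
            have := hB d hd
            have := (hD d hd).1
            by_cases hd0 : d < 0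
            · have := hB d hd hd0 u0 hu0 hU
              unfold sg; split_ifs <;> omega
            · unfold sg; split_ifs <;> omega
          omega
      · have e := hsum a ha b hb hab u
        have la := hA a ha ha0 u hu hu'
        have lb := hA b hb hb0 u hu hu'
        have := h2 u hu hu'
        have e1 : sg u a = -1 := by unfold sg; split_ifs <;> omega
        have e2 : sg u b = -1 := by unfold sg; split_ifs <;> omega
        omega
    · have hneg : ∀ d ∈ D, d < 0 := by
        intro d hd
        have := (hD d hd).1
        by_contra hcon
        exact hp ⟨d, hd, by omega⟩
      have hz : ∀ u, 0 < u → U u → ∀ d ∈ D, sg u d = 0 := by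
        intro u hu hu' d hd
        have := hB d hd (hneg d hd) u hu hu'
        have := hneg d hd
        unfold sg; split_ifs <;> omega
      have hm : m = 0 := by
        rw [sum_eq_zero (hz u0 hu0 hU)] at hu2; omega
      obtain ⟨a, ha⟩ := hne
      obtain ⟨b, hb, hab⟩ : ∃ b ∈ D, a ≠ b := by
        by_contra hcon
        push Not at hcon
        rw [sum_eq_single_of_mem a ha (fun d hd hda => absurd (hcon d hd).symm hda)] at h3
        have := hneg a ha
        unfold sg at h3
        rw [if_pos (by omega)] at h3
        simp at h3
      refine ⟨a, ha, b, hb, hab, ⟨0, fun c hc0 => ?_, fun u hu hu' => ?_, hpar a ha b hb hab⟩,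
        fun u hu hu' => Or.inr (Or.inl ⟨hneg a ha, hneg b hb, hB a ha (hneg a ha) u hu hu',
          hB b hb (hneg b hb) u hu hu'⟩)⟩
      · have : 0 ≤ ∑ d ∈ (D.erase a).erase b, sg c d := by
          refine sum_nonneg fun d hd => ?_
          have := hneg d (mem_erase.1 (mem_erase.1 hd).2).2
          unfold sg; split_ifs <;> omega
        omega
      · rw [sum_eq_zero fun d hd => hz u hu hu' d (mem_erase.1 (mem_erase.1 hd).2).2]
        rfl

theorem moves_of_ballot {n : ℕ} (N : ℕ) : ∀ {S R : Finset ℤ}, (S \ R).card ≤ N → IsCol n S →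
    IsCol n R → (∃ u, 0 < u ∧ Unused n S u) → Ballot n S R →
    Relation.ReflTransGen (Move n) S R := by
  induction N with
  | zero =>
    intro S R hN hS hR _ h
    have hSR : S ⊆ R := sdiff_eq_empty_iff_subset.1 (card_eq_zero.1 (by omega))
    have : R ⊆ S := fun x hx => ((h.1 x).1 (Or.inl hx)).resolve_right fun h' => (hR x hx).2 (hSR h')
    rw [subset_antisymm hSR this]
  | succ N ih =>
    intro S R hN hS hR hU h
    rcases (S \ R).eq_empty_or_nonempty with hemp | hne
    · exact ih (by rw [hemp]; simp) hS hR hU h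
    obtain ⟨u0, hu0, hU0⟩ := hU
    obtain ⟨a, ha, b, hb, hab, h1, h2⟩ := h.2.exists_pair
      (fun x hx => ⟨(hS x (mem_sdiff.1 hx).1).1.1, fun h' =>
        (hS x (mem_sdiff.1 hx).1).2 (mem_sdiff.1 h').1⟩)
      (fun x hx => ⟨fun h' => h'.2.1 (mem_sdiff.1 hx).1, fun h' => h'.2.2
        (by rw [neg_neg]; exact (mem_sdiff.1 hx).1)⟩) hu0 hU0 hne
    obtain ⟨haS, haR⟩ := mem_sdiff.1 ha
    obtain ⟨hbS, hbR⟩ := mem_sdiff.1 hb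
    have haR' : -a ∈ R := ((h.1 a).2 (Or.inl haS)).resolve_left haR
    have hbR' : -b ∈ R := ((h.1 b).2 (Or.inl hbS)).resolve_left hbR
    have habs := abs_flip hS haS hbS
    have hun : ∀ u, Unused n (insert (-a) (insert (-b) ((S.erase a).erase b))) u ↔ Unused n S u := by
      intro u
      have := not_congr (habs u)
      rw [not_or, not_or] at this
      exact and_congr_right fun _ => this
    have hd : insert (-a) (insert (-b) ((S.erase a).erase b)) \ R = ((S \ R).erase a).erase b := by
      ext x
      rw [mem_sdiff, mem_flip, mem_erase, mem_erase, mem_sdiff]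
      constructor
      · rintro ⟨rfl | rfl | ⟨g1, g2, g3⟩, g⟩
        · exact absurd haR' g
        · exact absurd hbR' g
        · exact ⟨g3, g2, g1, g⟩
      · rintro ⟨g1, g2, g3, g4⟩
        exact ⟨Or.inr (Or.inr ⟨g3, g2, g1⟩), g4⟩
    refine Relation.ReflTransGen.head (b := insert (-a) (insert (-b) ((S.erase a).erase b)))
      ⟨a, b, haS, hbS, hab, rfl, fun u hu g1 g2 => ?_⟩ (ih ?_ (isCol_flip hS haS hbS) hR
        ⟨u0, hu0, (hun u0).2 hU0⟩ ⟨fun x => (h.1 x).trans (habs x).symm, ?_⟩)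
    · have key : ∀ v, 0 < v → Unused n S v → ¬ Bt (pos n a) (pos n v) (pos n (-b)) ∧
          ¬ Bt (pos n a) (pos n (-v)) (pos n (-b)) := by
        intro v hv0 hv
        refine (move_arith (hS a haS).1 (hS b hbS).1 hv.1 hv0 ⟨?_, ?_, ?_, ?_⟩ (hS.ne haS hbS)).2 ?_
        · rintro rfl; exact hv.2.1 haS
        · rintro rfl; exact hv.2.2 (by rwa [neg_neg])
        · rintro rfl; exact hv.2.1 hbS
        · rintro rfl; exact hv.2.2 (by rwa [neg_neg])
        · rcases h2 v hv0 hv with g | g | g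
          · exact Or.inl g
          · exact Or.inr (Or.inl g)
          · exact Or.inr (Or.inr (Or.inl g))
      have hu' : Unused n S u := ⟨hu, g1, g2⟩
      have := hu.1
      rcases lt_or_ge 0 u with h | h
      · exact (key u h hu').1
      · have := (key (-u) (by omega) hu'.neg).2
        rwa [neg_neg] at this
    · rw [hd, card_erase_of_mem (mem_erase.2 ⟨hab.symm, hb⟩), card_erase_of_mem ha]
      omega
    · rw [hd]
      obtain ⟨m, k1, k2, k3⟩ := h1
      exact ⟨m, k1, fun u hu hu' => k2 u hu ((hun u).1 hu'), k3⟩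

/-! ### Splitting and extending on the level of sets -/

/-- The number of the elements larger than `a`. -/
def cnt (X : Finset ℤ) (a : ℤ) : ℤ := ∑ x ∈ X, if a < x then 1 else 0

theorem cnt_nonneg (X : Finset ℤ) (a : ℤ) : 0 ≤ cnt X a :=
  sum_nonneg fun x _ => by split_ifs <;> omega

theorem cnt_union {X Y : Finset ℤ} (h : Disjoint X Y) (a : ℤ) : cnt (X ∪ Y) a = cnt X a + cnt Y a :=
  sum_union h

theorem cnt_pred (X : Finset ℤ) (a : ℤ) : cnt X (a - 1) = cnt X a + if a ∈ X then 1 else 0 := by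
  unfold cnt
  have : (if a ∈ X then (1 : ℤ) else 0) = ∑ x ∈ X, if x = a then 1 else 0 := by
    rw [sum_ite_eq' X a]
  rw [this, ← sum_add_distrib]
  refine sum_congr rfl fun x _ => ?_
  split_ifs <;> omega

theorem cnt_anti (X : Finset ℤ) {a b : ℤ} (h : a ≤ b) : cnt X b ≤ cnt X a :=
  sum_le_sum fun x _ => by split_ifs <;> omega

theorem cnt_eq_card {X : Finset ℤ} {a : ℤ} (h : ∀ x ∈ X, a < x) : cnt X a = X.card := by
  unfold cnt
  rw [sum_congr rfl fun x hx => if_pos (h x hx)]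
  simp

theorem cnt_eq_zero {X : Finset ℤ} {a : ℤ} (h : ∀ x ∈ X, x ≤ a) : cnt X a = 0 :=
  sum_eq_zero fun x hx => if_neg (by have := h x hx; omega)

theorem cnt_mono {X Y : Finset ℤ} {a : ℤ} (h : ∀ x ∈ X, a < x → x ∈ Y) : cnt X a ≤ cnt Y a := by
  unfold cnt
  rw [← sum_filter, ← sum_filter]
  refine sum_le_sum_of_subset_of_nonneg (fun x hx => ?_) fun _ _ _ => by omega
  rw [mem_filter] at hx ⊢
  exact ⟨h x hx.1 hx.2, hx.2⟩

theorem cnt_lt {X Y : Finset ℤ} {a z : ℤ} (h : ∀ x ∈ X, a < x → x ∈ Y) (hz : z ∈ Y) (hz' : z ∉ X)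
    (haz : a < z) : cnt X a + 1 ≤ cnt Y a := by
  have h1 : cnt (insert z X) a ≤ cnt Y a := cnt_mono fun x hx hax => by
    rcases mem_insert.1 hx with rfl | hx
    · exact hz
    · exact h x hx hax
  have h2 : cnt (insert z X) a = (if a < z then 1 else 0) + cnt X a := sum_insert hz'
  rw [if_pos haz] at h2
  omega

/-- The positive letters that are in the column together with their negatives. -/
def dblSet (S : Finset ℤ) : Finset ℤ := S.filter (fun x => 0 < x ∧ -x ∈ S)

theorem mem_dblSet {S : Finset ℤ} {x : ℤ} : x ∈ dblSet S ↔ x ∈ S ∧ 0 < x ∧ -x ∈ S := mem_filter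

/-- A positive letter such that neither the letter nor its negative is in the column. -/
def Free (n : ℕ) (S : Finset ℤ) (f : ℤ) : Prop := 1 ≤ f ∧ f ≤ n ∧ f ∉ S ∧ -f ∉ S

/-- The condition on the set `J` of the letters `t₁, t₂, …` for the column with the set `S` of
nonzero letters and `2m` letters `0`. -/
structure IsJ (n : ℕ) (S : Finset ℤ) (m : ℕ) (J : Finset ℤ) : Prop where
  free : ∀ t ∈ J, Free n S t
  card : (J.card : ℤ) = 2 * m + (dblSet S).card
  lt : ∀ t ∈ J, cnt J t + 1 ≤ 2 * m + cnt (dblSet S) t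
  eq : ∀ f, Free n S f → f ∉ J → cnt J f = 2 * m + cnt (dblSet S) f

/-- The data of a column of height at most `k`, with the set `S` of its nonzero letters and `2m`
letters `0`, the set `J` of the letters `t₁, t₂, …` and the set `E` of the letters by which the
column is extended. -/
structure Spl (n k : ℕ) (S : Finset ℤ) (m : ℕ) (J E : Finset ℤ) : Prop where
  letter : ∀ x ∈ S, IsLetter n x
  isJ : IsJ n S m J
  freeE : ∀ e ∈ E, Free n S e ∧ e ∉ J
  card : (E.card : ℤ) + S.card + 2 * m = k
  even : Even E.card
  min : ∀ e ∈ E, ∀ f, Free n S f → f ∉ J → f ∉ E → e < f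

/-- The set of the extended left column. -/
def leftSet (S J E : Finset ℤ) : Finset ℤ :=
  S.filter (fun x => ¬ (0 < x ∧ -x ∈ S)) ∪ J ∪ E.image (fun x => -x)

/-- The set of the extended right column. -/
def rightSet (S J E : Finset ℤ) : Finset ℤ :=
  S.filter (fun x => ¬ (x < 0 ∧ -x ∈ S)) ∪ J.image (fun x => -x) ∪ E

theorem mem_leftSet {S J E : Finset ℤ} {x : ℤ} :
    x ∈ leftSet S J E ↔ (x ∈ S ∧ ¬ (0 < x ∧ -x ∈ S)) ∨ x ∈ J ∨ -x ∈ E := by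
  unfold leftSet
  simp only [mem_union, mem_filter, mem_image, or_assoc]
  have : (∃ a ∈ E, -a = x) ↔ -x ∈ E :=
    ⟨by rintro ⟨a, h, rfl⟩; rwa [neg_neg], fun h => ⟨-x, h, neg_neg x⟩⟩
  rw [this]

theorem mem_rightSet {S J E : Finset ℤ} {x : ℤ} :
    x ∈ rightSet S J E ↔ (x ∈ S ∧ ¬ (x < 0 ∧ -x ∈ S)) ∨ -x ∈ J ∨ x ∈ E := by
  unfold rightSet
  simp only [mem_union, mem_filter, mem_image, or_assoc]
  have : (∃ a ∈ J, -a = x) ↔ -x ∈ J :=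
    ⟨by rintro ⟨a, h, rfl⟩; rwa [neg_neg], fun h => ⟨-x, h, neg_neg x⟩⟩
  rw [this]

theorem IsJ.le {n : ℕ} {S : Finset ℤ} {m : ℕ} {J : Finset ℤ} (h : IsJ n S m J) (a : ℤ) :
    cnt J a ≤ 2 * m + cnt (dblSet S) a := by
  by_cases hJ : ∃ t ∈ J, a < t
  · obtain ⟨t0, h1, h2⟩ := hJ
    obtain ⟨t, ht, hmin⟩ := exists_min_image (J.filter (a < ·)) id ⟨t0, mem_filter.2 ⟨h1, h2⟩⟩
    rw [mem_filter] at ht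
    have e : cnt J a = cnt J (t - 1) := by
      unfold cnt
      refine sum_congr rfl fun x hx => ?_
      have := hmin x
      rw [mem_filter] at this
      have : a < x → t ≤ x := fun hax => this ⟨hx, hax⟩
      split_ifs <;> omega
    rw [e, cnt_pred, if_pos ht.1]
    exact (h.lt t ht.1).trans (by have := cnt_anti (dblSet S) ht.2.le; omega)
  · push Not at hJ
    rw [cnt_eq_zero hJ]
    have := cnt_nonneg (dblSet S) a
    omega

section
variable {n k : ℕ} {S : Finset ℤ} {m : ℕ} {J E : Finset ℤ}

theorem Spl.mem_J (h : Spl n k S m J E) {x : ℤ} :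
    x ∈ J ↔ 0 < x ∧ x ∈ leftSet S J E ∧ -x ∈ rightSet S J E := by
  rw [mem_leftSet, mem_rightSet, neg_neg]
  constructor
  · intro hx
    exact ⟨by have := (h.isJ.free x hx).1; omega, Or.inr (Or.inl hx), Or.inr (Or.inl hx)⟩
  · rintro ⟨h0, h1 | h1 | h1, h2 | h2 | h2⟩
    · exact absurd ⟨by omega, h1.1⟩ h2.2
    · exact h2
    · have := (h.freeE _ h2).1.1; omega
    all_goals first | exact h1 | exact h2 | (have := (h.freeE _ h1).1.1; omega)

theorem Spl.mem_K (h : Spl n k S m J E) {x : ℤ} :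
    (x ∈ dblSet S ∨ x ∈ E) ↔ 0 < x ∧ -x ∈ leftSet S J E ∧ x ∈ rightSet S J E := by
  rw [mem_leftSet, mem_rightSet, neg_neg, mem_dblSet]
  constructor
  · rintro (hx | hx)
    · exact ⟨hx.2.1, Or.inl ⟨hx.2.2, by omega⟩, Or.inl ⟨hx.1, by omega⟩⟩
    · exact ⟨by have := (h.freeE x hx).1.1; omega, Or.inr (Or.inr hx), Or.inr (Or.inr hx)⟩
  · rintro ⟨h0, h1 | h1 | h1, h2 | h2 | h2⟩
    · exact Or.inl ⟨h2.1, h0, h1.1⟩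
    · have := (h.isJ.free _ h2).1; omega
    · exact Or.inr h2
    · have := (h.isJ.free _ h1).1; omega
    · have := (h.isJ.free _ h2).1; omega
    all_goals first | exact Or.inr h2 | exact Or.inr h1

theorem Spl.mem_both (h : Spl n k S m J E) {x : ℤ} :
    (x ∈ leftSet S J E ∧ x ∈ rightSet S J E) ↔ x ∈ S ∧ -x ∉ S := by
  rw [mem_leftSet, mem_rightSet]
  constructor
  · rintro ⟨h1, h2⟩
    by_cases hx : x ∈ S
    · refine ⟨hx, fun h' => ?_⟩
      have hx0 := (h.letter x hx).1
      have n1 : x ∉ J := fun g => (h.isJ.free _ g).2.2.1 hx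
      have n2 : -x ∉ J := fun g => (h.isJ.free _ g).2.2.2 (by rwa [neg_neg])
      have n3 : x ∉ E := fun g => (h.freeE _ g).1.2.2.1 hx
      have n4 : -x ∉ E := fun g => (h.freeE _ g).1.2.2.2 (by rwa [neg_neg])
      have h1' := (h1.resolve_right (by tauto)).2
      have h2' := (h2.resolve_right (by tauto)).2
      rcases lt_or_ge 0 x with g | g
      · exact h1' ⟨g, h'⟩
      · exact h2' ⟨by omega, h'⟩
    · exfalso
      have h1' := h1.resolve_left (fun g => hx g.1)
      have h2' := h2.resolve_left (fun g => hx g.1)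
      rcases h1' with g | g <;> rcases h2' with g' | g'
      · have := (h.isJ.free _ g).1; have := (h.isJ.free _ g').1; omega
      · exact (h.freeE _ g').2 g
      · exact (h.freeE _ g).2 g'
      · have := (h.freeE _ g).1.1; have := (h.freeE _ g').1.1; omega
  · rintro ⟨h1, h2⟩
    exact ⟨Or.inl ⟨h1, fun g => h2 g.2⟩, Or.inl ⟨h1, fun g => h2 g.2⟩⟩

theorem Spl.isCol_left (h : Spl n k S m J E) : IsCol n (leftSet S J E) := by
  have fJ := fun x hx => h.isJ.free x hx
  have fE := fun x hx => h.freeE x hx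
  intro x hx
  rw [mem_leftSet] at hx ⊢
  rw [neg_neg]
  refine ⟨?_, ?_⟩
  · rcases hx with g | g | g
    · exact h.letter x g.1
    · have := fJ x g; unfold Free at this; exact ⟨by omega, by omega⟩
    · have := (fE _ g).1; unfold Free at this; exact ⟨by omega, by omega⟩
  · rcases hx with g | g | g <;> rintro (g' | g' | g')
    · have := (h.letter x g.1).1
      have h1 : ¬ 0 < x := fun h0 => g.2 ⟨h0, g'.1⟩
      have h2 : ¬ 0 < -x := fun h0 => g'.2 ⟨h0, g.1⟩
      omega
    · exact (fJ _ g').2.2.2 (by rw [neg_neg]; exact g.1)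
    · exact (fE _ g').1.2.2.1 g.1
    · exact (fJ _ g).2.2.2 g'.1
    · have := (fJ _ g).1; have := (fJ _ g').1; omega
    · exact (fE _ g').2 g
    · exact (fE _ g).1.2.2.1 g'.1
    · exact (fE _ g).2 g'
    · have := (fE _ g).1.1; have := (fE _ g').1.1; omega

theorem Spl.abs (h : Spl n k S m J E) (x : ℤ) :
    (x ∈ rightSet S J E ∨ -x ∈ rightSet S J E) ↔ (x ∈ leftSet S J E ∨ -x ∈ leftSet S J E) := by
  have hx : x ∈ S → x ≠ 0 := fun hx => (h.letter x hx).1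
  have hx' : -x ∈ S → x ≠ 0 := fun hx => by have := (h.letter _ hx).1; omega
  rw [mem_leftSet, mem_leftSet, mem_rightSet, mem_rightSet, neg_neg]
  by_cases h1 : x ∈ S <;> by_cases h2 : -x ∈ S
  · have := hx h1
    simp only [h1, h2, and_true, true_and]
    constructor <;> intro _ <;> rcases lt_or_ge 0 x with g | g
    · right; left; omega
    · left; left; omega
    · left; left; omega
    · right; left; omega
  · simp [h1, h2]
  · simp [h1, h2]
  · simp only [h1, h2, false_and, false_or]; tauto

theorem Spl.isCol_right (h : Spl n k S m J E) : IsCol n (rightSet S J E) := by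
  intro x hx
  have hl : IsLetter n x := by
    rcases (h.abs x).1 (Or.inl hx) with g | g
    · exact (h.isCol_left x g).1
    · have := (h.isCol_left _ g).1.neg; rwa [neg_neg] at this
  refine ⟨hl, fun hx' => ?_⟩
  have hx0 := hl.1
  have b := (h.abs x).1 (Or.inl hx)
  rcases b with g | g
  · have e := h.mem_both.1 ⟨g, hx⟩
    rcases lt_or_ge 0 x with g0 | g0
    · exact (h.isJ.free x (h.mem_J.2 ⟨g0, g, hx'⟩)).2.2.1 e.1
    · have := (h.mem_K (x := -x)).2 ⟨by omega, by rwa [neg_neg], hx'⟩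
      rcases this with c | c
      · exact e.2 (mem_dblSet.1 c).1
      · exact (h.freeE _ c).1.2.2.2 (by rw [neg_neg]; exact e.1)
  · have e := h.mem_both.1 ⟨g, hx'⟩
    rw [neg_neg] at e
    rcases lt_or_ge 0 x with g0 | g0
    · rcases h.mem_K.2 ⟨g0, g, hx⟩ with c | c
      · exact e.2 (mem_dblSet.1 c).1
      · exact (h.freeE _ c).1.2.2.2 e.1
    · exact (h.isJ.free (-x) (h.mem_J.2 ⟨by omega, g, by rwa [neg_neg]⟩)).2.2.1 e.1

theorem Spl.card_left (h : Spl n k S m J E) : (leftSet S J E).card = k := by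
  have e1 : (S.filter (fun x => ¬ (0 < x ∧ -x ∈ S))).card + (dblSet S).card = S.card := by
    rw [add_comm]; exact card_filter_add_card_filter_not _
  have d1 : Disjoint (S.filter (fun x => ¬ (0 < x ∧ -x ∈ S))) J := by
    rw [disjoint_left]
    exact fun x hx hx' => (h.isJ.free x hx').2.2.1 (mem_filter.1 hx).1
  have d2 : Disjoint (S.filter (fun x => ¬ (0 < x ∧ -x ∈ S)) ∪ J) (E.image (fun x => -x)) := by
    rw [disjoint_left]
    intro x hx hx'
    obtain ⟨y, hy, rfl⟩ := mem_image.1 hx'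
    rcases mem_union.1 hx with g | g
    · exact (h.freeE y hy).1.2.2.2 (mem_filter.1 g).1
    · have := (h.isJ.free _ g).1; have := (h.freeE y hy).1.1; omega
  unfold leftSet
  rw [card_union_of_disjoint d2, card_union_of_disjoint d1, card_image_of_injective _ neg_injective]
  have := h.card
  have := h.isJ.card
  omega

theorem Spl.sum_sg (h : Spl n k S m J E) {c : ℤ} (hc : 0 ≤ c) :
    ∑ d ∈ leftSet S J E \ rightSet S J E, sg c d = cnt (dblSet S) c + cnt E c - cnt J c := by
  have hd : Disjoint (dblSet S) E := by
    rw [disjoint_left]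
    exact fun x hx hx' => (h.freeE x hx').1.2.2.1 (mem_dblSet.1 hx).1
  have e : leftSet S J E \ rightSet S J E = J ∪ (dblSet S ∪ E).image (fun x => -x) := by
    ext x
    rw [mem_sdiff, mem_union, mem_image, h.mem_J]
    constructor
    · rintro ⟨h1, h2⟩
      have hx0 := (h.isCol_left x h1).1.1
      have h3 := ((h.abs x).2 (Or.inl h1)).resolve_left h2
      rcases lt_or_ge 0 x with g | g
      · exact Or.inl ⟨g, h1, h3⟩
      · refine Or.inr ⟨-x, mem_union.2 (h.mem_K.2 ⟨by omega, by rwa [neg_neg], h3⟩), neg_neg x⟩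
    · rintro (⟨h0, h1, h2⟩ | ⟨y, hy, rfl⟩)
      · exact ⟨h1, fun h' => (h.isCol_right _ h').2 h2⟩
      · obtain ⟨h0, h1, h2⟩ := h.mem_K.1 (mem_union.1 hy)
        exact ⟨h1, fun h' => (h.isCol_right _ h2).2 h'⟩
  rw [e, sum_union, sum_image neg_injective.injOn, ← cnt_union hd, cnt, cnt]
  · have e1 : ∑ x ∈ J, sg c x = -∑ x ∈ J, if c < x then 1 else 0 := by
      rw [← sum_neg_distrib]
      refine sum_congr rfl fun x hx => ?_
      have := (h.isJ.free x hx).1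
      unfold sg; split_ifs <;> omega
    have e2 : ∑ x ∈ dblSet S ∪ E, sg c (-x) = ∑ x ∈ dblSet S ∪ E, if c < x then 1 else 0 := by
      refine sum_congr rfl fun x hx => ?_
      have := (h.mem_K.1 (mem_union.1 hx)).1
      unfold sg; split_ifs <;> omega
    rw [e1, e2]; ring
  · rw [disjoint_left]
    intro x hx hx'
    obtain ⟨y, hy, rfl⟩ := mem_image.1 hx'
    have := (h.mem_K.1 (mem_union.1 hy)).1
    have := (h.isJ.free _ hx).1
    omega

theorem Spl.unused_iff (h : Spl n k S m J E) {u : ℤ} (hu : 0 < u) :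
    Unused n (leftSet S J E) u ↔ Free n S u ∧ u ∉ J ∧ u ∉ E := by
  unfold Unused Free
  rw [mem_leftSet, mem_leftSet, neg_neg]
  have e1 : -u ∉ J := fun g => by have := (h.isJ.free _ g).1; omega
  have e2 : -u ∉ E := fun g => by have := (h.freeE _ g).1.1; omega
  constructor
  · rintro ⟨h1, h2, h3⟩
    have := h1.2
    have n1 : -u ∉ S := fun g => h3 (Or.inl ⟨g, by omega⟩)
    exact ⟨⟨by omega, by omega, fun g => h2 (Or.inl ⟨g, fun g' => n1 g'.2⟩), n1⟩, by tauto, by tauto⟩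
  · rintro ⟨⟨h1, h2, h3, h4⟩, h5, h6⟩
    exact ⟨⟨by omega, by omega⟩, by tauto, by tauto⟩

theorem Spl.ballot (h : Spl n k S m J E) : Ballot n (leftSet S J E) (rightSet S J E) := by
  refine ⟨h.abs, m, fun c hc => ?_, fun u hu hu' => ?_, ?_⟩
  · rw [h.sum_sg hc]
    have := h.isJ.le c
    have := cnt_nonneg E c
    omega
  · rw [h.sum_sg hu.le]
    obtain ⟨g1, g2, g3⟩ := (h.unused_iff hu).1 hu'
    have := h.isJ.eq u g1 g2
    have := cnt_eq_zero (X := E) (a := u) fun e he => (h.min e he u g1 g2 g3).le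
    omega
  · rw [h.sum_sg le_rfl, cnt_eq_card, cnt_eq_card, cnt_eq_card, h.isJ.card]
    · have := h.even
      rw [← Int.even_coe_nat] at this
      rw [Int.even_iff] at this ⊢
      omega
    · exact fun x hx => by have := (h.isJ.free x hx).1; omega
    · exact fun x hx => by have := (h.freeE x hx).1.1; omega
    · exact fun x hx => (mem_dblSet.1 hx).2.1

end

/-- There are unused letters. -/
theorem exists_unused {n k : ℕ} (hk : k < n) {L : Finset ℤ} (hc : L.card = k) :
    ∃ u, 0 < u ∧ Unused n L u := by
  by_contra hcon
  push Not at hcon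
  have : Icc (1 : ℤ) n ⊆ L.image (fun x => (x.natAbs : ℤ)) := by
    intro u hu
    rw [mem_Icc] at hu
    have := hcon u (by omega)
    have hul : IsLetter n u := ⟨by omega, by omega⟩
    rw [mem_image]
    by_cases h1 : u ∈ L
    · exact ⟨u, h1, by omega⟩
    by_cases h2 : -u ∈ L
    · exact ⟨-u, h2, by omega⟩
    exact absurd ⟨hul, h1, h2⟩ this
  have h1 := card_le_card this
  have h2 := card_image_le (s := L) (f := fun x => (x.natAbs : ℤ))
  rw [Int.card_Icc] at h1
  omega

theorem Spl.inj_aux {n k : ℕ} {S S' : Finset ℤ} {m : ℕ} {J E E' : Finset ℤ}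
    (h : Spl n k S m J E) (h' : Spl n k S' m J E')
    (hK : ∀ x, (x ∈ dblSet S ∨ x ∈ E) ↔ (x ∈ dblSet S' ∨ x ∈ E')) (hc : E.card ≤ E'.card) {x : ℤ}
    (hx : x ∈ E) (hx' : x ∉ E') (hmax : ∀ y, x < y → (y ∈ E ↔ y ∈ E')) : False := by
  have hd : ∀ {S J E} (_ : Spl n k S m J E), Disjoint (dblSet S) E := by
    intro S J E h
    rw [disjoint_left]
    exact fun x hx hx' => (h.freeE x hx').1.2.2.1 (mem_dblSet.1 hx).1
  obtain ⟨y0, hy0, hy0x⟩ : ∃ y ∈ E', y < x := by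
    by_contra hcon
    push Not at hcon
    have : E' ⊆ E.erase x := fun y hy => by
      have h1 := hcon y hy
      have h2 : y ≠ x := by rintro rfl; exact hx' hy
      exact mem_erase.2 ⟨h2, (hmax y (by omega)).2 hy⟩
    have := card_le_card this
    rw [card_erase_of_mem hx] at this
    have := card_pos.2 ⟨x, hx⟩
    omega
  obtain ⟨y, hy, hymax⟩ := exists_max_image (E'.filter (· < x)) id ⟨y0, mem_filter.2 ⟨hy0, hy0x⟩⟩
  rw [mem_filter] at hy
  have e1 := h'.isJ.eq y (h'.freeE y hy.1).1 (h'.freeE y hy.1).2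
  have e2 := h.isJ.le y
  have e3 := cnt_union (hd h) y
  have e4 := cnt_union (hd h') y
  have e5 : dblSet S ∪ E = dblSet S' ∪ E' := by
    ext z; rw [mem_union, mem_union]; exact hK z
  have e6 : cnt E' y + 1 ≤ cnt E y := by
    refine cnt_lt (z := x) (fun z hz hyz => ?_) hx hx' hy.2
    have h2 : z ≠ x := by rintro rfl; exact hx' hz
    by_cases hzx : z < x
    · have := hymax z (mem_filter.2 ⟨hz, hzx⟩)
      simp only [id] at this
      omega
    · exact (hmax z (by omega)).2 hz
  rw [e5] at e3
  omega

/-- The column is determined by the sets of the extended columns. -/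
theorem Spl.inj {n k : ℕ} (hk : k < n) {S S' : Finset ℤ} {m m' : ℕ} {J J' E E' : Finset ℤ}
    (h : Spl n k S m J E) (h' : Spl n k S' m' J' E') (h1 : leftSet S J E = leftSet S' J' E')
    (h2 : rightSet S J E = rightSet S' J' E') : S = S' ∧ m = m' := by
  have hJ : J = J' := by ext x; rw [h.mem_J, h'.mem_J, h1, h2]
  subst hJ
  have hK : ∀ x, (x ∈ dblSet S ∨ x ∈ E) ↔ (x ∈ dblSet S' ∨ x ∈ E') := by
    intro x; rw [h.mem_K, h'.mem_K, h1, h2]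
  have hd : ∀ {S m J E} (_ : Spl n k S m J E), Disjoint (dblSet S) E := by
    intro S m J E h
    rw [disjoint_left]
    exact fun x hx hx' => (h.freeE x hx').1.2.2.1 (mem_dblSet.1 hx).1
  have hKe : dblSet S ∪ E = dblSet S' ∪ E' := by
    ext z; rw [mem_union, mem_union]; exact hK z
  obtain ⟨u, hu0, hu⟩ := exists_unused hk h.card_left
  have hm : m = m' := by
    have g := (h.unused_iff hu0).1 hu
    rw [h1] at hu
    have g' := (h'.unused_iff hu0).1 hu
    have a1 := h.isJ.eq u g.1 g.2.1
    have a2 := h'.isJ.eq u g'.1 g'.2.1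
    have a3 := cnt_eq_zero (X := E) (a := u) fun e he => (h.min e he u g.1 g.2.1 g.2.2).le
    have a4 := cnt_eq_zero (X := E') (a := u) fun e he => (h'.min e he u g'.1 g'.2.1 g'.2.2).le
    have a5 := cnt_union (hd h) u
    have a6 := cnt_union (hd h') u
    rw [hKe] at a5
    omega
  subst hm
  refine ⟨?_, rfl⟩
  have hcE : E.card = E'.card := by
    have a1 := h.isJ.card
    have a2 := h'.isJ.card
    have a3 := card_union_of_disjoint (hd h)
    have a4 := card_union_of_disjoint (hd h')
    rw [hKe] at a3
    omega
  have hE : E = E' := by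
    by_contra hne
    have hne' : (symmDiff E E').Nonempty := by
      rw [nonempty_iff_ne_empty]
      intro h0
      exact hne (symmDiff_eq_bot.1 h0)
    obtain ⟨x, hx, hmax⟩ := exists_max_image (symmDiff E E') id hne'
    have hmax' : ∀ y, x < y → (y ∈ E ↔ y ∈ E') := by
      intro y hy
      have := hmax y
      rw [mem_symmDiff] at this
      simp only [id] at this
      by_contra hcon
      have := this (by tauto)
      omega
    rcases mem_symmDiff.1 hx with ⟨g1, g2⟩ | ⟨g1, g2⟩
    · exact h.inj_aux h' hK hcE.le g1 g2 hmax'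
    · exact h'.inj_aux h (fun x => (hK x).symm) hcE.ge g1 g2 fun y hy => (hmax' y hy).symm
  subst hE
  have hI : ∀ x : ℤ, x ∈ dblSet S ↔ x ∈ dblSet S' := by
    intro x
    have a1 : x ∈ dblSet S → x ∉ E := fun q => disjoint_left.1 (hd h) q
    have a2 : x ∈ dblSet S' → x ∉ E := fun q => disjoint_left.1 (hd h') q
    have := hK x
    tauto
  have main : ∀ {S S' : Finset ℤ} {m : ℕ}, Spl n k S m J E → (∀ x : ℤ, x ∈ dblSet S ↔ x ∈ dblSet S') →
      (∀ x : ℤ, (x ∈ S ∧ -x ∉ S) ↔ (x ∈ S' ∧ -x ∉ S')) → ∀ x ∈ S, x ∈ S' := by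
    intro S S' m h hI hb x hx
    by_cases hnx : -x ∈ S
    · have hx0 := (h.letter x hx).1
      rcases lt_or_ge 0 x with g | g
      · exact (mem_dblSet.1 ((hI x).1 (mem_dblSet.2 ⟨hx, g, hnx⟩))).1
      · have := (mem_dblSet.1 ((hI (-x)).1 (mem_dblSet.2 ⟨hnx, by omega, by rwa [neg_neg]⟩))).2.2
        rwa [neg_neg] at this
    · exact ((hb x).1 ⟨hx, hnx⟩).1
  have hb : ∀ x : ℤ, (x ∈ S ∧ -x ∉ S) ↔ (x ∈ S' ∧ -x ∉ S') := by
    intro x; rw [← h.mem_both, ← h'.mem_both, h1, h2]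
  exact subset_antisymm (main h hI hb) (main h' (fun x => (hI x).symm) fun x => (hb x).symm)

theorem sum_sg_eq_cnt {D : Finset ℤ} (hD : ∀ x ∈ D, x ≠ 0) {c : ℤ} (hc : 0 ≤ c) :
    ∑ d ∈ D, sg c d = cnt ((D.filter (· < 0)).image (fun x => -x)) c - cnt (D.filter (0 < ·)) c := by
  unfold cnt
  rw [sum_image fun x _ y _ h => neg_injective h, sum_filter, sum_filter, ← sum_sub_distrib]
  refine sum_congr rfl fun x hx => ?_
  have := hD x hx
  unfold sg
  split_ifs <;> omega

/-- The strict left-to-right minima of a function with steps `±1`, all of whose steps downwards are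
in `K`, count how far the minimum of the function has decreased. -/
theorem cnt_records {H : ℤ → ℤ} {K J E : Finset ℤ} (hE : ∀ x, x ∈ E ↔ x ∈ K ∧ ∀ y, 0 ≤ y → y < x → H x < H y)
    (hK : ∀ x ∈ K, 0 < x) (hJK : ∀ x ∈ K, x ∉ J)
    (hH : ∀ a, H (a - 1) = H a + (if a ∈ K then 1 else 0) - if a ∈ J then 1 else 0) (a : ℕ) :
    (∃ y : ℤ, 0 ≤ y ∧ y ≤ a ∧ H y = H 0 - E.card + cnt E a) ∧
      ∀ y : ℤ, 0 ≤ y → y ≤ a → H 0 - E.card + cnt E a ≤ H y := by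
  induction a with
  | zero =>
    have : cnt E 0 = E.card := cnt_eq_card fun x hx => hK x ((hE x).1 hx).1
    rw [Nat.cast_zero]
    refine ⟨⟨0, le_rfl, le_rfl, by omega⟩, fun y h1 h2 => ?_⟩
    have : y = 0 := by omega
    subst this
    omega
  | succ a ih =>
    obtain ⟨⟨y, hy0, hya, hy⟩, ih⟩ := ih
    have h1 := cnt_pred E ((a + 1 : ℕ) : ℤ)
    have h2 := hH ((a + 1 : ℕ) : ℤ)
    have e : ((a + 1 : ℕ) : ℤ) - 1 = a := by push_cast; ring
    rw [e] at h1 h2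
    have h3 := ih a (by omega) le_rfl
    by_cases hmem : ((a + 1 : ℕ) : ℤ) ∈ E
    · have g := (hE _).1 hmem
      have g2 := g.2 y hy0 (by omega)
      rw [if_pos g.1, if_neg (hJK _ g.1)] at h2
      rw [if_pos hmem] at h1
      refine ⟨⟨_, by omega, le_rfl, by omega⟩, fun z hz hz' => ?_⟩
      rcases eq_or_lt_of_le hz' with rfl | hz'
      · omega
      · have := ih z hz (by omega); omega
    · rw [if_neg hmem] at h1
      have h4 : H 0 - E.card + cnt E a ≤ H ((a + 1 : ℕ) : ℤ) := by
        by_cases hk : ((a + 1 : ℕ) : ℤ) ∈ K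
        · have : ¬ ∀ y, 0 ≤ y → y < ((a + 1 : ℕ) : ℤ) → H ((a + 1 : ℕ) : ℤ) < H y :=
            fun h => hmem ((hE _).2 ⟨hk, h⟩)
          push Not at this
          obtain ⟨z, hz, hz', hz''⟩ := this
          have := ih z hz (by push_cast at hz'; omega)
          omega
        · rw [if_neg hk] at h2
          split_ifs at h2 <;> omega
      refine ⟨⟨y, hy0, by omega, by omega⟩, fun z hz hz' => ?_⟩
      rcases eq_or_lt_of_le hz' with rfl | hz'
      · omega
      · have := ih z hz (by omega); omega

theorem exists_spl {n k : ℕ} (hk : k < n) {L R : Finset ℤ} (hL : IsCol n L) (hc : L.card = k)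
    (hR : IsCol n R) (hB : Ballot n L R) :
    ∃ S m J E, Spl n k S m J E ∧ leftSet S J E = L ∧ rightSet S J E = R := by
  obtain ⟨habs, m, hpos, hzero, heven⟩ := hB
  obtain ⟨u0, hu0, hu0'⟩ := exists_unused hk hc
  have hD : ∀ x ∈ L \ R, x ≠ 0 := fun x hx => (hL x (mem_sdiff.1 hx).1).1.1
  set J := (L \ R).filter (0 < ·) with hJdef
  set K := ((L \ R).filter (· < 0)).image (fun x => -x) with hKdef
  have mJ : ∀ x, x ∈ J ↔ 0 < x ∧ x ∈ L ∧ -x ∈ R := by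
    intro x
    rw [hJdef, mem_filter, mem_sdiff]
    refine ⟨fun h => ⟨h.2, h.1.1, ?_⟩, fun h => ⟨⟨h.2.1, fun g => (hR _ g).2 h.2.2⟩, h.1⟩⟩
    exact ((habs x).2 (Or.inl h.1.1)).resolve_left h.1.2
  have mK : ∀ x, x ∈ K ↔ 0 < x ∧ -x ∈ L ∧ x ∈ R := by
    intro x
    rw [hKdef, mem_image]
    constructor
    · rintro ⟨y, h, rfl⟩
      rw [mem_filter, mem_sdiff] at h
      rw [neg_neg]
      exact ⟨by omega, h.1.1, ((habs y).2 (Or.inl h.1.1)).resolve_left h.1.2⟩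
    · rintro ⟨h0, h1, h2⟩
      refine ⟨-x, mem_filter.2 ⟨mem_sdiff.2 ⟨h1, (hR _ h2).2⟩, by omega⟩, neg_neg x⟩
  have hJK : ∀ x ∈ K, x ∉ J := fun x h g => (hL _ ((mJ x).1 g).2.1).2 ((mK x).1 h).2.1
  set H : ℤ → ℤ := fun a => 2 * m + cnt K a - cnt J a with hHdef
  have hHsum : ∀ c, 0 ≤ c → H c = 2 * m + ∑ d ∈ L \ R, sg c d := fun c h => by
    rw [sum_sg_eq_cnt hD h, hHdef]; ring
  have hH : ∀ a, H (a - 1) = H a + (if a ∈ K then 1 else 0) - if a ∈ J then 1 else 0 := fun a => by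
    simp only [hHdef, cnt_pred]; ring
  obtain ⟨E, hE⟩ : ∃ E : Finset ℤ, ∀ x, x ∈ E ↔ x ∈ K ∧ ∀ y, 0 ≤ y → y < x → H x < H y := by
    refine ⟨K.filter fun x => ∀ y ∈ Ico (0 : ℤ) x, H x < H y, fun x => ?_⟩
    simp only [mem_filter, mem_Ico, and_imp]
  have hKpos : ∀ x ∈ K, 0 < x := fun x hx => ((mK x).1 hx).1
  have hEpos : ∀ x ∈ E, 0 < x := fun x hx => hKpos x ((hE x).1 hx).1
  have hrec := cnt_records hE hKpos hJK hH
  have hpos' : ∀ c, 0 ≤ c → 0 ≤ H c := fun c h => by rw [hHsum c h]; exact hpos c h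
  have hzero' : ∀ u, 0 < u → Unused n L u → H u = 0 := fun u h h' => by
    rw [hHsum u h.le]; exact hzero u h h'
  have hEcard : (E.card : ℤ) = H 0 := by
    obtain ⟨⟨y, h1, h2, h3⟩, h4⟩ := hrec n
    have h5 : cnt E n = 0 := cnt_eq_zero fun x hx => by
      have := (hR x ((mK x).1 ((hE x).1 hx).1).2.2).1.2
      omega
    have h6 := h4 u0 hu0.le (by have := hu0'.1.2; omega)
    rw [hzero' u0 hu0 hu0'] at h6
    have := hpos' y h1
    omega
  have hle : ∀ a : ℤ, 0 ≤ a → cnt E a ≤ H a := by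
    intro a ha
    lift a to ℕ using ha
    have := (hrec a).2 a (by omega) le_rfl
    omega
  have hEeq : ∀ e ∈ E, H e = cnt E e := by
    intro e he
    have h0 := (hEpos e he).le
    have h1 := hle e h0
    lift e to ℕ using h0
    obtain ⟨y, g1, g2, g3⟩ := (hrec e).1
    rcases eq_or_lt_of_le g2 with rfl | g2
    · omega
    · have := ((hE _).1 he).2 y g1 g2
      omega
  have hm : 0 ≤ m := by
    have h1 := hzero' u0 hu0 hu0'
    have h2 := hpos' n (by omega)
    have h3 : cnt K n = 0 := cnt_eq_zero fun x hx => by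
      have := (hR x ((mK x).1 hx).2.2).1.2; omega
    have h4 := cnt_nonneg J n
    simp only [hHdef] at h2
    omega
  lift m to ℕ using hm
  set I := K \ E with hI
  set S := L ∩ R ∪ I ∪ I.image (fun x => -x) with hS
  have mI : ∀ x, x ∈ I ↔ x ∈ K ∧ x ∉ E := fun x => by rw [hI, mem_sdiff]
  have mS : ∀ x, x ∈ S ↔ (x ∈ L ∧ x ∈ R) ∨ x ∈ I ∨ -x ∈ I := by
    intro x
    have : (∃ a ∈ I, -a = x) ↔ -x ∈ I :=
      ⟨by rintro ⟨a, h, rfl⟩; rwa [neg_neg], fun h => ⟨-x, h, neg_neg x⟩⟩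
    rw [hS, mem_union, mem_union, mem_inter, mem_image, this, or_assoc]
  have hIpos : ∀ x ∈ I, 0 < x := fun x hx => hKpos x ((mI x).1 hx).1
  have hLR : ∀ x, x ∈ I → x ∉ L ∧ -x ∉ R := fun x hx => by
    have h1 := (mK x).1 ((mI x).1 hx).1
    exact ⟨fun g => (hL _ g).2 h1.2.1, (hR _ h1.2.2).2⟩
  have mdbl : dblSet S = I := by
    ext x
    rw [mem_dblSet, mS, mS, neg_neg]
    constructor
    · rintro ⟨h1, h0, h2⟩
      by_contra hx
      have hx' : -x ∉ I := fun g => by have := hIpos _ g; omega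
      simp only [hx, hx', or_false] at h1 h2
      exact (hL x h1.1).2 h2.1
    · intro h
      exact ⟨Or.inr (Or.inl h), hIpos x h, Or.inr (Or.inr h)⟩
  have hEK : E ⊆ K := fun x hx => ((hE x).1 hx).1
  have hKIE : K = I ∪ E := (sdiff_union_of_subset hEK).symm
  have hIE : Disjoint I E := sdiff_disjoint
  have cK : ∀ a, cnt K a = cnt I a + cnt E a := fun a => by rw [hKIE]; exact cnt_union hIE a
  have hlet : ∀ x ∈ S, IsLetter n x := by
    intro x hx
    rcases (mS x).1 hx with h | h | h
    · exact (hL x h.1).1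
    · exact (hR x ((mK x).1 ((mI x).1 h).1).2.2).1
    · have := (hR _ ((mK _).1 ((mI _).1 h).1).2.2).1.neg
      rwa [neg_neg] at this
  have free : ∀ f, Free n S f ↔ f ∈ J ∨ f ∈ E ∨ (0 < f ∧ Unused n L f) := by
    intro f
    unfold Free
    rw [mS, mS, neg_neg]
    constructor
    · rintro ⟨h1, h2, h3, h4⟩
      push Not at h3 h4
      by_cases hu : f ∉ L ∧ -f ∉ L
      · exact Or.inr (Or.inr ⟨by omega, ⟨by omega, by omega⟩, hu.1, hu.2⟩)
      · by_cases hf : f ∈ L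
        · have := ((habs f).2 (Or.inl hf)).resolve_left (h3.1 hf)
          exact Or.inl ((mJ f).2 ⟨by omega, hf, this⟩)
        · have hf' : -f ∈ L := by by_contra g; exact hu ⟨hf, g⟩
          have := ((habs f).2 (Or.inr hf')).resolve_right (h4.1 hf')
          refine Or.inr (Or.inl ?_)
          by_contra hfE
          exact h3.2.1 ((mI f).2 ⟨(mK f).2 ⟨by omega, hf', this⟩, hfE⟩)
    · rintro (h | h | h)
      · have g := (mJ f).1 h
        have hl := (hL f g.2.1)
        have := hl.1.2
        refine ⟨by omega, by omega, ?_, ?_⟩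
        · rintro (q | q | q)
          · exact (hR _ q.2).2 g.2.2
          · exact (hLR _ q).1 g.2.1
          · have := hIpos _ q; omega
        · rintro (q | q | q)
          · exact hl.2 q.1
          · have := hIpos _ q; omega
          · exact (hLR _ q).1 g.2.1
      · have g := (mK f).1 (hEK h)
        have hl := (hR f g.2.2)
        have := hl.1.2
        refine ⟨by omega, by omega, ?_, ?_⟩
        · rintro (q | q | q)
          · exact (hL _ q.1).2 g.2.1
          · exact ((mI f).1 q).2 h
          · have := hIpos _ q; omega
        · rintro (q | q | q)
          · exact hl.2 q.2
          · have := hIpos _ q; omega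
          · exact ((mI f).1 q).2 h
      · have := h.2.1.2
        refine ⟨by omega, by omega, ?_, ?_⟩
        · rintro (q | q | q)
          · exact h.2.2.1 q.1
          · exact h.2.2.2 ((mK _).1 ((mI f).1 q).1).2.1
          · have := hIpos _ q; omega
        · rintro (q | q | q)
          · exact h.2.2.2 q.1
          · have := hIpos _ q; omega
          · exact h.2.2.2 ((mK _).1 ((mI f).1 q).1).2.1
  have hcard : (J.card : ℤ) = 2 * m + I.card := by
    have h1 : H 0 = 2 * m + cnt K 0 - cnt J 0 := rfl
    rw [cK, cnt_eq_card hIpos, cnt_eq_card hEpos, cnt_eq_card fun x hx => ((mJ x).1 hx).1] at h1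
    omega
  have hEu : ∀ e ∈ E, ∀ u, 0 < u → Unused n L u → e < u := by
    intro e he u h0 hu
    have h1 := hle u h0.le
    rw [hzero' u h0 hu] at h1
    have hne : e ≠ u := by rintro rfl; exact hu.2.2 ((mK _).1 (hEK he)).2.1
    by_contra hcon
    have := cnt_lt (X := ∅) (Y := E) (a := u) (z := e) (by simp) he (by simp) (by omega)
    have := cnt_nonneg ∅ u
    omega
  refine ⟨S, m, J, E, ⟨hlet, ⟨fun t ht => (free t).2 (Or.inl ht), by rw [mdbl]; exact hcard, ?_, ?_⟩,
    fun e he => ⟨(free e).2 (Or.inr (Or.inl he)), hJK e (hEK he)⟩, ?_, ?_, ?_⟩, ?_, ?_⟩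
  · intro t ht
    have h0 := ((mJ t).1 ht).1
    have h1 := hle (t - 1) (by omega)
    have hK' : t ∉ K := fun g => hJK t g ht
    rw [hH, if_neg hK', if_pos ht, cnt_pred, if_neg fun g => hK' (hEK g)] at h1
    have h2 : H t = 2 * m + cnt K t - cnt J t := rfl
    have := cK t
    rw [mdbl]
    omega
  · intro f hf hfJ
    have h2 : H f = 2 * m + cnt K f - cnt J f := rfl
    have := cK f
    rw [mdbl]
    rcases (free f).1 hf with h | h | h
    · exact absurd h hfJ
    · have := hEeq f h; omega
    · have := hzero' f h.1 h.2
      have := cnt_eq_zero (X := E) (a := f) fun e he => (hEu e he f h.1 h.2).le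
      omega
  · have e1 : L = L ∩ R ∪ (J ∪ K.image (fun x => -x)) := by
      ext x
      have : (∃ a ∈ K, -a = x) ↔ -x ∈ K :=
        ⟨by rintro ⟨a, h, rfl⟩; rwa [neg_neg], fun h => ⟨-x, h, neg_neg x⟩⟩
      rw [mem_union, mem_union, mem_inter, mem_image, this, mJ, mK, neg_neg]
      constructor
      · intro h
        have := (hL x h).1.1
        by_cases hx : x ∈ R
        · exact Or.inl ⟨h, hx⟩
        · have := ((habs x).2 (Or.inl h)).resolve_left hx
          rcases lt_or_ge 0 x with g | g
          · exact Or.inr (Or.inl ⟨g, h, this⟩)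
          · exact Or.inr (Or.inr ⟨by omega, h, this⟩)
      · rintro (h | h | h)
        · exact h.1
        · exact h.2.1
        · exact h.2.1
    have c1 := congrArg card e1
    rw [card_union_of_disjoint, card_union_of_disjoint,
      card_image_of_injective _ neg_injective, hKIE, card_union_of_disjoint hIE] at c1
    · have c2 : S.card = (L ∩ R).card + I.card + I.card := by
        rw [hS, card_union_of_disjoint, card_union_of_disjoint,
          card_image_of_injective _ neg_injective]
        · exact disjoint_left.2 fun x h g => (hLR x g).1 (mem_inter.1 h).1
        · rw [disjoint_left]
          intro x h g
          obtain ⟨y, hy, rfl⟩ := mem_image.1 g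
          have := hIpos y hy
          rcases mem_union.1 h with h | h
          · exact (hLR y hy).2 (mem_inter.1 h).2
          · have := hIpos _ h; omega
      omega
    · rw [disjoint_left]
      intro x h g
      obtain ⟨y, hy, rfl⟩ := mem_image.1 g
      have := hKpos y hy
      have := ((mJ _).1 h).1
      omega
    · rw [disjoint_left]
      intro x h g
      rcases mem_union.1 g with g | g
      · exact (hR _ (mem_inter.1 h).2).2 ((mJ _).1 g).2.2
      · obtain ⟨y, hy, rfl⟩ := mem_image.1 g
        exact (hR _ ((mK _).1 hy).2.2).2 (mem_inter.1 h).2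
  · rw [← Int.even_coe_nat, hEcard, hHsum 0 le_rfl]
    exact (even_two_mul _).add heven
  · intro e he f hf hfJ hfE
    rcases (free f).1 hf with h | h | h
    · exact absurd h hfJ
    · exact absurd h hfE
    · exact hEu e he f h.1 h.2
  · ext x
    rw [mem_leftSet, mS, mS, neg_neg]
    constructor
    · rintro (⟨h1 | h1 | h1, h2⟩ | h | h)
      · exact h1.1
      · exact absurd ⟨hIpos x h1, Or.inr (Or.inr h1)⟩ h2
      · have := ((mK _).1 ((mI _).1 h1).1).2.1; rwa [neg_neg] at this
      · exact ((mJ x).1 h).2.1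
      · have := ((mK _).1 (hEK h)).2.1; rwa [neg_neg] at this
    · intro h
      have h0 := (hL x h).1.1
      have hx := (hL x h).2
      have hxI : x ∉ I := fun g => (hLR x g).1 h
      by_cases hR' : x ∈ R
      · refine Or.inl ⟨Or.inl ⟨h, hR'⟩, ?_⟩
        rintro ⟨g0, g | g | g⟩
        · exact hx g.1
        · have := hIpos _ g; omega
        · exact hxI g
      · have hR'' := ((habs x).2 (Or.inl h)).resolve_left hR'
        rcases lt_or_ge 0 x with g | g
        · exact Or.inr (Or.inl ((mJ x).2 ⟨g, h, hR''⟩))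
        · have hk' := (mK (-x)).2 ⟨by omega, by rwa [neg_neg], hR''⟩
          by_cases hE' : -x ∈ E
          · exact Or.inr (Or.inr hE')
          · exact Or.inl ⟨Or.inr (Or.inr ((mI _).2 ⟨hk', hE'⟩)), by omega⟩
  · ext x
    rw [mem_rightSet, mS, mS, neg_neg]
    constructor
    · rintro (⟨h1 | h1 | h1, h2⟩ | h | h)
      · exact h1.2
      · exact ((mK _).1 ((mI _).1 h1).1).2.2
      · exact absurd ⟨by have := hIpos _ h1; omega, Or.inr (Or.inl h1)⟩ h2
      · have := ((mJ _).1 h).2.2; rwa [neg_neg] at this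
      · exact ((mK _).1 (hEK h)).2.2
    · intro h
      have h0 := (hR x h).1.1
      have hx := (hR x h).2
      have hxI : -x ∉ I := fun g => (hLR _ g).2 (by rwa [neg_neg])
      by_cases hL' : x ∈ L
      · refine Or.inl ⟨Or.inl ⟨hL', h⟩, ?_⟩
        rintro ⟨g0, g | g | g⟩
        · exact hx g.2
        · exact hxI g
        · have := hIpos _ g; omega
      · have hL'' := ((habs x).1 (Or.inl h)).resolve_left hL'
        rcases lt_or_ge x 0 with g | g
        · exact Or.inr (Or.inl ((mJ (-x)).2 ⟨by omega, hL'', by rwa [neg_neg]⟩))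
        · have hk' := (mK x).2 ⟨by omega, hL'', h⟩
          by_cases hE' : x ∈ E
          · exact Or.inr (Or.inr hE')
          · exact Or.inl ⟨Or.inr (Or.inl ((mI _).2 ⟨hk', hE'⟩)), by omega⟩

theorem card_abs_le {S : Finset ℤ} (hS : ∀ x ∈ S, x ≠ 0) (z : ℕ) :
    (S.filter (fun x => (x.natAbs : ℤ) ≤ z)).card +
      ((Icc (1 : ℤ) z).filter (fun f => f ∉ S ∧ -f ∉ S)).card =
      z + ((dblSet S).filter (· ≤ (z : ℤ))).card := by
  set P := S.filter (fun x => 0 < x ∧ x ≤ (z : ℤ))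
  set N := (S.filter (fun x => x < 0 ∧ -x ≤ (z : ℤ))).image (fun x => -x)
  have mN : ∀ x, x ∈ N ↔ -x ∈ S ∧ 0 < x ∧ x ≤ z := by
    intro x
    rw [mem_image]
    constructor
    · rintro ⟨y, h, rfl⟩
      rw [mem_filter] at h
      rw [neg_neg]
      exact ⟨h.1, by omega, h.2.2⟩
    · exact fun h => ⟨-x, mem_filter.2 ⟨h.1, by omega, by omega⟩, neg_neg x⟩
  have mP : ∀ x, x ∈ P ↔ x ∈ S ∧ 0 < x ∧ x ≤ z := fun x => mem_filter
  have h1 := card_union_add_card_inter P N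
  have h2 : P ∩ N = (dblSet S).filter (· ≤ (z : ℤ)) := by
    ext x
    rw [mem_inter, mP, mN, mem_filter, mem_dblSet]
    exact ⟨fun h => ⟨⟨h.1.1, h.1.2.1, h.2.1⟩, h.1.2.2⟩,
      fun h => ⟨⟨h.1.1, h.1.2.1, h.2⟩, h.1.2.2, h.1.2.1, h.2⟩⟩
  have h3 : (Icc (1 : ℤ) z).filter (fun f => f ∉ S ∧ -f ∉ S) = Icc (1 : ℤ) z \ (P ∪ N) := by
    ext x
    rw [mem_filter, mem_sdiff, mem_union, mP, mN, mem_Icc]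
    refine and_congr_right fun h => ?_
    have g : 0 < x ∧ x ≤ z := by omega
    simp only [g, and_true, not_or]
  have h4 : P ∪ N ⊆ Icc (1 : ℤ) z := fun x hx => by
    rw [mem_union, mP, mN] at hx
    rw [mem_Icc]
    omega
  have h5 : (S.filter (fun x => (x.natAbs : ℤ) ≤ z)).card = P.card + N.card := by
    rw [card_image_of_injective _ neg_injective, ← card_union_of_disjoint]
    · congr 1
      ext x
      rw [mem_union, mem_filter, mP, mem_filter, ← and_or_left]
      refine and_congr_right fun h => ?_
      have := hS x h
      omega
    · rw [disjoint_left]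
      intro x h g
      have := ((mP x).1 h).2.1
      have := (mem_filter.1 g).2.1
      omega
  have h6 := card_sdiff_add_card_eq_card h4
  rw [← h3, Int.card_Icc] at h6
  rw [h2] at h1
  omega

theorem exists_partial_isJ (n : ℕ) (S : Finset ℤ) (m d : ℕ) : ∃ J : Finset ℤ,
    (∀ t ∈ J, Free n S t ∧ (n : ℤ) - d < t) ∧ (∀ t ∈ J, cnt J t + 1 ≤ 2 * m + cnt (dblSet S) t) ∧
    (∀ f, Free n S f → (n : ℤ) - d < f → f ∉ J → cnt J f = 2 * m + cnt (dblSet S) f) ∧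
    cnt J (n - d) ≤ 2 * m + cnt (dblSet S) (n - d) := by
  induction d with
  | zero =>
    refine ⟨∅, by simp, by simp, fun f hf h => ?_, ?_⟩
    · have := hf.2.1; push_cast at h; omega
    · have := cnt_nonneg (dblSet S) (n - (0 : ℕ))
      have : cnt ∅ (n - (0 : ℕ)) = 0 := rfl
      omega
  | succ d ih =>
    obtain ⟨J, h1, h2, h3, h4⟩ := ih
    set a : ℤ := (n : ℤ) - d
    have ea : (n : ℤ) - (d + 1 : ℕ) = a - 1 := by push_cast; ring
    rw [ea]
    have haJ : a ∉ J := fun h => by have := (h1 a h).2; omega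
    have p1 := cnt_pred J a
    have p2 := cnt_pred (dblSet S) a
    rw [if_neg haJ] at p1
    by_cases hfa : Free n S a ∧ cnt J a + 1 ≤ 2 * m + cnt (dblSet S) a
    · have hadd : ∀ x, cnt (insert a J) x = (if x < a then 1 else 0) + cnt J x :=
        fun x => sum_insert haJ
      refine ⟨insert a J, fun t ht => ?_, fun t ht => ?_, fun f hf hfa' hfJ => ?_, ?_⟩
      · rcases mem_insert.1 ht with rfl | ht
        · exact ⟨hfa.1, by omega⟩
        · exact ⟨(h1 t ht).1, by have := (h1 t ht).2; omega⟩
      · rw [hadd]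
        rcases mem_insert.1 ht with rfl | ht
        · rw [if_neg (lt_irrefl _)]; have := hfa.2; omega
        · rw [if_neg (by have := (h1 t ht).2; omega)]; have := h2 t ht; omega
      · rw [mem_insert, not_or] at hfJ
        have := h3 f hf (by omega) hfJ.2
        rw [hadd, if_neg (by omega)]
        omega
      · rw [hadd, if_pos (by omega)]
        split_ifs at p2 <;> omega
    · refine ⟨J, fun t ht => ⟨(h1 t ht).1, by have := (h1 t ht).2; omega⟩, h2,
        fun f hf hfa' hfJ => ?_, by split_ifs at p2 <;> omega⟩
      rcases eq_or_lt_of_le (show a ≤ f by omega) with rfl | h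
      · have : ¬ cnt J a + 1 ≤ 2 * m + cnt (dblSet S) a := fun g => hfa ⟨hf, g⟩
        omega
      · exact h3 f hf h hfJ

theorem cnt_zero_sub {X : Finset ℤ} (hX : ∀ x ∈ X, 0 < x) (b : ℤ) :
    cnt X 0 = cnt X b + (X.filter (· ≤ b)).card := by
  have h1 : cnt X 0 = X.card := cnt_eq_card hX
  have h2 : cnt X b = (X.filter (¬ · ≤ b)).card := by
    unfold cnt
    simp [not_le]
  have := card_filter_add_card_filter_not (s := X) (· ≤ b)
  omega

/-- A column with a set of letters that satisfies the condition on KN columns can be split. -/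
theorem exists_isJ {n : ℕ} {S : Finset ℤ} {m : ℕ} (hS : ∀ x ∈ S, IsLetter n x)
    (hc : S.card + 2 * m ≤ n)
    (hKN : ∀ z ∈ dblSet S, ((S.filter (fun x => (x.natAbs : ℤ) ≤ z)).card : ℤ) ≤ z) :
    ∃ J, IsJ n S m J := by
  obtain ⟨J, h1, h2, h3, h4⟩ := exists_partial_isJ n S m n
  rw [sub_self] at h1 h3 h4
  have hS0 : ∀ x ∈ S, x ≠ 0 := fun x hx => (hS x hx).1
  have hJ0 : ∀ x ∈ J, 0 < x := fun x hx => (h1 x hx).2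
  have hI0 : ∀ x ∈ dblSet S, 0 < x := fun x hx => (mem_dblSet.1 hx).2.1
  have hfree : ∀ (b : ℕ), b ≤ n → (∀ a : ℤ, 0 ≤ a → a < b → cnt J a < 2 * m + cnt (dblSet S) a) →
      (b : ℤ) ∈ dblSet S ∨ b = n ∧ cnt J b < 2 * m + cnt (dblSet S) b →
      ((Icc (1 : ℤ) b).filter (fun f => f ∉ S ∧ -f ∉ S)).card ≤ (J.filter (· ≤ (b : ℤ))).card := by
    intro b hbn h hb
    refine card_le_card fun f hf => ?_
    rw [mem_filter, mem_Icc] at hf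
    refine mem_filter.2 ⟨?_, hf.1.2⟩
    by_contra hfJ
    have e := h3 f ⟨hf.1.1, by omega, hf.2.1, hf.2.2⟩ (by omega) hfJ
    rcases eq_or_lt_of_le hf.1.2 with g | g
    · rcases hb with hb | hb
      · exact hf.2.1 (by rw [g]; exact (mem_dblSet.1 hb).1)
      · rw [← g] at hb; omega
    · have := h f (by omega) g
      omega
  have key : 2 * m + cnt (dblSet S) 0 ≤ cnt J 0 := by
    by_contra hlt
    by_cases hex : ∃ b : ℕ, 2 * m + cnt (dblSet S) b ≤ cnt J b
    · classical
      have hspec := Nat.find_spec hex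
      have hmin := fun a => Nat.find_min hex (m := a)
      set b := Nat.find hex
      have hb0 : b ≠ 0 := fun h => by rw [h] at hspec; exact hlt (by simpa using hspec)
      have hm' := hmin (b - 1) (by omega)
      have p1 := cnt_pred J b
      have p2 := cnt_pred (dblSet S) b
      have e : ((b - 1 : ℕ) : ℤ) = (b : ℤ) - 1 := by omega
      rw [e] at hm'
      have hbI : (b : ℤ) ∈ dblSet S := by
        by_contra hbI
        rw [if_neg hbI] at p2
        split_ifs at p1 <;> omega
      have hbn : b ≤ n := by have := (hS _ (mem_dblSet.1 hbI).1).2; omega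
      have q1 := hfree b hbn (fun a ha hab => by
        lift a to ℕ using ha
        have := hmin a (by omega)
        omega) (Or.inl hbI)
      have q2 := card_abs_le hS0 b
      have q3 := hKN b hbI
      have q4 := cnt_zero_sub hJ0 b
      have q5 := cnt_zero_sub hI0 b
      omega
    · push Not at hex
      have q1 := hfree n le_rfl (fun a ha hab => by
        lift a to ℕ using ha
        exact hex a) (Or.inr ⟨rfl, hex n⟩)
      have q2 := card_abs_le hS0 n
      have q3 : S.filter (fun x => (x.natAbs : ℤ) ≤ n) = S :=
        filter_true_of_mem fun x hx => by have := (hS x hx).2; omega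
      have q4 := cnt_zero_sub hJ0 n
      have q5 := cnt_zero_sub hI0 n
      have q7 : cnt (dblSet S) n = 0 := cnt_eq_zero fun x hx => by
        have := (hS x (mem_dblSet.1 hx).1).2; omega
      have q8 := cnt_nonneg J n
      rw [q3] at q2
      omega
  refine ⟨J, fun t ht => (h1 t ht).1, ?_, h2, fun f hf hfJ => h3 f hf (by have := hf.1; omega) hfJ⟩
  rw [cnt_eq_card hJ0, cnt_eq_card hI0] at key
  rw [cnt_eq_card hJ0, cnt_eq_card hI0] at h4
  omega

theorem exists_initial (F : Finset ℤ) (r : ℕ) (hr : r ≤ F.card) :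
    ∃ E ⊆ F, E.card = r ∧ ∀ e ∈ E, ∀ f ∈ F, f ∉ E → e < f := by
  induction r with
  | zero => exact ⟨∅, by simp, by simp, by simp⟩
  | succ r ih =>
    obtain ⟨E, h1, h2, h3⟩ := ih (by omega)
    have hne : (F \ E).Nonempty := by
      rw [← card_pos, card_sdiff_of_subset h1]
      omega
    obtain ⟨x, hx, hmin⟩ := exists_min_image (F \ E) id hne
    rw [mem_sdiff] at hx
    refine ⟨insert x E, insert_subset hx.1 h1, by rw [card_insert_of_notMem hx.2, h2], ?_⟩
    intro e he f hf hfE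
    rw [mem_insert, not_or] at hfE
    rcases mem_insert.1 he with rfl | he
    · exact lt_of_le_of_ne (hmin f (mem_sdiff.2 ⟨hf, hfE.2⟩)) (Ne.symm hfE.1)
    · exact h3 e he f hf hfE.2

/-- A column that can be split can be extended. -/
theorem exists_spl_of_isJ {n k : ℕ} (hk : k ≤ n) {S : Finset ℤ} {m : ℕ} {J : Finset ℤ}
    (hS : ∀ x ∈ S, IsLetter n x) (hJ : IsJ n S m J) (hc : S.card + 2 * m ≤ k)
    (he : Even (k - (S.card + 2 * m))) : ∃ E, Spl n k S m J E := by
  set F := (Icc (1 : ℤ) n).filter (fun f => f ∉ S ∧ -f ∉ S) with hF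
  have mF : ∀ f, f ∈ F ↔ Free n S f := fun f => by
    rw [hF, mem_filter, mem_Icc, and_assoc, Free]
  have h1 := card_abs_le (fun x hx => (hS x hx).1) n
  have g1 : S.filter (fun x => (x.natAbs : ℤ) ≤ n) = S :=
    filter_true_of_mem fun x hx => by have := (hS x hx).2; omega
  have g2 : (dblSet S).filter (· ≤ (n : ℤ)) = dblSet S :=
    filter_true_of_mem fun x hx => by have := (hS x (mem_dblSet.1 hx).1).2; omega
  rw [g1, g2, ← hF] at h1
  have h2 : J ⊆ F := fun t ht => (mF t).2 (hJ.free t ht)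
  have h3 := card_sdiff_of_subset h2
  have h4 := hJ.card
  obtain ⟨E, e1, e2, e3⟩ := exists_initial (F \ J) (k - (S.card + 2 * m)) (by rw [h3]; omega)
  refine ⟨E, hS, hJ, fun e he => ?_, by omega, by rwa [e2], fun e he f hf hfJ hfE => ?_⟩
  · have := mem_sdiff.1 (e1 he)
    exact ⟨(mF e).1 this.1, this.2⟩
  · exact e3 e he f (mem_sdiff.2 ⟨(mF f).2 hf, hfJ⟩) hfE

/-! ### KN columns as lists -/

/-- The positive letters of a column. -/
def upL (S : Finset ℤ) : List ℤ := (S.filter (0 < ·)).sort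

/-- The negative letters of a column. -/
def dnL (S : Finset ℤ) : List ℤ := (S.filter (· < 0)).sort

theorem mem_upL {S : Finset ℤ} {x : ℤ} : x ∈ upL S ↔ x ∈ S ∧ 0 < x := by simp [upL]

theorem mem_dnL {S : Finset ℤ} {x : ℤ} : x ∈ dnL S ↔ x ∈ S ∧ x < 0 := by simp [dnL]

theorem upL_pairwise (S : Finset ℤ) : (upL S).Pairwise (· < ·) := (sortedLT_sort _).pairwise

theorem dnL_pairwise (S : Finset ℤ) : (dnL S).Pairwise (· < ·) := (sortedLT_sort _).pairwise

/-- The pairs `n̄ n` in the middle of a column. -/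
def midL (n m : ℕ) : List ℤ := (List.replicate m [-(n : ℤ), (n : ℤ)]).flatten

theorem midL_succ (n m : ℕ) : midL n (m + 1) = -(n : ℤ) :: (n : ℤ) :: midL n m := by
  simp [midL, List.replicate_succ]

theorem length_midL (n m : ℕ) : (midL n m).length = 2 * m := by
  induction m with
  | zero => rfl
  | succ m ih => rw [midL_succ, List.length_cons, List.length_cons, ih]; ring

theorem mem_midL {n m : ℕ} {x : ℤ} (h : x ∈ midL n m) : 1 ≤ m ∧ (x = -(n : ℤ) ∨ x = n) := by
  induction m with
  | zero => simp [midL] at h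
  | succ m ih =>
    rw [midL_succ, List.mem_cons, List.mem_cons] at h
    refine ⟨by omega, ?_⟩
    rcases h with h | h | h
    · exact Or.inl h
    · exact Or.inr h
    · exact (ih h).2

/-- The column with the set `S` of letters and, in its middle, `m` pairs `n̄ n`. -/
def colOf (n : ℕ) (S : Finset ℤ) (m : ℕ) : List ℤ := upL S ++ (midL n m ++ dnL S)

/-- The column with the set `S` of nonzero letters and `2m` letters `0`. -/
def zeroCol (S : Finset ℤ) (m : ℕ) : List ℤ := upL S ++ (List.replicate (2 * m) 0 ++ dnL S)

theorem toZeros_cons {n : ℕ} {x : ℤ} {C : List ℤ} (hx : 0 < x) :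
    toZeros n (x :: C) = x :: toZeros n C := by
  cases C with
  | nil => simp [toZeros]
  | cons y C => rw [toZeros, if_neg (by omega)]

theorem toZeros_neg {n : ℕ} {D : List ℤ} (hD : ∀ x ∈ D, x < 0) : toZeros n D = D := by
  induction D with
  | nil => simp [toZeros]
  | cons x D ih =>
    cases D with
    | nil => simp [toZeros]
    | cons y D =>
      have := hD y (by simp)
      rw [toZeros, if_neg (by omega), ih fun z hz => hD z (List.mem_cons_of_mem _ hz)]

theorem toZeros_colOf (n : ℕ) (S : Finset ℤ) (m : ℕ) : toZeros n (colOf n S m) = zeroCol S m := by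
  have h1 : ∀ U C : List ℤ, (∀ x ∈ U, 0 < x) → toZeros n (U ++ C) = U ++ toZeros n C := by
    intro U C hU
    induction U with
    | nil => rfl
    | cons x U ih =>
      rw [List.cons_append, toZeros_cons (hU x (by simp)), ih fun z hz => hU z (List.mem_cons_of_mem _ hz)]
      rfl
  have h2 : toZeros n (midL n m ++ dnL S) = List.replicate (2 * m) 0 ++ dnL S := by
    induction m with
    | zero => exact toZeros_neg fun x hx => (mem_dnL.1 hx).2
    | succ m ih =>
      rw [midL_succ, List.cons_append, List.cons_append, toZeros, if_pos ⟨rfl, rfl⟩, ih]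
      rfl
  rw [colOf, h1 _ _ fun x hx => (mem_upL.1 hx).2, h2, zeroCol]

theorem length_colOf {n : ℕ} {S : Finset ℤ} (hS : ∀ x ∈ S, x ≠ 0) (m : ℕ) :
    (colOf n S m).length = S.card + 2 * m := by
  rw [colOf, List.length_append, List.length_append, length_midL, upL, dnL, length_sort, length_sort]
  have := card_filter_add_card_filter_not (s := S) (0 < ·)
  have e : S.filter (¬ 0 < ·) = S.filter (· < 0) :=
    filter_congr fun x hx => by have := hS x hx; omega
  rw [e] at this
  omega

theorem exists_colOf {n : ℕ} (C : List ℤ) (hC : ∀ x ∈ C, IsLetter n x)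
    (h : C.IsChain (fun x y => pos n x < pos n y ∨ (x = -(n : ℤ) ∧ y = n))) :
    ∃ S m, C = colOf n S m ∧ ∀ x ∈ S, IsLetter n x := by
  suffices ∃ U D : List ℤ, ∃ m, C = U ++ (midL n m ++ D) ∧ (∀ x ∈ U, 0 < x) ∧ (∀ x ∈ D, x < 0) ∧
      U.Pairwise (· < ·) ∧ D.Pairwise (· < ·) by
    obtain ⟨U, D, m, h1, h2, h3, h4, h5⟩ := this
    have e1 : upL (U ++ D).toFinset = U := by
      refine Eq.trans ?_ ((List.toFinset_sort (· ≤ ·) (h4.imp ne_of_lt)).2 (h4.imp le_of_lt))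
      rw [upL]
      congr 1
      ext x
      rw [mem_filter, List.mem_toFinset, List.mem_toFinset, List.mem_append]
      have := h2 x
      have g : x ∈ D → ¬ 0 < x := fun hx => by have := h3 x hx; omega
      tauto
    have e2 : dnL (U ++ D).toFinset = D := by
      refine Eq.trans ?_ ((List.toFinset_sort (· ≤ ·) (h5.imp ne_of_lt)).2 (h5.imp le_of_lt))
      rw [dnL]
      congr 1
      ext x
      rw [mem_filter, List.mem_toFinset, List.mem_toFinset, List.mem_append]
      have := h3 x
      have g : x ∈ U → ¬ x < 0 := fun hx => by have := h2 x hx; omega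
      tauto
    refine ⟨(U ++ D).toFinset, m, by rw [colOf, e1, e2]; exact h1, fun x hx => hC x ?_⟩
    rw [List.mem_toFinset, List.mem_append] at hx
    rw [h1]
    simp only [List.mem_append]
    tauto
  induction C with
  | nil => exact ⟨[], [], 0, rfl, by simp, by simp, by simp, by simp⟩
  | cons x C ih =>
    rw [List.isChain_cons] at h
    obtain ⟨U, D, m, h1, h2, h3, h4, h5⟩ := ih (fun y hy => hC y (List.mem_cons_of_mem _ hy)) h.2
    have hx := hC x (by simp)
    have hC' : ∀ y ∈ C, IsLetter n y := fun y hy => hC y (List.mem_cons_of_mem _ hy)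
    have hn : 0 < n := by have := hx.1; have := hx.2; omega
    rcases lt_or_gt_of_ne hx.1 with hx0 | hx0
    · cases U with
      | cons y U =>
        have g1 := h.1 y (by rw [h1]; simp)
        have g2 := h2 y (by simp)
        have g3 : x = -(n : ℤ) ∧ y = n := by
          refine g1.resolve_left ?_
          have := (hC' y (by rw [h1]; simp)).2
          have := hx.2
          unfold pos
          rw [if_neg (by omega), if_pos g2]
          omega
        cases U with
        | cons z U =>
          have g4 := (List.pairwise_cons.1 h4).1 z (by simp)
          have := (hC' z (by rw [h1]; simp)).2
          omega
        | nil =>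
          refine ⟨[], D, m + 1, ?_, by simp, h3, by simp, h5⟩
          rw [h1, g3.1, g3.2, midL_succ]
          rfl
      | nil =>
        cases m with
        | succ m =>
          have g1 := h.1 (-(n : ℤ)) (by rw [h1, midL_succ]; simp)
          have := hx.2
          unfold pos at g1
          rw [if_neg (by omega), if_neg (by omega)] at g1
          omega
        | zero =>
          have e : C = D := h1
          subst e
          refine ⟨[], x :: C, 0, rfl, by simp, by simpa using ⟨hx0, h3⟩, by simp, ?_⟩
          rw [← List.isChain_iff_pairwise, List.isChain_cons]
          refine ⟨fun y hy => ?_, List.isChain_iff_pairwise.2 h5⟩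
          have g1 := h.1 y hy
          have g2 := h3 y (List.mem_of_mem_head? hy)
          unfold pos at g1
          rw [if_neg (by omega), if_neg (by omega)] at g1
          omega
    · refine ⟨x :: U, D, m, by rw [h1]; rfl, by simpa using ⟨hx0, h2⟩, h3, ?_, h5⟩
      rw [← List.isChain_iff_pairwise, List.isChain_cons]
      refine ⟨fun y hy => ?_, List.isChain_iff_pairwise.2 h4⟩
      have g1 := h.1 y (by rw [h1, List.head?_append]; simp [Option.mem_def.1 hy])
      have g2 := h2 y (List.mem_of_mem_head? hy)
      unfold pos at g1
      rw [if_pos hx0, if_pos g2] at g1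
      omega

theorem exists_spl_of_isKRColumn {n k : ℕ} (hk : k < n) {C : List ℤ} (h : IsKRColumn n k C) :
    ∃ S m J E, C = colOf n S m ∧ Spl n k S m J E := by
  obtain ⟨⟨h1, h2, h3⟩, h4, h5⟩ := h
  obtain ⟨S, m, rfl, hS⟩ := exists_colOf C h1 h2
  rw [length_colOf fun x hx => (hS x hx).1] at h4 h5
  obtain ⟨J, hJ⟩ := exists_isJ (m := m) hS (by omega) fun z hz => by
    obtain ⟨hz1, hz0, hz2⟩ := mem_dblSet.1 hz
    lift z to ℕ using hz0.le
    obtain ⟨u1, u2, hu⟩ := List.append_of_mem (mem_upL.2 ⟨hz1, hz0⟩)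
    obtain ⟨d1, d2, hd⟩ := List.append_of_mem (mem_dnL.2 ⟨hz2, by omega⟩)
    have hup := upL_pairwise S
    have hdn := dnL_pairwise S
    have mu : ∀ x ∈ S, 0 < x → x ∈ u1 ++ (z : ℤ) :: u2 := fun x hx h0 => hu ▸ mem_upL.2 ⟨hx, h0⟩
    have md : ∀ x ∈ S, x < 0 → x ∈ d1 ++ -(z : ℤ) :: d2 := fun x hx h0 => hd ▸ mem_dnL.2 ⟨hx, h0⟩
    rw [hu, List.pairwise_append] at hup
    rw [hd, List.pairwise_append] at hdn
    have key := h3 u1.length (upL S ++ (midL n m ++ d1)).length z (by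
      rw [List.length_append, hu]; simp; omega) (by omega) (by rw [colOf, hu]; simp) (by
      rw [colOf, hd]
      have : upL S ++ (midL n m ++ (d1 ++ -(z : ℤ) :: d2)) =
        (upL S ++ (midL n m ++ d1)) ++ -(z : ℤ) :: d2 := by simp
      rw [this]
      simp)
    have hsub : S.filter (fun x => (x.natAbs : ℤ) ≤ z) ⊆
        ((u1 ++ [(z : ℤ)]) ++ -(z : ℤ) :: d2).toFinset := by
      intro x hx
      rw [mem_filter] at hx
      have hx0 := (hS x hx.1).1
      simp only [List.mem_toFinset, List.mem_append, List.mem_cons, List.not_mem_nil, or_false]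
      rcases lt_or_gt_of_ne hx0 with g | g
      · right
        rcases List.mem_append.1 (md x hx.1 g) with g' | g'
        · have := hdn.2.2 x g' (-(z : ℤ)) (by simp); omega
        · exact List.mem_cons.1 g'
      · left
        rcases List.mem_append.1 (mu x hx.1 g) with g' | g'
        · exact Or.inl g'
        · rcases List.mem_cons.1 g' with g' | g'
          · exact Or.inr g'
          · have := (List.pairwise_cons.1 hup.2.1).1 x g'; omega
    have c1 := (card_le_card hsub).trans (List.toFinset_card_le _)
    rw [colOf, hd] at key
    simp only [List.length_append, List.length_cons, List.length_nil] at key c1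
    omega
  obtain ⟨E, hE⟩ := exists_spl_of_isJ hk.le hS hJ h4 h5
  exact ⟨S, m, J, E, rfl, hE⟩

theorem Spl.isKRColumn {n k : ℕ} (hk : k < n) {S : Finset ℤ} {m : ℕ} {J E : Finset ℤ}
    (h : Spl n k S m J E) : IsKRColumn n k (colOf n S m) := by
  have hS0 : ∀ x ∈ S, x ≠ 0 := fun x hx => (h.letter x hx).1
  have hlen := length_colOf (n := n) hS0 m
  have hcard := h.card
  refine ⟨⟨fun x hx => ?_, ?_, fun a b j hab hj ha hb => ?_⟩, by omega, ?_⟩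
  · rw [colOf, List.mem_append, List.mem_append] at hx
    rcases hx with hx | hx | hx
    · exact h.letter x (mem_upL.1 hx).1
    · have := mem_midL hx; exact ⟨by omega, by omega⟩
    · exact h.letter x (mem_dnL.1 hx).1
  · have hmid : ∀ m, (midL n m).IsChain (fun x y => pos n x < pos n y ∨ (x = -(n : ℤ) ∧ y = n)) ∧
        (∀ x ∈ (midL n m).head?, x = -(n : ℤ)) ∧ ∀ x ∈ (midL n m).getLast?, x = (n : ℤ) := by
      intro m
      induction m with
      | zero => simp [midL]
      | succ m ih =>
        obtain ⟨i1, i2, i3⟩ := ih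
        rw [midL_succ]
        refine ⟨?_, by simp, fun x hx => ?_⟩
        · rw [List.isChain_cons, List.isChain_cons]
          refine ⟨by simp, fun y hy => ?_, i1⟩
          rw [i2 y hy]
          unfold pos
          left
          rw [if_pos (by omega), if_neg (by omega)]
          omega
        · cases hm : midL n m with
          | nil => rw [hm] at hx; simpa [eq_comm] using hx
          | cons y l =>
            rw [hm] at hx i3
            exact i3 x (by simpa using hx)
    rw [colOf, List.isChain_append, List.isChain_append]
    have hup : ∀ x ∈ upL S, 0 < x ∧ x ≤ n := fun x hx => by
      have := (h.letter x (mem_upL.1 hx).1).2; have := (mem_upL.1 hx).2; omega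
    have hdn : ∀ x ∈ dnL S, x < 0 ∧ -x ≤ n := fun x hx => by
      have := (h.letter x (mem_dnL.1 hx).1).2; have := (mem_dnL.1 hx).2; omega
    refine ⟨?_, ⟨(hmid m).1, ?_, fun x hx y hy => ?_⟩, fun x hx y hy => ?_⟩
    · refine List.Pairwise.isChain ((upL_pairwise S).imp_of_mem fun {x y} hx hy hxy => Or.inl ?_)
      unfold pos
      rw [if_pos (hup x hx).1, if_pos (hup y hy).1]
      exact hxy
    · refine List.Pairwise.isChain ((dnL_pairwise S).imp_of_mem fun {x y} hx hy hxy => Or.inl ?_)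
      have := hdn x hx
      have := hdn y hy
      unfold pos
      rw [if_neg (by omega), if_neg (by omega)]
      omega
    · rw [(hmid m).2.2 x hx]
      have := hdn y (List.mem_of_mem_head? hy)
      unfold pos
      left
      rw [if_pos (by omega), if_neg (by omega)]
      omega
    · have g1 := hup x (List.mem_of_mem_getLast? hx)
      have g2 := List.mem_append.1 (List.mem_of_mem_head? hy)
      have hy' : y < 0 ∧ -y ≤ n := by
        rcases g2 with g2 | g2
        · cases m with
          | zero => simp [midL] at g2
          | succ m =>
            rw [midL_succ] at hy
            have : -(n : ℤ) = y := by simpa using hy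
            omega
        · exact hdn y g2
      unfold pos
      left
      rw [if_pos (by omega), if_neg (by omega)]
      omega
  · have hblen := (List.getElem?_eq_some_iff.1 hb).1
    rw [hlen] at hblen ⊢
    by_cases hjn : n ≤ j
    · omega
    rw [colOf, List.getElem?_append] at ha hb
    have ha' : (upL S)[a]? = some (j : ℤ) := by
      split_ifs at ha with g
      · exact ha
      · have := List.mem_of_getElem? ha
        rcases List.mem_append.1 this with q | q
        · have := mem_midL q; omega
        · have := (mem_dnL.1 q).2; omega
    have hb1 : ¬ b < (upL S).length := fun g => by
      rw [if_pos g] at hb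
      have := (mem_upL.1 (List.mem_of_getElem? hb)).2
      omega
    rw [if_neg hb1, List.getElem?_append] at hb
    set b' := b - (upL S).length - (midL n m).length with hb'
    have hb2 : ¬ b - (upL S).length < (midL n m).length := fun g => by
      rw [if_pos g] at hb
      have := mem_midL (List.mem_of_getElem? hb)
      omega
    rw [if_neg hb2] at hb
    have hz : (j : ℤ) ∈ dblSet S := mem_dblSet.2 ⟨(mem_upL.1 (List.mem_of_getElem? ha')).1, by omega,
      (mem_dnL.1 (List.mem_of_getElem? hb)).1⟩
    obtain ⟨hal, hae⟩ := List.getElem?_eq_some_iff.1 ha'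
    obtain ⟨hbl, hbe⟩ := List.getElem?_eq_some_iff.1 hb
    have hu := upL_pairwise S
    have hd := dnL_pairwise S
    have hsub : ((upL S).take (a + 1) ++ (dnL S).drop b').toFinset ⊆
        S.filter (fun x => (x.natAbs : ℤ) ≤ j) := by
      intro x hx
      rw [List.mem_toFinset, List.mem_append] at hx
      rw [mem_filter]
      rcases hx with hx | hx
      · have hx' := mem_upL.1 (List.mem_of_mem_take hx)
        refine ⟨hx'.1, ?_⟩
        obtain ⟨i, hi, rfl⟩ := List.getElem_of_mem hx
        rw [List.length_take] at hi
        rw [List.getElem_take] at hx' ⊢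
        have : (upL S)[i] ≤ (upL S)[a] := by
          rcases eq_or_lt_of_le (show i ≤ a by omega) with g | g
          · simp only [g, le_refl]
          · exact (List.pairwise_iff_getElem.1 hu i a (by omega) hal g).le
        omega
      · have hx' := mem_dnL.1 (List.mem_of_mem_drop hx)
        refine ⟨hx'.1, ?_⟩
        obtain ⟨i, hi, rfl⟩ := List.getElem_of_mem hx
        rw [List.length_drop] at hi
        rw [List.getElem_drop] at hx' ⊢
        have : (dnL S)[b'] ≤ (dnL S)[b' + i] := by
          rcases Nat.eq_zero_or_pos i with g | g
          · simp only [g, Nat.add_zero, le_refl]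
          · exact (List.pairwise_iff_getElem.1 hd b' (b' + i) hbl (by omega) (by omega)).le
        omega
    have hnd : ((upL S).take (a + 1) ++ (dnL S).drop b').Nodup := by
      refine List.nodup_append.2 ⟨(hu.imp ne_of_lt).sublist (List.take_sublist _ _),
        (hd.imp ne_of_lt).sublist (List.drop_sublist _ _), fun x hx y hy hxy => ?_⟩
      have := (mem_upL.1 (List.mem_of_mem_take hx)).2
      have := (mem_dnL.1 (List.mem_of_mem_drop hy)).2
      omega
    have c1 := card_le_card hsub
    rw [List.toFinset_card_of_nodup hnd, List.length_append, List.length_take, List.length_drop] at c1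
    have c2 := card_abs_le hS0 j
    have c3 : (J.filter (· ≤ (j : ℤ))).card ≤
        ((Icc (1 : ℤ) j).filter (fun f => f ∉ S ∧ -f ∉ S)).card := card_le_card fun t ht => by
      rw [mem_filter] at ht
      have := h.isJ.free t ht.1
      rw [mem_filter, mem_Icc]
      exact ⟨⟨this.1, ht.2⟩, this.2.2⟩
    have hJ0 : ∀ x ∈ J, 0 < x := fun x hx => by have := (h.isJ.free x hx).1; omega
    have hI0 : ∀ x ∈ dblSet S, 0 < x := fun x hx => (mem_dblSet.1 hx).2.1
    have c4 := cnt_zero_sub hJ0 j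
    have c5 := cnt_zero_sub hI0 j
    have c6 := h.isJ.le j
    have c7 := h.isJ.card
    rw [cnt_eq_card hJ0] at c4
    rw [cnt_eq_card hI0] at c5
    have c8 := hlen
    rw [colOf, List.length_append, List.length_append] at c8
    omega
  · have : k - (colOf n S m).length = E.card := by omega
    rw [this]
    exact h.even

/-! ### Splitting and extending on the level of lists -/

/-- The increasing column with a given set of letters. -/
def sortS (n : ℕ) (X : Finset ℤ) : List ℤ := sortCol n X.sort

theorem sortCol_perm_congr {n : ℕ} {l l' : List ℤ} (h : l.Perm l') (hl : ∀ x ∈ l, IsLetter n x) :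
    sortCol n l = sortCol n l' := by
  have sortCol_pairwise : ∀ l, (sortCol n l).Pairwise (fun a b => pos n a ≤ pos n b) := fun l => by
    have i1 : Std.Total (fun a b => pos n a ≤ pos n b) := ⟨fun a b => le_total _ _⟩
    have i2 : IsTrans ℤ (fun a b => pos n a ≤ pos n b) := ⟨fun a b c => le_trans⟩
    exact List.pairwise_insertionSort _ l
  have p := (sortCol_perm n l).trans (h.trans (sortCol_perm n l').symm)
  refine p.eq_of_pairwise (le := fun a b => pos n a ≤ pos n b) (fun a b ha hb h1 h2 => ?_)
    (sortCol_pairwise l) (sortCol_pairwise l')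
  have h3 := hl a ((sortCol_perm n l).mem_iff.1 ha)
  have h4 := hl b (h.mem_iff.2 ((sortCol_perm n l').mem_iff.1 hb))
  have := h3.2
  have := h3.1
  have := h4.2
  have := h4.1
  unfold pos at h1 h2
  split_ifs at h1 h2 <;> omega

theorem sortCol_eq_sortS {n : ℕ} {l : List ℤ} {X : Finset ℤ} (h : l.Nodup) (hX : ∀ x, x ∈ l ↔ x ∈ X)
    (hl : ∀ x ∈ X, IsLetter n x) : sortCol n l = sortS n X :=
  sortCol_perm_congr ((List.perm_ext_iff_of_nodup h (sort_nodup _ _)).2 fun x => by rw [hX, mem_sort])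
    fun x hx => hl x ((hX x).1 hx)

theorem mem_sortS {n : ℕ} {X : Finset ℤ} {x : ℤ} : x ∈ sortS n X ↔ x ∈ X := by
  rw [sortS, (sortCol_perm n _).mem_iff, mem_sort]

theorem sortS_inj {n : ℕ} {X Y : Finset ℤ} (h : sortS n X = sortS n Y) : X = Y := by
  ext x; rw [← mem_sortS (n := n), h, mem_sortS]

/-- The elements of a set of positive integers in decreasing order. -/
def desc (n : ℕ) (X : Finset ℤ) : List ℕ :=
  (List.range' 1 n).reverse.filter (fun z : ℕ => (z : ℤ) ∈ X)

theorem mem_desc {n : ℕ} {X : Finset ℤ} {z : ℕ} : z ∈ desc n X ↔ (1 ≤ z ∧ z ≤ n) ∧ (z : ℤ) ∈ X := by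
  unfold desc
  rw [List.mem_filter, List.mem_reverse, List.mem_range'_1, decide_eq_true_eq]
  exact and_congr_left fun _ => by omega

theorem desc_pairwise (n : ℕ) (X : Finset ℤ) : (desc n X).Pairwise (fun a b => b < a) :=
  List.Pairwise.filter _ (List.pairwise_reverse.2 List.pairwise_lt_range')

theorem countP_desc {n : ℕ} {X : Finset ℤ} (hX : ∀ x ∈ X, 1 ≤ x ∧ x ≤ n) (f : ℕ) :
    ((desc n X).countP (fun z => f < z) : ℤ) = cnt X f := by
  have hnd : ((desc n X).filter (fun z => f < z)).Nodup :=
    List.Nodup.filter _ ((desc_pairwise n X).imp fun h => ne_of_gt h)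
  rw [List.countP_eq_length_filter, ← List.toFinset_card_of_nodup hnd, cnt, ← sum_filter, sum_const,
    nsmul_eq_mul, mul_one, ← card_image_of_injective _ Nat.cast_injective (β := ℤ)]
  congr 2
  ext x
  simp only [mem_image, List.mem_toFinset, List.mem_filter, mem_desc, decide_eq_true_eq, mem_filter]
  constructor
  · rintro ⟨a, h, rfl⟩
    exact ⟨h.1.2, by omega⟩
  · rintro ⟨h1, h2⟩
    have := hX x h1
    lift x to ℕ using by omega
    exact ⟨x, ⟨⟨by omega, h1⟩, by omega⟩, rfl⟩

theorem length_desc {n : ℕ} {X : Finset ℤ} (hX : ∀ x ∈ X, 1 ≤ x ∧ x ≤ n) :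
    (desc n X).length = X.card := by
  have h1 := countP_desc hX 0
  rw [cnt_eq_card fun x hx => by have := hX x hx; push_cast; omega,
    List.countP_eq_length.2 fun a ha => by have := (mem_desc.1 ha).1; simp; omega] at h1
  exact_mod_cast h1

theorem lt_getElem_iff {l : List ℕ} (h : l.Pairwise (fun a b => b ≤ a)) {f i : ℕ} (hi : i < l.length) :
    f < l[i] ↔ i + 1 ≤ l.countP (fun z => f < z) := by
  constructor
  · intro hf
    have h1 : (l.take (i + 1)).countP (fun z => f < z) = (l.take (i + 1)).length := by
      rw [List.countP_eq_length]
      intro a ha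
      obtain ⟨j, hj, rfl⟩ := List.getElem_of_mem ha
      rw [List.length_take] at hj
      rw [List.getElem_take, decide_eq_true_eq]
      rcases eq_or_lt_of_le (show j ≤ i by omega) with g | g
      · simpa only [g] using hf
      · exact lt_of_lt_of_le hf (List.pairwise_iff_getElem.1 h j i (by omega) hi g)
    have h2 := List.Sublist.countP_le (p := fun z => decide (f < z)) (List.take_sublist (i + 1) l)
    rw [h1, List.length_take] at h2
    omega
  · intro hc
    by_contra hf
    have h1 : (l.drop i).countP (fun z => f < z) = 0 := by
      rw [List.countP_eq_zero]
      intro a ha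
      obtain ⟨j, hj, rfl⟩ := List.getElem_of_mem ha
      rw [List.length_drop] at hj
      rw [List.getElem_drop, decide_eq_true_eq]
      rcases Nat.eq_zero_or_pos j with g | g
      · simpa only [g, Nat.add_zero] using hf
      · have := List.pairwise_iff_getElem.1 h i (i + j) hi (by omega) (by omega)
        omega
    have h2 : l.countP (fun z => f < z) = (l.take i).countP (fun z => f < z) +
        (l.drop i).countP (fun z => f < z) := by rw [← List.countP_append, List.take_append_drop]
    have h3 := List.countP_le_length (p := fun z => decide (f < z)) (l := l.take i)
    rw [List.length_take] at h3
    omega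

/-- A criterion for the result of the greedy choice of the letters `t₁, t₂, …`. -/
theorem splitJ_eq {C : List ℤ} {J : ℕ → Prop} (hJ : ∀ s, J s → (s : ℤ) ∉ C ∧ -(s : ℤ) ∉ C) :
    ∀ {ts zs : List ℕ}, List.Forall₂ (fun s z => s < z ∧
      ∀ f : ℕ, (f : ℤ) ∉ C ∧ -(f : ℤ) ∉ C → ¬ J f → s < f → z ≤ f) ts zs →
    ∀ t, ts.Pairwise (fun a b => b < a) → (∀ s, s ∈ ts ↔ J s ∧ s < t) → splitJ C t zs = ts := by
  intro ts zs h
  induction h with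
  | nil => intros; rfl
  | @cons s z ts zs h1 h2 ih =>
    intro t hp ht
    rw [List.pairwise_cons] at hp
    have hs := (ht s).1 (by simp)
    have e : Nat.findGreatest (fun s => (s : ℤ) ∉ C ∧ -(s : ℤ) ∉ C) (min t z - 1) = s := by
      rw [Nat.findGreatest_eq_iff]
      refine ⟨by have := h1.1; omega, fun _ => hJ s hs.1, fun f hf hf' hP => ?_⟩
      by_cases hfJ : J f
      · rcases List.mem_cons.1 ((ht f).2 ⟨hfJ, by omega⟩) with g | g
        · omega
        · have := hp.1 f g; omega
      · have := h1.2 f hP hfJ hf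
        omega
    rw [splitJ]
    simp only [e]
    rw [ih s hp.2 fun x => ?_]
    constructor
    · intro hx
      exact ⟨((ht x).1 (List.mem_cons_of_mem _ hx)).1, hp.1 x hx⟩
    · rintro ⟨hx, hxs⟩
      rcases List.mem_cons.1 ((ht x).2 ⟨hx, by omega⟩) with g | g
      · omega
      · exact g

theorem mem_zeroCol {S : Finset ℤ} {m : ℕ} {x : ℤ} (hx : x ≠ 0) : x ∈ zeroCol S m ↔ x ∈ S := by
  unfold zeroCol
  rw [List.mem_append, List.mem_append, mem_upL, mem_dnL, List.mem_replicate]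
  constructor
  · rintro (h | h | h)
    · exact h.1
    · exact absurd h.2 hx
    · exact h.1
  · intro h
    rcases lt_or_gt_of_ne hx with g | g
    · exact Or.inr (Or.inr ⟨h, g⟩)
    · exact Or.inl ⟨h, g⟩

theorem splitI_zeroCol (n : ℕ) (S : Finset ℤ) (m : ℕ) :
    splitI n (zeroCol S m) = List.replicate (2 * m) (n + 1) ++ desc n (dblSet S) := by
  unfold splitI desc
  congr 1
  · congr 1
    unfold zeroCol
    rw [List.count_append, List.count_append, List.count_replicate_self, List.count_eq_zero.2,
      List.count_eq_zero.2]
    · omega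
    · exact fun h => by have := (mem_dnL.1 h).2; omega
    · exact fun h => by have := (mem_upL.1 h).2; omega
  · refine List.filter_congr fun z hz => ?_
    rw [List.mem_reverse, List.mem_range'_1] at hz
    rw [decide_eq_decide, mem_zeroCol (by omega), mem_zeroCol (by omega), mem_dblSet]
    exact and_congr_right fun _ => ⟨fun g => ⟨by omega, g⟩, fun g => g.2⟩

theorem splitJ_zeroCol {n k : ℕ} {S : Finset ℤ} {m : ℕ} {J E : Finset ℤ} (h : Spl n k S m J E) :
    splitJ (zeroCol S m) (n + 1) (splitI n (zeroCol S m)) = desc n J := by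
  have hJ : ∀ x ∈ J, 1 ≤ x ∧ x ≤ n := fun x hx => ⟨(h.isJ.free x hx).1, (h.isJ.free x hx).2.1⟩
  have hI : ∀ x ∈ dblSet S, 1 ≤ x ∧ x ≤ n := fun x hx => by
    have h1 := mem_dblSet.1 hx
    have := (h.letter x h1.1).2
    omega
  rw [splitI_zeroCol]
  have hf : ∀ f : ℕ, 1 ≤ f → f ≤ n → ((f : ℤ) ∉ zeroCol S m ∧ -(f : ℤ) ∉ zeroCol S m ↔ Free n S f) := by
    intro f h1 h2
    rw [mem_zeroCol (by omega), mem_zeroCol (by omega), Free]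
    exact ⟨fun h => ⟨by omega, by omega, h⟩, fun h => h.2.2⟩
  refine splitJ_eq (J := fun s => (s : ℤ) ∈ J) (fun s hs => (hf s ?_ ?_).2 (h.isJ.free _ hs)) ?_ _
    (desc_pairwise n J) fun s => ?_
  · have := hJ _ hs; omega
  · have := hJ _ hs; omega
  · set zs := List.replicate (2 * m) (n + 1) ++ desc n (dblSet S) with hzs
    have hzp : zs.Pairwise (fun a b => b ≤ a) := by
      rw [hzs, List.pairwise_append]
      refine ⟨List.pairwise_replicate.2 (Or.inr le_rfl), (desc_pairwise n _).imp le_of_lt,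
        fun a ha b hb => ?_⟩
      have := (List.mem_replicate.1 ha).2
      have := (mem_desc.1 hb).1
      omega
    have hzc : ∀ f : ℕ, f ≤ n → (zs.countP (fun z => f < z) : ℤ) = 2 * m + cnt (dblSet S) f := by
      intro f hfn
      rw [hzs, List.countP_append, List.countP_replicate,
        if_pos (by simpa using by omega), Nat.cast_add, countP_desc hI]
      push_cast
      ring
    have hts := (desc_pairwise n J).imp (S := fun a b => b ≤ a) le_of_lt
    rw [List.forall₂_iff_get]
    refine ⟨?_, fun i hi hi' => ?_⟩
    · rw [length_desc hJ, hzs, List.length_append, List.length_replicate, length_desc hI]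
      have := h.isJ.card
      omega
    simp only [List.get_eq_getElem]
    have hmem := mem_desc.1 (List.getElem_mem hi)
    set t := (desc n J)[i] with ht
    refine ⟨?_, fun f hfC hfJ htf => ?_⟩
    · have h1 := (lt_getElem_iff hts (f := t - 1) hi).1 (by omega)
      have h2 := countP_desc hJ (t - 1)
      have e : ((t - 1 : ℕ) : ℤ) = (t : ℤ) - 1 := by omega
      rw [e, cnt_pred, if_pos hmem.2] at h2
      have h3 := h.isJ.lt t hmem.2
      have h4 := hzc t hmem.1.2
      exact (lt_getElem_iff hzp hi').2 (by omega)
    · by_contra hlt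
      have hz : zs[i] ≤ n + 1 := by
        rcases List.mem_append.1 (show zs[i] ∈ _ ++ _ from List.getElem_mem hi') with g | g
        · exact (List.mem_replicate.1 g).2.le
        · have := (mem_desc.1 g).1; omega
      have h1 := (lt_getElem_iff hzp hi').1 (lt_of_not_ge hlt)
      have h2 := hzc f (by omega)
      have h3 := h.isJ.eq f ((hf f (by omega) (by omega)).1 hfC) hfJ
      have h4 := countP_desc hJ f
      have h5 := (lt_getElem_iff hts hi).2 (show i + 1 ≤ (desc n J).countP (fun z => f < z) by omega)
      omega
  · rw [mem_desc]
    constructor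
    · exact fun g => ⟨g.2, by omega⟩
    · exact fun g => ⟨by have := hJ _ g.1; omega, g.1⟩

theorem take_filter {E : Finset ℤ} : ∀ {l : List ℤ}, l.Pairwise (fun a b => b ∈ E → a ∈ E) →
    l.take (l.filter (· ∈ E)).length = l.filter (· ∈ E)
  | [], _ => rfl
  | x :: l, h => by
    rw [List.pairwise_cons] at h
    by_cases hx : x ∈ E
    · rw [List.filter_cons_of_pos (by simpa using hx), List.length_cons, List.take_succ_cons,
        take_filter h.2]
    · rw [List.filter_eq_nil_iff.2]
      · rfl
      · intro a ha
        rw [decide_eq_true_eq]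
        rcases List.mem_cons.1 ha with rfl | ha
        · exact hx
        · exact fun hE => hx (h.1 a ha hE)

theorem extLetters_eq {n k : ℕ} {S : Finset ℤ} {m : ℕ} {J E : Finset ℤ} (h : Spl n k S m J E)
    {L R : List ℤ} (hL : ∀ x, x ∈ L ↔ x ∈ leftSet S J ∅) (hR : ∀ x, x ∈ R ↔ x ∈ rightSet S J ∅)
    (hlen : L.length + E.card = k) :
    (extLetters n k L R).Nodup ∧ ∀ x, x ∈ extLetters n k L R ↔ x ∈ E := by
  unfold extLetters
  set l := ((List.range' 1 n).map (fun (i : ℕ) => (i : ℤ))).filter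
    (fun i => i ∉ L ∧ -i ∉ L ∧ i ∉ R ∧ -i ∉ R) with hl
  have hlp : l.Pairwise (· < ·) := by
    refine List.Pairwise.filter _ (List.pairwise_map.2 ((List.pairwise_lt_range' (s := 1) (n := n)).imp fun h => ?_))
    exact_mod_cast h
  have hml : ∀ x, x ∈ l ↔ Free n S x ∧ x ∉ J := by
    intro x
    have hr : x ∈ (List.range' 1 n).map (fun (i : ℕ) => (i : ℤ)) ↔ 1 ≤ x ∧ x ≤ n := by
      simp only [List.mem_map, List.mem_range'_1]
      exact ⟨by rintro ⟨a, h, rfl⟩; omega, fun h => ⟨x.toNat, by omega, by omega⟩⟩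
    rw [hl, List.mem_filter, decide_eq_true_eq, hr, hL, hL, hR, hR, mem_leftSet, mem_leftSet,
      mem_rightSet, mem_rightSet, neg_neg, Free]
    simp only [notMem_empty, or_false]
    constructor
    · rintro ⟨h0, h1, h2, h3, h4⟩
      push Not at h1 h2 h3 h4
      exact ⟨⟨h0.1, h0.2, fun g => by have := h3.1 g; omega,
        fun g => by have := h2.1 g; omega⟩, h1.2⟩
    · rintro ⟨⟨h1, h2, h3, h4⟩, h5⟩
      have h6 : -x ∉ J := fun g => by have := (h.isJ.free _ g).1; omega
      simp only [h1, h2, h3, h4, h5, h6, false_and, or_false, not_false_eq_true, and_self]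
  have hmE : ∀ x, x ∈ l.filter (· ∈ E) ↔ x ∈ E := by
    intro x
    rw [List.mem_filter, decide_eq_true_eq, hml]
    exact ⟨fun g => g.2, fun g => ⟨h.freeE x g, g⟩⟩
  have hnd : (l.filter (· ∈ E)).Nodup := (hlp.imp ne_of_lt).filter _
  have hlE : (l.filter (· ∈ E)).length = k - L.length := by
    rw [← List.toFinset_card_of_nodup hnd]
    have : (l.filter (· ∈ E)).toFinset = E := by ext x; rw [List.mem_toFinset, hmE]
    rw [this]
    omega
  rw [← hlE, take_filter]
  · exact ⟨hnd, hmE⟩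
  · refine hlp.imp_of_mem fun {a b} ha hb hab hbE => ?_
    by_contra haE
    have := h.min b hbE a ((hml a).1 ha).1 ((hml a).1 ha).2 haE
    omega

theorem extendCol_colOf {n k : ℕ} {S : Finset ℤ} {m : ℕ} {J E : Finset ℤ} (h : Spl n k S m J E) :
    extendCol n k (splitColD n (colOf n S m)) =
      (sortS n (leftSet S J E), sortS n (rightSet S J E)) := by
  have hS0 : ∀ x ∈ S, x ≠ 0 := fun x hx => (h.letter x hx).1
  have hJ : ∀ x ∈ J, 1 ≤ x ∧ x ≤ n := fun x hx => ⟨(h.isJ.free x hx).1, (h.isJ.free x hx).2.1⟩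
  set Jl : List ℤ := (desc n J).map (fun (t : ℕ) => (t : ℤ)) with hJl
  have mJl : ∀ x, x ∈ Jl ↔ x ∈ J := by
    intro x
    rw [hJl, List.mem_map]
    constructor
    · rintro ⟨a, g, rfl⟩
      exact (mem_desc.1 g).2
    · intro g
      have := hJ x g
      lift x to ℕ using by omega
      exact ⟨x, mem_desc.2 ⟨by omega, g⟩, rfl⟩
  have nJl : Jl.Nodup := List.Nodup.map Nat.cast_injective ((desc_pairwise n J).imp fun h => ne_of_gt h)
  have hnd : ∀ p : ℤ → Bool, p 0 = false → ((zeroCol S m).filter p).Nodup := by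
    intro p hp
    unfold zeroCol
    rw [List.filter_append, List.filter_append, List.filter_replicate, if_neg (by simp [hp]),
      List.nil_append, ← List.filter_append]
    refine List.Nodup.filter _ (List.nodup_append.2 ⟨sort_nodup _ _, sort_nodup _ _, ?_⟩)
    intro a ha b hb hab
    have := (mem_upL.1 ha).2
    have := (mem_dnL.1 hb).2
    omega
  have hz : ∀ x, x ∈ zeroCol S m ∧ x ≠ 0 ↔ x ∈ S := fun x =>
    ⟨fun g => (mem_zeroCol g.2).1 g.1, fun g => ⟨(mem_zeroCol (hS0 x g)).2 g, hS0 x g⟩⟩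
  set A := (zeroCol S m).filter (fun x => x ≠ 0 ∧ ¬ (0 < x ∧ -x ∈ zeroCol S m)) ++ Jl with hA
  set B := (zeroCol S m).filter (fun x => x ≠ 0 ∧ ¬ (x < 0 ∧ -x ∈ zeroCol S m)) ++
    Jl.map (fun t => -t) with hB
  have mA : ∀ x, x ∈ A ↔ x ∈ leftSet S J ∅ := by
    intro x
    rw [hA, List.mem_append, List.mem_filter, decide_eq_true_eq, ← and_assoc, hz, mJl, mem_leftSet]
    simp only [notMem_empty, or_false]
    refine or_congr_left (and_congr_right fun g => ?_)
    rw [mem_zeroCol (neg_ne_zero.2 (hS0 x g))]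
  have mB : ∀ x, x ∈ B ↔ x ∈ rightSet S J ∅ := by
    intro x
    have : (∃ a ∈ Jl, -a = x) ↔ -x ∈ J := by
      rw [← mJl]
      exact ⟨by rintro ⟨a, h, rfl⟩; rwa [neg_neg], fun h => ⟨-x, h, neg_neg x⟩⟩
    rw [hB, List.mem_append, List.mem_filter, decide_eq_true_eq, ← and_assoc, hz, List.mem_map, this,
      mem_rightSet]
    simp only [notMem_empty, or_false]
    refine or_congr_left (and_congr_right fun g => ?_)
    rw [mem_zeroCol (neg_ne_zero.2 (hS0 x g))]
  have nA : A.Nodup := by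
    refine List.nodup_append.2 ⟨hnd _ (by simp), nJl, fun a ha b hb hab => ?_⟩
    rw [List.mem_filter, decide_eq_true_eq, ← and_assoc, hz] at ha
    exact (h.isJ.free b ((mJl b).1 hb)).2.2.1 (hab ▸ ha.1)
  have nB : B.Nodup := by
    refine List.nodup_append.2 ⟨hnd _ (by simp), nJl.map neg_injective, fun a ha b hb hab => ?_⟩
    rw [List.mem_filter, decide_eq_true_eq, ← and_assoc, hz] at ha
    obtain ⟨t, ht, rfl⟩ := List.mem_map.1 hb
    exact (h.isJ.free t ((mJl t).1 ht)).2.2.2 (hab ▸ ha.1)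
  have hsp : splitColD n (colOf n S m) = (sortCol n A, sortCol n B) := by
    rw [splitColD, toZeros_colOf, splitB]
    simp only [splitJ_zeroCol h]
    rfl
  have hlA : (sortCol n A).length + E.card = k := by
    rw [(sortCol_perm n A).length_eq, ← List.toFinset_card_of_nodup nA, ← h.card_left]
    have e : leftSet S J E = A.toFinset ∪ E.image (fun x => -x) := by
      ext x
      rw [mem_union, List.mem_toFinset, mA, leftSet, leftSet, image_empty, union_empty, mem_union]
    rw [e, card_union_of_disjoint, card_image_of_injective _ neg_injective]
    rw [disjoint_left]
    intro x hx hxE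
    obtain ⟨e, he, rfl⟩ := mem_image.1 hxE
    have hfe := h.freeE e he
    rw [List.mem_toFinset, mA, mem_leftSet] at hx
    rcases hx with g | g | g
    · exact hfe.1.2.2.2 g.1
    · have := hJ _ g; have := hfe.1.1; omega
    · simp at g
  obtain ⟨hXn, hX⟩ := extLetters_eq h (L := sortCol n A) (R := sortCol n B)
    (fun x => by rw [(sortCol_perm n A).mem_iff, mA]) (fun x => by rw [(sortCol_perm n B).mem_iff, mB]) hlA
  rw [hsp, extendCol]
  simp only
  set X := extLetters n k (sortCol n A) (sortCol n B)
  rw [sortCol_eq_sortS (X := leftSet S J E), sortCol_eq_sortS (X := rightSet S J E)]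
  · refine List.nodup_append.2 ⟨(sortCol_perm n B).nodup_iff.2 nB, hXn, fun a ha b hb hab => ?_⟩
    subst hab
    have hfe := h.freeE a ((hX a).1 hb)
    rw [(sortCol_perm n B).mem_iff, mB, mem_rightSet] at ha
    rcases ha with g | g | g
    · exact hfe.1.2.2.1 g.1
    · have := hJ _ g; have := hfe.1.1; omega
    · simp at g
  · intro x
    rw [List.mem_append, (sortCol_perm n B).mem_iff, mB, hX, rightSet, union_empty, rightSet,
      mem_union (t := E)]
  · exact fun x hx => (h.isCol_right x hx).1
  · refine List.nodup_append.2 ⟨(sortCol_perm n A).nodup_iff.2 nA, hXn.map neg_injective,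
      fun a ha b hb hab => ?_⟩
    subst hab
    obtain ⟨e, he, rfl⟩ := List.mem_map.1 hb
    have hfe := h.freeE e ((hX e).1 he)
    rw [(sortCol_perm n A).mem_iff, mA, mem_leftSet] at ha
    rcases ha with g | g | g
    · exact hfe.1.2.2.2 g.1
    · have := hJ _ g; have := hfe.1.1; omega
    · simp at g
  · intro x
    have : (∃ a ∈ X, -a = x) ↔ ∃ a ∈ E, -a = x := by simp only [hX]
    rw [List.mem_append, (sortCol_perm n A).mem_iff, mA, List.mem_map, this, leftSet, image_empty,
      union_empty, leftSet, mem_union (t := E.image _), mem_image]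
  · exact fun x hx => (h.isCol_left x hx).1

/-! ### The image of the filling map -/

theorem sortCol_col {n k : ℕ} (hk : k ≤ n) {w : Equiv.Perm ℤ} (hw : SP n w) :
    sortCol n (col k w) = sortS n (colSet k w) := by
  refine sortCol_eq_sortS ?_ (fun x => ?_) fun x hx => (isCol_colSet hk hw x hx).1
  · exact List.Nodup.map (w.injective.comp Nat.cast_injective) List.nodup_range'
  · rw [mem_colSet, col, List.mem_map]
    simp only [List.mem_range'_1]
    constructor
    · rintro ⟨a, h, rfl⟩
      exact ⟨a, by omega, by omega, rfl⟩
    · rintro ⟨a, h1, h2, rfl⟩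
      lift a to ℕ using by omega
      exact ⟨a, by omega, rfl⟩

theorem exists_column_of_isQPath {n k : ℕ} (hk1 : 1 ≤ k) (hk : k < n) {w : Equiv.Perm ℤ} (hw : SP n w)
    {T : List (ℤ × ℤ)} (hT : T.Sublist (chainR k)) (hp : IsQPath n w T) :
    ∃ C, IsKRColumn n k C ∧ extendCol n k (splitColD n C) =
      (sortS n (colSet k w), sortS n (colSet k (endw w T))) := by
  have hL := isCol_colSet hk.le hw
  have hc := card_colSet k w
  obtain ⟨u, -, hu⟩ := exists_unused hk hc
  obtain ⟨h1, h2⟩ := ballot_of_moves hL ⟨u, hu⟩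
    (moves_of_isQPath hk hw (fun β hβ => hT.subset hβ) hk1 hp)
  obtain ⟨S, m, J, E, h, e1, e2⟩ := exists_spl hk hL hc h1 h2
  exact ⟨_, h.isKRColumn hk, by rw [extendCol_colOf h, e1, e2]⟩

theorem exists_isQPath_of_column {n k : ℕ} (hk1 : 1 ≤ k) (hk : k < n) {w : Equiv.Perm ℤ} (hw : SP n w)
    {C : List ℤ} (hC : IsKRColumn n k C) :
    ∃ T U, T.Sublist (chainL n k) ∧ U.Sublist (chainR k) ∧ IsQPath n w T ∧ IsQPath n (endw w T) U ∧
      SP n (endw w T) ∧ SP n (endw (endw w T) U) ∧ extendCol n k (splitColD n C) =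
        (sortS n (colSet k (endw w T)), sortS n (colSet k (endw (endw w T) U))) := by
  obtain ⟨S, m, J, E, rfl, h⟩ := exists_spl_of_isKRColumn hk hC
  obtain ⟨T, h1, h2, h3⟩ := exists_path_chainL hk hw h.isCol_left h.card_left
  have hw' := hw.endw (Seg.lab ⟨hk1, hk, _, rows_chainKI hk, rfl⟩ h1)
  have hm := moves_of_ballot _ le_rfl h.isCol_left h.isCol_right
    (exists_unused hk h.card_left) h.ballot
  rw [← h3] at hm
  obtain ⟨U, g1, g2, g3⟩ := exists_path_chainR hk1 hk hw' hm
  have hw'' := hw'.endw (Seg.lab ⟨hk1, hk, _, rows_rowR hk, chainR_eq hk1⟩ g1)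
  exact ⟨T, U, h1, g1, h2, g2, hw', hw'', by rw [extendCol_colOf h, h3, g3]⟩

theorem extend_cons (n k : ℕ) (p : List ℕ) (C : List ℤ) (b : List (List ℤ)) :
    extend n (k :: p) (splitD n (C :: b)) = (extendCol n k (splitColD n C)).1 ::
      (extendCol n k (splitColD n C)).2 :: extend n p (splitD n b) := rfl

theorem exists_column_of_admissible {n : ℕ} : ∀ {p : List ℕ}, (∀ k ∈ p, 1 ≤ k ∧ k < n) →
    ∀ {w : Equiv.Perm ℤ} {Ts : List (List (ℤ × ℤ))}, SP n w → List.Forall₂ List.Sublist Ts (chain n p) →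
    IsQPath n w Ts.flatten →
    ∃ b ∈ KR n p, extend n p (splitD n b) = (fillFrom w (dbl p) Ts).map (sortCol n)
  | [], _, w, Ts, _, hT, _ => by
    cases hT
    exact ⟨[], List.Forall₂.nil, rfl⟩
  | k :: p, hpn, w, Ts, hw, hT, hp => by
    obtain ⟨hk1, hk⟩ := hpn k (List.mem_cons_self ..)
    have hc : chain n (k :: p) = chainL n k :: chainR k :: chain n p := rfl
    rw [hc] at hT
    cases hT with
    | @cons T _ _ _ hT1 hT =>
    cases hT with
    | @cons U _ _ _ hT2 hT =>
    rw [List.flatten_cons, List.flatten_cons, isQPath_append, isQPath_append] at hp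
    have hw' := hw.endw (Seg.lab ⟨hk1, hk, _, rows_chainKI hk, rfl⟩ hT1)
    have hw'' := hw'.endw (Seg.lab ⟨hk1, hk, _, rows_rowR hk, chainR_eq hk1⟩ hT2)
    obtain ⟨C, h1, h2⟩ := exists_column_of_isQPath hk1 hk hw' hT2 hp.2.1
    obtain ⟨b, h3, h4⟩ := exists_column_of_admissible
      (fun k' hk' => hpn k' (List.mem_cons_of_mem _ hk')) hw'' hT hp.2.2
    refine ⟨C :: b, List.Forall₂.cons h1 h3, ?_⟩
    rw [extend_cons, h2, h4, ← sortCol_col hk.le hw', ← sortCol_col hk.le hw'']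
    rfl

theorem exists_admissible_of_column {n : ℕ} : ∀ {p : List ℕ}, (∀ k ∈ p, 1 ≤ k ∧ k < n) →
    ∀ {w : Equiv.Perm ℤ} {b : List (List ℤ)}, SP n w → b ∈ KR n p →
    ∃ Ts, List.Forall₂ List.Sublist Ts (chain n p) ∧ IsQPath n w Ts.flatten ∧
      extend n p (splitD n b) = (fillFrom w (dbl p) Ts).map (sortCol n)
  | [], _, w, b, _, hb => by
    cases hb
    exact ⟨[], List.Forall₂.nil, trivial, rfl⟩
  | k :: p, hpn, w, _, hw, .cons (b := C) hC hb => by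
    obtain ⟨hk1, hk⟩ := hpn k (List.mem_cons_self ..)
    obtain ⟨T, U, h1, h2, h3, h4, h5, h6, h7⟩ := exists_isQPath_of_column hk1 hk hw hC
    obtain ⟨Ts, g1, g2, g3⟩ := exists_admissible_of_column
      (fun k' hk' => hpn k' (List.mem_cons_of_mem _ hk')) h6 hb
    refine ⟨T :: U :: Ts, List.Forall₂.cons h1 (List.Forall₂.cons h2 g1), ?_, ?_⟩
    · rw [List.flatten_cons, List.flatten_cons, isQPath_append, isQPath_append]
      exact ⟨h3, h4, g2⟩
    · rw [extend_cons, h7, g3, ← sortCol_col hk.le h5, ← sortCol_col hk.le h6]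
      rfl

theorem extend_splitD_inj {n : ℕ} : ∀ {p : List ℕ}, (∀ k ∈ p, 1 ≤ k ∧ k < n) →
    ∀ {b b' : List (List ℤ)}, b ∈ KR n p → b' ∈ KR n p →
    extend n p (splitD n b) = extend n p (splitD n b') → b = b'
  | [], _, b, b', hb, hb', _ => by cases hb; cases hb'; rfl
  | k :: p, hpn, _, _, .cons (b := C) hC hb, .cons (b := C') hC' hb', h => by
    obtain ⟨hk1, hk⟩ := hpn k (List.mem_cons_self ..)
    obtain ⟨S, m, J, E, rfl, hs⟩ := exists_spl_of_isKRColumn hk hC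
    obtain ⟨S', m', J', E', rfl, hs'⟩ := exists_spl_of_isKRColumn hk hC'
    rw [extend_cons, extend_cons, extendCol_colOf hs, extendCol_colOf hs', List.cons.injEq,
      List.cons.injEq] at h
    obtain ⟨rfl, rfl⟩ := hs.inj hk hs' (sortS_inj h.1) (sortS_inj h.2.1)
    rw [extend_splitD_inj (fun k' hk' => hpn k' (List.mem_cons_of_mem _ hk')) hb hb' h.2.2]

end

end QAlcoveD

theorem mainTheorem7 (n : ℕ) (p : List ℕ) (hp : p.Pairwise (fun k k' => k' ≤ k))
    (hpn : ∀ k ∈ p, 1 ≤ k ∧ k < n) :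
    Set.InjOn (fun b => QAlcoveD.extend n p (QAlcoveD.splitD n b)) (QAlcoveD.KR n p) ∧
    ∃ sfill : QAlcoveD.Admissible n p ≃ QAlcoveD.KR n p,
      (∀ T : QAlcoveD.Admissible n p,
        QAlcoveD.extend n p (QAlcoveD.splitD n (sfill T).1) = QAlcoveD.sfillD n p T.1) ∧
      (∀ b : QAlcoveD.KR n p,
        (sfill.symm b).1 =
          QAlcoveD.pathD n p (QAlcoveD.ordD n (QAlcoveD.extend n p (QAlcoveD.splitD n b.1)))) := by
  have hinj : ∀ {b b' : List (List ℤ)}, b ∈ QAlcoveD.KR n p → b' ∈ QAlcoveD.KR n p → _ → b = b' :=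
    QAlcoveD.extend_splitD_inj hpn
  refine ⟨fun b hb b' hb' h => hinj hb hb' h, ?_⟩
  have hex : ∀ T : QAlcoveD.Admissible n p, ∃ b : QAlcoveD.KR n p,
      QAlcoveD.extend n p (QAlcoveD.splitD n b.1) = QAlcoveD.sfillD n p T.1 := fun T => by
    obtain ⟨b, hb, h⟩ := QAlcoveD.exists_column_of_admissible hpn (QAlcoveD.SP.one n) T.2.1 T.2.2
    exact ⟨⟨b, hb⟩, h⟩
  choose f hf using hex
  have hleft : ∀ T, QAlcoveD.pathD n p (QAlcoveD.ordD n
      (QAlcoveD.extend n p (QAlcoveD.splitD n (f T).1))) = T.1 := fun T => by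
    rw [hf, QAlcoveD.pathD_ordD_sfillD hp hpn T.2]
  have hbij : Function.Bijective f := by
    refine ⟨fun T T' h => Subtype.ext ?_, fun b => ?_⟩
    · rw [← hleft T, h, hleft T']
    · obtain ⟨T, h1, h2, h3⟩ := QAlcoveD.exists_admissible_of_column hpn (QAlcoveD.SP.one n) b.2
      exact ⟨⟨T, h1, h2⟩, Subtype.ext (hinj (f _).2 b.2 ((hf _).trans h3.symm))⟩
  refine ⟨Equiv.ofBijective f hbij, hf, fun b => ?_⟩
  obtain ⟨T, rfl⟩ := hbij.2 b
  rw [hleft, Equiv.ofBijective_symm_apply_apply]
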